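/- Let $R$ be a commutative Noetherian ring with a dualizing complex $\omega$ (a complex of $R$-modules with finitely generated cohomology and finite injective dimension such that $R\to {\bf R}\mathrm{Hom}_R(\omega,\omega)$ is an isomorphism), let $Y=\mathrm{Spec}\,R$, and let $A=\bigoplus_{i\in\mathbb Z}A_i$ be a commutative Noetherian $\mathbb Z$-graded $R$-algebra such that $A_0$ is a finite $R$-module. Let $\mathrm{Gr}(A)$ be the category of $\mathbb Z$-graded $A$-modules with weight-preserving maps, and write $M(i)_j=M_{i+j}$. Let $I^+$ (resp. $I^-$) be the ideal of $A$ generated by the homogeneous elements of positive (resp. negative) weight, and let ${\bf R}\Gamma_{I^\pm}(M)\in\mathcal D(\mathrm{Gr}(A))$ be the local cohomology complex, i.e. the shifted cone of the map from $M$ to its Čech complex on finitely many homogeneous generators of $I^\pm$. Let ${\bf R}\underline{\mathrm{Hom}}_A$ be the graded derived Hom, ${\bf R}\underline{\mathrm{Hom}}_A(M,N)_i={\bf R}\mathrm{Hom}_{\mathrm{Gr}(A)}(M,N(i))$, let ${\bf R}\mathrm{Hom}_A(M,N)$ be its weight $0$ part, and let $\mathbb D_Y(M)\in\mathcal D(\mathrm{Gr}(A))$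 be the graded dual, $\mathbb D_Y(M)_i={\bf R}\mathrm{Hom}_R(M_{-i},\omega)$. Assume that there is an isomorphism $\Psi:{\bf R}\Gamma_{I^+}(A)[1]\cong \mathbb D_Y({\bf R}\Gamma_{I^-}(A))$ in $\mathcal D(\mathrm{Gr}(A))$. (1) Let $M\in\mathcal D(\mathrm{Gr}(A))$ be perfect (isomorphic to a bounded complex of finitely generated projective graded modules), and let $N\in\mathcal D(\mathrm{Gr}(A))$ be such that ${\bf R}\Gamma_{I^+}(N)$ is locally coherent, i.e. every weight component of every cohomology module of ${\bf R}\Gamma_{I^+}(N)$ is a finitely generated $R$-module. Then there is an isomorphism in $\mathcal D(\mathrm{Gr}(A))$ $${\bf R}\underline{\mathrm{Hom}}_A(N,{\bf R}\Gamma_{I^-}(M))\;\cong\;\mathbb D_Y\big({\bf R}\underline{\mathrm{Hom}}_A(M,{\bf R}\Gamma_{I^+}(N))\big)[-1],$$ and $${\bf R}\mathrm{Hom}_A(M,{\bf R}\Gamma_{I^+}(N))\simeq 0\iff {\bf R}\mathrm{Hom}_A(N,{\bf R}\Gamma_{I^-}(M))\simeq 0.$$ (2) The condition on $N$ in (1)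 holds whenever all cohomology modules of $N\in\mathcal D(\mathrm{Gr}(A))$ are finitely generated graded $A$-modules. -/

import Mathlib

open CategoryTheory CategoryTheory.Limits

universe u

/-- A `ℤ`-graded module over the graded `R`-algebra `A = ⨁ 𝒜 i`: its weight components
`X j`, and the multiplication maps `𝒜 i × X j → X (i + j)`. -/
structure GrMod {R A : Type u} [CommRing R] [CommRing A] [Algebra R A]
    (𝒜 : ℤ → Submodule R A) [GradedAlgebra 𝒜] where
  X : ℤ → ModuleCat.{u} R
  act : ∀ {i j k : ℤ}, i + j = k → (𝒜 i →ₗ[R] X j →ₗ[R] X k)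
  one_act : ∀ {j : ℤ} (x : X j), act (zero_add j) ⟨1, SetLike.GradedOne.one_mem⟩ x = x
  mul_act : ∀ {i i' j k l : ℤ} (h : i' + j = k) (h' : i + k = l) (a : 𝒜 i) (b : 𝒜 i') (x : X j),
    act (show (i + i') + j = l by lia) ⟨a * b, SetLike.mul_mem_graded a.2 b.2⟩ x
      = act h' a (act h b x)

namespace GrMod

variable {R A : Type u} [CommRing R] [CommRing A] [Algebra R A]
    {𝒜 : ℤ → Submodule R A} [GradedAlgebra 𝒜]

/-- Morphisms of graded modules preserve the weights and commute with `A`. -/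
@[ext]
structure Hom (M N : GrMod 𝒜) where
  f : ∀ j, M.X j ⟶ N.X j
  map_act : ∀ {i j k : ℤ} (h : i + j = k) (a : 𝒜 i) (x : M.X j),
    (f k).hom (M.act h a x) = N.act h a ((f j).hom x)

instance : Category (GrMod 𝒜) where
  Hom M N := Hom M N
  id M := ⟨fun j => 𝟙 _, fun _ _ _ => rfl⟩
  comp φ ψ := ⟨fun j => φ.f j ≫ ψ.f j, fun h a x => by simp [φ.map_act, ψ.map_act]⟩

@[ext]
lemma hom_ext {M N : GrMod 𝒜} {φ ψ : M ⟶ N} (h : ∀ j, φ.f j = ψ.f j) : φ = ψ :=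
  Hom.ext (funext h)

@[simp] lemma id_f (M : GrMod 𝒜) (j : ℤ) : Hom.f (𝟙 M) j = 𝟙 (M.X j) := rfl
@[simp] lemma comp_f {M N P : GrMod 𝒜} (φ : M ⟶ N) (ψ : N ⟶ P) (j : ℤ) :
    Hom.f (φ ≫ ψ) j = φ.f j ≫ ψ.f j := rfl

section
variable {M N : GrMod 𝒜}
instance : Zero (M ⟶ N) := ⟨⟨fun _ => 0, fun h a x => by simp⟩⟩
instance : Add (M ⟶ N) :=
  ⟨fun φ ψ => ⟨fun j => φ.f j + ψ.f j, fun h a x => by simp [φ.map_act, ψ.map_act]⟩⟩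
instance : Neg (M ⟶ N) := ⟨fun φ => ⟨fun j => - φ.f j, fun h a x => by simp [φ.map_act]⟩⟩
instance : Sub (M ⟶ N) :=
  ⟨fun φ ψ => ⟨fun j => φ.f j - ψ.f j, fun h a x => by simp [φ.map_act, ψ.map_act]⟩⟩
instance : SMul ℕ (M ⟶ N) := ⟨fun n φ => ⟨fun j => n • φ.f j, fun h a x => by simp [φ.map_act]⟩⟩
instance : SMul ℤ (M ⟶ N) := ⟨fun n φ => ⟨fun j => n • φ.f j, fun h a x => by simp [φ.map_act]⟩⟩
instance : SMul R (M ⟶ N) := ⟨fun n φ => ⟨fun j => n • φ.f j, fun h a x => by simp [φ.map_act]⟩⟩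

lemma f_injective : Function.Injective (fun (φ : M ⟶ N) => φ.f) := fun _ _ h => Hom.ext h

instance : AddCommGroup (M ⟶ N) :=
  f_injective.addCommGroup _ rfl (fun _ _ => rfl) (fun _ => rfl) (fun _ _ => rfl)
    (fun _ _ => rfl) (fun _ _ => rfl)

@[simp] lemma zero_f (j : ℤ) : Hom.f (0 : M ⟶ N) j = 0 := rfl
@[simp] lemma add_f (φ ψ : M ⟶ N) (j : ℤ) : Hom.f (φ + ψ) j = φ.f j + ψ.f j := rfl
@[simp] lemma smul_f (r : R) (φ : M ⟶ N) (j : ℤ) : Hom.f (r • φ) j = r • φ.f j := rfl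

instance : Module R (M ⟶ N) :=
  f_injective.module R ⟨⟨fun φ => φ.f, rfl⟩, fun _ _ => rfl⟩ (fun _ _ => rfl)
end

instance : Preadditive (GrMod 𝒜) where

instance : Linear R (GrMod 𝒜) where

/-- The weight `j` component, as a functor `Gr(A) ⥤ Mod(R)`. -/
def weight (j : ℤ) : GrMod 𝒜 ⥤ ModuleCat.{u} R where
  obj M := M.X j
  map φ := φ.f j

instance (j : ℤ) : (weight (𝒜 := 𝒜) j).Additive where
instance (j : ℤ) : (weight (𝒜 := 𝒜) j).Linear R where

/-- Multiplication by `a ∈ A_i` on weight components. -/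
def actNat {i j k : ℤ} (h : i + j = k) (a : 𝒜 i) : weight (𝒜 := 𝒜) j ⟶ weight k where
  app M := ModuleCat.ofHom (M.act h a)
  naturality M N φ := by ext x; exact φ.map_act h a x |>.symm

lemma actNat_add {i j k : ℤ} (h : i + j = k) (a b : 𝒜 i) :
    actNat h (a + b) = actNat h a + actNat h b := by
  ext M x
  exact congrArg (fun t : M.X j →ₗ[R] M.X k => t x) (map_add (M.act h) a b)
lemma actNat_smul {i j k : ℤ} (h : i + j = k) (r : R) (a : 𝒜 i) (M : GrMod 𝒜) :
    (actNat h (r • a)).app M = r • (actNat h a).app M := by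
  ext x
  exact congrArg (fun t : M.X j →ₗ[R] M.X k => t x) (map_smul (M.act h) r a)
lemma actNat_one (j : ℤ) :
    actNat (zero_add j) (⟨1, SetLike.GradedOne.one_mem⟩ : 𝒜 0) = 𝟙 _ := by
  ext M x; exact M.one_act x
lemma actNat_mul {i i' j k l : ℤ} (h : i' + j = k) (h' : i + k = l) (a : 𝒜 i) (b : 𝒜 i') :
    actNat (show (i + i') + j = l by lia) (⟨a * b, SetLike.mul_mem_graded a.2 b.2⟩ : 𝒜 (i + i'))
      = actNat h b ≫ actNat h' a := by
  ext M x; exact M.mul_act h h' a b x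

section limits
variable {J : Type*} [Category* J] (F : J ⥤ GrMod 𝒜)

/-- Limits of graded modules are computed in each weight. -/
@[simps]
noncomputable def limObj [HasLimitsOfShape J (ModuleCat.{u} R)] : GrMod 𝒜 where
  X j := limit (F ⋙ weight j)
  act {i j k} h :=
    { toFun a := (limMap (Functor.whiskerLeft F (actNat h a))).hom
      map_add' a b := by
        rw [← ModuleCat.hom_add]; congr 1
        apply limit.hom_ext; intro x
        simp [actNat_add, NatTrans.app_add, Preadditive.comp_add, Preadditive.add_comp]
      map_smul' r a := by
        dsimp only [RingHom.id_apply]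
        rw [← ModuleCat.hom_smul]; congr 1
        apply limit.hom_ext; intro x; simp [actNat_smul] }
  one_act {j} x := by
    dsimp
    rw [actNat_one, show limMap (Functor.whiskerLeft F (𝟙 (weight j))) = 𝟙 _ by
      apply limit.hom_ext; intro y; simp]
    rfl
  mul_act {i i' j k l} h h' a b x := by
    dsimp
    rw [actNat_mul h h', ← ModuleCat.comp_apply]
    congr 2
    apply limit.hom_ext; intro y; simp

/-- The limit cone. -/
noncomputable def limCone [HasLimitsOfShape J (ModuleCat.{u} R)] : Cone F where
  pt := limObj F
  π :=
    { app x :=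
        { f j := limit.π (F ⋙ weight j) x
          map_act {i j k} h a y := by
            have := limMap_π (Functor.whiskerLeft F (actNat h a)) x
            exact congrArg (fun t => t.hom y) this }
      naturality x y f := by
        ext1 j
        exact (Category.id_comp _).trans (limit.w (F ⋙ weight j) f).symm }

/-- The limit cone is a limit. -/
noncomputable def limConeIsLimit [HasLimitsOfShape J (ModuleCat.{u} R)] : IsLimit (limCone F) where
  lift s :=
    { f j := limit.lift (F ⋙ weight j) ((weight j).mapCone s)
      map_act {i j k} h a y := by
        have : (actNat h a).app s.pt ≫ limit.lift (F ⋙ weight k) ((weight k).mapCone s)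
          = limit.lift (F ⋙ weight j) ((weight j).mapCone s) ≫
            limMap (Functor.whiskerLeft F (actNat h a)) := by
          apply limit.hom_ext; intro x
          simp
        exact congrArg (fun t => t.hom y) this }
  fac s x := by ext1 j; exact limit.lift_π _ _
  uniq s m hm := by
    ext1 j
    apply limit.hom_ext; intro x
    exact (congrArg (fun t => Hom.f t j) (hm x)).trans
      (limit.lift_π ((weight j).mapCone s) x).symm

lemma hasLimitsOfShape [HasLimitsOfShape J (ModuleCat.{u} R)] : HasLimitsOfShape J (GrMod 𝒜) where
  has_limit F := ⟨⟨⟨_, limConeIsLimit F⟩⟩⟩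

lemma preservesLimitsOfShape [HasLimitsOfShape J (ModuleCat.{u} R)] (j : ℤ) :
    PreservesLimitsOfShape J (weight (𝒜 := 𝒜) j) where
  preservesLimit {F} := preservesLimit_of_preserves_limit_cone (limConeIsLimit F)
    (IsLimit.ofIsoLimit (limit.isLimit _) (Cone.ext (Iso.refl _) (fun _ => (Category.id_comp _).symm)))

/-- Colimits of graded modules are computed in each weight. -/
@[simps]
noncomputable def colimObj [HasColimitsOfShape J (ModuleCat.{u} R)] : GrMod 𝒜 where
  X j := colimit (F ⋙ weight j)
  act {i j k} h :=
    { toFun a := (colimMap (Functor.whiskerLeft F (actNat h a))).hom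
      map_add' a b := by
        rw [← ModuleCat.hom_add]; congr 1
        apply colimit.hom_ext; intro x
        simp [actNat_add, NatTrans.app_add, Preadditive.comp_add, Preadditive.add_comp]
      map_smul' r a := by
        dsimp only [RingHom.id_apply]
        rw [← ModuleCat.hom_smul]; congr 1
        apply colimit.hom_ext; intro x; simp [actNat_smul] }
  one_act {j} x := by
    dsimp
    rw [actNat_one, show colimMap (Functor.whiskerLeft F (𝟙 (weight j))) = 𝟙 _ by
      apply colimit.hom_ext; intro y; simp]
    rfl
  mul_act {i i' j k l} h h' a b x := by
    dsimp
    rw [actNat_mul h h', ← ModuleCat.comp_apply]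
    congr 2
    apply colimit.hom_ext; intro y; simp

/-- The colimit cocone. -/
noncomputable def colimCocone [HasColimitsOfShape J (ModuleCat.{u} R)] : Cocone F where
  pt := colimObj F
  ι :=
    { app x :=
        { f j := colimit.ι (F ⋙ weight j) x
          map_act {i j k} h a y := by
            have := ι_colimMap (Functor.whiskerLeft F (actNat h a)) x
            exact congrArg (fun t => t.hom y) this.symm }
      naturality x y f := by
        ext1 j
        exact (colimit.w (F ⋙ weight j) f).trans (Category.comp_id _).symm }

/-- The colimit cocone is a colimit. -/
noncomputable def colimCoconeIsColimit [HasColimitsOfShape J (ModuleCat.{u} R)] :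
    IsColimit (colimCocone F) where
  desc s :=
    { f j := colimit.desc (F ⋙ weight j) ((weight j).mapCocone s)
      map_act {i j k} h a y := by
        have : colimMap (Functor.whiskerLeft F (actNat h a)) ≫
            colimit.desc (F ⋙ weight k) ((weight k).mapCocone s)
          = colimit.desc (F ⋙ weight j) ((weight j).mapCocone s) ≫ (actNat h a).app s.pt := by
          apply colimit.hom_ext; intro x
          simp
        exact congrArg (fun t => t.hom y) this }
  fac s x := by ext1 j; exact colimit.ι_desc _ _
  uniq s m hm := by
    ext1 j
    apply colimit.hom_ext; intro x
    exact (congrArg (fun t => Hom.f t j) (hm x)).trans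
      (colimit.ι_desc ((weight j).mapCocone s) x).symm

lemma hasColimitsOfShape [HasColimitsOfShape J (ModuleCat.{u} R)] : HasColimitsOfShape J (GrMod 𝒜) where
  has_colimit F := ⟨⟨⟨_, colimCoconeIsColimit F⟩⟩⟩

lemma preservesColimitsOfShape [HasColimitsOfShape J (ModuleCat.{u} R)] (j : ℤ) :
    PreservesColimitsOfShape J (weight (𝒜 := 𝒜) j) where
  preservesColimit {F} := preservesColimit_of_preserves_colimit_cocone (colimCoconeIsColimit F)
    (IsColimit.ofIsoColimit (colimit.isColimit _)
      (Cocone.ext (Iso.refl _) (fun _ => Category.comp_id _)))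

end limits

instance : HasFiniteLimits (GrMod 𝒜) := ⟨fun _ _ _ =>
  have : HasFiniteLimits (ModuleCat.{u} R) := Abelian.hasFiniteLimits
  hasLimitsOfShape⟩
instance : HasColimits (GrMod 𝒜) := ⟨fun _ _ => hasColimitsOfShape⟩
instance : HasFiniteColimits (GrMod 𝒜) := hasFiniteColimits_of_hasColimits _
instance (j : ℤ) : PreservesFiniteLimits (weight (𝒜 := 𝒜) j) := ⟨fun _ _ _ =>
  have : HasFiniteLimits (ModuleCat.{u} R) := Abelian.hasFiniteLimits
  preservesLimitsOfShape j⟩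
instance (j : ℤ) : PreservesColimits (weight (𝒜 := 𝒜) j) := ⟨fun {_} _ => preservesColimitsOfShape j⟩
instance (j : ℤ) : PreservesFiniteColimits (weight (𝒜 := 𝒜) j) :=
  PreservesColimits.preservesFiniteColimits _

lemma isIso_of_weight {M N : GrMod 𝒜} (φ : M ⟶ N) (h : ∀ j, IsIso (φ.f j)) : IsIso φ := by
  refine ⟨⟨fun j => inv (φ.f j), fun {i j k} h a x => ?_⟩, ?_, ?_⟩
  · obtain ⟨y, rfl⟩ : ∃ y, (φ.f j).hom y = x := ⟨(inv (φ.f j)).hom x, by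
      rw [← ModuleCat.comp_apply]; simp⟩
    rw [← φ.map_act]
    rw [← ModuleCat.comp_apply, ← ModuleCat.comp_apply]; simp
  · ext1 j; simp
  · ext1 j; simp

instance {M N : GrMod 𝒜} (φ : M ⟶ N) : IsIso (Abelian.coimageImageComparison φ) := by
  have : HasKernels (ModuleCat.{u} R) := Abelian.has_kernels
  have : HasCokernels (ModuleCat.{u} R) := Abelian.has_cokernels
  apply isIso_of_weight
  intro j
  have h := (Abelian.PreservesCoimage.hom_coimageImageComparison (weight j) φ).symm
  have : IsIso ((weight j).map (Abelian.coimageImageComparison φ) ≫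
      (Abelian.PreservesImage.iso (weight j) φ).hom) := by
    rw [h]; infer_instance
  have h2 := Iso.isIso_hom (Abelian.PreservesImage.iso (weight j) φ)
  exact @IsIso.of_isIso_comp_right _ _ _ _ _ ((weight j).map (Abelian.coimageImageComparison φ))
    (Abelian.PreservesImage.iso (weight j) φ).hom h2 this

noncomputable instance : Abelian (GrMod 𝒜) := by
  have : HasFiniteProducts (GrMod 𝒜) := inferInstance
  exact Abelian.ofCoimageImageComparisonIsIso


/-- A cone of graded modules is a limit if it is so in each weight. -/
noncomputable def isLimitOfWeight {J : Type*} [Category* J] {F : J ⥤ GrMod 𝒜} [HasLimit F]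
    [∀ j, PreservesLimit F (weight (𝒜 := 𝒜) j)] (c : Cone F)
    (hc : ∀ j, Nonempty (IsLimit ((weight j).mapCone c))) : IsLimit c := by
  have : IsIso (limit.lift F c) := by
    apply isIso_of_weight
    intro j
    let hl := isLimitOfPreserves (weight j) (limit.isLimit F)
    have : (weight j).map (limit.lift F c) =
        (IsLimit.conePointUniqueUpToIso (hc j).some hl).hom := by
      apply hl.hom_ext
      intro x
      rw [IsLimit.conePointUniqueUpToIso_hom_comp]
      exact congrArg (fun t => Hom.f t j) (limit.lift_π c x)
    have h2 : IsIso ((weight j).map (limit.lift F c)) := by rw [this]; exact Iso.isIso_hom _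
    exact h2
  exact IsLimit.ofIsoLimit (limit.isLimit F)
    (Cone.ext (asIso (limit.lift F c)) (fun x => by simp)).symm

instance : AB5OfSize.{u, u} (GrMod 𝒜) where
  ofShape J _ _ := ⟨⟨fun K _ _ => ⟨fun {F} => ⟨fun {c} hc => ⟨isLimitOfWeight _ (fun j => ⟨by
      let e := preservesColimitNatIso (J := J) (weight (𝒜 := 𝒜) j)
      exact (IsLimit.postcomposeHomEquiv (Functor.isoWhiskerLeft F e) _).1
        (IsLimit.ofIsoLimit
          (isLimitOfPreserves ((Functor.whiskeringRight J _ _).obj (weight (𝒜 := 𝒜) j) ⋙ colim) hc)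
          (Cone.ext (e.symm.app _) (fun k ↦ (NatIso.naturality_2 e.symm _).symm)))⟩)⟩⟩⟩⟩⟩

/-- The graded module `A(n)`, with `A(n)_j = A_{n+j}`. -/
def free (n : ℤ) : GrMod 𝒜 where
  X j := ModuleCat.of R (𝒜 (n + j))
  act {i j k} h :=
    LinearMap.mk₂ R (fun (a : 𝒜 i) (x : 𝒜 (n + j)) =>
      (⟨a * x, by
        have := SetLike.mul_mem_graded a.2 x.2
        rwa [show i + (n + j) = n + k by lia] at this⟩ : 𝒜 (n + k)))
      (fun a b x => Subtype.ext (add_mul _ _ _)) (fun r a x => Subtype.ext (smul_mul_assoc _ _ _))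
      (fun a x y => Subtype.ext (mul_add _ _ _)) (fun r a x => Subtype.ext (mul_smul_comm _ _ _))
  one_act x := Subtype.ext (one_mul _)
  mul_act h h' a b x := Subtype.ext (mul_assoc _ _ _)

lemma act_congr (M : GrMod 𝒜) {i i' j k : ℤ} (h : i + j = k) (h' : i' + j = k) (a : 𝒜 i)
    (a' : 𝒜 i') (haa : (a : A) = a') (x : M.X j) : M.act h a x = M.act h' a' x := by
  obtain rfl : i = i' := by lia
  obtain rfl : a = a' := Subtype.ext haa
  rfl

/-- The morphism `A(-n) ⟶ M` that sends `1` to `x`. -/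
def freeHom {M : GrMod 𝒜} {n : ℤ} (x : M.X n) : free (𝒜 := 𝒜) (-n) ⟶ M where
  f j := ModuleCat.ofHom ((M.act (show (-n + j) + n = j by lia)).flip x)
  map_act {i j k} h a y := by
    refine Eq.trans ?_ (M.mul_act (show (-n + j) + n = j by lia) h a y x)
    exact M.act_congr (i := -n + k) (i' := i + (-n + j)) (k := k) (by lia) (by lia) _ _ rfl x

/-- The element `1` of `A(-n)`, of weight `n`. -/
def freeGen (n : ℤ) : (free (𝒜 := 𝒜) (-n)).X n :=
  (⟨1, by rw [neg_add_cancel]; exact SetLike.GradedOne.one_mem⟩ : 𝒜 (-n + n))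

lemma freeHom_gen {M : GrMod 𝒜} {n : ℤ} (x : M.X n) :
    ((freeHom x).f n).hom (freeGen n) = x := by
  exact Eq.trans (M.act_congr (i := -n + n) (by lia) (zero_add n) _ ⟨1, SetLike.GradedOne.one_mem⟩ rfl x)
    (M.one_act x)

lemma free_hom_ext {M : GrMod 𝒜} {n : ℤ} {φ ψ : free (𝒜 := 𝒜) (-n) ⟶ M}
    (h : (φ.f n).hom (freeGen n) = (ψ.f n).hom (freeGen n)) : φ = ψ := by
  ext j (y : 𝒜 (-n + j))
  have hy : y = ((free (𝒜 := 𝒜) (-n)).act (show (-n + j) + n = j by lia) y (freeGen n)) :=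
    Subtype.ext (mul_one _).symm
  have h1 := φ.map_act (show (-n + j) + n = j by lia) y (freeGen n)
  have h2 := ψ.map_act (show (-n + j) + n = j by lia) y (freeGen n)
  rw [← hy] at h1 h2
  exact h1.trans ((congrArg _ h).trans h2.symm)

lemma surjective_of_epi {M N : GrMod 𝒜} (φ : M ⟶ N) [Epi φ] (j : ℤ) :
    Function.Surjective (φ.f j).hom := by
  have : Epi ((weight j).map φ) := inferInstance
  exact (ModuleCat.epi_iff_surjective _).1 this

instance (n : ℤ) : Projective (free (𝒜 := 𝒜) (-n)) where
  factors {M N} φ p _ := by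
    obtain ⟨x, hx⟩ := surjective_of_epi p n ((φ.f n).hom (freeGen n))
    refine ⟨freeHom x, free_hom_ext ?_⟩
    rw [comp_f, ModuleCat.comp_apply, freeHom_gen, hx]

lemma isSeparating_free :
    ObjectProperty.IsSeparating (.ofObj (fun n : ℤ => free (𝒜 := 𝒜) (-n))) := by
  intro M N φ ψ h
  ext j x
  have := congrArg (fun t => (Hom.f t j).hom (freeGen j))
    (h _ (ObjectProperty.ofObj_apply _ j) (freeHom x))
  simpa [freeHom_gen] using this

/-- The projective generator `⨁ₙ A(-n)` of `Gr(A)`. -/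
noncomputable def generator (𝒜 : ℤ → Submodule R A) [GradedAlgebra 𝒜] : GrMod 𝒜 :=
  ∐ (fun n : ULift.{u} ℤ => free (𝒜 := 𝒜) (-n.down))

lemma isSeparator_generator : IsSeparator (generator 𝒜) := by
  refine isSeparator_of_isColimit_cofan
    (f := fun n : ULift.{u} ℤ => free (𝒜 := 𝒜) (-n.down)) ?_ (coproductIsCoproduct _)
  intro M N φ ψ h
  refine isSeparating_free _ _ ?_
  rintro _ ⟨n⟩ g
  exact h _ (ObjectProperty.ofObj_apply _ (ULift.up n)) g

instance : Projective (generator 𝒜) := by unfold generator; infer_instance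

instance : IsGrothendieckAbelian.{u} (GrMod 𝒜) where
  hasSeparator := ⟨_, isSeparator_generator⟩

end GrMod

namespace KProjectiveResolution

open scoped ZeroObject
open CochainComplex HomComplex MorphismProperty Opposite

variable {C : Type (u + 1)} [Category.{u} C] [Abelian C]

lemma epi_of_isSeparator {G : C} (hG : IsSeparator G) {X Y : C} (p : X ⟶ Y)
    (h : ∀ g : G ⟶ Y, ∃ x : G ⟶ X, x ≫ p = g) : Epi p := by
  refine Preadditive.epi_of_cancel_zero _ (fun {Z} q hq => ?_)
  refine hG.def _ _ (fun g => ?_)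
  obtain ⟨x, rfl⟩ := h g
  simp [hq]

lemma acyclic_of_separator {G : C} (hG : IsSeparator G) (K : CochainComplex C ℤ)
    (h : ∀ (n : ℤ) (z : G ⟶ K.X n), z ≫ K.d n (n + 1) = 0 →
      ∃ x : G ⟶ K.X (n - 1), x ≫ K.d (n - 1) n = z) : K.Acyclic := by
  intro n
  rw [K.exactAt_iff' (n - 1) n (n + 1) (by simp) (by simp), ShortComplex.exact_iff_epi_toCycles]
  refine epi_of_isSeparator hG _ (fun g => ?_)
  let S := K.sc' (n - 1) n (n + 1)
  have hg : (g ≫ S.iCycles) ≫ S.g = 0 := by simp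
  obtain ⟨x, hx⟩ : ∃ x : G ⟶ S.X₁, x ≫ S.f = g ≫ S.iCycles := h n (g ≫ S.iCycles) hg
  exact ⟨x, by rw [← cancel_mono S.iCycles, Category.assoc, ShortComplex.toCycles_i, hx]⟩

lemma exists_of_acyclic (G : C) [Projective G] (K : CochainComplex C ℤ) (hK : K.Acyclic)
    (m n k : ℤ) (hmn : m + 1 = n) (hnk : n + 1 = k) (z : G ⟶ K.X n) (hz : z ≫ K.d n k = 0) :
    ∃ x : G ⟶ K.X m, x ≫ K.d m n = z := by
  have h := hK n
  rw [K.exactAt_iff' m n k (by simp; lia) (by simp; lia)] at h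
  exact ⟨h.liftFromProjective z hz, h.liftFromProjective_comp z hz⟩

lemma quasiIso_of_acyclic_mappingCone {K L : CochainComplex C ℤ} (φ : K ⟶ L)
    (h : (mappingCone φ).Acyclic) : QuasiIso φ := by
  have h1 := (HomotopyCategory.subcategoryAcyclic C).trW_iff_of_distinguished _
    (HomotopyCategory.mappingCone_triangleh_distinguished φ)
  have h2 := h1.2 ((HomotopyCategory.quotient_obj_mem_subcategoryAcyclic_iff_acyclic _).2 h)
  rw [← HomotopyCategory.quasiIso_eq_trW_subcategoryAcyclic] at h2
  exact (HomotopyCategory.quotient_map_mem_quasiIso_iff φ).1 h2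

/-- The inclusion of `G` in degree `n` into the contractible complex `G ⟶ G` in degrees
`n - 1` and `n`. -/
noncomputable def cell (G : C) (n : ℤ) :
    (HomologicalComplex.single C (ComplexShape.up ℤ) n).obj G ⟶
      HomologicalComplex.double (𝟙 G) (show (ComplexShape.up ℤ).Rel (n - 1) n by simp) :=
  HomologicalComplex.mkHomFromSingle
    (HomologicalComplex.doubleXIso₁ (𝟙 G) (by simp) (by simp)).inv
    (fun k hk => by
      rw [HomologicalComplex.double_d_eq_zero₀ _ _ _ _ (by lia), comp_zero])

/-- The generating cells. -/
def cells (G : C) : MorphismProperty (CochainComplex C ℤ) :=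
  MorphismProperty.ofHoms (cell G)

lemma cell_f (G : C) (n : ℤ) : (cell G n).f n =
    (HomologicalComplex.singleObjXSelf (ComplexShape.up ℤ) n G).hom ≫
      (HomologicalComplex.doubleXIso₁ (𝟙 G) (show (ComplexShape.up ℤ).Rel (n - 1) n by simp)
        (by simp)).inv :=
  HomologicalComplex.mkHomFromSingle_f _ _

lemma cells_rlp_iff (G : C) {K L : CochainComplex C ℤ} (p : K ⟶ L) :
    (cells G).rlp p ↔ ∀ (n : ℤ) (z : G ⟶ K.X n) (y : G ⟶ L.X (n - 1)),
      z ≫ K.d n (n + 1) = 0 → y ≫ L.d (n - 1) n = z ≫ p.f n →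
      ∃ x : G ⟶ K.X (n - 1), x ≫ K.d (n - 1) n = z ∧ x ≫ p.f (n - 1) = y := by
  constructor
  · intro hp n z y hz hy
    have hr : (ComplexShape.up ℤ).Rel (n - 1) n := by simp
    have hne : n - 1 ≠ n := by simp
    let a : (HomologicalComplex.single C (ComplexShape.up ℤ) n).obj G ⟶ K :=
      HomologicalComplex.mkHomFromSingle z (fun k hk => by
        obtain rfl : n + 1 = k := hk
        exact hz)
    let b : HomologicalComplex.double (𝟙 G) hr ⟶ L :=
      HomologicalComplex.mkHomFromDouble hr hne y (z ≫ p.f n) (by simp [hy]) (fun k hk => by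
        obtain rfl : n + 1 = k := hk
        rw [Category.assoc, p.comm, reassoc_of% hz, zero_comp])
    have sq : CommSq a (cell G n) p b := ⟨by
      apply HomologicalComplex.from_single_hom_ext
      simp [a, b, cell_f, HomologicalComplex.mkHomFromSingle_f]⟩
    have := hp _ ⟨n⟩
    refine ⟨(HomologicalComplex.doubleXIso₀ (𝟙 G) hr).inv ≫ sq.lift.f (n - 1), ?_, ?_⟩
    · have h1 := congrArg (fun t => HomologicalComplex.Hom.f t n) sq.fac_left
      simp only [HomologicalComplex.comp_f, cell_f, a, HomologicalComplex.mkHomFromSingle_f,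
        Category.assoc, Iso.cancel_iso_hom_left] at h1
      rw [Category.assoc, sq.lift.comm, HomologicalComplex.double_d _ _ hne]
      simpa using h1
    · have h1 := congrArg (fun t => HomologicalComplex.Hom.f t (n - 1)) sq.fac_right
      simp only [HomologicalComplex.comp_f, b, HomologicalComplex.mkHomFromDouble_f₀] at h1
      rw [Category.assoc, h1]
      simp
  · rintro h _ _ _ ⟨n⟩
    have hr : (ComplexShape.up ℤ).Rel (n - 1) n := by simp
    have hne : n - 1 ≠ n := by simp
    refine ⟨fun {a b} sq => ?_⟩
    have hw := congrArg (fun t => HomologicalComplex.Hom.f t n) sq.w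
    simp only [HomologicalComplex.comp_f, cell_f, Category.assoc] at hw
    obtain ⟨x, hx, hx'⟩ := h n
      ((HomologicalComplex.singleObjXSelf (ComplexShape.up ℤ) n G).inv ≫ a.f n)
      ((HomologicalComplex.doubleXIso₀ (𝟙 G) hr).inv ≫ b.f (n - 1)) (by simp) (by
        rw [Category.assoc, Category.assoc, hw, b.comm, HomologicalComplex.double_d _ _ hne]
        simp)
    refine ⟨⟨⟨HomologicalComplex.mkHomFromDouble hr hne x (x ≫ K.d (n - 1) n) (by simp) (by simp),
      ?_, ?_⟩⟩⟩
    · apply HomologicalComplex.from_single_hom_ext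
      simp [cell_f, hx]
    · apply HomologicalComplex.from_double_hom_ext
      · simp [hx']
      · simp only [HomologicalComplex.comp_f, HomologicalComplex.mkHomFromDouble_f₁, hx,
          Category.assoc]
        rw [hw]
        simp

lemma cells_le_mono (G : C) : cells G ≤ monomorphisms _ := by
  rintro _ _ _ ⟨n⟩
  rw [monomorphisms.iff]
  have (i : ℤ) : Mono ((cell G n).f i) := by
    by_cases hi : i = n
    · subst hi
      rw [cell_f]
      infer_instance
    · exact ⟨fun _ _ _ =>
        (HomologicalComplex.isZero_single_obj_X (ComplexShape.up ℤ) n G i hi).eq_of_tgt _ _⟩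
  exact HomologicalComplex.mono_of_mono_f _ this

instance [IsGrothendieckAbelian.{u} C] (G : C) : HasSmallObjectArgument.{u} (cells G) := by
  obtain ⟨κ, hκ', hκ⟩ := HasCardinalLT.exists_regular_cardinal_forall.{u}
    (fun n : ℤ => Subobject ((HomologicalComplex.single C (ComplexShape.up ℤ) n).obj G))
  have : Fact κ.IsRegular := ⟨hκ'⟩
  have : Nonempty κ.ord.ToType := by simpa using hκ'.ne_zero
  have := WellFoundedLT.toOrderBot κ.ord.ToType
  exact ⟨κ, inferInstance, inferInstance,
    { isSmall := isSmall_ofHoms _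
      preservesColimit {A B X Y} i hi f hf := by
        let hf' : (monomorphisms (CochainComplex C ℤ)).TransfiniteCompositionOfShape κ.ord.ToType f :=
          { toTransfiniteCompositionOfShape := hf.toTransfiniteCompositionOfShape
            map_mem j hj := by
              have := (hf.attachCells j hj).pushouts_coproducts
              simp only [ofHoms_homFamily] at this
              refine (?_ : _ ≤ monomorphisms (CochainComplex C ℤ)) _ this
              simp only [pushouts_le_iff, coproducts_le_iff]
              exact cells_le_mono G }
        have (j j' : κ.ord.ToType) (φ : j ⟶ j') : Mono (hf'.F.map φ) := hf'.mem_map φ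
        obtain ⟨n⟩ := hi
        exact IsGrothendieckAbelian.preservesColimit_coyoneda_obj_of_mono
          (Y := hf'.F) (κ := κ) (hκ n) }⟩

lemma cells_rlp_iff' (G : C) {K L : CochainComplex C ℤ} (p : K ⟶ L) :
    (cells G).rlp p ↔ ∀ (m n k : ℤ) (_ : m + 1 = n) (_ : n + 1 = k)
      (z : G ⟶ K.X n) (y : G ⟶ L.X m),
      z ≫ K.d n k = 0 → y ≫ L.d m n = z ≫ p.f n →
      ∃ x : G ⟶ K.X m, x ≫ K.d m n = z ∧ x ≫ p.f m = y := by
  rw [cells_rlp_iff]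
  constructor
  · intro h m n k hm hk
    obtain rfl : m = n - 1 := by lia
    subst hk
    exact h n
  · intro h n
    exact h (n - 1) n (n + 1) (by lia) rfl

lemma quasiIso_of_cells_rlp {G : C} (hG : IsSeparator G) {K L : CochainComplex C ℤ} (p : K ⟶ L)
    (h : (cells G).rlp p) : QuasiIso p := by
  rw [cells_rlp_iff'] at h
  apply quasiIso_of_acyclic_mappingCone
  apply acyclic_of_separator hG
  intro n z hz
  have h1 := congrArg (fun t => t ≫ (mappingCone.fst p).1.v (n + 1) (n + 1 + 1) rfl) hz
  have h2 := congrArg (fun t => t ≫ (mappingCone.snd p).v (n + 1) (n + 1) (add_zero _)) hz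
  simp only [Category.assoc, mappingCone.d_fst_v p n (n + 1) (n + 1 + 1) rfl rfl,
    mappingCone.d_snd_v p n (n + 1) rfl, zero_comp, Preadditive.comp_neg, Preadditive.comp_add,
    neg_eq_zero] at h1 h2
  obtain ⟨x, hx, hx'⟩ := h n (n + 1) _ rfl rfl (z ≫ (mappingCone.fst p).1.v n (n + 1) rfl)
    (- (z ≫ (mappingCone.snd p).v n n (add_zero n))) (by simpa using h1)
    (by
      rw [Preadditive.neg_comp, neg_eq_iff_add_eq_zero]
      simp only [Category.assoc]
      exact (add_comm _ _).trans h2)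
  refine ⟨- (x ≫ (mappingCone.inl p).v n (n - 1) (by lia)), ?_⟩
  rw [mappingCone.ext_to_iff p n (n + 1) rfl]
  simp only [Category.assoc, Preadditive.neg_comp, mappingCone.d_fst_v p (n - 1) n (n + 1) (by lia) rfl,
    mappingCone.d_snd_v p (n - 1) n (by lia), Preadditive.comp_neg, Preadditive.comp_add,
    mappingCone.inl_v_fst_v_assoc, mappingCone.inl_v_snd_v_assoc, zero_comp, comp_zero, hx, hx']
  simp

lemma neg_neg_id_comp {X Y : C} (f : X ⟶ Y) : - (- (𝟙 X ≫ f)) = f := by simp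

lemma neg_id_comp_comp {X Y Z : C} (f : X ⟶ Y) (g : Y ⟶ Z) :
    (- (𝟙 X ≫ f)) ≫ g = - (f ≫ g) := by simp

lemma δ_snd {K L : CochainComplex C ℤ} (φ : K ⟶ L) :
    δ (-1) 0 (mappingCocone.snd φ) = - Cochain.ofHom (mappingCocone.fst φ ≫ φ) := by
  refine (Cochain.δ_leftShift (mappingCone.snd φ) (-1) (-1) 0 (zero_add _) 1 (by lia)).trans ?_
  rw [mappingCone.δ_snd]
  ext p
  have h1 : (mappingCocone.fst φ).f p =
      𝟙 ((mappingCone φ).X (p + -1)) ≫ (mappingCone.fst φ).1.v (p + -1) p (by lia) := by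
    simp [mappingCocone.fst, Cochain.leftShift_v (n := 1) _ _ _ _ p p _ (p + -1) (by lia)]
    exact neg_neg_id_comp (C := C) _
  have h2 : (- Cochain.ofHom (mappingCocone.fst φ ≫ φ)).v p p (add_zero p) =
      - ((mappingCocone.fst φ).f p ≫ φ.f p) :=
    (Cochain.neg_v _ p p _).trans (congrArg Neg.neg (Cochain.ofHom_v _ p))
  refine Eq.trans ?_ h2.symm
  rw [h1]
  simp [Cochain.leftShift_v (n := 1) _ _ _ _ p p _ (p + -1) (by lia)]
  exact neg_id_comp_comp (C := C) _ _

lemma d_snd {K L : CochainComplex C ℤ} (φ : K ⟶ L) (q p r : ℤ) (hq : p + -1 = q)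
    (hr : r + -1 = p) :
    (mappingCocone φ).d p r ≫ (mappingCocone.snd φ).v r p hr =
      - (mappingCocone.fst φ).f p ≫ φ.f p - (mappingCocone.snd φ).v p q hq ≫ L.d q p := by
  have h := congrArg (fun t => t.v p p (add_zero p)) (δ_snd φ)
  simp only [δ_v (-1) 0 (by lia) _ p p (add_zero p) q r (by lia) (by lia), Cochain.neg_v,
    Cochain.ofHom_v, HomologicalComplex.comp_f, Int.negOnePow_zero, one_smul] at h
  rw [eq_sub_iff_add_eq, add_comm, h]

lemma cells_rlp_fst (G : C) [Projective G] (K : CochainComplex C ℤ) (hK : K.Acyclic) :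
    (cells G).rlp (mappingCocone.fst (𝟙 K)) := by
  rw [cells_rlp_iff']
  intro m n k hm hk z y hz hy
  have h1 := congrArg (fun t => t ≫ (mappingCocone.snd (𝟙 K)).v k n (by lia)) hz
  simp only [Category.assoc, d_snd (𝟙 K) m n k (by lia) (by lia), zero_comp,
    HomologicalComplex.id_f, Category.comp_id, Preadditive.comp_sub, Preadditive.comp_neg] at h1
  rw [← hy] at h1
  obtain ⟨l, hl⟩ := exists_of_acyclic G K hK (m - 1) m n (by lia) hm
    (-y - z ≫ (mappingCocone.snd (𝟙 K)).v n m (by lia)) (by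
      rw [Preadditive.sub_comp, Preadditive.neg_comp, Category.assoc, h1])
  refine ⟨y ≫ (mappingCocone.inl (𝟙 K)).v m m (add_zero m) +
    l ≫ (mappingCocone.inr (𝟙 K)).1.v (m - 1) m (by lia), ?_, by simp⟩
  have ext {a b : G ⟶ (mappingCocone (𝟙 K)).X n}
      (h1 : a ≫ (mappingCocone.fst (𝟙 K)).f n = b ≫ (mappingCocone.fst (𝟙 K)).f n)
      (h2 : a ≫ (mappingCocone.snd (𝟙 K)).v n m (by lia) =
        b ≫ (mappingCocone.snd (𝟙 K)).v n m (by lia)) : a = b := by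
    rw [← Category.comp_id a, ← Category.comp_id b,
      ← mappingCocone.id_X (𝟙 K) n m (by lia), Preadditive.comp_add, Preadditive.comp_add,
      reassoc_of% h1, reassoc_of% h2]
  refine ext ?_ ?_
  · rw [Category.assoc, ← (mappingCocone.fst (𝟙 K)).comm, Preadditive.add_comp, ← hy,
      Category.assoc, Category.assoc, mappingCocone.inl_v_fst_f_assoc,
      mappingCocone.inr_v_fst_f_assoc, zero_comp, comp_zero, add_zero]
  · rw [Category.assoc, d_snd (𝟙 K) (m - 1) m n (by lia) (by lia)]
    simp [hl]

lemma isKProjective_of_llp {G : C} [Projective G] (P : CochainComplex C ℤ)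
    (hP : (cells G).rlp.llp (0 : (0 : CochainComplex C ℤ) ⟶ P)) : P.IsKProjective where
  nonempty_homotopy_zero {K} f hK := by
    have := hP _ (cells_rlp_fst G K hK)
    have sq : CommSq (0 : 0 ⟶ mappingCocone (𝟙 K)) (0 : 0 ⟶ P) (mappingCocone.fst (𝟙 K)) f :=
      ⟨by simp⟩
    have hfac := sq.fac_right
    refine ⟨(Cochain.equivHomotopy f 0).symm
      ⟨- (Cochain.ofHom sq.lift).comp (mappingCocone.snd (𝟙 K)) (zero_add _), ?_⟩⟩
    have h3 : Cochain.ofHom f = (Cochain.ofHom sq.lift).comp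
        (Cochain.ofHom (mappingCocone.fst (𝟙 K))) (zero_add 0) := by
      rw [← Cochain.ofHom_comp, hfac]
    rw [δ_neg, δ_ofHom_comp, δ_snd]
    simp [h3]

theorem exists_resolution [IsGrothendieckAbelian.{u} C] {G : C} [Projective G] (hG : IsSeparator G)
    (M : CochainComplex C ℤ) :
    ∃ (P : CochainComplex C ℤ) (π : P ⟶ M), P.IsKProjective ∧ QuasiIso π := by
  let fac := (functorialFactorizationData (cells G).rlp.llp (cells G).rlp).factorizationData
    (0 : 0 ⟶ M)
  have h0 : fac.i = 0 := (isZero_zero _).eq_of_src _ _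
  exact ⟨fac.Z, fac.p, isKProjective_of_llp (G := G) _ (h0 ▸ fac.hi),
    quasiIso_of_cells_rlp hG _ fac.hp⟩

end KProjectiveResolution

namespace GrMod

open CochainComplex CochainComplex.HomComplex

variable {R A : Type u} [CommRing R] [CommRing A] [Algebra R A]
    {𝒜 : ℤ → Submodule R A} [GradedAlgebra 𝒜]

/-- The weight shift `N ↦ N(i)`, with `N(i)_j = N_{i+j}`. -/
def twist (i : ℤ) : GrMod 𝒜 ⥤ GrMod 𝒜 where
  obj N :=
    { X j := N.X (i + j)
      act {a j k} h := N.act (show a + (i + j) = i + k by lia)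
      one_act x := (N.act_congr _ (zero_add _) _ _ rfl x).trans (N.one_act x)
      mul_act {a b j k l} h h' x y z :=
        N.mul_act (show b + (i + j) = i + k by lia) (show a + (i + k) = i + l by lia) x y z }
  map φ :=
    { f j := φ.f (i + j)
      map_act {a j k} h x y := φ.map_act (show a + (i + j) = i + k by lia) x y }

instance (i : ℤ) : (twist (𝒜 := 𝒜) i).Additive where

/-- Multiplication by `a ∈ A_d` as a morphism of graded modules `N(i) ⟶ N(d+i)`,
natural in `N`. -/
def mulTwist {d i k : ℤ} (h : d + i = k) (a : 𝒜 d) : twist (𝒜 := 𝒜) i ⟶ twist k where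
  app N :=
    { f j := ModuleCat.ofHom (N.act (show d + (i + j) = k + j by lia) a)
      map_act {e j l} h' b x := by
        refine (N.mul_act (show e + (i + j) = i + l by lia) (show d + (i + l) = k + l by lia)
          a b x).symm.trans ?_
        refine (N.act_congr (i' := e + d) _ (by lia) _
          ⟨b * a, SetLike.mul_mem_graded b.2 a.2⟩ (mul_comm _ _) x).trans ?_
        exact N.mul_act (show d + (i + j) = k + j by lia) (show e + (k + j) = k + l by lia) b a x }
  naturality N N' φ := by
    ext j x
    exact (φ.map_act (show d + (i + j) = k + j by lia) a x).symm

lemma mulTwist_add {d i k : ℤ} (h : d + i = k) (a b : 𝒜 d) :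
    mulTwist h (a + b) = mulTwist h a + mulTwist h b := by
  ext N j x
  exact congrArg (fun t : N.X (i + j) →ₗ[R] N.X (k + j) => t x)
    (map_add (N.act (show d + (i + j) = k + j by lia)) a b)

lemma mulTwist_smul_app {d i k : ℤ} (h : d + i = k) (r : R) (a : 𝒜 d) (N : GrMod 𝒜) :
    (mulTwist h (r • a)).app N = r • (mulTwist h a).app N := by
  ext j x
  exact congrArg (fun t : N.X (i + j) →ₗ[R] N.X (k + j) => t x)
    (map_smul (N.act (show d + (i + j) = k + j by lia)) r a)

lemma mulTwist_one (i : ℤ) :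
    mulTwist (zero_add i) (⟨1, SetLike.GradedOne.one_mem⟩ : 𝒜 0) = 𝟙 _ := by
  ext N j x
  exact (N.act_congr _ (zero_add _) _ _ rfl x).trans (N.one_act x)

lemma mulTwist_mul {d e i k l : ℤ} (h : e + i = k) (h' : d + k = l) (a : 𝒜 d) (b : 𝒜 e) :
    mulTwist (show (d + e) + i = l by lia)
        (⟨a * b, SetLike.mul_mem_graded a.2 b.2⟩ : 𝒜 (d + e))
      = mulTwist h b ≫ mulTwist h' a := by
  ext N j x
  exact N.mul_act (show e + (i + j) = k + j by lia) (show d + (k + j) = l + j by lia) a b x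

/-- The identity of `N`, seen as a morphism `N ⟶ N(k)` for `k = 0`. -/
def toTwistZero {k : ℤ} (hk : k = 0) : 𝟭 (GrMod 𝒜) ⟶ twist k where
  app N :=
    { f j := ModuleCat.ofHom (N.act (show 0 + j = k + j by lia) ⟨1, SetLike.GradedOne.one_mem⟩)
      map_act {e j l} h' b x := by
        subst hk
        refine (N.mul_act h' (show 0 + l = 0 + l by lia) _ b x).symm.trans ?_
        refine (N.act_congr (i' := e + 0) _ (by lia) _
          ⟨b * 1, SetLike.mul_mem_graded b.2 SetLike.GradedOne.one_mem⟩ (mul_comm _ _) x).trans ?_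
        exact N.mul_act (show 0 + j = 0 + j by lia) (show e + (0 + j) = 0 + l by lia) b
          ⟨1, SetLike.GradedOne.one_mem⟩ x }
  naturality N N' φ := by
    ext j x
    exact (φ.map_act (show 0 + j = k + j by lia) _ x).symm

/-- The sequence `M → M(d) → M(2d) → ⋯` given by multiplication by `f ∈ A_d`. -/
noncomputable def locSeq {d : ℤ} (f : 𝒜 d) : ℕ ⥤ GrMod 𝒜 ⥤ GrMod 𝒜 :=
  Functor.ofSequence (X := fun n => twist ((n : ℤ) * d))
    (fun n => mulTwist (show d + (n : ℤ) * d = ((n + 1 : ℕ) : ℤ) * d by push_cast; ring) f)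

instance : HasColimitsOfShape ℕ (GrMod 𝒜) := hasColimitsOfShape

/-- The localization `M ↦ M_f` at a homogeneous element `f ∈ A_d`, as the colimit of
`M → M(d) → M(2d) → ⋯`: an element `x` of `M(nd)_j = M_{nd+j}` represents the fraction
`x / f ^ n` of weight `j`. -/
noncomputable def loc {d : ℤ} (f : 𝒜 d) : GrMod 𝒜 ⥤ GrMod 𝒜 :=
  (locSeq f).flip ⋙ colim

/-- The canonical map `M(nd) ⟶ M_f`, which is `x ↦ x / f ^ n`. -/
noncomputable def locι {d : ℤ} (f : 𝒜 d) (n : ℕ) : twist ((n : ℤ) * d) ⟶ loc f where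
  app M := colimit.ι ((locSeq f).flip.obj M) n
  naturality _ _ φ := (ι_colimMap ((locSeq f).flip.map φ) n).symm

lemma loc_hom_ext {d : ℤ} (f : 𝒜 d) {M N : GrMod 𝒜} {φ ψ : (loc f).obj M ⟶ N}
    (h : ∀ n, (locι f n).app M ≫ φ = (locι f n).app M ≫ ψ) : φ = ψ :=
  colimit.hom_ext (F := (locSeq f).flip.obj M) h

instance {d : ℤ} (f : 𝒜 d) : (loc f).Additive where
  map_add {M N φ ψ} := loc_hom_ext f (fun n => by
    rw [Preadditive.comp_add, ← NatTrans.naturality, ← NatTrans.naturality,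
      ← NatTrans.naturality, Functor.map_add, Preadditive.add_comp])

/-- The canonical map `M ⟶ M_f`. -/
noncomputable def toLoc {d : ℤ} (f : 𝒜 d) : 𝟭 (GrMod 𝒜) ⟶ loc f :=
  toTwistZero (show ((0 : ℕ) : ℤ) * d = 0 by simp) ≫ locι f 0

/-- The local cohomology complex `RΓ_I(M)` for the ideal `I` generated by the homogeneous
elements `f₁, …, fᵣ`: the total complex of `M → ⨁ M_{fᵢ} → ⨁ M_{fᵢ fⱼ} → ⋯`, that is, the
shifted cone of the map from `M` to the Čech complex of `M`. It is built one element at a time: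
`RΓ_{(f, f₁, …, fᵣ)}(M)` is the shifted cone of `RΓ_{(f₁, …, fᵣ)}(M) → RΓ_{(f₁, …, fᵣ)}(M)_f`. -/
noncomputable def localCohomology :
    List (Σ d : ℤ, 𝒜 d) → CochainComplex (GrMod 𝒜) ℤ →
    CochainComplex (GrMod 𝒜) ℤ
  | [], M => M
  | f :: fs, M => mappingCocone
      ((NatTrans.mapHomologicalComplex (toLoc f.2) (ComplexShape.up ℤ)).app (localCohomology fs M))

/-- The graded Hom complex `\underline{Hom}_A(P, N)`: its weight `i` part is the Hom complex from
`P` to `N(i)` in `Gr(A)`, and `a ∈ A_d` acts by composition with `a : N(i) → N(d+i)`. -/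
noncomputable def gradedHom (P N : CochainComplex (GrMod 𝒜) ℤ) : CochainComplex (GrMod 𝒜) ℤ where
  X n :=
    { X i := ModuleCat.of R (Cochain P (((twist i).mapHomologicalComplex _).obj N) n)
      act {d i k} h := LinearMap.mk₂ R (fun (a : 𝒜 d)
          (z : Cochain P (((twist i).mapHomologicalComplex _).obj N) n) =>
          z.comp (Cochain.ofHom
            ((NatTrans.mapHomologicalComplex (mulTwist h a) (ComplexShape.up ℤ)).app N))
            (add_zero n))
        (fun a b z => by
          refine Cochain.ext _ _ (fun p q hpq => ?_)
          simp only [mulTwist_add, Cochain.comp_zero_cochain_v, Cochain.ofHom_v, Cochain.add_v,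
            NatTrans.mapHomologicalComplex_app_f, NatTrans.app_add]
          exact Preadditive.comp_add (C := GrMod 𝒜) _ _ _ _ _ _)
        (fun r a z => by
          refine Cochain.ext _ _ (fun p q hpq => ?_)
          simp [mulTwist_smul_app]
          exact Linear.comp_smul (C := GrMod 𝒜) _ _ _ _ _ _)
        (fun a z z' => by simp)
        (fun r a z => by simp)
      one_act x := by
        dsimp only [LinearMap.mk₂_apply]
        rw [mulTwist_one, NatTrans.mapHomologicalComplex_id]
        exact Cochain.comp_id x
      mul_act h h' a b x := by
        dsimp only [LinearMap.mk₂_apply]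
        rw [mulTwist_mul h h', NatTrans.mapHomologicalComplex_comp, NatTrans.comp_app,
          Cochain.ofHom_comp]
        exact (Cochain.comp_assoc_of_third_is_zero_cochain _ _ _ _).symm }
  d n m :=
    { f i := ModuleCat.ofHom (δ_hom R P (((twist i).mapHomologicalComplex _).obj N) n m)
      map_act h a z := δ_comp_ofHom _ _ _ }
  shape n m hnm := by
    refine hom_ext (fun i => ModuleCat.hom_ext (LinearMap.ext fun z => ?_))
    exact δ_shape _ _ hnm z
  d_comp_d' n m l _ _ := by
    refine hom_ext (fun i => ModuleCat.hom_ext (LinearMap.ext fun z => ?_))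
    exact δ_δ _ _ _ z

/-- The weight `i` component of a complex of graded modules, a complex of `R`-modules. -/
noncomputable def weightC (i : ℤ) :
    CochainComplex (GrMod 𝒜) ℤ ⥤ CochainComplex (ModuleCat.{u} R) ℤ :=
  (weight i).mapHomologicalComplex _

/-- Multiplication by `a ∈ A_d` on the weight components of a complex of graded modules. -/
noncomputable def actC {d i k : ℤ} (h : d + i = k) (a : 𝒜 d) :
    weightC (𝒜 := 𝒜) i ⟶ weightC k :=
  NatTrans.mapHomologicalComplex (actNat h a) _

lemma actC_f {d i k : ℤ} (h : d + i = k) (a : 𝒜 d) (M : CochainComplex (GrMod 𝒜) ℤ) (n : ℤ) :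
    ((actC h a).app M).f n = (actNat h a).app (M.X n) := rfl

/-- The graded dual of `M` with values in a complex `E` of `R`-modules: its weight `i` part is the
Hom complex from `M_{-i}` to `E`, and `a ∈ A_d` acts by composition with
`a : M_{-(d+i)} → M_{-i}`. -/
noncomputable def homDual (E : CochainComplex (ModuleCat.{u} R) ℤ)
    (M : CochainComplex (GrMod 𝒜) ℤ) : CochainComplex (GrMod 𝒜) ℤ where
  X n :=
    { X i := ModuleCat.of R (Cochain ((weightC (-i)).obj M) E n)
      act {d i k} h := LinearMap.mk₂ R (fun (a : 𝒜 d)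
          (z : Cochain ((weightC (-i)).obj M) E n) =>
          (Cochain.ofHom ((actC (show d + -k = -i by lia) a).app M)).comp z (zero_add n))
        (fun a b z => by
          refine Cochain.ext _ _ (fun p q hpq => ?_)
          simp only [Cochain.zero_cochain_comp_v, Cochain.ofHom_v, Cochain.add_v, actC_f,
            actNat_add, NatTrans.app_add]
          exact Preadditive.add_comp (C := ModuleCat.{u} R) _ _ _ _ _ _)
        (fun r a z => by
          refine Cochain.ext _ _ (fun p q hpq => ?_)
          simp only [Cochain.zero_cochain_comp_v, Cochain.ofHom_v, Cochain.smul_v, actC_f,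
            actNat_smul]
          exact Linear.smul_comp (C := ModuleCat.{u} R) _ _ _ _ _ _)
        (fun a z z' => by simp)
        (fun r a z => by simp)
      one_act {j} x := by
        dsimp only [LinearMap.mk₂_apply]
        rw [actC, actNat_one, NatTrans.mapHomologicalComplex_id]
        exact Cochain.id_comp x
      mul_act {d e i j k} h h' a b x := by
        dsimp only [LinearMap.mk₂_apply]
        have h1 : (actC (show (d + e) + -k = -i by lia)
              (⟨a * b, SetLike.mul_mem_graded a.2 b.2⟩ : 𝒜 (d + e))).app M =
            (actC (show d + -k = -j by lia) a).app M ≫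
              (actC (show e + -j = -i by lia) b).app M := by
          refine HomologicalComplex.hom_ext _ _ (fun n => ModuleCat.hom_ext (LinearMap.ext fun y => ?_))
          refine ((M.X n).act_congr (i' := e + d) _ (by lia) _
            ⟨b * a, SetLike.mul_mem_graded b.2 a.2⟩ (mul_comm _ _) y).trans ?_
          exact (M.X n).mul_act (show d + -k = -j by lia) (show e + -j = -i by lia) b a y
        rw [h1, Cochain.ofHom_comp]
        exact Cochain.comp_assoc_of_first_is_zero_cochain _ _ _ _ }
  d n m :=
    { f i := ModuleCat.ofHom (δ_hom R ((weightC (-i)).obj M) E n m)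
      map_act h a z := δ_ofHom_comp _ _ _ }
  shape n m hnm := by
    refine hom_ext (fun i => ModuleCat.hom_ext (LinearMap.ext fun z => ?_))
    exact δ_shape _ _ hnm z
  d_comp_d' n m l _ _ := by
    refine hom_ext (fun i => ModuleCat.hom_ext (LinearMap.ext fun z => ?_))
    exact δ_δ _ _ _ z

/-- A graded module is finitely generated if it is generated by finitely many homogeneous
elements. -/
def FG (M : GrMod 𝒜) : Prop :=
  ∃ (n : ℕ) (w : Fin n → ℤ) (x : ∀ r, M.X (w r)), ∀ (j : ℤ) (y : M.X j),
    ∃ a : ∀ r, 𝒜 (j - w r), y = ∑ r, M.act (show j - w r + w r = j by lia) (a r) (x r)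

/-- The construction underlying the derived category `𝒟(Gr(A))`. -/
noncomputable instance : HasDerivedCategory (GrMod 𝒜) := HasDerivedCategory.standard _

/-- The construction underlying the derived category of `R`-modules. -/
noncomputable instance {S : Type u} [CommRing S] : HasDerivedCategory (ModuleCat.{u} S) :=
  HasDerivedCategory.standard _

/-- Two complexes of graded modules are isomorphic as objects of `𝒟(Gr(A))`. -/
def DerivedIso (M N : CochainComplex (GrMod 𝒜) ℤ) : Prop :=
  Nonempty (DerivedCategory.Q.obj M ≅ DerivedCategory.Q.obj N)

/-- `M ∈ 𝒟_perf(Gr(A))`: in `𝒟(Gr(A))`, `M` is isomorphic to a bounded complex of finitely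
generated projective graded modules. -/
def IsPerfect (M : CochainComplex (GrMod 𝒜) ℤ) : Prop :=
  ∃ P : CochainComplex (GrMod 𝒜) ℤ,
    (∃ a b : ℤ, P.IsStrictlyGE a ∧ P.IsStrictlyLE b) ∧
    (∀ n, Projective (P.X n) ∧ (P.X n).FG) ∧ DerivedIso P M

/-- `M ∈ 𝒟_coh(Gr(A))`: all cohomology modules are finitely generated graded `A`-modules. -/
def IsCoherent (M : CochainComplex (GrMod 𝒜) ℤ) : Prop :=
  ∀ n, (M.homology n).FG

/-- `M ∈ 𝒟_lc(Gr(A))`: every weight component of every cohomology module is a finitely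
generated `R`-module. -/
def IsLocallyCoherent (M : CochainComplex (GrMod 𝒜) ℤ) : Prop :=
  ∀ n i : ℤ, Module.Finite R ((M.homology n).X i)

/-- `ω` is a dualizing complex over `R` (for `R` Noetherian): it has finitely generated
cohomology and finite injective dimension (hence bounded cohomology), and the homothety map
`R → RHom_R(ω, ω)` is an isomorphism. -/
structure IsDualizing (ω : DerivedCategory (ModuleCat.{u} R)) : Prop where
  finite (n : ℤ) :
    Module.Finite R ((DerivedCategory.homologyFunctor (ModuleCat.{u} R) n).obj ω)
  exists_injective : ∃ E : CochainComplex (ModuleCat.{u} R) ℤ,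
    (∃ a b : ℤ, E.IsStrictlyGE a ∧ E.IsStrictlyLE b) ∧
    (∀ n, Injective (E.X n)) ∧ Nonempty (DerivedCategory.Q.obj E ≅ ω)
  bijective : Function.Bijective (fun r : R => r • 𝟙 ω)
  eq_zero (n : ℤ) (hn : n ≠ 0) (f : ω ⟶ ω⟦n⟧) : f = 0

/-- The dualizing functor `𝔻_Y(M) = R\underline{Hom}_R(M, ω)` for `Y = Spec R`, with
`𝔻_Y(M)_i = RHom_R(M_{-i}, ω)`, computed with a bounded complex of injective modules that
represents `ω`. -/
noncomputable def dualY {ω : DerivedCategory (ModuleCat.{u} R)} (hω : IsDualizing ω)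
    (M : CochainComplex (GrMod 𝒜) ℤ) : CochainComplex (GrMod 𝒜) ℤ :=
  homDual hω.exists_injective.choose M

/-- A K-projective resolution of the complex `M` of graded modules. -/
noncomputable def kProjRes (M : CochainComplex (GrMod 𝒜) ℤ) : CochainComplex (GrMod 𝒜) ℤ :=
  (KProjectiveResolution.exists_resolution isSeparator_generator M).choose

/-- `R\underline{Hom}_A(M, N) ∈ 𝒟(Gr(A))`, computed with a K-projective resolution of `M`. -/
noncomputable def gradedRHom (M N : CochainComplex (GrMod 𝒜) ℤ) : CochainComplex (GrMod 𝒜) ℤ :=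
  gradedHom (kProjRes M) N

/-- `RHom_A(M, N)`, the weight `0` component of `R\underline{Hom}_A(M, N)`. -/
noncomputable def RHom (M N : CochainComplex (GrMod 𝒜) ℤ) :
    CochainComplex (ModuleCat.{u} R) ℤ :=
  (weightC 0).obj (gradedRHom M N)

/-- The graded module `A`, as a complex concentrated in degree `0`. -/
noncomputable def unit (𝒜 : ℤ → Submodule R A) [GradedAlgebra 𝒜] :
    CochainComplex (GrMod 𝒜) ℤ :=
  (CochainComplex.singleFunctor (GrMod 𝒜) 0).obj (free 0)

/-- The ideal `I⁺` generated by the homogeneous elements of positive weight. -/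
def idealPos (𝒜 : ℤ → Submodule R A) : Ideal A := Ideal.span {a | ∃ d : ℤ, 0 < d ∧ a ∈ 𝒜 d}

/-- The ideal `I⁻` generated by the homogeneous elements of negative weight. -/
def idealNeg (𝒜 : ℤ → Submodule R A) : Ideal A := Ideal.span {a | ∃ d : ℤ, d < 0 ∧ a ∈ 𝒜 d}

/-- The ideal generated by a finite list of homogeneous elements. -/
def idealOf (f : List (Σ d : ℤ, 𝒜 d)) : Ideal A := Ideal.span {a | ∃ p ∈ f, a = (p.2 : A)}

end GrMod

/-! Write `D` for the graded dual with values in a bounded complex `E` of injectives that represents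
`ω`, `P` for a bounded complex of finitely generated projectives isomorphic to `M`, `P^∨` for
`Hom(P, A)`, and `f`, `g` for the given generators of `I⁺`, `I⁻`.

The duality rests on representability. Contraction identifies `D(Hom(P, X))` with `Hom(X, D(P^∨))`
(`homDualGradedHom`, invertible because of dual bases). Localization at a homogeneous element has a
right adjoint, so `Hom(RΓ_f X, Y) ≅ Hom(X, Y')` with `Y'` independent of `X`
(`exists_gradedHom_localCohomology_iso`). Hence `D(Hom(P, RΓ_f X)) ≅ Hom(X, Ξ')` and `D(RΓ_g X) ≅
Hom(X, J')`, where `Ξ'` and `J'` do not depend on `X`; putting `X = A` computes the representing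
objects. These are isomorphisms of complexes for arbitrary `X`, so nothing has to be resolved for
them; derived invariance of `Hom` is used only when its first argument is K-projective.

For `J'` this gives `J' ≅ D(RΓ_g A) ≅ RΓ_f(A)[1]`, by `Ψ`, so `D(RΓ_g P) ≅ Hom(P, RΓ_f(A)[1])`.
Dualize once more. The left side returns `RΓ_g P` by biduality; the right side becomes `Hom(RΓ_f A,
D(P^∨))[-1] ≅ Hom(A, Ξ')[-1] ≅ Ξ'[-1]`. So `RΓ_g M ≅ Ξ'[-1]`, and applying `Hom(Q, -)` for a
K-projective resolution `Q` of `N` turns this into the duality, because `Hom(Q, Ξ')` is `D(Hom(P,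
RΓ_f Q))`.

Biduality holds weight by weight for locally coherent complexes (`quasiIso_biduality`). For shifts
of `R` it is the homothety isomorphism; attaching copies of `R` to kill generators of the top
cohomology reaches complexes bounded above, and truncation reaches the rest, since `D` changes
amplitudes by a bounded amount. It applies to `RΓ_g P` by the analogue of (2) for `I⁻`. The
equivalence of vanishing also follows from biduality, because `Hom(P, RΓ_f N)` is again locally
coherent (`isLocallyCoherent_gradedHom`).

For (2) one proves more: the cohomology of `RΓ` has finitely generated weight components which
vanish in large weights of the relevant sign (`isSmall_localCohomology_of_torsion`). If all
generators of the ideal act on the cohomology of `X` in a torsion way, then `RΓ X ≅ X` and the claim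
concerns finitely generated torsion modules. In general, for a generator `t` of weight `d`, the cone
of `t : X → X(d)` has cohomology killed by `t²`, so one more generator has become torsion. The
kernel of `t` on `H^n(RΓ X)` is a quotient of `H^{n-1}` of `RΓ` of this cone, and `H^n(RΓ X)` is
`t`-torsion; since `t` moves weights towards the region of vanishing, smallness descends to `H^n(RΓ
X)` (`isSmall_of_torsion`). -/

namespace ComplexLemmas

open CochainComplex CochainComplex.HomComplex

/-! ### Cochains into and out of mapping cones -/

section Preadditive

variable {C : Type*} [Category* C] [Preadditive C] [HasBinaryBiproducts C]
  {K L : CochainComplex C ℤ} (φ : K ⟶ L) (M : CochainComplex C ℤ)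

/-- If every cocycle from the cone of `φ` is a coboundary, then precomposition with `φ` is
injective on cohomology. -/
lemma eq_δ_of_ofHom_comp_eq_δ
    (h : ∀ (m n k : ℤ), m + 1 = n → n + 1 = k → ∀ z : Cochain (mappingCone φ) M n, δ n k z = 0 →
      ∃ w : Cochain (mappingCone φ) M m, δ m n w = z)
    {m n k : ℤ} (hm : m + 1 = n) (hk : n + 1 = k) (z : Cochain L M n) (hz : δ n k z = 0)
    (y : Cochain K M m) (hy : δ m n y = (Cochain.ofHom φ).comp z (zero_add n)) :
    ∃ w : Cochain L M m, δ m n w = z := by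
  -- Since `δ y` is the restriction of `z` along `φ`, the pair `(±y, z)` is a cocycle on the cone;
  -- the restriction to `L` of a primitive of it is a primitive of `z`.
  obtain ⟨w, hw⟩ := h m n k hm hk (mappingCone.descCochain φ (n.negOnePow • y) z hm) (by
    subst hk
    rw [mappingCone.δ_descCochain φ _ _ hm _ rfl, hz, δ_units_smul, hy, Int.negOnePow_succ]
    simp)
  refine ⟨(Cochain.ofHom (mappingCone.inr φ)).comp w (zero_add m), ?_⟩
  rw [δ_ofHom_comp, hw, mappingCone.inr_descCochain]

/-- If every cocycle from the cone of `φ` is a coboundary, then precomposition with `φ` is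
surjective on cohomology. -/
lemma exists_ofHom_comp_add_δ
    (h : ∀ (m n k : ℤ), m + 1 = n → n + 1 = k → ∀ z : Cochain (mappingCone φ) M n, δ n k z = 0 →
      ∃ w : Cochain (mappingCone φ) M m, δ m n w = z)
    {m n k : ℤ} (hm : m + 1 = n) (hk : n + 1 = k) (z : Cochain K M n) (hz : δ n k z = 0) :
    ∃ (x : Cochain L M n) (w : Cochain K M m), δ n k x = 0 ∧
      z = (Cochain.ofHom φ).comp x (zero_add n) + δ m n w := by
  -- The cocycle `z` is pulled back to the cone. A primitive `w` restricts to `L` as an extension of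
  -- `z` up to sign, and to `K` as the coboundary correction.
  obtain ⟨w, hw⟩ := h n k (k + 1) hk rfl ((mappingCone.fst φ).1.comp z (by lia)) (by
    rw [δ_comp _ _ _ 2 k (k + 1) rfl rfl hk, hz, Cocycle.δ_eq_zero]
    simp)
  have hd : w = mappingCone.descCochain φ ((mappingCone.inl φ).comp w (by lia))
      ((Cochain.ofHom (mappingCone.inr φ)).comp w (zero_add n)) hm := by
    rw [mappingCone.ext_cochain_from_iff φ m n hm]
    simp
  rw [hd, mappingCone.δ_descCochain φ _ _ hm k hk] at hw
  have h1 := congrArg (fun t => (Cochain.ofHom (mappingCone.inr φ)).comp t (zero_add k)) hw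
  have h2 := congrArg (fun t => (mappingCone.inl φ).comp t (show -1 + k = n by lia)) hw
  refine ⟨k.negOnePow • (Cochain.ofHom (mappingCone.inr φ)).comp w (zero_add n),
    (mappingCone.inl φ).comp w (by lia), ?_, ?_⟩
  · simp only [Cochain.comp_add, mappingCone.inr_fst_assoc, mappingCone.inr_snd_assoc,
      zero_add, δ_ofHom_comp] at h1
    rw [δ_units_smul, δ_ofHom_comp, h1, smul_zero]
  · simp only [Cochain.comp_add, mappingCone.inl_fst_assoc, mappingCone.inl_snd_assoc,
      add_zero] at h2
    rw [← h2, Cochain.comp_units_smul, add_comm]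

/-- If every cocycle to the cone of `φ` is a coboundary, then postcomposition with `φ` is
injective on cohomology. -/
lemma eq_δ_of_comp_ofHom_eq_δ
    (h : ∀ (m n k : ℤ), m + 1 = n → n + 1 = k → ∀ z : Cochain M (mappingCone φ) n, δ n k z = 0 →
      ∃ w : Cochain M (mappingCone φ) m, δ m n w = z)
    {m n k : ℤ} (hm : m + 1 = n) (hk : n + 1 = k) (z : Cochain M K n) (hz : δ n k z = 0)
    (y : Cochain M L m) (hy : δ m n y = z.comp (Cochain.ofHom φ) (add_zero n)) :
    ∃ w : Cochain M K m, δ m n w = z := by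
  obtain ⟨w, hw⟩ := h (m - 1) m n (by lia) hm (mappingCone.liftCochain φ z (-y) hm) (by
    rw [mappingCone.δ_liftCochain φ _ _ hm k hk, hz, δ_neg, hy]
    simp)
  refine ⟨-(w.comp (mappingCone.fst φ).1 (by lia)), ?_⟩
  have h1 := congrArg (fun t => t.comp (mappingCone.fst φ).1 hm) hw
  rw [δ_neg, δ_comp w _ _ m 2 n hm (by lia) rfl, Cocycle.δ_eq_zero, Cochain.comp_zero, zero_add,
    Int.negOnePow_one, Units.neg_smul, one_smul, neg_neg, h1]
  simp

/-- If every cocycle to the cone of `φ` is a coboundary, then postcomposition with `φ` is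
surjective on cohomology. -/
lemma exists_comp_ofHom_add_δ
    (h : ∀ (m n k : ℤ), m + 1 = n → n + 1 = k → ∀ z : Cochain M (mappingCone φ) n, δ n k z = 0 →
      ∃ w : Cochain M (mappingCone φ) m, δ m n w = z)
    {m n k : ℤ} (hm : m + 1 = n) (hk : n + 1 = k) (z : Cochain M L n) (hz : δ n k z = 0) :
    ∃ (x : Cochain M K n) (w : Cochain M L m), δ n k x = 0 ∧
      z = x.comp (Cochain.ofHom φ) (add_zero n) + δ m n w := by
  obtain ⟨w, hw⟩ := h m n k hm hk (z.comp (Cochain.ofHom (mappingCone.inr φ)) (add_zero n)) (by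
    rw [δ_comp_ofHom, hz, Cochain.zero_comp])
  obtain ⟨a, b, rfl⟩ : ∃ a b, w = mappingCone.liftCochain φ a b hm :=
    ⟨w.comp (mappingCone.fst φ).1 hm, w.comp (mappingCone.snd φ) (add_zero m), by
      rw [mappingCone.ext_cochain_to_iff φ m n hm]
      simp⟩
  rw [mappingCone.δ_liftCochain φ _ _ hm k hk] at hw
  have h1 := congrArg (fun t => t.comp (mappingCone.fst φ).1 hk) hw
  have h2 := congrArg (fun t => t.comp (mappingCone.snd φ) (add_zero n)) hw
  refine ⟨a, b, ?_, ?_⟩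
  · simpa using h1
  · simp at h2
    rw [← h2, add_comm]

end Preadditive

/-! ### K-projective and K-injective complexes in terms of cochains -/

section Abelian

variable {C : Type*} [Category* C] [Abelian C]

lemma acyclic_mappingCone_iff {K L : CochainComplex C ℤ} (φ : K ⟶ L) :
    (mappingCone φ).Acyclic ↔ QuasiIso φ := by
  have h1 := (HomotopyCategory.subcategoryAcyclic C).trW_iff_of_distinguished _
    (HomotopyCategory.mappingCone_triangleh_distinguished φ)
  rw [← HomotopyCategory.quasiIso_eq_trW_subcategoryAcyclic] at h1
  exact ((HomotopyCategory.quotient_obj_mem_subcategoryAcyclic_iff_acyclic _).symm.trans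
    h1.symm).trans (HomotopyCategory.quotient_map_mem_quasiIso_iff φ)

/-- A cocycle of degree `n` is a morphism from `K` to the acyclic complex `L⟦n⟧`; K-projectivity
gives a null-homotopy, which unshifts to a primitive. -/
lemma eq_δ_of_isKProjective {K L : CochainComplex C ℤ} [K.IsKProjective] (hL : L.Acyclic)
    (m n k : ℤ) (hm : m + 1 = n) (hk : n + 1 = k) (z : Cochain K L n) (hz : δ n k z = 0) :
    ∃ w : Cochain K L m, δ m n w = z := by
  obtain ⟨φ, hφ⟩ := (Cocycle.equivHom ..).surjective
    ((Cocycle.mk z k hk hz).rightShift n 0 (zero_add n))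
  rw [Cocycle.ext_iff] at hφ
  have hL' : (L⟦n⟧).Acyclic := (HomotopyCategory.quotient_obj_mem_subcategoryAcyclic_iff_acyclic _).1
      ((HomotopyCategory.subcategoryAcyclic C).prop_of_iso
        (((HomotopyCategory.quotient C (.up ℤ)).commShiftIso n).symm.app L)
        ((HomotopyCategory.subcategoryAcyclic C).le_shift n _
          ((HomotopyCategory.quotient_obj_mem_subcategoryAcyclic_iff_acyclic _).2 hL)))
  obtain ⟨h⟩ := IsKProjective.nonempty_homotopy_zero φ hL'
  obtain ⟨f, hf⟩ := Cochain.equivHomotopy _ _ h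
  simp only [Int.reduceNeg, Cochain.ofHom_zero, add_zero] at hf
  refine ⟨n.negOnePow • Cochain.rightUnshift f m (by lia), ?_⟩
  apply (Cochain.rightShiftAddEquiv _ _ _ n 0 (by simp)).injective
  simp only [Cochain.rightShiftAddEquiv_apply]
  have hφ' : z.rightShift n 0 (zero_add n) = Cochain.ofHom φ := hφ.symm
  rw [hφ', hf, δ_units_smul, Cochain.rightShift_units_smul,
    Cochain.δ_rightUnshift _ _ _ _ 0 (by simp)]
  simp [smul_smul]

lemma eq_δ_of_isKInjective {K L : CochainComplex C ℤ} [L.IsKInjective] (hK : K.Acyclic)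
    (m n k : ℤ) (hm : m + 1 = n) (hk : n + 1 = k) (z : Cochain K L n) (hz : δ n k z = 0) :
    ∃ w : Cochain K L m, δ m n w = z :=
  IsKInjective.eq_δ_of_cocycle (Cocycle.mk z k hk hz) hK m hm

/-- Cochains from an acyclic K-projective complex. -/
lemma eq_δ_of_isKProjective_of_acyclic {K L : CochainComplex C ℤ} [K.IsKProjective]
    (hK : K.Acyclic) (m n k : ℤ) (hm : m + 1 = n) (hk : n + 1 = k) (z : Cochain K L n)
    (hz : δ n k z = 0) : ∃ w : Cochain K L m, δ m n w = z := by
  -- `β` contracts `K`, which is K-projective and acyclic; composing a cocycle with `β` gives a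
  -- primitive up to sign.
  obtain ⟨β, hβ⟩ := eq_δ_of_isKProjective hK (-1) 0 1 (by simp) (by simp)
    (Cochain.ofHom (𝟙 K)) (by simp)
  refine ⟨n.negOnePow • β.comp z (by lia), ?_⟩
  rw [δ_units_smul, δ_comp β z _ 0 k n hm (by simp) hk, hz, hβ]
  simp [smul_smul]

lemma isKProjective_mappingCone {K L : CochainComplex C ℤ} (φ : K ⟶ L) [K.IsKProjective]
    [L.IsKProjective] : (mappingCone φ).IsKProjective := by
  rw [isKProjective_iff_leftOrthogonal]
  refine ObjectProperty.ext_of_isTriangulatedClosed₃ _ _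
    (HomotopyCategory.mappingCone_triangleh_distinguished φ) ?_ ?_
  · exact IsKProjective.leftOrthogonal K
  · exact IsKProjective.leftOrthogonal L

end Abelian

/-! ### Elementwise criteria for complexes of modules -/

section ModuleCat

variable {R : Type u} [CommRing R]

lemma acyclic_iff_forall {C : CochainComplex (ModuleCat.{u} R) ℤ} :
    C.Acyclic ↔ ∀ (m n k : ℤ) (_ : m + 1 = n) (_ : n + 1 = k) (x : C.X n), C.d n k x = 0 →
      ∃ y : C.X m, C.d m n y = x := by
  constructor
  · intro h m n k hm hk
    have := h n
    rw [C.exactAt_iff' m n k (by simp; lia) (by simp; lia), ShortComplex.moduleCat_exact_iff] at this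
    exact this
  · intro h n
    rw [C.exactAt_iff' (n - 1) n (n + 1) (by simp) (by simp), ShortComplex.moduleCat_exact_iff]
    exact h (n - 1) n (n + 1) (by lia) rfl

lemma comm_apply {C D : CochainComplex (ModuleCat.{u} R) ℤ} (φ : C ⟶ D) (m n : ℤ) (x : C.X m) :
    φ.f n (C.d m n x) = D.d m n (φ.f m x) := by
  rw [← ModuleCat.comp_apply, ← φ.comm]; rfl

/-- An elementwise criterion for quasi-isomorphisms of complexes of modules. -/
lemma quasiIso_of_forall {K L : CochainComplex (ModuleCat.{u} R) ℤ} (φ : K ⟶ L)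
    (hi : ∀ (m n k : ℤ) (_ : m + 1 = n) (_ : n + 1 = k) (x : K.X n) (y : L.X m),
      K.d n k x = 0 → L.d m n y = φ.f n x → ∃ w : K.X m, K.d m n w = x)
    (hs : ∀ (m n k : ℤ) (_ : m + 1 = n) (_ : n + 1 = k) (y : L.X n), L.d n k y = 0 →
      ∃ (x : K.X n) (w : L.X m), K.d n k x = 0 ∧ y = φ.f n x + L.d m n w) : QuasiIso φ := by
  rw [← acyclic_mappingCone_iff, acyclic_iff_forall]
  intro m n k hm hk x hx
  have e1 : (mappingCone.fst φ).1.v k (k + 1) rfl ((mappingCone φ).d n k x) =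
      - K.d k (k + 1) ((mappingCone.fst φ).1.v n k hk x) :=
    congrArg (fun t => t.hom x) (mappingCone.d_fst_v φ n k (k + 1) hk rfl)
  have e2 : (mappingCone.snd φ).v k k (add_zero k) ((mappingCone φ).d n k x) =
      φ.f k ((mappingCone.fst φ).1.v n k hk x) +
        L.d n k ((mappingCone.snd φ).v n n (add_zero n) x) :=
    congrArg (fun t => t.hom x) (mappingCone.d_snd_v φ n k hk)
  rw [hx, map_zero] at e1 e2
  -- A cocycle of the cone is a pair `(a, b)` with `d a = 0` and `φ a = -d b`. The first hypothesis
  -- gives `a = d w`; then `φ w + b` is a cocycle, which the second writes as `φ c + d v`. The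
  -- primitive is `(c - w, v)`.
  set a := (mappingCone.fst φ).1.v n k hk x with ha
  set b := (mappingCone.snd φ).v n n (add_zero n) x with hb
  obtain ⟨w, hw⟩ := hi n k (k + 1) hk rfl a (-b) (by rw [eq_comm, neg_eq_zero] at e1; exact e1)
    (by rw [map_neg, neg_eq_iff_add_eq_zero, add_comm]; exact e2.symm)
  obtain ⟨c, v, hc, hv⟩ := hs m n k hm hk (φ.f n w + b) (by
    rw [map_add, ← comm_apply, hw]; exact e2.symm)
  refine ⟨(mappingCone.inl φ).v n m (by lia) (c - w) + (mappingCone.inr φ).f m v, ?_⟩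
  have f1 : (mappingCone φ).d m n ((mappingCone.inl φ).v n m (by lia) (c - w)) =
      (mappingCone.inr φ).f n (φ.f n (c - w)) -
        (mappingCone.inl φ).v k n (by lia) (K.d n k (c - w)) :=
    congrArg (fun t => t.hom (c - w)) (mappingCone.inl_v_d φ n m k (by lia) (by lia))
  have f2 : x = (mappingCone.inl φ).v k n (by lia) a + (mappingCone.inr φ).f n b :=
    congrArg (fun t => t.hom x) (mappingCone.id_X φ n k hk).symm
  rw [map_add, f1, ← comm_apply, f2, map_sub (K.d n k).hom, hc, hw]
  have f3 : b = φ.f n (c - w) + L.d m n v := by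
    rw [map_sub, sub_add_eq_add_sub, ← hv]; simp
  rw [f3, map_add]
  simp
  abel

end ModuleCat

end ComplexLemmas

/-! ### Graded complexes weight by weight -/

namespace GrMod

open CochainComplex CochainComplex.HomComplex ComplexLemmas

variable {R A : Type u} [CommRing R] [CommRing A] [Algebra R A]
    {𝒜 : ℤ → Submodule R A} [GradedAlgebra 𝒜]

/-- The weight shift of complexes. -/
noncomputable abbrev twC (i : ℤ) :
    CochainComplex (GrMod 𝒜) ℤ ⥤ CochainComplex (GrMod 𝒜) ℤ :=
  (twist i).mapHomologicalComplex _

lemma isIso_of_bijective {M N : GrMod 𝒜} (φ : M ⟶ N)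
    (h : ∀ j, Function.Bijective (φ.f j).hom) : IsIso φ :=
  isIso_of_weight φ (fun j => (ConcreteCategory.isIso_iff_bijective (φ.f j)).2 (h j))

lemma isIso_of_bijective_f {K L : CochainComplex (GrMod 𝒜) ℤ} (φ : K ⟶ L)
    (h : ∀ n j, Function.Bijective ((φ.f n).f j).hom) : IsIso φ := by
  have (n : ℤ) : IsIso (φ.f n) := isIso_of_bijective _ (h n)
  exact HomologicalComplex.Hom.isIso_of_components φ

lemma isZero_of_weight {M : GrMod 𝒜} (h : ∀ j, IsZero (M.X j)) : IsZero M := by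
  rw [IsZero.iff_id_eq_zero]
  ext1 j
  exact (h j).eq_of_src _ _

lemma isZero_weight {M : GrMod 𝒜} (h : IsZero M) (j : ℤ) : IsZero (M.X j) :=
  (weight j).map_isZero h

instance (j : ℤ) : (weight (𝒜 := 𝒜) j).PreservesHomology :=
  Functor.preservesHomologyOfExact _

/-- The weight components of the cohomology. -/
noncomputable def homologyWeightIso (K : CochainComplex (GrMod 𝒜) ℤ) (j n : ℤ) :
    ((weightC j).obj K).homology n ≅ (weight j).obj (K.homology n) :=
  (K.sc n).mapHomologyIso (weight j)

instance (j : ℤ) {K L : CochainComplex (GrMod 𝒜) ℤ} (φ : K ⟶ L) [QuasiIso φ] :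
    QuasiIso ((weightC j).map φ) :=
  inferInstanceAs (QuasiIso (((weight j).mapHomologicalComplex _).map φ))

/-- The weight functors are exact and jointly reflect isomorphisms. This reduces statements on `Hom`
complexes and duals to complexes of `R`-modules. -/
lemma quasiIso_iff_weight {K L : CochainComplex (GrMod 𝒜) ℤ} (φ : K ⟶ L) :
    QuasiIso φ ↔ ∀ j, QuasiIso ((weightC j).map φ) := by
  refine ⟨fun _ j => inferInstance, fun h => ?_⟩
  rw [quasiIso_iff]
  intro n
  rw [quasiIsoAt_iff_isIso_homologyMap]
  apply isIso_of_weight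
  intro j
  have h1 : IsIso (HomologicalComplex.homologyMap ((weightC j).map φ) n) := inferInstance
  have h2 : HomologicalComplex.homologyMap ((weightC j).map φ) n ≫ (homologyWeightIso L j n).hom =
      (homologyWeightIso K j n).hom ≫ (weight j).map (HomologicalComplex.homologyMap φ n) :=
    ShortComplex.mapHomologyIso_hom_naturality
      (φ := (HomologicalComplex.shortComplexFunctor _ _ n).map φ) (weight j)
  have h3 : IsIso ((weight j).map (HomologicalComplex.homologyMap φ n)) := by
    rw [← Iso.inv_comp_eq] at h2
    rw [← h2]
    infer_instance
  exact h3

lemma quasiIso_twC {K L : CochainComplex (GrMod 𝒜) ℤ} (φ : K ⟶ L) [QuasiIso φ] (i : ℤ) :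
    QuasiIso ((twC i).map φ) := by
  rw [quasiIso_iff_weight]
  exact fun j => inferInstanceAs (QuasiIso ((weightC (i + j)).map φ))

/-! ### Functoriality of the graded Hom complex and of the dual -/

section maps

/-- Postcomposition on the graded Hom complex. -/
noncomputable def gradedHomMap (P : CochainComplex (GrMod 𝒜) ℤ)
    {N N' : CochainComplex (GrMod 𝒜) ℤ} (φ : N ⟶ N') : gradedHom P N ⟶ gradedHom P N' where
  f n :=
    { f i := ModuleCat.ofHom
        { toFun (z : Cochain P ((twC i).obj N) n) :=
            z.comp (Cochain.ofHom ((twC i).map φ)) (add_zero n)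
          map_add' _ _ := Cochain.add_comp _ _ _ _
          map_smul' _ _ := Cochain.smul_comp _ _ _ _ }
      map_act {d i k} h a (z : Cochain P ((twC i).obj N) n) := by
        let t := NatTrans.mapHomologicalComplex (mulTwist h a) (ComplexShape.up ℤ)
        have key : (z.comp (Cochain.ofHom (t.app N)) (add_zero n)).comp
              (Cochain.ofHom ((twC k).map φ)) (add_zero n) =
            (z.comp (Cochain.ofHom ((twC i).map φ)) (add_zero n)).comp
              (Cochain.ofHom (t.app N')) (add_zero n) := by
          rw [Cochain.comp_assoc_of_third_is_zero_cochain,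
            Cochain.comp_assoc_of_third_is_zero_cochain, ← Cochain.ofHom_comp,
            ← Cochain.ofHom_comp, t.naturality]
        exact key }
  comm' n m _ := hom_ext (fun i => ModuleCat.hom_ext (LinearMap.ext fun z =>
    δ_comp_ofHom (K := (twC i).obj N') z ((twC i).map φ) m))

/-- Precomposition on the graded Hom complex. -/
noncomputable def gradedHomPre {P P' : CochainComplex (GrMod 𝒜) ℤ} (φ : P ⟶ P')
    (N : CochainComplex (GrMod 𝒜) ℤ) : gradedHom P' N ⟶ gradedHom P N where
  f n :=
    { f i := ModuleCat.ofHom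
        { toFun (z : Cochain P' ((twC i).obj N) n) :=
            (Cochain.ofHom φ).comp z (zero_add n)
          map_add' _ _ := Cochain.comp_add _ _ _ _
          map_smul' _ _ := Cochain.comp_smul _ _ _ _ }
      map_act {d i k} h a (z : Cochain P' ((twC i).obj N) n) :=
        (Cochain.comp_assoc_of_third_is_zero_cochain (Cochain.ofHom φ) z (Cochain.ofHom
          ((NatTrans.mapHomologicalComplex (mulTwist h a) (ComplexShape.up ℤ)).app N))
          (zero_add n)).symm }
  comm' n m _ := hom_ext (fun i => ModuleCat.hom_ext (LinearMap.ext fun z =>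
    δ_ofHom_comp φ (K := (twC i).obj N) z m))

/-- Contravariant functoriality of the graded dual. -/
noncomputable def homDualMap (E : CochainComplex (ModuleCat.{u} R) ℤ)
    {M M' : CochainComplex (GrMod 𝒜) ℤ} (φ : M ⟶ M') : homDual E M' ⟶ homDual E M where
  f n :=
    { f i := ModuleCat.ofHom
        { toFun (z : Cochain ((weightC (-i)).obj M') E n) :=
            (Cochain.ofHom ((weightC (-i)).map φ)).comp z (zero_add n)
          map_add' _ _ := Cochain.comp_add _ _ _ _
          map_smul' _ _ := Cochain.comp_smul _ _ _ _ }
      map_act {d i k} h a (z : Cochain ((weightC (-i)).obj M') E n) := by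
        let t := actC (𝒜 := 𝒜) (show d + -k = -i by lia) a
        have key : (Cochain.ofHom ((weightC (-k)).map φ)).comp
              ((Cochain.ofHom (t.app M')).comp z (zero_add n)) (zero_add n) =
            (Cochain.ofHom (t.app M)).comp
              ((Cochain.ofHom ((weightC (-i)).map φ)).comp z (zero_add n)) (zero_add n) := by
          rw [← Cochain.comp_assoc_of_first_is_zero_cochain,
            ← Cochain.comp_assoc_of_first_is_zero_cochain, ← Cochain.ofHom_comp,
            ← Cochain.ofHom_comp, t.naturality]
        exact key }
  comm' n m _ := hom_ext (fun i => ModuleCat.hom_ext (LinearMap.ext fun z =>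
    δ_ofHom_comp ((weightC (-i)).map φ) (K := E) z m))

lemma quasiIso_gradedHomMap (P : CochainComplex (GrMod 𝒜) ℤ) [P.IsKProjective]
    {N N' : CochainComplex (GrMod 𝒜) ℤ} (φ : N ⟶ N') [QuasiIso φ] :
    QuasiIso (gradedHomMap P φ) := by
  rw [quasiIso_iff_weight]
  intro i
  have := quasiIso_twC φ i
  have h := (acyclic_mappingCone_iff ((twC i).map φ)).2 inferInstance
  have h2 := eq_δ_of_isKProjective (K := P) h
  refine quasiIso_of_forall _ (fun m n k hm hk x y hx hy => ?_) (fun m n k hm hk y hy => ?_)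
  · exact eq_δ_of_comp_ofHom_eq_δ _ _ h2 hm hk x hx y hy
  · exact exists_comp_ofHom_add_δ _ _ h2 hm hk y hy

lemma quasiIso_gradedHomPre {P P' : CochainComplex (GrMod 𝒜) ℤ} [P.IsKProjective]
    [P'.IsKProjective] (φ : P ⟶ P') [QuasiIso φ] (N : CochainComplex (GrMod 𝒜) ℤ) :
    QuasiIso (gradedHomPre φ N) := by
  rw [quasiIso_iff_weight]
  intro i
  have := isKProjective_mappingCone φ
  have h := (acyclic_mappingCone_iff φ).2 inferInstance
  have h2 := eq_δ_of_isKProjective_of_acyclic (L := (twC i).obj N) h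
  refine quasiIso_of_forall _ (fun m n k hm hk x y hx hy => ?_) (fun m n k hm hk y hy => ?_)
  · exact eq_δ_of_ofHom_comp_eq_δ _ _ h2 hm hk x hx y hy
  · exact exists_ofHom_comp_add_δ _ _ h2 hm hk y hy

lemma quasiIso_homDualMap (E : CochainComplex (ModuleCat.{u} R) ℤ) [E.IsKInjective]
    {M M' : CochainComplex (GrMod 𝒜) ℤ} (φ : M ⟶ M') [QuasiIso φ] :
    QuasiIso (homDualMap E φ) := by
  rw [quasiIso_iff_weight]
  intro i
  have h := (acyclic_mappingCone_iff ((weightC (-i)).map φ)).2 inferInstance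
  have h2 := eq_δ_of_isKInjective (L := E) h
  refine quasiIso_of_forall _ (fun m n k hm hk x y hx hy => ?_) (fun m n k hm hk y hy => ?_)
  · exact eq_δ_of_ofHom_comp_eq_δ _ _ h2 hm hk x hx y hy
  · exact exists_ofHom_comp_add_δ _ _ h2 hm hk y hy

end maps

/-! ### Isomorphisms in the derived category -/

namespace DerivedIso

variable {M N P : CochainComplex (GrMod 𝒜) ℤ}

lemma of_quasiIso (φ : M ⟶ N) [QuasiIso φ] : DerivedIso M N :=
  ⟨asIso (DerivedCategory.Q.map φ)⟩

lemma of_iso (e : M ≅ N) : DerivedIso M N := ⟨DerivedCategory.Q.mapIso e⟩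

lemma symm (h : DerivedIso M N) : DerivedIso N M := ⟨h.some.symm⟩

lemma trans (h : DerivedIso M N) (h' : DerivedIso N P) : DerivedIso M P := ⟨h.some ≪≫ h'.some⟩

/-- An isomorphism in the derived category out of a K-projective complex is induced by a
quasi-isomorphism. -/
lemma exists_quasiIso [M.IsKProjective] (h : DerivedIso M N) : ∃ φ : M ⟶ N, QuasiIso φ := by
  obtain ⟨e⟩ := h
  obtain ⟨g, hg⟩ := (IsKProjective.Qh_map_bijective M
    ((HomotopyCategory.quotient _ _).obj N)).surjective
    ((DerivedCategory.quotientCompQhIso (GrMod 𝒜)).hom.app M ≫ e.hom ≫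
      (DerivedCategory.quotientCompQhIso (GrMod 𝒜)).inv.app N)
  obtain ⟨φ, rfl⟩ := (HomotopyCategory.quotient _ _).map_surjective g
  refine ⟨φ, ?_⟩
  have h1 : IsIso (DerivedCategory.Qh.map ((HomotopyCategory.quotient (GrMod 𝒜) (.up ℤ)).map φ)) := by
    rw [hg]; infer_instance
  rw [← DerivedCategory.isIso_Q_map_iff_quasiIso]
  exact (NatIso.isIso_map_iff (DerivedCategory.quotientCompQhIso (GrMod 𝒜)) φ).1 h1

/-- A K-projective resolution of `M` also maps to `N`, because morphisms from it in the derived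
category are represented by morphisms of complexes. A construction that preserves quasi-isomorphisms
therefore preserves `DerivedIso`. -/
lemma exists_roof (h : DerivedIso M N) :
    ∃ (Z : CochainComplex (GrMod 𝒜) ℤ) (φ : Z ⟶ M) (ψ : Z ⟶ N), Z.IsKProjective ∧
      QuasiIso φ ∧ QuasiIso ψ := by
  obtain ⟨Z, φ, hZ, hφ⟩ := KProjectiveResolution.exists_resolution isSeparator_generator M
  obtain ⟨ψ, hψ⟩ := ((of_quasiIso φ).trans h).exists_quasiIso
  exact ⟨Z, φ, ψ, hZ, hφ, hψ⟩

lemma gradedHom_right (P : CochainComplex (GrMod 𝒜) ℤ) [P.IsKProjective] (h : DerivedIso M N) :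
    DerivedIso (gradedHom P M) (gradedHom P N) := by
  obtain ⟨Z, φ, ψ, _, _, _⟩ := h.exists_roof
  have := quasiIso_gradedHomMap P φ
  have := quasiIso_gradedHomMap P ψ
  exact (of_quasiIso (gradedHomMap P φ)).symm.trans (of_quasiIso (gradedHomMap P ψ))

lemma gradedHom_left [M.IsKProjective] [N.IsKProjective] (h : DerivedIso M N)
    (Y : CochainComplex (GrMod 𝒜) ℤ) : DerivedIso (gradedHom M Y) (gradedHom N Y) := by
  obtain ⟨φ, _⟩ := h.exists_quasiIso
  have := quasiIso_gradedHomPre φ Y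
  exact (of_quasiIso (gradedHomPre φ Y)).symm

lemma homDual (E : CochainComplex (ModuleCat.{u} R) ℤ) [E.IsKInjective] (h : DerivedIso M N) :
    DerivedIso (homDual E M) (GrMod.homDual E N) := by
  obtain ⟨Z, φ, ψ, _, _, _⟩ := h.exists_roof
  have := quasiIso_homDualMap E φ
  have := quasiIso_homDualMap E ψ
  exact (of_quasiIso (homDualMap E φ)).trans (of_quasiIso (homDualMap E ψ)).symm

lemma shift (h : DerivedIso M N) (n : ℤ) : DerivedIso (M⟦n⟧) (N⟦n⟧) :=
  ⟨(DerivedCategory.Q.commShiftIso n).app M ≪≫ (CategoryTheory.shiftFunctor _ n).mapIso h.some ≪≫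
    ((DerivedCategory.Q.commShiftIso n).app N).symm⟩

lemma acyclic_weight_iff (h : DerivedIso M N) (j : ℤ) :
    ((weightC j).obj M).Acyclic ↔ ((weightC j).obj N).Acyclic := by
  obtain ⟨Z, φ, ψ, _, _, _⟩ := h.exists_roof
  have key {X Y : CochainComplex (ModuleCat.{u} R) ℤ} (f : X ⟶ Y) [QuasiIso f] :
      X.Acyclic ↔ Y.Acyclic :=
    forall_congr' (fun n => exactAt_iff_of_quasiIsoAt f n)
  exact (key ((weightC j).map φ)).symm.trans (key ((weightC j).map ψ))

end DerivedIso

end GrMod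

/-! ### Hom complexes out of `A`, and shifts of Hom complexes -/

namespace GrMod

open CochainComplex CochainComplex.HomComplex ComplexLemmas

variable {R A : Type u} [CommRing R] [CommRing A] [Algebra R A]
    {𝒜 : ℤ → Submodule R A} [GradedAlgebra 𝒜]

lemma fromSingleMk_smul {C : Type*} [Category* C] [Preadditive C] [HasZeroObject C] [Linear R C]
    {X : C} {K : CochainComplex C ℤ} (r : R) {p q n : ℤ} (f : X ⟶ K.X q) (h : p + n = q) :
    Cochain.fromSingleMk (r • f) h = r • Cochain.fromSingleMk f h := by
  refine Cochain.ext _ _ (fun p' q' hpq' => ?_)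
  by_cases hp : p' = p
  · subst hp
    obtain rfl : q = q' := by lia
    rw [Cochain.smul_v, Cochain.fromSingleMk_v, Cochain.fromSingleMk_v, Linear.comp_smul]
    rfl
  · rw [Cochain.smul_v, Cochain.fromSingleMk_v_eq_zero _ _ _ _ _ hp,
      Cochain.fromSingleMk_v_eq_zero _ _ _ _ _ hp, smul_zero]

lemma rightUnshift_comp_ofHom {C : Type*} [Category* C] [Preadditive C]
    {K L M : CochainComplex C ℤ} {a n m : ℤ} (z : Cochain K (L⟦a⟧) n) (h : n + a = m) (φ : L ⟶ M) :
    (z.comp (Cochain.ofHom (φ⟦a⟧')) (add_zero n)).rightUnshift m h =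
      (z.rightUnshift m h).comp (Cochain.ofHom φ) (add_zero m) := by
  refine Cochain.ext _ _ (fun p q hpq => ?_)
  rw [Cochain.rightUnshift_v _ _ _ _ _ _ (q - a) (by lia), Cochain.comp_zero_cochain_v,
    Cochain.comp_zero_cochain_v, Cochain.rightUnshift_v _ _ _ _ _ _ (q - a) (by lia)]
  simp
  exact (Category.assoc _ _ _).trans
    ((congrArg (z.v p (q - a) (by lia) ≫ ·) (HomologicalComplex.XIsoOfEq_hom_naturality φ
      (show q - a + a = q by lia))).trans (Category.assoc _ _ _).symm)

lemma leftUnshift_comp_ofHom {C : Type*} [Category* C] [Preadditive C]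
    {K L M : CochainComplex C ℤ} {a n m : ℤ} (z : Cochain (K⟦a⟧) L n) (h : m + a = n) (φ : L ⟶ M) :
    (z.comp (Cochain.ofHom φ) (add_zero n)).leftUnshift m h =
      (z.leftUnshift m h).comp (Cochain.ofHom φ) (add_zero m) := by
  refine Cochain.ext _ _ (fun p q hpq => ?_)
  rw [Cochain.leftUnshift_v _ _ _ _ _ _ (p - a) (by lia), Cochain.comp_zero_cochain_v,
    Cochain.comp_zero_cochain_v, Cochain.leftUnshift_v _ _ _ _ _ _ (p - a) (by lia)]
  simp
  rfl

/-! ### Elements of graded modules as morphisms from shifts of `A` -/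

lemma act_of_eq_one (M : GrMod 𝒜) {i j : ℤ} (h : i + j = j) (a : 𝒜 i) (ha : (a : A) = 1)
    (x : M.X j) : M.act h a x = x :=
  (M.act_congr h (zero_add j) a ⟨1, SetLike.GradedOne.one_mem⟩ ha x).trans (M.one_act x)

/-- Transport along an equality of weights. -/
def castW (M : GrMod 𝒜) {j k : ℤ} (h : j = k) (x : M.X j) : M.X k :=
  M.act (show 0 + j = k by lia) ⟨1, SetLike.GradedOne.one_mem⟩ x

@[simp]
lemma castW_rfl (M : GrMod 𝒜) {j : ℤ} (h : j = j) (x : M.X j) : M.castW h x = x :=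
  M.act_of_eq_one _ _ rfl x

/-- The morphism `A(j) ⟶ M(t)` that sends `a` to `a x`, for `x` of weight `t - j`. -/
def evalAt {M : GrMod 𝒜} {j k t : ℤ} (h : j + k = t) (x : M.X k) :
    free (𝒜 := 𝒜) j ⟶ (twist t).obj M where
  f l := ModuleCat.ofHom ((M.act (show (j + l) + k = t + l by lia)).flip x)
  map_act {d i l} h' a y := by
    refine Eq.trans ?_ (M.mul_act (show (j + i) + k = t + i by lia) (show d + (t + i) = t + l by lia)
      a y x)
    exact M.act_congr (i := j + l) (i' := d + (j + i)) (k := t + l) (by lia) (by lia) _ _ rfl x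

lemma evalAt_apply {M : GrMod 𝒜} {j k t : ℤ} (h : j + k = t) (x : M.X k) (l : ℤ)
    (a : 𝒜 (j + l)) :
    ((evalAt h x).f l).hom a = M.act (show (j + l) + k = t + l by lia) a x := rfl

lemma evalAt_add {M : GrMod 𝒜} {j k t : ℤ} (h : j + k = t) (x y : M.X k) :
    evalAt (𝒜 := 𝒜) h (x + y) = evalAt h x + evalAt h y := by
  ext l a
  exact map_add (M.act (show (j + l) + k = t + l by lia) a) x y

lemma evalAt_smul {M : GrMod 𝒜} {j k t : ℤ} (h : j + k = t) (r : R) (x : M.X k) :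
    evalAt (𝒜 := 𝒜) h (r • x) = r • evalAt h x := by
  ext l a
  exact map_smul (M.act (show (j + l) + k = t + l by lia) a) r x

lemma evalAt_map {M N : GrMod 𝒜} (φ : M ⟶ N) {j k t : ℤ} (h : j + k = t) (x : M.X k) :
    evalAt h x ≫ (twist t).map φ = evalAt h ((φ.f k).hom x) := by
  ext l a
  exact φ.map_act (show (j + l) + k = t + l by lia) a x

lemma evalAt_mulTwist (M : GrMod 𝒜) {j k t d k' t' : ℤ} (h : j + k = t) (h' : j + k' = t')
    (hk : d + k = k') (ht : d + t = t') (a : 𝒜 d) (x : M.X k) :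
    evalAt h x ≫ (mulTwist ht a).app M = evalAt h' (M.act hk a x) := by
  ext l (b : 𝒜 (j + l))
  refine (M.mul_act (show (j + l) + k = t + l by lia) (show d + (t + l) = t' + l by lia)
    a b x).symm.trans ?_
  refine (M.act_congr (i' := (j + l) + d) _ (by lia) _
    ⟨b * a, SetLike.mul_mem_graded b.2 a.2⟩ (mul_comm _ _) x).trans ?_
  exact M.mul_act hk (show (j + l) + k' = t' + l by lia) b a x

/-- `A(j)` is free on the element `1` of weight `-j`, so a morphism to `M(t)` is the choice of an
element of `M` of weight `t - j`. -/
lemma evalAt_bijective (M : GrMod 𝒜) {j k t : ℤ} (h : j + k = t) :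
    Function.Bijective (fun x : M.X k => evalAt (𝒜 := 𝒜) h x) := by
  have h1 : (1 : A) ∈ 𝒜 (j + -j) := by
    rw [add_neg_cancel]; exact SetLike.GradedOne.one_mem
  obtain rfl : k = t + -j := by lia
  constructor
  · intro x y hxy
    have := congrArg (fun φ => (Hom.f φ (-j)).hom (⟨1, h1⟩ : 𝒜 (j + -j))) hxy
    dsimp only at this
    rw [evalAt_apply, evalAt_apply, M.act_of_eq_one _ _ rfl, M.act_of_eq_one _ _ rfl] at this
    exact this
  · intro φ
    refine ⟨(φ.f (-j)).hom (⟨1, h1⟩ : 𝒜 (j + -j)), ?_⟩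
    ext l (a : 𝒜 (j + l))
    have := φ.map_act (show (j + l) + -j = l by lia) a (⟨1, h1⟩ : 𝒜 (j + -j))
    refine (this.symm.trans ?_)
    congr 1
    exact Subtype.ext (mul_one _)

/-! ### The graded Hom complex from `A` -/

/-- The canonical morphism `X ⟶ \underline{Hom}_A(A, X)`. -/
noncomputable def toGradedHomUnit (X : CochainComplex (GrMod 𝒜) ℤ) :
    X ⟶ gradedHom (unit 𝒜) X where
  f n :=
    { f i := ModuleCat.ofHom
        { toFun x := (Cochain.fromSingleMk (K := (twC i).obj X) (evalAt (zero_add i) x)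
            (zero_add n) : Cochain (unit 𝒜) ((twC i).obj X) n)
          map_add' x y := by
            rw [evalAt_add]
            exact Cochain.fromSingleMk_add (K := (twC i).obj X) _ _ _
          map_smul' r x := by
            rw [evalAt_smul]
            exact fromSingleMk_smul (K := (twC i).obj X) r _ _ }
      map_act {d i k} h a x := by
        have e1 := Cochain.fromSingleMk_postcomp (K := (twC i).obj X) (L := (twC k).obj X)
          (evalAt (zero_add i) x) (zero_add n)
          ((NatTrans.mapHomologicalComplex (mulTwist h a) (ComplexShape.up ℤ)).app X)
        have e2 : evalAt (zero_add i) x ≫ (mulTwist h a).app (X.X n) =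
          evalAt (zero_add k) ((X.X n).act h a x) := evalAt_mulTwist _ _ _ _ _ _ _
        have e3 := congrArg (fun t => Cochain.fromSingleMk (K := (twC k).obj X) t (zero_add n)) e2.symm
        exact e3.trans e1 }
  comm' n m _ := hom_ext (fun i => ModuleCat.hom_ext (LinearMap.ext fun x => by
    refine (Cochain.δ_fromSingleMk (K := (twC i).obj X) (evalAt (zero_add i) x) (zero_add n)
      m m (zero_add m)).trans ?_
    exact congrArg (fun t => Cochain.fromSingleMk (K := (twC i).obj X) t (zero_add m))
      (evalAt_map (X.d n m) (zero_add i) x)))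

/-- A cochain out of a complex concentrated in degree `0` has a single component, and a morphism out
of `A` is a single element. -/
instance (X : CochainComplex (GrMod 𝒜) ℤ) : IsIso (toGradedHomUnit X) := by
  apply isIso_of_bijective_f
  intro n i
  exact ((Cochain.fromSingleEquiv (K := (twC i).obj X) (zero_add n)).symm.bijective).comp
    (evalAt_bijective (X.X n) (zero_add i))

/-! ### Shifts -/

/-- `\underline{Hom}_A(X, Y[a]) ≅ \underline{Hom}_A(X, Y)[a]`. -/
noncomputable def gradedHomShift (X Y : CochainComplex (GrMod 𝒜) ℤ) (a : ℤ) :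
    gradedHom X (Y⟦a⟧) ⟶ (gradedHom X Y)⟦a⟧ where
  f n :=
    { f i := ModuleCat.ofHom
        { toFun (z : Cochain X ((twC i).obj (Y⟦a⟧)) n) :=
            (z.comp (Cochain.ofHom (((twC i).commShiftIso a).hom.app Y)) (add_zero n)).rightUnshift
              (n + a) rfl
          map_add' z z' := by rw [Cochain.add_comp, Cochain.rightUnshift_add]
          map_smul' r z := by
            rw [Cochain.smul_comp, Cochain.rightUnshift_smul]; rfl }
      map_act {d i k} h b (z : Cochain X ((twC i).obj (Y⟦a⟧)) n) := by
        let t := NatTrans.mapHomologicalComplex (mulTwist h b) (ComplexShape.up ℤ)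
        have key : ((z.comp (Cochain.ofHom (t.app (Y⟦a⟧))) (add_zero n)).comp
              (Cochain.ofHom (((twC k).commShiftIso a).hom.app Y)) (add_zero n)).rightUnshift
                (n + a) rfl =
            ((z.comp (Cochain.ofHom (((twC i).commShiftIso a).hom.app Y))
              (add_zero n)).rightUnshift (n + a) rfl).comp
                (Cochain.ofHom (t.app Y)) (add_zero (n + a)) := by
          rw [← rightUnshift_comp_ofHom, Cochain.comp_assoc_of_third_is_zero_cochain,
            Cochain.comp_assoc_of_third_is_zero_cochain, ← Cochain.ofHom_comp,
            ← Cochain.ofHom_comp]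
          congr 3
        exact key }
  comm' n m _ := hom_ext (fun i => ModuleCat.hom_ext (LinearMap.ext fun z => by
    have key (z : Cochain X ((twC i).obj (Y⟦a⟧)) n) :
        a.negOnePow • δ (n + a) (m + a) ((z.comp (Cochain.ofHom
          (((twC i).commShiftIso a).hom.app Y)) (add_zero n)).rightUnshift (n + a) rfl) =
        ((δ n m z).comp (Cochain.ofHom
          (((twC i).commShiftIso a).hom.app Y)) (add_zero m)).rightUnshift (m + a) rfl := by
      -- Unshifting a cochain multiplies `δ` by `(-1)^a`, which cancels the sign in the differential
      -- of the shifted complex.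
      rw [Cochain.δ_rightUnshift _ _ _ _ m rfl, smul_smul, Int.units_mul_self, one_smul,
        δ_comp_ofHom]
    exact key z))

/-- `\underline{Hom}_A(X[a], Y) ≅ \underline{Hom}_A(X, Y)[-a]`. -/
noncomputable def gradedHomShiftLeft (X Y : CochainComplex (GrMod 𝒜) ℤ) (a : ℤ) :
    gradedHom (X⟦a⟧) Y ⟶ (gradedHom X Y)⟦-a⟧ where
  f n :=
    { f i := ModuleCat.ofHom
        { toFun (z : Cochain (X⟦a⟧) ((twC i).obj Y) n) := z.leftUnshift (n + -a) (by lia)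
          map_add' z z' := by rw [Cochain.leftUnshift_add]
          map_smul' r z := by rw [Cochain.leftUnshift_smul]; rfl }
      map_act {d i k} h b (z : Cochain (X⟦a⟧) ((twC i).obj Y) n) := by
        let t := NatTrans.mapHomologicalComplex (mulTwist h b) (ComplexShape.up ℤ)
        have key : (z.comp (Cochain.ofHom (t.app Y)) (add_zero n)).leftUnshift
                (n + -a) (by lia) =
            (z.leftUnshift (n + -a) (by lia)).comp
                (Cochain.ofHom (t.app Y)) (add_zero (n + -a)) := by
          exact leftUnshift_comp_ofHom z _ _
        exact key }
  comm' n m _ := hom_ext (fun i => ModuleCat.hom_ext (LinearMap.ext fun z => by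
    have key (z : Cochain (X⟦a⟧) ((twC i).obj Y) n) :
        (-a).negOnePow • δ (n + -a) (m + -a) (z.leftUnshift (n + -a) (by lia)) =
        (δ n m z).leftUnshift (m + -a) (by lia) := by
      rw [Cochain.δ_leftUnshift _ _ _ _ m (by lia), smul_smul, Int.negOnePow_neg,
        Int.units_mul_self, one_smul]
    exact key z))

instance (X Y : CochainComplex (GrMod 𝒜) ℤ) (a : ℤ) : IsIso (gradedHomShift X Y a) := by
  apply isIso_of_bijective_f
  intro n i
  have h : Function.Bijective (fun z : Cochain X ((twC i).obj (Y⟦a⟧)) n =>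
      z.comp (Cochain.ofHom (((twC i).commShiftIso a).hom.app Y)) (add_zero n)) := by
    refine Function.bijective_iff_has_inverse.2 ⟨fun z =>
      z.comp (Cochain.ofHom (((twC i).commShiftIso a).inv.app Y)) (add_zero n), fun z => ?_,
      fun z => ?_⟩
    · dsimp only
      rw [Cochain.comp_assoc_of_third_is_zero_cochain, ← Cochain.ofHom_comp]
      simp
    · dsimp only
      rw [Cochain.comp_assoc_of_third_is_zero_cochain, ← Cochain.ofHom_comp]
      simp
  exact ((Cochain.rightShiftAddEquiv X ((twC i).obj Y) (n + a) a n rfl).symm.bijective).comp h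

instance (X Y : CochainComplex (GrMod 𝒜) ℤ) (a : ℤ) : IsIso (gradedHomShiftLeft X Y a) := by
  apply isIso_of_bijective_f
  intro n i
  exact (Cochain.leftShiftAddEquiv X ((twC i).obj Y) (n + -a) a n (by lia)).symm.bijective

end GrMod

/-! ### Dual bases and the `A`-dual of a complex -/

namespace GrMod

open CochainComplex CochainComplex.HomComplex ComplexLemmas

variable {R A : Type u} [CommRing R] [CommRing A] [Algebra R A]
    {𝒜 : ℤ → Submodule R A} [GradedAlgebra 𝒜]

/-- The morphism `A(j) ⟶ M` that sends `a` to `a x`, for `x` of weight `-j`. -/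
def freeEval {M : GrMod 𝒜} {j k : ℤ} (h : j + k = 0) (x : M.X k) : free (𝒜 := 𝒜) j ⟶ M where
  f l := ModuleCat.ofHom ((M.act (show (j + l) + k = l by lia)).flip x)
  map_act {d i l} h' a y := by
    refine Eq.trans ?_ (M.mul_act (show (j + i) + k = i by lia) (show d + i = l by lia) a y x)
    exact M.act_congr (i := j + l) (i' := d + (j + i)) (k := l) (by lia) (by lia) _ _ rfl x

lemma freeEval_comp {M N : GrMod 𝒜} {j k : ℤ} (h : j + k = 0) (x : M.X k) (φ : M ⟶ N) :
    freeEval h x ≫ φ = freeEval h ((φ.f k).hom x) := by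
  ext l a
  exact φ.map_act (show (j + l) + k = l by lia) a x

/-- Multiplication by `a ∈ A_d`, as a morphism `A(j) ⟶ A(d + j)`. -/
def mulFree {d j k : ℤ} (h : d + j = k) (a : 𝒜 d) : free (𝒜 := 𝒜) j ⟶ free k where
  f l := ModuleCat.ofHom
    { toFun (x : 𝒜 (j + l)) := (⟨a * x, by
        have := SetLike.mul_mem_graded a.2 x.2
        rwa [show d + (j + l) = k + l by lia] at this⟩ : 𝒜 (k + l))
      map_add' x y := Subtype.ext (mul_add _ _ _)
      map_smul' r x := Subtype.ext (mul_smul_comm _ _ _) }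
  map_act {e i l} h' b y := Subtype.ext (mul_left_comm _ _ _)

lemma freeEval_free {j k l : ℤ} (h : j + k = 0) (x : 𝒜 (l + k)) (h' : (l + k) + j = l) :
    freeEval (M := free l) h x = mulFree h' x := by
  ext m a
  exact Subtype.ext (mul_comm _ _)

lemma mulFree_evalAt {M : GrMod 𝒜} {d j j' k k' t : ℤ} (hj : d + j = j') (h : j' + k = t)
    (h' : j + k' = t) (hk : d + k = k') (a : 𝒜 d) (x : M.X k) :
    mulFree hj a ≫ evalAt h x = evalAt h' (M.act hk a x) := by
  ext l (b : 𝒜 (j + l))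
  refine Eq.trans ?_ (M.mul_act hk (show (j + l) + k' = t + l by lia) b a x)
  exact M.act_congr (i := j' + l) (i' := (j + l) + d) _ (by lia) _
    ⟨b * a, SetLike.mul_mem_graded b.2 a.2⟩ (mul_comm _ _) x

lemma mem_of_eq {i j : ℤ} (h : i = j) (a : 𝒜 i) : (a : A) ∈ 𝒜 j := h ▸ a.2

/-- Finitely generated projective graded modules have finite dual bases. -/
lemma exists_dualBasis (P : GrMod 𝒜) [Projective P] (hP : P.FG) :
    ∃ (n : ℕ) (w : Fin n → ℤ) (x : ∀ r, P.X (w r)), ∀ (j : Fin n → ℤ) (hj : ∀ r, j r + w r = 0),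
      ∃ ξ : ∀ r, P ⟶ free (j r), ∑ r, ξ r ≫ freeEval (hj r) (x r) = 𝟙 P := by
  obtain ⟨n, w, x, hx⟩ := hP
  refine ⟨n, w, x, fun j hj => ?_⟩
  have : HasFiniteBiproducts (GrMod 𝒜) := Abelian.hasFiniteBiproducts
  let π : (⨁ fun r => free (𝒜 := 𝒜) (j r)) ⟶ P := biproduct.desc (fun r => freeEval (hj r) (x r))
  have hπ : Epi π := by
    have (l : ℤ) : Epi (π.f l) := by
      rw [ModuleCat.epi_iff_surjective]
      intro y
      obtain ⟨a, rfl⟩ := hx l y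
      have hm (r) : (a r : A) ∈ 𝒜 (j r + l) := mem_of_eq (by have := hj r; lia) (a r)
      refine ⟨∑ r, ((biproduct.ι (fun r => free (𝒜 := 𝒜) (j r)) r).f l).hom
        (⟨a r, hm r⟩ : 𝒜 (j r + l)), ?_⟩
      rw [map_sum]
      refine Finset.sum_congr rfl (fun r _ => ?_)
      have h1 := congrArg (fun φ => (Hom.f φ l).hom (⟨a r, hm r⟩ : 𝒜 (j r + l)))
        (biproduct.ι_desc (fun r => freeEval (hj r) (x r)) r)
      refine Eq.trans h1 ?_
      exact P.act_congr (show (j r + l) + w r = l by have := hj r; lia)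
        (show l - w r + w r = l by lia) ⟨a r, hm r⟩ (a r) rfl _
    constructor
    intro Z φ ψ h
    ext1 l
    rw [← cancel_epi (π.f l)]
    exact congrArg (fun t => Hom.f t l) h
  -- A section of the surjection `⨁ A(j_r) → P` given by the generators; its components are the dual
  -- basis.
  let s := Projective.factorThru (𝟙 P) π
  refine ⟨fun r => s ≫ biproduct.π _ r, ?_⟩
  have h1 : s ≫ π = 𝟙 P := Projective.factorThru_comp _ _
  rw [← h1, ← Category.id_comp π, ← biproduct.total, Preadditive.sum_comp, Preadditive.comp_sum]
  refine Finset.sum_congr rfl (fun r _ => ?_)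
  rw [Category.assoc, Category.assoc]
  congr 2
  exact (biproduct.ι_desc (fun r => freeEval (hj r) (x r)) r).symm

/-- The dual `\underline{Hom}_A(P, A)` of a complex of graded modules. -/
def dualC (P : CochainComplex (GrMod 𝒜) ℤ) : CochainComplex (GrMod 𝒜) ℤ where
  X m :=
    { X j := ModuleCat.of R (P.X (-m) ⟶ free j)
      act {d j k} h := LinearMap.mk₂ R (fun (a : 𝒜 d) (ξ : P.X (-m) ⟶ free j) => ξ ≫ mulFree h a)
        (fun a b ξ => by
          rw [← Preadditive.comp_add]; congr 1; ext l x; exact Subtype.ext (add_mul _ _ _))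
        (fun r a ξ => by
          rw [← Linear.comp_smul]; congr 1; ext l x; exact Subtype.ext (smul_mul_assoc _ _ _))
        (fun a ξ ξ' => Preadditive.add_comp _ _ _ _ _ _)
        (fun r a ξ => Linear.smul_comp _ _ _ _ _ _)
      one_act ξ := by
        ext l x
        exact Subtype.ext (one_mul _)
      mul_act h h' a b ξ := by
        ext l x
        exact Subtype.ext (mul_assoc _ _ _) }
  d m n :=
    { f j := ModuleCat.ofHom
        -- The sign is that of `δ` on a cochain of degree `m` from `P` to a target with zero
        -- differential.
        { toFun (ξ : P.X (-m) ⟶ free j) := (m + 1).negOnePow • (P.d (-n) (-m) ≫ ξ)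
          map_add' ξ ξ' := by rw [Preadditive.comp_add, smul_add]
          map_smul' r ξ := by
            rw [RingHom.id_apply, Linear.comp_smul]
            exact smul_comm (_ : ℤ) (_ : R) _ }
      map_act {d j k} h a ξ := by
        have key : (m + 1).negOnePow • (P.d (-n) (-m) ≫ (ξ : P.X (-m) ⟶ free j) ≫ mulFree h a) =
          ((m + 1).negOnePow • (P.d (-n) (-m) ≫ ξ)) ≫ mulFree h a := by
          rw [Linear.units_smul_comp, Category.assoc]
        exact key }
  shape m n h := by
    refine hom_ext (fun j => ModuleCat.hom_ext (LinearMap.ext fun ξ => ?_))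
    have : P.d (-n) (-m) = 0 := P.shape _ _ (fun h' => h (by
      simp only [ComplexShape.up_Rel] at h' ⊢; lia))
    have key : (m + 1).negOnePow • (P.d (-n) (-m) ≫ (ξ : P.X (-m) ⟶ free j)) = 0 := by
      rw [this, zero_comp, smul_zero]
    exact key
  d_comp_d' m n k _ _ := by
    refine hom_ext (fun j => ModuleCat.hom_ext (LinearMap.ext fun ξ => ?_))
    have key : (n + 1).negOnePow • (P.d (-k) (-n) ≫
        ((m + 1).negOnePow • (P.d (-n) (-m) ≫ (ξ : P.X (-m) ⟶ free j)))) = 0 := by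
      rw [Linear.comp_units_smul, ← Category.assoc, P.d_comp_d, zero_comp, smul_zero, smul_zero]
    exact key

end GrMod

/-! ### The pairing of `P^∨` with `X`, and the contraction `D(Hom(P, X)) → Hom(X, D(P^∨))` -/

namespace GrMod

open CochainComplex CochainComplex.HomComplex ComplexLemmas

variable {R A : Type u} [CommRing R] [CommRing A] [Algebra R A]
    {𝒜 : ℤ → Submodule R A} [GradedAlgebra 𝒜]

lemma single_add {C : Type*} [Category* C] [Preadditive C] {K L : CochainComplex C ℤ} {p q : ℤ}
    (f g : K.X p ⟶ L.X q) (n : ℤ) :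
    Cochain.single (f + g) n = Cochain.single f n + Cochain.single g n := by
  refine Cochain.ext _ _ (fun p' q' h => ?_)
  rw [Cochain.add_v]
  by_cases hp : p' = p
  · by_cases hq : q' = q
    · subst hp hq
      simp
    · simp [Cochain.single_v_eq_zero' _ _ _ _ _ hq]
  · simp [Cochain.single_v_eq_zero _ _ _ _ _ hp]

lemma single_smul {C : Type*} [Category* C] [Preadditive C] [Linear R C]
    {K L : CochainComplex C ℤ} {p q : ℤ} (r : R) (f : K.X p ⟶ L.X q) (n : ℤ) :
    Cochain.single (r • f) n = r • Cochain.single f n := by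
  refine Cochain.ext _ _ (fun p' q' h => ?_)
  rw [Cochain.smul_v]
  by_cases hp : p' = p
  · by_cases hq : q' = q
    · subst hp hq
      simp
    · simp [Cochain.single_v_eq_zero' _ _ _ _ _ hq]
  · simp [Cochain.single_v_eq_zero _ _ _ _ _ hp]

lemma single_comp_ofHom {C : Type*} [Category* C] [Preadditive C]
    {K L L' : CochainComplex C ℤ} {p q : ℤ} (f : K.X p ⟶ L.X q) (n : ℤ) (φ : L ⟶ L') :
    (Cochain.single f n).comp (Cochain.ofHom φ) (add_zero n) =
      Cochain.single (f ≫ φ.f q) n := by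
  refine Cochain.ext _ _ (fun p' q' h => ?_)
  by_cases hp : p' = p
  · by_cases hq : q' = q
    · subst hp hq
      simp
    · simp [Cochain.single_v_eq_zero' _ _ _ _ _ hq]
  · simp [Cochain.single_v_eq_zero _ _ _ _ _ hp]

/-- The cochain from `P` to `X(t)` given by `ξ : P⁻ᵐ ⟶ A(j)` and an element `x` of `X`. -/
noncomputable def pairing {P X : CochainComplex (GrMod 𝒜) ℤ} {m s j k t : ℤ} (h : j + k = t)
    (ξ : P.X (-m) ⟶ free j) (x : (X.X s).X k) (q : ℤ) : Cochain P ((twC t).obj X) q :=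
  Cochain.single (L := (twC t).obj X) (ξ ≫ evalAt h x) q

section

variable {P X : CochainComplex (GrMod 𝒜) ℤ} {m s j k t : ℤ} (h : j + k = t)
    (ξ ξ' : P.X (-m) ⟶ free j) (x y : (X.X s).X k) (q : ℤ)

lemma pairing_add_left : pairing h (ξ + ξ') x q = pairing h ξ x q + pairing h ξ' x q :=
  (congrArg (fun f => Cochain.single (L := (twC t).obj X) f q)
    (Preadditive.add_comp (C := GrMod 𝒜) _ _ _ _ _ _)).trans (single_add _ _ _)

lemma pairing_smul_left (r : R) : pairing h (r • ξ) x q = r • pairing h ξ x q :=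
  (congrArg (fun f => Cochain.single (L := (twC t).obj X) f q)
    (Linear.smul_comp (C := GrMod 𝒜) _ _ _ _ _ _)).trans (single_smul _ _ _)

lemma pairing_add_right : pairing h ξ (x + y) q = pairing h ξ x q + pairing h ξ y q :=
  (congrArg (fun f => Cochain.single (L := (twC t).obj X) f q)
    ((congrArg (ξ ≫ ·) (evalAt_add h x y)).trans
    (Preadditive.comp_add (C := GrMod 𝒜) _ _ _ _ _ _))).trans (single_add _ _ _)

lemma pairing_smul_right (r : R) : pairing h ξ (r • x) q = r • pairing h ξ x q :=
  (congrArg (fun f => Cochain.single (L := (twC t).obj X) f q)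
    ((congrArg (ξ ≫ ·) (evalAt_smul h r x)).trans
    (Linear.comp_smul (C := GrMod 𝒜) _ _ _ _ _ _))).trans (single_smul _ _ _)

lemma pairing_mulTwist {d k' t' : ℤ} (h' : j + k' = t') (hk : d + k = k') (ht : d + t = t')
    (a : 𝒜 d) :
    (pairing h ξ x q).comp (Cochain.ofHom ((NatTrans.mapHomologicalComplex (mulTwist ht a)
      (ComplexShape.up ℤ)).app X)) (add_zero q) = pairing h' ξ ((X.X s).act hk a x) q :=
  (single_comp_ofHom (L := (twC t).obj X) (L' := (twC t').obj X) _ _ _).trans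
    (congrArg (fun f => Cochain.single (L := (twC t').obj X) f q)
      ((Category.assoc _ _ _).trans (congrArg (ξ ≫ ·) (evalAt_mulTwist _ _ _ hk ht a x))))

lemma pairing_mulFree {d j' k' : ℤ} (hj : d + j = j') (h : j' + k = t)
    (h' : j + k' = t) (hk : d + k = k') (a : 𝒜 d) :
    pairing h (ξ ≫ mulFree hj a) x q = pairing h' ξ ((X.X s).act hk a x) q :=
  congrArg (fun f => Cochain.single (L := (twC t).obj X) f q)
      ((Category.assoc _ _ _).trans (congrArg (ξ ≫ ·) (mulFree_evalAt _ _ _ hk a x)))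

lemma pairing_units_smul_left (ε : ℤˣ) : pairing h (ε • ξ) x q = ε • pairing h ξ x q :=
  (AddMonoidHom.mk' (fun ξ => pairing h ξ x q)
    (fun ξ ξ' => pairing_add_left h ξ ξ' x q)).map_zsmul (ε : ℤ) ξ

/-- The Leibniz rule. The sign `(-1)^s` sits on the term with `dξ`, as if `x` were the left factor
of the product. -/
lemma δ_pairing {m' s' q' : ℤ} (hs : s + 1 = s') (hq : q + 1 = q') (hm : m + 1 = m')
    (hms : m + s = q) :
    δ q q' (pairing h ξ x q) = pairing h ξ (((X.d s s').f k).hom x) q' +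
      s.negOnePow • pairing h ((((dualC P).d m m').f j).hom ξ) x q' := by
  refine (Cochain.δ_single (L := (twC t).obj X) _ q q' hq (-m') s' (by lia) hs).trans ?_
  congr 1
  · exact congrArg (fun f => Cochain.single (L := (twC t).obj X) f q')
      ((Category.assoc _ _ _).trans (congrArg (ξ ≫ ·) (evalAt_map _ _ _)))
  · have h1 : pairing h ((((dualC P).d m m').f j).hom ξ) x q' =
        (m + 1).negOnePow • Cochain.single (L := (twC t).obj X)
          (P.d (-m') (-m) ≫ (ξ ≫ evalAt h x)) q' := by
      exact (pairing_units_smul_left h (P.d (-m') (-m) ≫ ξ) x q' (m + 1).negOnePow).trans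
        (congrArg ((m + 1).negOnePow • ·)
          (congrArg (fun f => Cochain.single (L := (twC t).obj X) f q') (Category.assoc _ _ _)))
    rw [h1, smul_smul, ← Int.negOnePow_add]
    congr 2
    lia
end

section

variable {E : CochainComplex (ModuleCat.{u} R) ℤ} {P X : CochainComplex (GrMod 𝒜) ℤ}

/-- The components of an element of the dual of a graded Hom complex. -/
noncomputable def dualHomEval {i n : ℤ} (φ : Cochain ((weightC (-i)).obj (gradedHom P X)) E n)
    {q r : ℤ} (h : q + n = r) : Cochain P ((twC (-i)).obj X) q →ₗ[R] E.X r :=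
  (φ.v q r h).hom

lemma dualHomEval_act {d i k n : ℤ} (h : d + i = k) (a : 𝒜 d)
    (φ : Cochain ((weightC (-i)).obj (gradedHom P X)) E n) {q r : ℤ} (hq : q + n = r)
    (z : Cochain P ((twC (-k)).obj X) q) :
    dualHomEval (((homDual E (gradedHom P X)).X n).act h a φ :
      Cochain ((weightC (-k)).obj (gradedHom P X)) E n) hq z =
    dualHomEval φ hq (z.comp (Cochain.ofHom ((NatTrans.mapHomologicalComplex (mulTwist
      (show d + -k = -i by lia) a) (ComplexShape.up ℤ)).app X)) (add_zero _)) :=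
  congrArg (fun t : ((weightC (-k)).obj (gradedHom P X)).X q ⟶ E.X r => t.hom z)
    (Cochain.zero_cochain_comp_v (Cochain.ofHom
      ((actC (show d + -k = -i by lia) a).app (gradedHom P X))) φ q r hq)

/-- The values of a cochain with values in a graded dual. -/
noncomputable def homDualEval {Z : CochainComplex (GrMod 𝒜) ℤ} {i n : ℤ}
    (z : Cochain X ((twC i).obj (homDual E Z)) n) {s s' : ℤ} (h : s + n = s') (k : ℤ) :
    (X.X s).X k →ₗ[R] Cochain ((weightC (-(i + k))).obj Z) E s' :=
  ((z.v s s' h).f k).hom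

/-- The linear form on the dual of `P` given by a linear form on the graded Hom complex from `P`
to `X` and an element of `X`. -/
noncomputable def dualContract {i n : ℤ}
    (φ : Cochain ((weightC (-i)).obj (gradedHom P X)) E n) {s s' : ℤ} (hs : s + n = s') {k : ℤ}
    (x : (X.X s).X k) : Cochain ((weightC (-(i + k))).obj (dualC P)) E s' :=
  Cochain.mk (fun m r hm => ModuleCat.ofHom
    { toFun ξ := dualHomEval φ (show (m + s) + n = r by lia)
        (pairing (show -(i + k) + k = -i by lia) ξ x (m + s))
      map_add' ξ ξ' := by rw [← map_add]; congr 1; exact pairing_add_left _ _ _ _ _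
      map_smul' a ξ := by
        rw [RingHom.id_apply, ← map_smul]; congr 1; exact pairing_smul_left _ _ _ _ _ })

lemma dualContract_v {i n : ℤ}
    (φ : Cochain ((weightC (-i)).obj (gradedHom P X)) E n) {s s' : ℤ} (hs : s + n = s') {k : ℤ}
    (x : (X.X s).X k) {m r : ℤ} (hm : m + s' = r) (ξ : P.X (-m) ⟶ free (-(i + k))) :
    ((dualContract φ hs x).v m r hm).hom ξ = dualHomEval φ (show (m + s) + n = r by lia)
        (pairing (show -(i + k) + k = -i by lia) ξ x (m + s)) := rfl

lemma dualContract_ext {k n : ℤ} {z z' : Cochain ((weightC k).obj (dualC P)) E n}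
    (h : ∀ (m r : ℤ) (hm : m + n = r) (ξ : P.X (-m) ⟶ free k),
      (z.v m r hm).hom ξ = (z'.v m r hm).hom ξ) : z = z' :=
  Cochain.ext _ _ (fun m r hm => ModuleCat.hom_ext (LinearMap.ext fun ξ => h m r hm ξ))

/-- The pairing is balanced over `A`: a scalar acting on `x` can be moved to `ξ`, where it is the
action on the dual of `P^∨`. -/
lemma dualContract_act {i n : ℤ}
    (φ : Cochain ((weightC (-i)).obj (gradedHom P X)) E n) {s s' : ℤ} (hs : s + n = s')
    {d k k' : ℤ} (h : d + k = k') (a : 𝒜 d) (x : (X.X s).X k) :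
    dualContract φ hs ((X.X s).act h a x) =
      ((homDual E (dualC P)).X s').act (show d + (i + k) = i + k' by lia) a
        (dualContract φ hs x) := by
  refine dualContract_ext (fun m r hm ξ => ?_)
  have h1 : ((((homDual E (dualC P)).X s').act (show d + (i + k) = i + k' by lia) a
        (dualContract φ hs x) : Cochain ((weightC (-(i + k'))).obj (dualC P)) E s').v m r hm).hom ξ =
      ((dualContract φ hs x).v m r hm).hom
        (ξ ≫ mulFree (show d + -(i + k') = -(i + k) by lia) a) :=
    congrArg (fun t => t.hom ξ) (Cochain.zero_cochain_comp_v
      (Cochain.ofHom ((actC (show d + -(i + k') = -(i + k) by lia) a).app (dualC P)))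
        (dualContract φ hs x) m r hm)
  rw [h1, dualContract_v, dualContract_v]
  congr 1
  exact (pairing_mulFree _ _ _ _ _ _ _ _).symm

/-- `dualContract`, as a morphism of graded modules. -/
noncomputable def dualContractHom {i n : ℤ}
    (φ : Cochain ((weightC (-i)).obj (gradedHom P X)) E n) {s s' : ℤ} (hs : s + n = s') :
    X.X s ⟶ (twist i).obj ((homDual E (dualC P)).X s') where
  f k := ModuleCat.ofHom
    { toFun x := dualContract φ hs x
      map_add' x y := by
        refine dualContract_ext (fun m r hm ξ => ?_)
        rw [dualContract_v, Cochain.add_v, pairing_add_right, map_add]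
        exact (congrArg₂ (· + ·) (dualContract_v _ _ _ _ _) (dualContract_v _ _ _ _ _)).symm
      map_smul' a x := by
        refine dualContract_ext (fun m r hm ξ => ?_)
        rw [dualContract_v, RingHom.id_apply, Cochain.smul_v, pairing_smul_right, map_smul]
        exact (congrArg (a • ·) (dualContract_v _ _ _ _ _)).symm }
  map_act h a x := dualContract_act φ hs h a x

/-- `dualContract`, as a cochain. -/
noncomputable def dualContractCochain {i n : ℤ}
    (φ : Cochain ((weightC (-i)).obj (gradedHom P X)) E n) :
    Cochain X ((twC i).obj (homDual E (dualC P))) n :=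
  Cochain.mk (fun _ _ hs => dualContractHom φ hs)

lemma dualContractCochain_ext {i n : ℤ} {z z' : Cochain X ((twC i).obj (homDual E (dualC P))) n}
    (h : ∀ (s s' : ℤ) (hs : s + n = s') (k : ℤ) (x : (X.X s).X k) (m r : ℤ) (hm : m + s' = r)
      (ξ : P.X (-m) ⟶ free (-(i + k))),
      ((homDualEval z hs k x).v m r hm).hom ξ = ((homDualEval z' hs k x).v m r hm).hom ξ) : z = z' := by
  refine Cochain.ext _ _ (fun s s' hs => hom_ext (fun k => ModuleCat.hom_ext
    (LinearMap.ext fun x => ?_)))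
  exact dualContract_ext (fun m r hm ξ => h s s' hs k x m r hm ξ)

lemma dualContractCochain_apply {i n : ℤ}
    (φ : Cochain ((weightC (-i)).obj (gradedHom P X)) E n) {s s' : ℤ} (hs : s + n = s') {k : ℤ}
    (x : (X.X s).X k) {m r : ℤ} (hm : m + s' = r) (ξ : P.X (-m) ⟶ free (-(i + k))) :
    ((homDualEval (dualContractCochain φ) hs k x).v m r hm).hom ξ =
      dualHomEval φ (show (m + s) + n = r by lia)
        (pairing (show -(i + k) + k = -i by lia) ξ x (m + s)) := by
  exact dualContract_v φ hs x hm ξ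

lemma dualHomEval_δ {i n n' : ℤ} (hn : n + 1 = n')
    (φ : Cochain ((weightC (-i)).obj (gradedHom P X)) E n) {q q' r r' : ℤ} (hq : q + 1 = q')
    (hr : r + 1 = r') (h : q + n = r) (z : Cochain P ((twC (-i)).obj X) q) :
    dualHomEval (δ n n' φ) (show q + n' = r' by lia) z =
      (E.d r r').hom (dualHomEval φ h z) +
        n'.negOnePow • dualHomEval φ (show q' + n = r' by lia) (δ q q' z) :=
  congrArg (fun t => t.hom z) (δ_v n n' hn φ q r' (by lia) r q' (by lia) hq)

lemma δ_dualContract_apply {k n n' : ℤ} (hn : n + 1 = n')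
    (ζ : Cochain ((weightC k).obj (dualC P)) E n) {m m' r r' : ℤ} (hm : m + 1 = m')
    (hr : r + 1 = r') (h : m + n = r) (ξ : P.X (-m) ⟶ free k) :
    ((δ n n' ζ).v m r' (by lia)).hom ξ = (E.d r r').hom ((ζ.v m r h).hom ξ) +
      n'.negOnePow • (ζ.v m' r' (by lia)).hom ((((dualC P).d m m').f k).hom ξ) :=
  congrArg (fun t => t.hom ξ) (δ_v n n' hn ζ m r' (by lia) r m' (by lia) hm)

lemma δ_cochain_homDual_apply {Z : CochainComplex (GrMod 𝒜) ℤ} {i n n' : ℤ} (hn : n + 1 = n')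
    (z : Cochain X ((twC i).obj (homDual E Z)) n) {s s₁ s' : ℤ} (hs : s + n' = s')
    (hs₁ : s + 1 = s₁) {s₀ : ℤ} (hs₀ : s₀ + 1 = s') (h : s + n = s₀) {k : ℤ}
    (x : (X.X s).X k) :
    homDualEval (δ n n' z) hs k x = δ s₀ s' (homDualEval z h k x) +
      n'.negOnePow • homDualEval z (show s₁ + n = s' by lia) k (((X.d s s₁).f k).hom x) :=
  congrArg (fun t => (Hom.f t k).hom x) (δ_v n n' hn z s s' hs s₀ s₁ (by lia) hs₁)

/-- Both sides consist of a term with the differential of `E`, one with `dx` and one with `dξ`. On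
the left the last two come from the Leibniz rule for the pairing; on the right they come from the
differentials of `X` and of `P^∨`. -/
lemma δ_dualContractCochain {i n n' : ℤ} (hn : n + 1 = n')
    (φ : Cochain ((weightC (-i)).obj (gradedHom P X)) E n) :
    dualContractCochain (δ n n' φ) = δ n n' (dualContractCochain φ) := by
  refine dualContractCochain_ext (fun s s' hs k x m r hm ξ => ?_)
  have h1 := congrArg (fun t : Cochain ((weightC (-(i + k))).obj (dualC P)) E s' =>
    (t.v m r hm).hom ξ) (δ_cochain_homDual_apply hn (dualContractCochain φ) hs rfl
      (show (s' - 1) + 1 = s' by lia) (by lia) x)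
  have h2 := δ_dualContract_apply (show (s' - 1) + 1 = s' by lia)
    (dualContract φ (show s + n = s' - 1 by lia) x) (m := m) rfl (show (r - 1) + 1 = r by lia)
    (by lia) ξ
  refine (dualContractCochain_apply _ hs x hm ξ).trans (Eq.trans ?_ h1.symm)
  refine Eq.trans ?_ (congrArg (· + n'.negOnePow • dualHomEval φ (show (m + (s + 1)) + n = r by lia)
        (pairing (show -(i + k) + k = -i by lia) ξ (((X.d s (s + 1)).f k).hom x) (m + (s + 1))))
          h2.symm)
  rw [dualHomEval_δ hn φ (show (m + s) + 1 = m + (s + 1) by lia) (show (r - 1) + 1 = r by lia)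
    (by lia), δ_pairing _ _ _ _ (show s + 1 = s + 1 from rfl) (show (m + s) + 1 = m + (s + 1) by lia)
      (show m + 1 = m + 1 from rfl) rfl, map_add, smul_add]
  have gen : ∀ a b c c' : E.X r, c = c' → a + (b + c) = a + c' + b := by
    rintro a b c _ rfl
    rw [add_comm b, add_assoc]
  refine gen _ _ _ _ ?_
  have h3 : dualHomEval φ (show (m + (s + 1)) + n = r by lia)
      (s.negOnePow • pairing (show -(i + k) + k = -i by lia)
        ((((dualC P).d m (m + 1)).f (-(i + k))).hom ξ) x (m + (s + 1))) =
      s.negOnePow • dualHomEval φ (show (m + (s + 1)) + n = r by lia)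
      (pairing (show -(i + k) + k = -i by lia)
        ((((dualC P).d m (m + 1)).f (-(i + k))).hom ξ) x (m + (s + 1))) :=
    map_zsmul _ (s.negOnePow : ℤ) _
  -- The signs of the `dξ` terms agree: `(-1)^{n'}` from `φ` and `(-1)^s` from the Leibniz rule
  -- multiply to the sign `(-1)^{s'}` of the inner dual.
  rw [h3, smul_smul, ← Int.negOnePow_add, show n' + s = s' by lia]
  congr 1
  have key : ∀ q (hq : q = m + 1 + s) (hq' : q + n = r), dualHomEval φ hq'
      (pairing (show -(i + k) + k = -i by lia)
        ((((dualC P).d m (m + 1)).f (-(i + k))).hom ξ) x q) =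
      ((dualContract φ (show s + n = s' - 1 by lia) x).v (m + 1) r (by lia)).hom
        ((((dualC P).d m (m + 1)).f (-(i + k))).hom ξ) := by
    rintro q rfl hq'
    rfl
  exact key _ (by lia) _

end

/-- The canonical map from the dual of `\underline{Hom}_A(P, X)` to
`\underline{Hom}_A(X, 𝔻(\underline{Hom}_A(P, A)))`. -/
noncomputable def homDualGradedHom (E : CochainComplex (ModuleCat.{u} R) ℤ)
    (P X : CochainComplex (GrMod 𝒜) ℤ) :
    homDual E (gradedHom P X) ⟶ gradedHom X (homDual E (dualC P)) where
  f n :=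
    { f i := ModuleCat.ofHom
        { toFun (φ : Cochain ((weightC (-i)).obj (gradedHom P X)) E n) := dualContractCochain φ
          map_add' φ φ' := dualContractCochain_ext (fun s s' hs k x m r hm ξ => rfl)
          map_smul' a φ := dualContractCochain_ext (fun s s' hs k x m r hm ξ => rfl) }
      map_act {d i k} h a (φ : Cochain ((weightC (-i)).obj (gradedHom P X)) E n) := by
        refine dualContractCochain_ext (fun s s' hs l x m r hm ξ => ?_)
        have h1 : (pairing (show -(k + l) + l = -k by lia) ξ x (m + s)).comp
            (Cochain.ofHom ((NatTrans.mapHomologicalComplex (mulTwist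
              (show d + -k = -i by lia) a) (ComplexShape.up ℤ)).app X)) (add_zero _) =
            pairing (show -(k + l) + (d + l) = -i by lia) ξ ((X.X s).act rfl a x) (m + s) :=
          pairing_mulTwist _ _ _ _ _ rfl _ a
        have h2 : pairing (show -(i + l) + l = -i by lia)
            (ξ ≫ mulFree (show d + -(k + l) = -(i + l) by lia) a) x (m + s) =
            pairing (show -(k + l) + (d + l) = -i by lia) ξ ((X.X s).act rfl a x) (m + s) :=
          pairing_mulFree _ _ _ _ _ _ rfl a
        have h3 := dualHomEval_act h a φ (show (m + s) + n = r by lia)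
          (pairing (show -(k + l) + l = -k by lia) ξ x (m + s))
        have h4 : homDualEval (((gradedHom X (homDual E (dualC P))).X n).act h a
            (dualContractCochain φ) : Cochain X ((twC k).obj (homDual E (dualC P))) n) hs l x =
            ((homDual E (dualC P)).X s').act (show d + (i + l) = k + l by lia) a
              (homDualEval (dualContractCochain φ) hs l x) :=
          congrArg (fun t => (Hom.f t l).hom x) (Cochain.comp_zero_cochain_v
            (dualContractCochain φ) (Cochain.ofHom ((NatTrans.mapHomologicalComplex (mulTwist h a)
              (ComplexShape.up ℤ)).app (homDual E (dualC P)))) s s' hs)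
        have h5 : (((((homDual E (dualC P)).X s').act (show d + (i + l) = k + l by lia) a
              (homDualEval (dualContractCochain φ) hs l x) :
                Cochain ((weightC (-(k + l))).obj (dualC P)) E s').v m r hm).hom ξ : E.X r) =
            dualHomEval φ (show (m + s) + n = r by lia)
              (pairing (show -(i + l) + l = -i by lia)
            (ξ ≫ mulFree (show d + -(k + l) = -(i + l) by lia) a) x (m + s)) :=
          congrArg (fun t => t.hom ξ) (Cochain.zero_cochain_comp_v (Cochain.ofHom
              ((actC (show d + -(k + l) = -(i + l) by lia) a).app (dualC P)))
              (homDualEval (dualContractCochain φ) hs l x) m r hm)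
        refine h3.trans (Eq.trans ?_ (congrArg (fun t : Cochain ((weightC (-(k + l))).obj (dualC P))
          E s' => (t.v m r hm).hom ξ) h4.symm))
        exact (congrArg (dualHomEval φ (show (m + s) + n = r by lia)) (h1.trans h2.symm)).trans
          h5.symm }
  comm' n n' hn := hom_ext (fun i => ModuleCat.hom_ext (LinearMap.ext fun φ =>
    (δ_dualContractCochain hn _).symm))

end GrMod

/-! ### Contraction is an isomorphism for bounded complexes of finitely generated projectives -/

namespace GrMod

open CochainComplex CochainComplex.HomComplex ComplexLemmas

variable {R A : Type u} [CommRing R] [CommRing A] [Algebra R A]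
    {𝒜 : ℤ → Submodule R A} [GradedAlgebra 𝒜]

section

variable {P : GrMod 𝒜} {n : ℕ} {w : Fin n → ℤ} {x : ∀ r, P.X (w r)} {j : Fin n → ℤ}
  {hj : ∀ r, j r + w r = 0} {ξ : ∀ r, P ⟶ free (j r)}

/-- Composing `φ` with the dual basis expansion of the identity recovers `φ` from its values on the
generators. -/
lemma sum_dualBasis_twist (hξ : ∑ r, ξ r ≫ freeEval (hj r) (x r) = 𝟙 P) {M : GrMod 𝒜} {t : ℤ}
    (φ : P ⟶ (twist t).obj M) (h : ∀ r, j r + (t + w r) = t) :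
    ∑ r, ξ r ≫ evalAt (h r) ((φ.f (w r)).hom (x r)) = φ := by
  refine Eq.trans ?_ ((congrArg (· ≫ φ) hξ).trans (Category.id_comp φ))
  refine Eq.trans ?_ (Preadditive.sum_comp _ _ _).symm
  refine Finset.sum_congr rfl (fun r _ => ?_)
  rw [Category.assoc, freeEval_comp]
  rfl

lemma sum_dualBasis_free (hξ : ∑ r, ξ r ≫ freeEval (hj r) (x r) = 𝟙 P) {l : ℤ}
    (φ : P ⟶ free l) (h : ∀ r, (l + w r) + j r = l) :
    ∑ r, ξ r ≫ mulFree (h r) ((φ.f (w r)).hom (x r)) = φ := by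
  refine Eq.trans ?_ ((congrArg (· ≫ φ) hξ).trans (Category.id_comp φ))
  refine Eq.trans ?_ (Preadditive.sum_comp _ _ _).symm
  refine Finset.sum_congr rfl (fun r _ => ?_)
  rw [Category.assoc, freeEval_comp]
  congr 1
  exact (freeEval_free (hj r) _ (h r)).symm

end

section

variable {E : CochainComplex (ModuleCat.{u} R) ℤ} {P X : CochainComplex (GrMod 𝒜) ℤ}

lemma homDualEval_act {Z : CochainComplex (GrMod 𝒜) ℤ} {i n : ℤ}
    (ψ : Cochain X ((twC i).obj (homDual E Z)) n) {s s' : ℤ} (hs : s + n = s') {d k k' : ℤ}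
    (h : d + k = k') (a : 𝒜 d) (x : (X.X s).X k) {m r : ℤ} (hm : m + s' = r)
    (ξ : (Z.X m).X (-(i + k'))) :
    ((homDualEval ψ hs k' ((X.X s).act h a x)).v m r hm).hom ξ =
      ((homDualEval ψ hs k x).v m r hm).hom
        ((Z.X m).act (show d + -(i + k') = -(i + k) by lia) a ξ) := by
  have h1 : homDualEval ψ hs k' ((X.X s).act h a x) =
    ((homDual E Z).X s').act (show d + (i + k) = i + k' by lia) a (homDualEval ψ hs k x) :=
    (ψ.v s s' hs).map_act h a x
  rw [h1]
  exact congrArg (fun t : ((weightC (-(i + k'))).obj Z).X m ⟶ E.X r => t.hom ξ)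
    (Cochain.zero_cochain_comp_v (Cochain.ofHom
      ((actC (show d + -(i + k') = -(i + k) by lia) a).app Z)) (homDualEval ψ hs k x) m r hm)

/-- The value of a cochain at an element. -/
noncomputable def cochainEval {t q : ℤ} {p s : ℤ} (h : p + q = s) {k : ℤ} (y : (P.X p).X k) :
    Cochain P ((twC t).obj X) q →ₗ[R] (X.X s).X (t + k) where
  toFun z := ((z.v p s h).f k).hom y
  map_add' _ _ := rfl
  map_smul' _ _ := rfl

/-- The value of a linear cochain at an element. -/
noncomputable def linEval {C : CochainComplex (ModuleCat.{u} R) ℤ} {q p s : ℤ} (h : p + q = s)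
    (y : C.X p) : Cochain C E q →ₗ[R] E.X s where
  toFun z := (z.v p s h).hom y
  map_add' _ _ := rfl
  map_smul' _ _ := rfl

/-- Pairings span `Hom(P, X)`: in each degree a cochain is expanded by the dual basis, and only
finitely many degrees of `P` contribute. -/
lemma cochain_eq_sum {S : Finset ℤ} (hS : ∀ m ∉ S, IsZero (P.X (-m)))
    {n : ℤ → ℕ} {w : ∀ m, Fin (n m) → ℤ} {x : ∀ m r, (P.X (-m)).X (w m r)}
    {j : ∀ m, Fin (n m) → ℤ} {hj : ∀ m r, j m r + w m r = 0}
    {ξ : ∀ m r, P.X (-m) ⟶ free (j m r)}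
    (hξ : ∀ m, ∑ r, ξ m r ≫ freeEval (hj m r) (x m r) = 𝟙 (P.X (-m))) {t q : ℤ}
    (h : ∀ m r, j m r + (t + w m r) = t) (z : Cochain P ((twC t).obj X) q) :
    z = ∑ m ∈ S, ∑ r, pairing (h m r) (ξ m r)
      (cochainEval (show -m + q = q - m by lia) (x m r) z) q := by
  refine Cochain.ext _ _ (fun p s hs => ?_)
  obtain ⟨m, rfl⟩ : ∃ m, p = -m := ⟨-p, by lia⟩
  obtain rfl : s = q - m := by lia
  by_cases hm : m ∈ S
  · have h1 : (∑ m ∈ S, ∑ r, pairing (h m r) (ξ m r)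
        (cochainEval (show -m + q = q - m by lia) (x m r) z) q).v (-m) (q - m) hs =
        ∑ m' ∈ S, ∑ r, (pairing (h m' r) (ξ m' r)
        (cochainEval (show -m' + q = q - m' by lia) (x m' r) z) q).v (-m) (q - m) hs := by
      refine (map_sum (AddMonoidHom.mk' (fun c : Cochain P ((twC t).obj X) q =>
        c.v (-m) (q - m) hs) (fun _ _ => rfl)) _ _).trans ?_
      refine Finset.sum_congr rfl (fun m' _ => ?_)
      exact map_sum (AddMonoidHom.mk' (fun c : Cochain P ((twC t).obj X) q =>
        c.v (-m) (q - m) hs) (fun _ _ => rfl)) _ _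
    refine Eq.trans ?_ h1.symm
    refine Eq.trans ?_ (Finset.sum_eq_single m (fun m' _ hm' => ?_) (fun h => (h hm).elim)).symm
    · refine (sum_dualBasis_twist (hξ m) (z.v (-m) (q - m) hs) (h m)).symm.trans ?_
      refine Finset.sum_congr rfl (fun r _ => ?_)
      exact (Cochain.single_v (L := (twC t).obj X) _ q hs).symm
    · refine Finset.sum_eq_zero (fun r _ => ?_)
      exact Cochain.single_v_eq_zero (L := (twC t).obj X) _ q _ _ hs (by lia)
  · exact (hS m hm).eq_of_src _ _

/-- Injectivity holds because the contraction records the values of a functional on pairings, which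
span `Hom(P, X)`. Surjectivity comes from an explicit preimage built on the dual bases. -/
lemma dualContractCochain_bijective {S : Finset ℤ} (hS : ∀ m ∉ S, IsZero (P.X (-m)))
    (hP : ∀ m, Projective (P.X m) ∧ (P.X m).FG) (n i : ℤ) :
    Function.Bijective (dualContractCochain (E := E) (P := P) (X := X) (i := i) (n := n)) := by
  choose N w x hb using fun m => @exists_dualBasis _ _ _ _ _ _ _ (P.X (-m)) (hP (-m)).1 (hP (-m)).2
  -- `-w` is written this way so that the weight of `ξ` has the form `-(i + k)` required by the
  -- contraction at an element of weight `k = -i + w`.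
  have hj (m r) : -(i + (-i + w m r)) + w m r = 0 := by lia
  choose ξ hξ using fun m => hb m (fun r => -(i + (-i + w m r))) (hj m)
  have h (m r) : -(i + (-i + w m r)) + (-i + w m r) = -i := by lia
  constructor
  · intro φ φ' hφ
    have h1 (q r : ℤ) (hq : q + n = r) (z : Cochain P ((twC (-i)).obj X) q) :
        dualHomEval φ hq z = dualHomEval φ' hq z := by
      rw [cochain_eq_sum hS hξ h z, map_sum, map_sum]
      refine Finset.sum_congr rfl (fun m _ => ?_)
      rw [map_sum, map_sum]
      refine Finset.sum_congr rfl (fun ρ _ => ?_)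
      have key (q' s : ℤ) (e : q' = m + s) (hq' : q' + n = r) (y : (X.X s).X (-i + w m ρ)) :
          dualHomEval φ hq' (pairing (h m ρ) (ξ m ρ) y q') =
            dualHomEval φ' hq' (pairing (h m ρ) (ξ m ρ) y q') := by
        subst e
        have h2 := congrArg (fun z : Cochain X ((twC i).obj (homDual E (dualC P))) n =>
          ((homDualEval z (show s + n = s + n from rfl)
          (-i + w m ρ) y).v m r (by lia)).hom (ξ m ρ)) hφ
        exact h2
      exact key q _ (by lia) hq _
    refine Cochain.ext _ _ (fun q r hq => ModuleCat.hom_ext (LinearMap.ext fun z => h1 q r hq z))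
  · intro ψ
    -- Since `z = ∑ ξ_ρ · z(x_ρ)`, the preimage of `ψ` has to send `z` to `∑ ψ(z(x_ρ))(ξ_ρ)`.
    let φ : Cochain ((weightC (-i)).obj (gradedHom P X)) E n := Cochain.mk (fun q r hq =>
      ModuleCat.ofHom (∑ m ∈ S, ∑ ρ, (linEval (C := (weightC (-(i + (-i + w m ρ)))).obj (dualC P))
        (show m + (r - m) = r by lia) (ξ m ρ)) ∘ₗ
        (homDualEval ψ (show (q - m) + n = r - m by lia) (-i + w m ρ)) ∘ₗ
        (cochainEval (show -m + q = q - m by lia) (x m ρ))))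
    have hφ (q r : ℤ) (hq : q + n = r) (z : Cochain P ((twC (-i)).obj X) q) :
        dualHomEval φ hq z = ∑ m ∈ S, ∑ ρ, ((homDualEval ψ (show (q - m) + n = r - m by lia)
          (-i + w m ρ) (cochainEval (show -m + q = q - m by lia) (x m ρ) z)).v m r
            (by lia)).hom (ξ m ρ) := by
      refine (LinearMap.sum_apply _ _ _).trans (Finset.sum_congr rfl (fun m _ => ?_))
      exact LinearMap.sum_apply _ _ _
    refine ⟨φ, dualContractCochain_ext (fun s s' hs k y m r hm η => ?_)⟩
    refine (hφ _ _ _ _).trans ?_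
    by_cases hmS : m ∈ S
    · refine (Finset.sum_eq_single m (fun m' _ hm' => ?_) (fun h => (h hmS).elim)).trans ?_
      · refine Finset.sum_eq_zero (fun ρ _ => ?_)
        have h1 : cochainEval (show -m' + (m + s) = (m + s) - m' by lia) (x m' ρ)
          (pairing (show -(i + k) + k = -i by lia) η y (m + s)) = 0 :=
          congrArg (fun t => (Hom.f t (w m' ρ)).hom (x m' ρ))
            (Cochain.single_v_eq_zero (L := (twC (-i)).obj X) _ (m + s) _ _ _ (by lia))
        rw [h1, map_zero]
        rfl
      -- The pairing of `η` and `y` has the value `η(x_ρ) y` at `x_ρ`. By `A`-linearity of `ψ` the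
      -- factor `η(x_ρ)` moves to `ξ_ρ`, and the dual basis sums the results to `η`.
      · have key (s₁ s₁' : ℤ) (e : s₁ = s) (e' : s₁' = s') (h1 : -m + (m + s) = s₁)
            (h2 : s₁ + n = s₁') (h3 : m + s₁' = r) (ρ : Fin (N m)) :
            ((homDualEval ψ h2 (-i + w m ρ) (cochainEval h1 (x m ρ)
              (pairing (show -(i + k) + k = -i by lia) η y (m + s)))).v m r h3).hom (ξ m ρ) =
            ((homDualEval ψ hs k y).v m r hm).hom
              (ξ m ρ ≫ mulFree (show (-(i + k) + w m ρ) + -(i + (-i + w m ρ)) = -(i + k) by lia)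
                ((η.f (w m ρ)).hom (x m ρ))) := by
          subst e e'
          have h4 : cochainEval h1 (x m ρ)
              (pairing (show -(i + k) + k = -i by lia) η y (m + s₁)) =
              (X.X s₁).act (show (-(i + k) + w m ρ) + k = -i + w m ρ by lia)
                ((η.f (w m ρ)).hom (x m ρ)) y :=
            congrArg (fun t => (Hom.f t (w m ρ)).hom (x m ρ))
              (Cochain.single_v (L := (twC (-i)).obj X) _ (m + s₁) h1)
          rw [h4]
          exact homDualEval_act ψ h2 _ _ y h3 (ξ m ρ)
        refine (Finset.sum_congr rfl (fun ρ _ => key _ _ (by lia) (by lia) _ _ _ ρ)).trans ?_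
        refine (map_sum (((homDualEval ψ hs k y).v m r hm).hom) _ _).symm.trans ?_
        exact congrArg (((homDualEval ψ hs k y).v m r hm).hom)
          (sum_dualBasis_free (hξ m) η (fun ρ => by lia))
    · obtain rfl : η = 0 := (hS m hmS).eq_of_src _ _
      refine Eq.trans (Finset.sum_eq_zero (fun m' _ => Finset.sum_eq_zero (fun ρ _ => ?_)))
        (map_zero (((homDualEval ψ hs k y).v m r hm).hom)).symm
      have h1 : pairing (P := P) (show -(i + k) + k = -i by lia) (0 : P.X (-m) ⟶ _) y (m + s) = 0 :=
        (congrArg (fun f => Cochain.single (L := (twC (-i)).obj X) f (m + s))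
          (zero_comp)).trans (Cochain.single_zero _ _ _ _ _)
      rw [h1, map_zero, map_zero]
      rfl

lemma isIso_homDualGradedHom {S : Finset ℤ} (hS : ∀ m ∉ S, IsZero (P.X (-m)))
    (hP : ∀ m, Projective (P.X m) ∧ (P.X m).FG) : IsIso (homDualGradedHom E P X) :=
  isIso_of_bijective_f _ (fun n i => dualContractCochain_bijective hS hP n i)

end

end GrMod

namespace GrMod

open CochainComplex CochainComplex.HomComplex ComplexLemmas

variable {R A : Type u} [CommRing R] [CommRing A] [Algebra R A]
    {𝒜 : ℤ → Submodule R A} [GradedAlgebra 𝒜]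

/-! ### Transport along equalities of weights -/

@[simp]
lemma castW_castW (M : GrMod 𝒜) {i j k : ℤ} (h : i = j) (h' : j = k) (x : M.X i) :
    M.castW h' (M.castW h x) = M.castW (h.trans h') x := by
  subst h h'
  simp

lemma castW_add (M : GrMod 𝒜) {i j : ℤ} (h : i = j) (x y : M.X i) :
    M.castW h (x + y) = M.castW h x + M.castW h y := map_add _ _ _

lemma castW_smul (M : GrMod 𝒜) {i j : ℤ} (h : i = j) (r : R) (x : M.X i) :
    M.castW h (r • x) = r • M.castW h x := map_smul _ _ _

lemma castW_zero (M : GrMod 𝒜) {i j : ℤ} (h : i = j) : M.castW h (0 : M.X i) = 0 := map_zero _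

lemma map_castW {M N : GrMod 𝒜} (φ : M ⟶ N) {i j : ℤ} (h : i = j) (x : M.X i) :
    (φ.f j).hom (M.castW h x) = N.castW h ((φ.f i).hom x) := by
  subst h
  simp

lemma act_castW (M : GrMod 𝒜) {d i j k : ℤ} (h : i = j) (h' : d + j = k) (a : 𝒜 d) (x : M.X i) :
    M.act h' a (M.castW h x) = M.act (show d + i = k by lia) a x := by
  subst h
  simp

lemma castW_act (M : GrMod 𝒜) {d i j k : ℤ} (h' : d + i = j) (h : j = k) (a : 𝒜 d) (x : M.X i) :
    M.castW h (M.act h' a x) = M.act (show d + i = k by lia) a x := by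
  subst h
  simp

/-! ### Localization -/

section

variable {d : ℤ} (f : 𝒜 d)

lemma mulTwist_locι (M : GrMod 𝒜) (n : ℕ) (h : d + (n : ℤ) * d = ((n + 1 : ℕ) : ℤ) * d) :
    (mulTwist h f).app M ≫ (locι f (n + 1)).app M = (locι f n).app M := by
  have h1 := colimit.w ((locSeq f).flip.obj M) (homOfLE (Nat.le_add_right n 1))
  have h2 : ((locSeq f).flip.obj M).map (homOfLE (Nat.le_add_right n 1)) =
      (mulTwist h f).app M :=
    congrArg (fun t => NatTrans.app t M) (Functor.ofSequence_map_homOfLE_succ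
      (X := fun n : ℕ => twist (𝒜 := 𝒜) ((n : ℤ) * d))
      (fun n => mulTwist (show d + (n : ℤ) * d = ((n + 1 : ℕ) : ℤ) * d by push_cast; ring) f) n)
  rw [h2] at h1
  exact h1

lemma locι_act (M : GrMod 𝒜) (n : ℕ) {j : ℤ} (x : M.X (n * d + j))
    (h : d + (n * d + j) = ((n + 1 : ℕ) : ℤ) * d + j) :
    (((locι f (n + 1)).app M).f j).hom (M.act h f x) = (((locι f n).app M).f j).hom x :=
  congrArg (fun t => (Hom.f t j).hom x)
    (mulTwist_locι f M n (show d + (n : ℤ) * d = ((n + 1 : ℕ) : ℤ) * d by push_cast; ring))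

/-- Morphisms out of a localization. -/
noncomputable def locDesc {M N : GrMod 𝒜} (φ : ∀ n : ℕ, (twist ((n : ℤ) * d)).obj M ⟶ N)
    (hφ : ∀ n : ℕ, (mulTwist (show d + (n : ℤ) * d = ((n + 1 : ℕ) : ℤ) * d by push_cast; ring) f).app M
      ≫ φ (n + 1) = φ n) : (loc f).obj M ⟶ N :=
  colimit.desc ((locSeq f).flip.obj M)
    { pt := N
      ι := NatTrans.ofSequence (F := (locSeq f).flip.obj M) φ (fun n => by
        refine Eq.trans ?_ ((hφ n).trans (Category.comp_id _).symm)
        congr 1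
        exact congrArg (fun t => NatTrans.app t M) (Functor.ofSequence_map_homOfLE_succ
          (X := fun n : ℕ => twist (𝒜 := 𝒜) ((n : ℤ) * d))
          (fun n => mulTwist (show d + (n : ℤ) * d = ((n + 1 : ℕ) : ℤ) * d by
            push_cast; ring) f) n)) }

lemma locι_locDesc {M N : GrMod 𝒜} (φ : ∀ n : ℕ, (twist ((n : ℤ) * d)).obj M ⟶ N)
    (hφ : ∀ n : ℕ, (mulTwist (show d + (n : ℤ) * d = ((n + 1 : ℕ) : ℤ) * d by push_cast; ring) f).app M
      ≫ φ (n + 1) = φ n) (n : ℕ) : (locι f n).app M ≫ locDesc f φ hφ = φ n :=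
  colimit.ι_desc _ _

lemma locι_locDesc_apply {M N : GrMod 𝒜} (φ : ∀ n : ℕ, (twist ((n : ℤ) * d)).obj M ⟶ N)
    (hφ : ∀ n : ℕ, (mulTwist (show d + (n : ℤ) * d = ((n + 1 : ℕ) : ℤ) * d by push_cast; ring) f).app M
      ≫ φ (n + 1) = φ n) (n : ℕ) {j : ℤ} (x : M.X (n * d + j)) :
    ((locDesc f φ hφ).f j).hom ((((locι f n).app M).f j).hom x) = ((φ n).f j).hom x :=
  congrArg (fun t => (Hom.f t j).hom x) (locι_locDesc f φ hφ n)

instance (M : GrMod 𝒜) (j : ℤ) : PreservesColimit ((locSeq f).flip.obj M) (weight j) :=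
  (preservesColimitsOfShape (R := R) (𝒜 := 𝒜) (J := ℕ) j).preservesColimit

instance : PreservesFilteredColimitsOfSize.{0, 0} (forget (ModuleCat.{u} R)) :=
  preservesFilteredColimitsOfSize_shrink.{0, u, 0, u} _

lemma exists_locι (M : GrMod 𝒜) {j : ℤ} (y : ((loc f).obj M).X j) :
    ∃ (n : ℕ) (x : M.X (n * d + j)), (((locι f n).app M).f j).hom x = y := by
  let hc := isColimitOfPreserves (weight (𝒜 := 𝒜) j) (colimit.isColimit ((locSeq f).flip.obj M))
  obtain ⟨n, x, hx⟩ := Concrete.isColimit_exists_rep _ hc y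
  exact ⟨n, x, hx⟩

/-- Identifying the transition maps with powers of `f` turns equality in the filtered colimit into
the usual criterion for fractions. -/
lemma locSeq_map_apply (M : GrMod 𝒜) {j : ℤ} (n m : ℕ) (x : M.X (n * d + j))
    (h : m * d + (n * d + j) = ((n + m : ℕ) : ℤ) * d + j) :
    ((((locSeq f).flip.obj M).map (homOfLE (Nat.le_add_right n m))).f j).hom x =
      M.act h (⟨f ^ m, by simpa using SetLike.pow_mem_graded m f.2⟩ : 𝒜 (m * d)) x := by
  induction m with
  | zero =>
    have h1 : ((locSeq f).flip.obj M).map (homOfLE (Nat.le_add_right n 0)) = 𝟙 _ :=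
      ((locSeq f).flip.obj M).map_id n
    rw [h1]
    exact (M.act_congr (i' := 0) _ (by simp) _ ⟨1, SetLike.GradedOne.one_mem⟩ (pow_zero _) x).trans
      (M.one_act x) |>.symm
  | succ m ih =>
    have h1 : ((locSeq f).flip.obj M).map (homOfLE (Nat.le_add_right n (m + 1))) =
        ((locSeq f).flip.obj M).map (homOfLE (Nat.le_add_right n m)) ≫
          (mulTwist (show d + ((n + m : ℕ) : ℤ) * d = ((n + m + 1 : ℕ) : ℤ) * d by
            push_cast; ring) f).app M := by
      have h2 : homOfLE (Nat.le_add_right n (m + 1)) =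
        homOfLE (Nat.le_add_right n m) ≫ homOfLE (Nat.le_add_right (n + m) 1) := rfl
      refine (congrArg (((locSeq f).flip.obj M).map) h2).trans ((Functor.map_comp _ _ _).trans ?_)
      congr 1
      exact congrArg (fun t => NatTrans.app t M) (Functor.ofSequence_map_homOfLE_succ
          (X := fun n : ℕ => twist (𝒜 := 𝒜) ((n : ℤ) * d))
          (fun n => mulTwist (show d + (n : ℤ) * d = ((n + 1 : ℕ) : ℤ) * d by
            push_cast; ring) f) (n + m))
    rw [h1]
    refine (congrArg (M.act (show d + (((n + m : ℕ) : ℤ) * d + j) = ((n + m + 1 : ℕ) : ℤ) * d + j by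
      push_cast; ring) f) (ih (by push_cast; ring))).trans ?_
    refine (M.mul_act _ _ _ _ x).symm.trans ?_
    exact M.act_congr _ _ _ _ (pow_succ' _ _).symm x

lemma exists_act_pow_eq_zero (M : GrMod 𝒜) {j : ℤ} (n : ℕ) (x : M.X (n * d + j))
    (hx : (((locι f n).app M).f j).hom x = 0) :
    ∃ m : ℕ, ∀ k (h : m * d + (n * d + j) = k), M.act h (⟨f ^ m, by
        simpa using SetLike.pow_mem_graded m f.2⟩ : 𝒜 (m * d)) x = 0 := by
  let hc := isColimitOfPreserves (weight (𝒜 := 𝒜) j) (colimit.isColimit ((locSeq f).flip.obj M))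
  obtain ⟨l, p, q, hl⟩ := Concrete.isColimit_exists_of_rep_eq _ hc (i := n) (j := n) x 0
    (hx.trans (map_zero ((((locι f n).app M).f j).hom)).symm)
  obtain ⟨m, rfl⟩ := Nat.exists_eq_add_of_le (leOfHom p)
  refine ⟨m, ?_⟩
  rintro _ rfl
  have h1 := (locSeq_map_apply f M n m x (by push_cast; ring)).symm.trans
    (hl.trans (map_zero ((((locSeq f).flip.obj M).map q).f j).hom))
  have h2 := congrArg (M.castW (show ((n + m : ℕ) : ℤ) * d + j = m * d + (n * d + j) by
    push_cast; ring)) h1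
  rw [castW_act] at h2
  exact h2.trans (castW_zero _ _)

/-! ### The right adjoint of localization -/

/-- The index set of the weight `j` component of `coloc`. -/
abbrev ColocIndex (d j : ℤ) : Type := {p : ℕ × ℤ // p.1 * d + p.2 = j}

/-- The weight `j` component of `coloc`. -/
def colocX (M : GrMod 𝒜) (j : ℤ) : Submodule R (∀ p : ColocIndex d j, M.X p.1.2) where
  carrier := {y | ∀ (n : ℕ) (k k' : ℤ) (h : n * d + k = j) (h' : (n + 1 : ℕ) * d + k' = j),
    M.act (show d + k' = k by push_cast at h'; linarith) f (y ⟨(n + 1, k'), h'⟩) = y ⟨(n, k), h⟩}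
  add_mem' {y y'} hy hy' n k k' h h' := (map_add _ _ _).trans
    (congrArg₂ (· + ·) (hy n k k' h h') (hy' n k k' h h'))
  zero_mem' n k k' h h' := map_zero _
  smul_mem' r y hy n k k' h h' := (map_smul _ _ _).trans (congrArg (r • ·) (hy n k k' h h'))

variable {f} in
lemma act_colocX_congr {M : GrMod 𝒜} {j : ℤ} (y : colocX f M j) {n : ℕ} {k k' : ℤ}
    (h : n * d + k = j) (h' : n * d + k' = j) {e e' l : ℤ} (hk : e + k = l) (hk' : e' + k' = l)
    (a : 𝒜 e) (a' : 𝒜 e') (ha : (a : A) = a') :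
    M.act hk a (y.1 ⟨(n, k), h⟩) = M.act hk' a' (y.1 ⟨(n, k'), h'⟩) := by
  obtain rfl : k = k' := by lia
  exact M.act_congr _ _ _ _ ha _

lemma act_comm (M : GrMod 𝒜) {d e i j k l : ℤ} (h : d + i = j) (h' : e + j = l) (h₁ : e + i = k)
    (h₂ : d + k = l) (a : 𝒜 d) (b : 𝒜 e) (x : M.X i) :
    M.act h' b (M.act h a x) = M.act h₂ a (M.act h₁ b x) := by
  refine (M.mul_act _ _ _ _ x).symm.trans ((M.act_congr _ _ _ _ (mul_comm _ _) x).trans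
    (M.mul_act _ _ _ _ x))

/-- The graded module of sequences `(yₙ)` with `f yₙ₊₁ = yₙ`. -/
def coloc (M : GrMod 𝒜) : GrMod 𝒜 where
  X j := ModuleCat.of R (colocX f M j)
  act {i j k} h := LinearMap.mk₂ R (fun (a : 𝒜 i) (y : colocX f M j) => (⟨fun p =>
      M.act (show i + (p.1.2 - i) = p.1.2 by lia) a (y.1 ⟨(p.1.1, p.1.2 - i), by
        have := p.2; lia⟩), fun n l l' hl hl' => by
        dsimp only
        refine (M.act_comm _ _ (show d + (l' - i) = l - i by push_cast at hl'; linarith)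
          (by lia) _ _ _).trans ?_
        rw [y.2 n (l - i) (l' - i) (by lia) (by lia)]⟩ : colocX f M k))
      (fun a b y => Subtype.ext (funext fun p => by
        exact LinearMap.map_add₂ (M.act (show i + (p.1.2 - i) = p.1.2 by lia)) a b _))
      (fun r a y => Subtype.ext (funext fun p => by
        exact LinearMap.map_smul₂ (M.act (show i + (p.1.2 - i) = p.1.2 by lia)) r a _))
      (fun a y y' => Subtype.ext (funext fun p => map_add (M.act _ a) _ _))
      (fun r a y => Subtype.ext (funext fun p => map_smul (M.act _ a) _ _))
  one_act {j} (y : colocX f M j) := Subtype.ext (funext fun p => by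
    refine (act_colocX_congr y (n := p.1.1) (k' := p.1.2) _ p.2 _ (zero_add _) _
      ⟨1, SetLike.GradedOne.one_mem⟩ rfl).trans (M.one_act _))
  mul_act {i i' j k l} h h' a b (y : colocX f M j) := Subtype.ext (funext fun p => by
    refine Eq.trans ?_ (M.mul_act (show i' + (p.1.2 - i - i') = p.1.2 - i by lia)
      (show i + (p.1.2 - i) = p.1.2 by lia) a b _)
    exact act_colocX_congr y _ _ _ _ _ _ rfl)

end

end GrMod

/-! ### The adjunction between localization and the module of sequences -/

namespace GrMod

open CochainComplex CochainComplex.HomComplex ComplexLemmas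

variable {R A : Type u} [CommRing R] [CommRing A] [Algebra R A]
    {𝒜 : ℤ → Submodule R A} [GradedAlgebra 𝒜]

section

variable {d : ℤ} (f : 𝒜 d)

/-- `coloc`, as a functor. -/
def colocFunctor : GrMod 𝒜 ⥤ GrMod 𝒜 where
  obj M := coloc f M
  map {M N} φ :=
    { f j := ModuleCat.ofHom
        { toFun (y : colocX f M j) := (⟨fun p => (φ.f p.1.2).hom (y.1 p), fun n k k' h h' => by
            rw [← φ.map_act]
            exact congrArg (φ.f k).hom (y.2 n k k' h h')⟩ : colocX f N j)
          map_add' y y' := Subtype.ext (funext fun p => map_add (φ.f p.1.2).hom _ _)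
          map_smul' r y := Subtype.ext (funext fun p => map_smul (φ.f p.1.2).hom _ _) }
      map_act h a y := Subtype.ext (funext fun p => φ.map_act _ _ _) }

instance : (colocFunctor (𝒜 := 𝒜) f).Additive where

/-- The projection `(yₙ) ↦ y₀`. -/
def colocProj : colocFunctor (𝒜 := 𝒜) f ⟶ 𝟭 _ where
  app M :=
    { f j := ModuleCat.ofHom
        { toFun (y : colocX f M j) := y.1 ⟨(0, j), by simp⟩
          map_add' _ _ := rfl
          map_smul' _ _ := rfl }
      map_act {i j k} h a (y : colocX f M j) :=
        act_colocX_congr y (n := 0) (show ((0 : ℕ) : ℤ) * d + (k - i) = j by simp; lia)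
          (by simp) _ _ _ _ rfl }

variable {X Y : GrMod 𝒜} {i : ℤ}

/-- A component of the adjoint of a morphism out of a localization. -/
noncomputable def colocVal (v : (loc f).obj X ⟶ (twist i).obj Y) {j : ℤ} (n : ℕ) (k : ℤ)
    (h : n * d + k = i + j) (x : X.X j) : Y.X k :=
  Y.castW (show i + (k - i) = k by lia) ((v.f (k - i)).hom
    ((((locι f n).app X).f (k - i)).hom (X.castW (show j = n * d + (k - i) by lia) x)))

lemma colocVal_eq (v : (loc f).obj X ⟶ (twist i).obj Y) {j : ℤ} (n : ℕ) (k : ℤ)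
    (h : n * d + k = i + j) (x : X.X j) {l : ℤ} (hl : i + l = k) :
    colocVal f v n k h x = Y.castW hl ((v.f l).hom
      ((((locι f n).app X).f l).hom (X.castW (show j = n * d + l by lia) x))) := by
  subst hl
  have key : ∀ m (e : m = l) (h1 : i + m = i + l) (h2 : j = n * d + m),
      Y.castW h1 ((v.f m).hom ((((locι f n).app X).f m).hom (X.castW h2 x))) =
      Y.castW rfl ((v.f l).hom ((((locι f n).app X).f l).hom
        (X.castW (show j = n * d + l by lia) x))) := by
    rintro _ rfl _ _
    rfl
  exact key _ (by lia) _ _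

lemma colocVal_self (v : (loc f).obj X ⟶ (twist i).obj Y) (n : ℕ) (l : ℤ)
    (h : n * d + (i + l) = i + (n * d + l)) (x : X.X (n * d + l)) :
    colocVal f v n (i + l) h x = (v.f l).hom ((((locι f n).app X).f l).hom x) := by
  refine (colocVal_eq f v n _ h x rfl).trans ((castW_rfl Y _ _).trans ?_)
  rw [castW_rfl]

/-- The values in question are `v(x / f^n)`, and `f · (x / f^{n+1}) = x / f^n`. -/
lemma act_colocVal (v : (loc f).obj X ⟶ (twist i).obj Y) {j : ℤ} (n : ℕ) (k k' : ℤ)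
    (h : n * d + k = i + j) (h' : (n + 1 : ℕ) * d + k' = i + j) (x : X.X j) :
    Y.act (show d + k' = k by push_cast at h'; linarith) f (colocVal f v (n + 1) k' h' x) =
      colocVal f v n k h x := by
  have hk : d + k' = k := by push_cast at h'; linarith
  rw [colocVal_eq f v n k h x (show i + (d + (k' - i)) = k by lia)]
  refine (act_castW Y _ _ _ _).trans ?_
  have h1 := v.map_act (show d + (k' - i) = d + (k' - i) from rfl) f
    ((((locι f (n + 1)).app X).f (k' - i)).hom (X.castW (by lia) x))
  have h2 := ((locι f (n + 1)).app X).map_act (show d + (k' - i) = d + (k' - i) from rfl) f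
    (X.castW (show j = ((n + 1 : ℕ) : ℤ) * d + (k' - i) by lia) x)
  have h3 := (congrArg ((v.f (d + (k' - i))).hom) h2).trans h1
  have h4 := congrArg (Y.castW (show i + (d + (k' - i)) = k by lia)) h3
  refine Eq.trans ?_ (h4.symm.trans ?_)
  · exact (Y.castW_act _ _ _ _).symm
  · congr 2
    have h5 := locι_act f X n (X.castW (show j = n * d + (d + (k' - i)) by lia) x)
      (by push_cast; ring)
    refine Eq.trans ?_ h5
    congr 1
    exact (act_castW X _ _ _ _).trans (act_castW X _ _ _ _).symm

/-- The adjoint `X ⟶ coloc Y (i)` of a morphism `X_f ⟶ Y(i)`. -/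
noncomputable def locAdj (v : (loc f).obj X ⟶ (twist i).obj Y) : X ⟶ (twist i).obj (coloc f Y) where
  f j := ModuleCat.ofHom
    { toFun x := (⟨fun p => colocVal f v p.1.1 p.1.2 p.2 x,
        fun n k k' h h' => act_colocVal f v n k k' h h' x⟩ : colocX f Y (i + j))
      map_add' x x' := Subtype.ext (funext fun p => by
        simp only [colocVal, castW_add]
        refine (congrArg _ ((congrArg _ (map_add (((locι f p.1.1).app X).f (p.1.2 - i)).hom _ _)).trans
          (map_add ((v.f (p.1.2 - i)).hom) _ _))).trans (castW_add _ _ _ _))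
      map_smul' r x := Subtype.ext (funext fun p => by
        simp only [colocVal, castW_smul]
        refine (congrArg _ ((congrArg _ (map_smul (((locι f p.1.1).app X).f (p.1.2 - i)).hom _ _)).trans
          (map_smul ((v.f (p.1.2 - i)).hom) _ _))).trans (castW_smul _ _ _ _)) }
  map_act {e j l} h a x := Subtype.ext (funext fun p => by
    have hp := p.2
    refine (colocVal_eq f v p.1.1 p.1.2 p.2 _ (show i + (e + (p.1.2 - e - i)) = p.1.2 by lia)).trans ?_
    refine Eq.trans ?_ (congrArg (Y.act (show e + (p.1.2 - e) = p.1.2 by lia) a)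
      (colocVal_eq f v p.1.1 (p.1.2 - e) (by lia) x
        (show i + (p.1.2 - e - i) = p.1.2 - e by lia))).symm
    rw [castW_act]
    refine Eq.trans ?_ (act_castW Y _ _ _ _).symm
    have h1 := v.map_act (show e + (p.1.2 - e - i) = e + (p.1.2 - e - i) from rfl) a
      ((((locι f p.1.1).app X).f (p.1.2 - e - i)).hom (X.castW (by lia) x))
    have h2 := ((locι f p.1.1).app X).map_act
      (show e + (p.1.2 - e - i) = e + (p.1.2 - e - i) from rfl) a
      (X.castW (show j = (p.1.1 : ℤ) * d + (p.1.2 - e - i) by lia) x)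
    have h3 := (congrArg ((v.f (e + (p.1.2 - e - i))).hom) h2).trans h1
    have h4 := congrArg (Y.castW (show i + (e + (p.1.2 - e - i)) = p.1.2 by lia)) h3
    refine Eq.trans ?_ (h4.trans ?_)
    · congr 3
      exact (act_castW X _ _ _ _).symm
    · exact (Y.castW_act _ _ _ _))

lemma locAdj_apply (v : (loc f).obj X ⟶ (twist i).obj Y) (n : ℕ) (l : ℤ)
    (h : n * d + (i + l) = i + (n * d + l)) (x : X.X (n * d + l)) :
    (show colocX f Y _ from ((locAdj f v).f (n * d + l)).hom x).1 ⟨(n, i + l), h⟩ =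
      (v.f l).hom ((((locι f n).app X).f l).hom x) :=
  colocVal_self f v n l h x

lemma hom_coloc_ext {u u' : X ⟶ (twist i).obj (coloc f Y)}
    (H : ∀ (n : ℕ) (l : ℤ) (h : n * d + (i + l) = i + (n * d + l)) (x : X.X (n * d + l)),
      (show colocX f Y _ from (u.f (n * d + l)).hom x).1 ⟨(n, i + l), h⟩ =
      (show colocX f Y _ from (u'.f (n * d + l)).hom x).1 ⟨(n, i + l), h⟩) : u = u' := by
  refine hom_ext (fun j => ModuleCat.hom_ext (LinearMap.ext fun x => Subtype.ext (funext ?_)))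
  rintro ⟨⟨n, k⟩, hk⟩
  obtain ⟨l, rfl⟩ : ∃ l, k = i + l := ⟨k - i, by lia⟩
  dsimp only at hk
  obtain rfl : j = n * d + l := by lia
  exact H n l hk x

/-- A morphism out of the colimit `X_f` is a family of maps on the `X(nd)` compatible with
multiplication by `f`. Read at one element of `X`, such a family is a sequence `(y_n)` with `f
y_{n+1} = y_n`. -/
lemma locAdj_bijective :
    Function.Bijective (locAdj f : ((loc f).obj X ⟶ (twist i).obj Y) → _) := by
  constructor
  · intro v v' h
    refine loc_hom_ext f (fun n => hom_ext (fun l => ModuleCat.hom_ext (LinearMap.ext fun x => ?_)))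
    have h1 := congrArg (fun u : X ⟶ (twist i).obj (coloc f Y) =>
      (show colocX f Y _ from (u.f (n * d + l)).hom x).1 ⟨(n, i + l), by lia⟩) h
    exact (locAdj_apply f v n l (by lia) x).symm.trans (h1.trans (locAdj_apply f v' n l (by lia) x))
  · intro u
    let φ (n : ℕ) : (twist ((n : ℤ) * d)).obj X ⟶ (twist i).obj Y :=
      { f l := ModuleCat.ofHom
          { toFun x := (show colocX f Y _ from (u.f (n * d + l)).hom x).1 ⟨(n, i + l), by lia⟩
            map_add' x y := congrArg (fun t : colocX f Y _ => t.1 ⟨(n, i + l), by lia⟩)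
              (map_add (u.f (n * d + l)).hom x y)
            map_smul' r x := congrArg (fun t : colocX f Y _ => t.1 ⟨(n, i + l), by lia⟩)
              (map_smul (u.f (n * d + l)).hom r x) }
        map_act {e j l} h a x := by
          refine (congrArg (fun t : colocX f Y _ => t.1 ⟨(n, i + l), by lia⟩)
            (u.map_act (show e + (n * d + j) = n * d + l by lia) a x)).trans ?_
          exact act_colocX_congr (show colocX f Y _ from (u.f (n * d + j)).hom x) _ _ _ _ _ _ rfl }
    refine ⟨locDesc f φ (fun n => hom_ext (fun l => ModuleCat.hom_ext (LinearMap.ext fun x => ?_))),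
      hom_coloc_ext f (fun n l h x => (locAdj_apply f _ n l h x).trans
        (locι_locDesc_apply f φ _ n x))⟩
    refine (congrArg (fun t : colocX f Y _ => t.1 ⟨(n + 1, i + l), by lia⟩)
      (u.map_act (show d + (n * d + l) = ((n + 1 : ℕ) : ℤ) * d + l by push_cast; ring) f x)).trans ?_
    exact (show colocX f Y _ from (u.f (n * d + l)).hom x).2 n _ _ _ _

lemma locAdj_add (v v' : (loc f).obj X ⟶ (twist i).obj Y) :
    locAdj f (v + v') = locAdj f v + locAdj f v' :=
  hom_coloc_ext f (fun n l h x => (locAdj_apply f _ n l h x).trans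
    (congrArg₂ (· + ·) (locAdj_apply f v n l h x) (locAdj_apply f v' n l h x)).symm)

lemma locAdj_smul (r : R) (v : (loc f).obj X ⟶ (twist i).obj Y) :
    locAdj f (r • v) = r • locAdj f v :=
  hom_coloc_ext f (fun n l h x => (locAdj_apply f _ n l h x).trans
    (congrArg (r • ·) (locAdj_apply f v n l h x)).symm)

lemma locAdj_comp_left {X' : GrMod 𝒜} (u : X' ⟶ X) (v : (loc f).obj X ⟶ (twist i).obj Y) :
    locAdj f ((loc f).map u ≫ v) = u ≫ locAdj f v :=
  hom_coloc_ext f (fun n l h x => by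
    refine (locAdj_apply f _ n l h x).trans
      (Eq.trans ?_ (locAdj_apply f v n l h ((u.f (n * d + l)).hom x)).symm)
    exact (congrArg (fun t => (v.f l).hom ((Hom.f t l).hom x)) ((locι f n).naturality u)).symm)

lemma locAdj_comp_right {Y' : GrMod 𝒜} (v : (loc f).obj X ⟶ (twist i).obj Y) (u : Y ⟶ Y') :
    locAdj f (v ≫ (twist i).map u) = locAdj f v ≫ (twist i).map ((colocFunctor f).map u) :=
  hom_coloc_ext f (fun n l h x => by
    refine (locAdj_apply f _ n l h x).trans ?_
    exact (congrArg (u.f (i + l)).hom (locAdj_apply f v n l h x)).symm)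

lemma locAdj_mulTwist (v : (loc f).obj X ⟶ (twist i).obj Y) {e k : ℤ} (h : e + i = k) (a : 𝒜 e) :
    locAdj f (v ≫ (mulTwist h a).app Y) = locAdj f v ≫ (mulTwist h a).app (coloc f Y) :=
  hom_coloc_ext f (fun n l h' x => by
    refine (locAdj_apply f _ n l h' x).trans ?_
    refine (congrArg (Y.act (show e + (i + l) = k + l by lia) a)
      (locAdj_apply f v n l (by lia) x).symm).trans ?_
    exact act_colocX_congr (show colocX f Y _ from ((locAdj f v).f (n * d + l)).hom x)
      _ _ _ _ _ _ rfl)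

/-- The zeroth term of the sequence attached to `x` is `v(x / 1)`. So restriction along `X → X_f`
corresponds to the projection to zeroth terms, and a cocone over the former corresponds to a cone
over the latter. -/
lemma locAdj_colocProj (v : (loc f).obj X ⟶ (twist i).obj Y) :
    locAdj f v ≫ (twist i).map ((colocProj f).app Y) = (toLoc f).app X ≫ v := by
  refine hom_ext (fun j => ModuleCat.hom_ext (LinearMap.ext fun x => ?_))
  exact (colocVal_eq f v 0 (i + j) (by simp) x rfl).trans (castW_rfl Y _ _)

end

end GrMod

/-! ### Cochain calculus for mapping cocones -/

namespace ComplexLemmas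

open CochainComplex CochainComplex.HomComplex

variable {C D : Type*} [Category* C] [Preadditive C] [Category* D] [Preadditive D]

lemma map_comp_natTrans {F G : C ⥤ D} [F.Additive] [G.Additive] (τ : F ⟶ G)
    {K L : CochainComplex C ℤ} {n : ℤ} (z : Cochain K L n) :
    (z.map F).comp (Cochain.ofHom ((NatTrans.mapHomologicalComplex τ _).app L)) (add_zero n) =
      (Cochain.ofHom ((NatTrans.mapHomologicalComplex τ _).app K)).comp (z.map G) (zero_add n) := by
  refine Cochain.ext _ _ (fun p q h => ?_)
  simp only [Cochain.comp_zero_cochain_v, Cochain.zero_cochain_comp_v, Cochain.map_v,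
    Cochain.ofHom_v, NatTrans.mapHomologicalComplex_app_f]
  exact τ.naturality _

/-- The right inclusion in a mapping cocone, as a cochain. -/
noncomputable def coconeInr {K L : CochainComplex C ℤ} (φ : K ⟶ L)
    [HomologicalComplex.HasHomotopyCofiber φ] : Cochain L (mappingCocone φ) 1 :=
  (mappingCocone.inr φ).1

lemma δ_coconeInr {K L : CochainComplex C ℤ} (φ : K ⟶ L)
    [HomologicalComplex.HasHomotopyCofiber φ] (n : ℤ) : δ 1 n (coconeInr φ) = 0 :=
  Cocycle.δ_eq_zero _ _

lemma coconeInr_comp_descCochain {K L M : CochainComplex C ℤ} (φ : K ⟶ L)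
    [HomologicalComplex.HasHomotopyCofiber φ] {n m : ℤ} (α : Cochain K M m) (β : Cochain L M n)
    (h : m + 1 = n) (h' : 1 + m = n) :
    (coconeInr φ).comp (mappingCocone.descCochain φ α β h) h' = β :=
  mappingCocone.inr_comp_descCochain φ α β h

lemma δ_mappingCocone_inl {K L : CochainComplex C ℤ} (φ : K ⟶ L)
    [HomologicalComplex.HasHomotopyCofiber φ] :
    δ 0 1 (mappingCocone.inl φ) =
      -(Cochain.ofHom φ).comp (coconeInr φ) (zero_add 1) := by
  have h := mappingCocone.δ_liftCochain φ (Cochain.ofHom (𝟙 K)) (0 : Cochain K L (-1))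
    (by lia) 1 rfl
  -- The inclusion is the lift of the pair `(𝟙, 0)`, so the formula for `δ` of a lift computes its
  -- coboundary.
  have h2 : mappingCocone.liftCochain φ (Cochain.ofHom (𝟙 K)) (0 : Cochain K L (-1)) (by lia) =
      mappingCocone.inl φ := by
    refine Cochain.ext _ _ (fun p q hpq => ?_)
    obtain rfl : p = q := by lia
    rw [← Category.comp_id ((mappingCocone.liftCochain φ (Cochain.ofHom (𝟙 K))
      (0 : Cochain K L (-1)) (by lia)).v p p hpq), ← mappingCocone.id_X φ p (p - 1) (by lia),
      Preadditive.comp_add]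
    simp
  rw [h2] at h
  simpa [coconeInr] using h

lemma mappingCocone_ext_from {K L M : CochainComplex C ℤ} (φ : K ⟶ L)
    [HomologicalComplex.HasHomotopyCofiber φ] {n m : ℤ} (h : 1 + n = m)
    {z z' : Cochain (mappingCocone φ) M n}
    (h₁ : (mappingCocone.inl φ).comp z (zero_add n) = (mappingCocone.inl φ).comp z' (zero_add n))
    (h₂ : (coconeInr φ).comp z h = (coconeInr φ).comp z' h) : z = z' := by
  refine Cochain.ext _ _ (fun p q hpq => ?_)
  have e₁ := Cochain.congr_v h₁ p q hpq
  have e₂ := Cochain.congr_v h₂ (p - 1) q (by lia)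
  rw [Cochain.zero_cochain_comp_v, Cochain.zero_cochain_comp_v] at e₁
  rw [Cochain.comp_v _ _ h (p - 1) p q (by lia) (by lia),
    Cochain.comp_v _ _ h (p - 1) p q (by lia) (by lia)] at e₂
  unfold coconeInr at e₂
  rw [← Category.id_comp (z.v p q hpq), ← Category.id_comp (z'.v p q hpq),
    ← mappingCocone.id_X φ p (p - 1) (by lia)]
  simp only [Preadditive.add_comp, Category.assoc, e₁, e₂]

end ComplexLemmas

/-! ### The adjunction for local cohomology at one element -/

namespace GrMod

open CochainComplex CochainComplex.HomComplex ComplexLemmas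

variable {R A : Type u} [CommRing R] [CommRing A] [Algebra R A]
    {𝒜 : ℤ → Submodule R A} [GradedAlgebra 𝒜] {d : ℤ} (f : 𝒜 d)

/-- The localization of complexes. -/
noncomputable abbrev locC : CochainComplex (GrMod 𝒜) ℤ ⥤ CochainComplex (GrMod 𝒜) ℤ :=
  (loc f).mapHomologicalComplex _

/-- The right adjoint of the localization of complexes. -/
noncomputable abbrev colocC : CochainComplex (GrMod 𝒜) ℤ ⥤ CochainComplex (GrMod 𝒜) ℤ :=
  (colocFunctor f).mapHomologicalComplex _

/-- The canonical map `X ⟶ X_f` of complexes. -/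
noncomputable def toLocC (X : CochainComplex (GrMod 𝒜) ℤ) : X ⟶ (locC f).obj X where
  f n := (toLoc f).app (X.X n)
  comm' n m _ := ((toLoc f).naturality (X.d n m)).symm

/-- The projection `(yₙ) ↦ y₀` of complexes. -/
noncomputable def colocProjC (Y : CochainComplex (GrMod 𝒜) ℤ) : (colocC f).obj Y ⟶ Y where
  f n := (colocProj f).app (Y.X n)
  comm' n m _ := ((colocProj f).naturality (Y.d n m)).symm

/-- Local cohomology for one element. -/
noncomputable abbrev locCocone (X : CochainComplex (GrMod 𝒜) ℤ) : CochainComplex (GrMod 𝒜) ℤ :=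
  mappingCocone (toLocC f X)

section

variable {X Y : CochainComplex (GrMod 𝒜) ℤ} {i m : ℤ}

/-- `locAdj` for cochains. -/
noncomputable def cochainAdj (β : Cochain ((locC f).obj X) ((twC i).obj Y) m) :
    Cochain X ((twC i).obj ((colocC f).obj Y)) m :=
  Cochain.mk (fun p q h => locAdj f (β.v p q h))

lemma cochainAdj_add (β β' : Cochain ((locC f).obj X) ((twC i).obj Y) m) :
    cochainAdj f (β + β') = cochainAdj f β + cochainAdj f β' :=
  Cochain.ext _ _ (fun _ _ _ => locAdj_add f _ _)

lemma cochainAdj_smul (r : R) (β : Cochain ((locC f).obj X) ((twC i).obj Y) m) :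
    cochainAdj f (r • β) = r • cochainAdj f β :=
  Cochain.ext _ _ (fun _ _ _ => locAdj_smul f _ _)

lemma locAdj_units_smul {X Y : GrMod 𝒜} {i : ℤ} (ε : ℤˣ) (v : (loc f).obj X ⟶ (twist i).obj Y) :
    locAdj f (ε • v) = ε • locAdj f v :=
  (AddMonoidHom.mk' (locAdj f (X := X) (Y := Y) (i := i)) (locAdj_add f)).map_zsmul (ε : ℤ) v

lemma cochainAdj_bijective : Function.Bijective
    (cochainAdj f (X := X) (Y := Y) (i := i) (m := m)) := by
  constructor
  · intro β β' h
    exact Cochain.ext _ _ (fun p q hpq => (locAdj_bijective f).1 (Cochain.congr_v h p q hpq))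
  · intro z
    choose β hβ using fun p q hpq => (locAdj_bijective f).2 (z.v p q hpq)
    exact ⟨Cochain.mk β, Cochain.ext _ _ (fun p q hpq => hβ p q hpq)⟩

lemma δ_cochainAdj {m' : ℤ} (hm : m + 1 = m') (β : Cochain ((locC f).obj X) ((twC i).obj Y) m) :
    δ m m' (cochainAdj f β) = cochainAdj f (δ m m' β) := by
  refine Cochain.ext _ _ (fun p q hpq => ?_)
  refine (δ_v m m' hm (cochainAdj f β) p q hpq (q - 1) (p + 1) rfl rfl).trans ?_
  refine Eq.trans ?_ (congrArg (locAdj f)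
    (δ_v m m' hm β p q hpq (q - 1) (p + 1) rfl rfl)).symm
  refine Eq.trans ?_ (locAdj_add f _ _).symm
  refine congrArg₂ (· + ·) (locAdj_comp_right f _ _).symm ?_
  exact Eq.trans (congrArg (m'.negOnePow • ·) (locAdj_comp_left f _ _).symm)
    (locAdj_units_smul f _ _).symm

lemma cochainAdj_colocProj (β : Cochain ((locC f).obj X) ((twC i).obj Y) m) :
    (cochainAdj f β).comp (Cochain.ofHom ((twC i).map (colocProjC f Y))) (add_zero m) =
      (Cochain.ofHom (toLocC f X)).comp β (zero_add m) := by
  refine Cochain.ext _ _ (fun p q hpq => ?_)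
  rw [Cochain.comp_zero_cochain_v, Cochain.zero_cochain_comp_v]
  exact locAdj_colocProj f _

lemma cochainAdj_mulTwist (β : Cochain ((locC f).obj X) ((twC i).obj Y) m) {e k : ℤ}
    (h : e + i = k) (a : 𝒜 e) :
    cochainAdj f (β.comp (Cochain.ofHom
      ((NatTrans.mapHomologicalComplex (mulTwist h a) (ComplexShape.up ℤ)).app Y)) (add_zero m)) =
    (cochainAdj f β).comp (Cochain.ofHom
      ((NatTrans.mapHomologicalComplex (mulTwist h a) (ComplexShape.up ℤ)).app
        ((colocC f).obj Y))) (add_zero m) := by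
  refine Cochain.ext _ _ (fun p q hpq => ?_)
  refine (congrArg (locAdj f) (Cochain.comp_zero_cochain_v _ _ _ _ _)).trans ?_
  exact (locAdj_mulTwist f _ h a).trans (Cochain.comp_zero_cochain_v (cochainAdj f β)
    (Cochain.ofHom ((NatTrans.mapHomologicalComplex (mulTwist h a) (ComplexShape.up ℤ)).app
      ((colocC f).obj Y))) p q hpq).symm

/-- The complex that represents `\underline{Hom}_A(RΓ_f(-), Y)`. -/
noncomputable abbrev colocCone (Y : CochainComplex (GrMod 𝒜) ℤ) : CochainComplex (GrMod 𝒜) ℤ :=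
  mappingCone (colocProjC f Y)

/-- The adjunction isomorphism on cochains. -/
noncomputable def locCoconeAdj (z : Cochain (locCocone f X) ((twC i).obj Y) m) :
    Cochain X ((twC i).obj (colocCone f Y)) m :=
  -- The sign `(-1)^m` absorbs the sign that the degree `-1` cochain `mappingCone.inl` contributes
  -- to `δ` of a composite.
  (m.negOnePow • cochainAdj f ((coconeInr (toLocC f X)).comp z (add_comm 1 m))).comp
      ((mappingCone.inl (colocProjC f Y)).map (twist i)) (add_neg_cancel_right m 1) +
    ((mappingCocone.inl (toLocC f X)).comp z (zero_add m)).comp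
      (Cochain.ofHom ((twC i).map (mappingCone.inr (colocProjC f Y)))) (add_zero m)

/-- A cochain on the cocone is a pair of a cochain on `X` and a cochain `β` on `X_f`. The cross term
on the source side is `X → X_f` followed by `β`; on the target side it is the adjoint of `β`
followed by the projection to zeroth terms. `cochainAdj_colocProj` equates the two. -/
lemma δ_locCoconeAdj {m' : ℤ} (hm : m + 1 = m') (z : Cochain (locCocone f X) ((twC i).obj Y) m) :
    δ m m' (locCoconeAdj f z) = locCoconeAdj f (δ m m' z) := by
  subst hm
  have e₁ : δ (m + 1) (m + 1 + 1) ((coconeInr (toLocC f X)).comp z (add_comm 1 m)) =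
      (coconeInr (toLocC f X)).comp (δ m (m + 1) z) (add_comm 1 (m + 1)) := by
    rw [δ_comp _ _ (add_comm 1 m) 2 (m + 1) (m + 1 + 1) rfl rfl rfl, δ_coconeInr]
    simp
  have e₂ : δ m (m + 1) ((mappingCocone.inl (toLocC f X)).comp z (zero_add m)) =
      (mappingCocone.inl (toLocC f X)).comp (δ m (m + 1) z) (zero_add _) -
        m.negOnePow • (Cochain.ofHom (toLocC f X)).comp
          ((coconeInr (toLocC f X)).comp z (add_comm 1 m)) (zero_add _) := by
    rw [δ_comp _ _ _ 1 (m + 1) (m + 1) rfl rfl rfl, δ_mappingCocone_inl, Cochain.neg_comp,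
      smul_neg, ← sub_eq_add_neg, Cochain.comp_assoc_of_first_is_zero_cochain]
  have e₃ : δ (-1) 0 ((mappingCone.inl (colocProjC f Y)).map (twist i)) =
      (Cochain.ofHom ((twC i).map (colocProjC f Y))).comp
        (Cochain.ofHom ((twC i).map (mappingCone.inr (colocProjC f Y)))) (zero_add 0) := by
    rw [δ_map, mappingCone.δ_inl, Cochain.map_ofHom, ← Cochain.ofHom_comp, Functor.map_comp]
  unfold locCoconeAdj
  rw [δ_add, δ_comp_ofHom, e₂, ← e₁,
    δ_comp _ _ _ (m + 1 + 1) 0 (m + 1) rfl rfl (by lia), e₃, δ_units_smul, δ_cochainAdj f rfl,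
    ← Cochain.comp_assoc_of_third_is_zero_cochain, Cochain.units_smul_comp, cochainAdj_colocProj,
    Cochain.sub_comp]
  simp only [Cochain.units_smul_comp, Int.negOnePow_succ, Int.negOnePow_neg, Int.negOnePow_one,
    Units.neg_smul, one_smul, Cochain.neg_comp]
  abel

lemma locCoconeAdj_mulTwist (z : Cochain (locCocone f X) ((twC i).obj Y) m) {e k : ℤ}
    (h : e + i = k) (a : 𝒜 e) :
    locCoconeAdj f (z.comp (Cochain.ofHom
      ((NatTrans.mapHomologicalComplex (mulTwist h a) (ComplexShape.up ℤ)).app Y)) (add_zero m)) =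
    (locCoconeAdj f z).comp (Cochain.ofHom
      ((NatTrans.mapHomologicalComplex (mulTwist h a) (ComplexShape.up ℤ)).app
        (colocCone f Y))) (add_zero m) := by
  unfold locCoconeAdj
  rw [Cochain.add_comp]
  congr 1
  · rw [Cochain.comp_assoc_of_third_is_zero_cochain]
    have h1 := map_comp_natTrans (mulTwist h a) (mappingCone.inl (colocProjC f Y))
    have h2 : (m.negOnePow • cochainAdj f ((coconeInr (toLocC f X)).comp z (add_comm 1 m))).comp
        (Cochain.ofHom ((NatTrans.mapHomologicalComplex (mulTwist h a) (ComplexShape.up ℤ)).app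
          ((colocC f).obj Y))) (add_zero _) =
        m.negOnePow • cochainAdj f ((coconeInr (toLocC f X)).comp (z.comp (Cochain.ofHom
          ((NatTrans.mapHomologicalComplex (mulTwist h a) (ComplexShape.up ℤ)).app Y))
            (add_zero m)) (add_comm 1 m)) := by
      rw [Cochain.units_smul_comp, ← cochainAdj_mulTwist,
        Cochain.comp_assoc_of_third_is_zero_cochain]
    rw [h1, ← Cochain.comp_assoc_of_second_is_zero_cochain, h2]
  · rw [Cochain.comp_assoc_of_third_is_zero_cochain, Cochain.comp_assoc_of_third_is_zero_cochain,
      Cochain.comp_assoc_of_third_is_zero_cochain, Cochain.comp_assoc_of_third_is_zero_cochain,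
      ← Cochain.ofHom_comp, ← Cochain.ofHom_comp]
    congr 3
    exact ((NatTrans.mapHomologicalComplex (mulTwist h a) (ComplexShape.up ℤ)).naturality
      (mappingCone.inr (colocProjC f Y))).symm

/-- The projections of the twisted cone recover the part on `X` unchanged and the part on `X_f`
through the bijective adjunction; `h₁` to `h₅` are the biproduct identities of the cone after
twisting. -/
lemma locCoconeAdj_bijective : Function.Bijective
    (locCoconeAdj f (X := X) (Y := Y) (i := i) (m := m)) := by
  have h₁ : ((mappingCone.inl (colocProjC f Y)).map (twist i)).comp
      ((mappingCone.fst (colocProjC f Y)).1.map (twist i)) (neg_add_cancel 1) =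
      Cochain.ofHom (𝟙 _) := by
    rw [← Cochain.map_comp, mappingCone.inl_fst, Cochain.map_ofHom, CategoryTheory.Functor.map_id]
  have h₂ : ((mappingCone.inl (colocProjC f Y)).map (twist i)).comp
      ((mappingCone.snd (colocProjC f Y)).map (twist i)) (add_zero (-1)) = 0 := by
    rw [← Cochain.map_comp, mappingCone.inl_snd, Cochain.map_zero]
  have h₃ : ((Cochain.ofHom (mappingCone.inr (colocProjC f Y))).map (twist i)).comp
      ((mappingCone.fst (colocProjC f Y)).1.map (twist i)) (zero_add 1) = 0 := by
    rw [← Cochain.map_comp, mappingCone.inr_fst, Cochain.map_zero]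
  have h₄ : ((Cochain.ofHom (mappingCone.inr (colocProjC f Y))).map (twist i)).comp
      ((mappingCone.snd (colocProjC f Y)).map (twist i)) (zero_add 0) = Cochain.ofHom (𝟙 _) := by
    rw [← Cochain.map_comp, mappingCone.inr_snd, Cochain.map_ofHom, CategoryTheory.Functor.map_id]
  have h₅ : ((mappingCone.fst (colocProjC f Y)).1.map (twist i)).comp
      ((mappingCone.inl (colocProjC f Y)).map (twist i)) (add_neg_cancel 1) +
      ((mappingCone.snd (colocProjC f Y)).map (twist i)).comp
        ((Cochain.ofHom (mappingCone.inr (colocProjC f Y))).map (twist i)) (add_zero 0) =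
      Cochain.ofHom (𝟙 _) := by
    rw [← Cochain.map_comp, ← Cochain.map_comp, ← Cochain.map_add, mappingCone.id,
      Cochain.map_ofHom, CategoryTheory.Functor.map_id]
  rw [Cochain.map_ofHom] at h₃ h₄ h₅
  have hfst (z : Cochain (locCocone f X) ((twC i).obj Y) m) :
      (locCoconeAdj f z).comp ((mappingCone.fst (colocProjC f Y)).1.map (twist i)) rfl =
        m.negOnePow • cochainAdj f ((coconeInr (toLocC f X)).comp z (add_comm 1 m)) := by
    unfold locCoconeAdj
    rw [Cochain.add_comp, Cochain.comp_assoc _ _ _ _ (neg_add_cancel 1) (by lia), h₁,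
      Cochain.comp_assoc_of_second_is_zero_cochain, h₃, Cochain.comp_zero, add_zero,
      Cochain.comp_id]
  have hsnd (z : Cochain (locCocone f X) ((twC i).obj Y) m) :
      (locCoconeAdj f z).comp ((mappingCone.snd (colocProjC f Y)).map (twist i)) (add_zero m) =
        (mappingCocone.inl (toLocC f X)).comp z (zero_add m) := by
    unfold locCoconeAdj
    rw [Cochain.add_comp, Cochain.comp_assoc_of_third_is_zero_cochain, h₂,
      Cochain.comp_assoc_of_third_is_zero_cochain, h₄, Cochain.comp_zero, zero_add,
      Cochain.comp_id]
  constructor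
  · intro z z' h
    refine mappingCocone_ext_from (toLocC f X) (add_comm 1 m) ?_ ?_
    · rw [← hsnd, ← hsnd, h]
    · have h6 := (hfst z).symm.trans ((congrArg (fun w => w.comp
        ((mappingCone.fst (colocProjC f Y)).1.map (twist i)) rfl) h).trans (hfst z'))
      exact (cochainAdj_bijective f).1 (smul_left_cancel _ h6)
  · intro w
    obtain ⟨β, hβ⟩ := (cochainAdj_bijective f).2
      (m.negOnePow • w.comp ((mappingCone.fst (colocProjC f Y)).1.map (twist i)) rfl)
    refine ⟨mappingCocone.descCochain (toLocC f X)
      (w.comp ((mappingCone.snd (colocProjC f Y)).map (twist i)) (add_zero m)) β rfl, ?_⟩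
    unfold locCoconeAdj
    rw [mappingCocone.inl_comp_descCochain, coconeInr_comp_descCochain, hβ, smul_smul,
      Int.units_mul_self, one_smul, Cochain.comp_assoc _ _ _ _ (add_neg_cancel 1) (by lia),
      Cochain.comp_assoc_of_third_is_zero_cochain, ← Cochain.comp_add, h₅, Cochain.comp_id]

end

end GrMod

/-! ### Representing `Hom(RΓ(-), Y)` -/

namespace GrMod

open CochainComplex CochainComplex.HomComplex ComplexLemmas

variable {R A : Type u} [CommRing R] [CommRing A] [Algebra R A]
    {𝒜 : ℤ → Submodule R A} [GradedAlgebra 𝒜]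

lemma locCoconeAdj_add {d : ℤ} (f : 𝒜 d) {X Y : CochainComplex (GrMod 𝒜) ℤ} {i m : ℤ}
    (z z' : Cochain (locCocone f X) ((twC i).obj Y) m) :
    locCoconeAdj f (z + z') = locCoconeAdj f z + locCoconeAdj f z' := by
  unfold locCoconeAdj
  rw [Cochain.comp_add, Cochain.comp_add, cochainAdj_add, smul_add, Cochain.add_comp,
    Cochain.add_comp]
  abel

lemma locCoconeAdj_smul {d : ℤ} (f : 𝒜 d) {X Y : CochainComplex (GrMod 𝒜) ℤ} {i m : ℤ}
    (r : R) (z : Cochain (locCocone f X) ((twC i).obj Y) m) :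
    locCoconeAdj f (r • z) = r • locCoconeAdj f z := by
  unfold locCoconeAdj
  have h := smul_comm (m.negOnePow : ℤ) r
    (cochainAdj f ((coconeInr (toLocC f X)).comp z (add_comm 1 m)))
  rw [Cochain.comp_smul, Cochain.comp_smul, cochainAdj_smul, smul_add, Cochain.smul_comp]
  congr 1
  exact (congrArg (fun t => Cochain.comp t ((mappingCone.inl (colocProjC f Y)).map (twist i))
    (add_neg_cancel_right m 1)) h).trans (Cochain.smul_comp _ _ _ _)

/-- `\underline{Hom}_A(RΓ_f(X), Y) ≅ \underline{Hom}_A(X, Y')`. -/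
noncomputable def gradedHomLocCocone {d : ℤ} (f : 𝒜 d) (X Y : CochainComplex (GrMod 𝒜) ℤ) :
    gradedHom (locCocone f X) Y ⟶ gradedHom X (colocCone f Y) where
  f n :=
    { f i := ModuleCat.ofHom
        { toFun (z : Cochain (locCocone f X) ((twC i).obj Y) n) := locCoconeAdj f z
          map_add' z z' := locCoconeAdj_add f z z'
          map_smul' r z := locCoconeAdj_smul f r z }
      map_act {d i k} h b (z : Cochain (locCocone f X) ((twC i).obj Y) n) :=
        locCoconeAdj_mulTwist f z h b }
  comm' n m hm := hom_ext (fun i => ModuleCat.hom_ext (LinearMap.ext fun z =>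
    δ_locCoconeAdj f hm z))

lemma isIso_gradedHomLocCocone {d : ℤ} (f : 𝒜 d) (X Y : CochainComplex (GrMod 𝒜) ℤ) :
    IsIso (gradedHomLocCocone f X Y) :=
  isIso_of_bijective_f _ (fun _ _ => locCoconeAdj_bijective f)

/-- The one-element adjunction is iterated, from the outermost cocone inwards. The order of
quantifiers matters: `Y'` serves all `X` at once, so it can be identified later by evaluating at `X
= A`. -/
lemma exists_gradedHom_localCohomology_iso (l : List (Σ d : ℤ, 𝒜 d))
    (Y : CochainComplex (GrMod 𝒜) ℤ) :
    ∃ Y' : CochainComplex (GrMod 𝒜) ℤ, ∀ X : CochainComplex (GrMod 𝒜) ℤ,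
      Nonempty (gradedHom (localCohomology l X) Y ≅ gradedHom X Y') := by
  induction l generalizing Y with
  | nil => exact ⟨Y, fun X => ⟨Iso.refl _⟩⟩
  | cons p l ih =>
    obtain ⟨Y', hY'⟩ := ih (colocCone p.2 Y)
    refine ⟨Y', fun X => ⟨?_⟩⟩
    have := isIso_gradedHomLocCocone p.2 (localCohomology l X) Y
    have e := asIso (gradedHomLocCocone p.2 (localCohomology l X) Y)
    exact e ≪≫ (hY' X).some

end GrMod

namespace GrMod

open CochainComplex CochainComplex.HomComplex ComplexLemmas

variable {R A : Type u} [CommRing R] [CommRing A] [Algebra R A]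
    {𝒜 : ℤ → Submodule R A} [GradedAlgebra 𝒜]

/-! ### The unit object, resolutions, invariance of local coherence -/

lemma isLocallyCoherent_of_derivedIso {M N : CochainComplex (GrMod 𝒜) ℤ} (h : DerivedIso M N)
    (hM : IsLocallyCoherent M) : IsLocallyCoherent N := by
  intro n i
  have e := (weight i).mapIso ((DerivedCategory.homologyFunctorFactors (GrMod 𝒜) n).symm.app M ≪≫
    (DerivedCategory.homologyFunctor (GrMod 𝒜) n).mapIso h.some ≪≫
    (DerivedCategory.homologyFunctorFactors (GrMod 𝒜) n).app N)
  have h1 : Module.Finite R ((weight i).obj ((HomologicalComplex.homologyFunctor (GrMod 𝒜)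
    (ComplexShape.up ℤ) n).obj M)) := hM n i
  exact Module.Finite.equiv e.toLinearEquiv

lemma isIso_Q_map {K L : CochainComplex (GrMod 𝒜) ℤ} {φ : K ⟶ L} (h : QuasiIso φ) :
    IsIso (DerivedCategory.Q.map φ) := inferInstance

lemma kProjRes_spec (M : CochainComplex (GrMod 𝒜) ℤ) :
    (kProjRes M).IsKProjective ∧ DerivedIso (kProjRes M) M := by
  obtain ⟨φ, h, h'⟩ := (KProjectiveResolution.exists_resolution isSeparator_generator M).choose_spec
  exact ⟨h, ⟨@asIso _ _ _ _ (DerivedCategory.Q.map φ) (isIso_Q_map h')⟩⟩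

lemma IsDualizing.isKInjective {ω : DerivedCategory (ModuleCat.{u} R)} (hω : IsDualizing ω) :
    hω.exists_injective.choose.IsKInjective := by
  obtain ⟨⟨a, b, _, _⟩, h, _⟩ := hω.exists_injective.choose_spec
  exact isKInjective_of_injective _ a

section unit

lemma fg_free (n : ℤ) : (free (𝒜 := 𝒜) (-n)).FG :=
  ⟨1, fun _ => n, fun _ => freeGen n, fun j (y : 𝒜 (-n + j)) =>
    ⟨fun _ => ⟨y, by rw [← neg_add_eq_sub]; exact y.2⟩, by
      rw [Fin.sum_univ_one]
      exact Subtype.ext (mul_one (y : A)).symm⟩⟩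

lemma FG.of_iso {M N : GrMod 𝒜} (e : M ≅ N) (h : M.FG) : N.FG := by
  obtain ⟨n, w, x, hx⟩ := h
  refine ⟨n, w, fun r => (e.hom.f _).hom (x r), fun j y => ?_⟩
  obtain ⟨a, ha⟩ := hx j ((e.inv.f j).hom y)
  refine ⟨a, ?_⟩
  have h2 : (e.hom.f j).hom ((e.inv.f j).hom y) = y := by
    rw [← ModuleCat.comp_apply, ← comp_f, e.inv_hom_id]; rfl
  rw [← h2, ha, map_sum]
  exact Finset.sum_congr rfl (fun r _ => e.hom.map_act _ _ _)

lemma fg_of_isZero {M : GrMod 𝒜} (h : IsZero M) : M.FG :=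
  ⟨0, Fin.elim0, fun r => r.elim0, fun j y => ⟨fun r => r.elim0, by
    have := ModuleCat.subsingleton_of_isZero (isZero_weight h j)
    exact Subsingleton.elim _ _⟩⟩

lemma isZero_unit_X {n : ℤ} (h : n ≠ 0) : IsZero ((unit 𝒜).X n) :=
  HomologicalComplex.isZero_single_obj_X _ _ _ _ h

lemma projective_unit (n : ℤ) : Projective ((unit 𝒜).X n) ∧ ((unit 𝒜).X n).FG := by
  by_cases h : n = 0
  · subst h
    let e : free (𝒜 := 𝒜) (-0) ≅ (unit 𝒜).X 0 :=
      eqToIso (by rw [neg_zero]) ≪≫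
        (HomologicalComplex.singleObjXSelf (ComplexShape.up ℤ) 0 (free (𝒜 := 𝒜) 0)).symm
    exact ⟨Projective.of_iso e inferInstance, (fg_free 0).of_iso e⟩
  · exact ⟨(isZero_unit_X h).projective, fg_of_isZero (isZero_unit_X h)⟩

lemma isIso_homDualMap (E : CochainComplex (ModuleCat.{u} R) ℤ)
    {M M' : CochainComplex (GrMod 𝒜) ℤ} (φ : M ⟶ M') [IsIso φ] : IsIso (homDualMap E φ) := by
  have h {X Y : CochainComplex (ModuleCat.{u} R) ℤ} {n : ℤ} (φ : X ⟶ Y) (ψ : Y ⟶ X)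
      (h : φ ≫ ψ = 𝟙 X) (z : Cochain X E n) :
      (Cochain.ofHom φ).comp ((Cochain.ofHom ψ).comp z (zero_add n)) (zero_add n) = z := by
    rw [← Cochain.comp_assoc_of_first_is_zero_cochain, ← Cochain.ofHom_comp, h, Cochain.id_comp]
  refine isIso_of_bijective_f _ (fun n i => ?_)
  have h1 : (weightC (-i)).map φ ≫ (weightC (-i)).map (inv φ) = 𝟙 _ := by
    rw [← Functor.map_comp, IsIso.hom_inv_id, CategoryTheory.Functor.map_id]
  have h2 : (weightC (-i)).map (inv φ) ≫ (weightC (-i)).map φ = 𝟙 _ := by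
    rw [← Functor.map_comp, IsIso.inv_hom_id, CategoryTheory.Functor.map_id]
  exact Function.bijective_iff_has_inverse.2
    ⟨fun (z : Cochain ((weightC (-i)).obj M) E n) =>
      (Cochain.ofHom ((weightC (-i)).map (inv φ))).comp z (zero_add n), h _ _ h2, h _ _ h1⟩

/-- Contraction for `P = A`, combined with `X ≅ Hom(A, X)`. The dual thereby becomes a Hom over `A`,
to which the adjunction for local cohomology applies. -/
lemma exists_homDual_iso (E : CochainComplex (ModuleCat.{u} R) ℤ) :
    ∃ J : CochainComplex (GrMod 𝒜) ℤ, ∀ X : CochainComplex (GrMod 𝒜) ℤ,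
      Nonempty (homDual E X ≅ gradedHom X J) := by
  refine ⟨homDual E (dualC (unit 𝒜)), fun X => ?_⟩
  have h1 : IsIso (homDualGradedHom E (unit 𝒜) X) :=
    isIso_homDualGradedHom (S := {0}) (fun m hm => isZero_unit_X (by simpa using hm))
      projective_unit
  have h2 : IsIso (homDualMap E (toGradedHomUnit X)) := isIso_homDualMap E _
  exact ⟨(asIso (homDualMap E (toGradedHomUnit X))).symm ≪≫
    asIso (homDualGradedHom E (unit 𝒜) X)⟩

end unit

lemma exists_finset_isZero (P : CochainComplex (GrMod 𝒜) ℤ) (a b : ℤ) [P.IsStrictlyGE a]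
    [P.IsStrictlyLE b] : ∃ S : Finset ℤ, ∀ m ∉ S, IsZero (P.X (-m)) := by
  refine ⟨Finset.Icc (-b) (-a), fun m hm => ?_⟩
  rw [Finset.mem_Icc, not_and_or] at hm
  rcases hm with hm | hm
  · exact P.isZero_of_isStrictlyLE b _ (by lia)
  · exact P.isZero_of_isStrictlyGE a _ (by lia)

end GrMod

namespace ComplexLemmas

open CochainComplex CochainComplex.HomComplex

/-! ### Short exact sequences of complexes -/

section

open HomologicalComplex HomologicalComplex.HomologySequence ComposableArrows

universe v w

variable {C : Type w} [Category.{v} C] [Abelian C]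

lemma quasiIso_biprod_fst (X X' : CochainComplex C ℤ) :
    QuasiIso (biprod.fst : X' ⊞ mappingCone (𝟙 X) ⟶ X') := by
  let e : HomotopyEquiv (X' ⊞ mappingCone (𝟙 X)) X' :=
    { hom := biprod.fst
      inv := biprod.inl
      homotopyHomInvId :=
        ((Homotopy.ofEq (by simp)).trans (((Homotopy.refl (biprod.fst ≫ biprod.inl)).add
          (((mappingCone.homotopyToZeroOfId X).compLeft biprod.snd).compRight
            biprod.inr)).symm)).trans (Homotopy.ofEq (by simp))
      homotopyInvHomId := Homotopy.ofEq (by simp) }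
  exact HomotopyEquiv.quasiIso_hom e

/-- A morphism of complexes factors as a monomorphism followed by a quasi-isomorphism that has a
section. -/
lemma exists_shortExact {X X' : CochainComplex C ℤ} (φ : X ⟶ X') :
    ∃ (Y Z : CochainComplex C ℤ) (i : X ⟶ Y) (p : Y ⟶ Z) (w : i ≫ p = 0) (π : Y ⟶ X'),
      (ShortComplex.mk i p w).ShortExact ∧ QuasiIso π ∧ i ≫ π = φ ∧
        ∃ s : X' ⟶ Y, Mono s ∧ s ≫ π = 𝟙 X' := by
  -- Adding the inclusion of `X` into the contractible cone of its identity makes `φ` a monomorphism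
  -- without changing the homotopy type of the target.
  let i : X ⟶ X' ⊞ mappingCone (𝟙 X) := biprod.lift φ (mappingCone.inr (𝟙 X))
  have hi : Mono i := by
    apply HomologicalComplex.mono_of_mono_f
    intro n
    have h : i.f n ≫ (biprod.snd : X' ⊞ mappingCone (𝟙 X) ⟶ _).f n ≫
        (mappingCone.snd (𝟙 X)).v n n (add_zero n) = 𝟙 _ := by
      rw [← Category.assoc, ← HomologicalComplex.comp_f, biprod.lift_snd]
      simp
    exact mono_of_mono_fac h
  exact ⟨_, cokernel i, i, cokernel.π i, cokernel.condition i, biprod.fst,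
    { exact := ShortComplex.exact_cokernel i
      mono_f := hi
      epi_g := inferInstance }, quasiIso_biprod_fst X X', biprod.lift_fst _ _,
    biprod.inl, inferInstance, biprod.inl_fst⟩

variable {S₁ S₂ : ShortComplex (CochainComplex C ℤ)} (φ : S₁ ⟶ S₂) (hS₁ : S₁.ShortExact)
  (hS₂ : S₂.ShortExact)
include hS₁ hS₂

/-- One half of the five lemma on the long exact sequences. The halves are kept apart because the
dévissage for biduality proves surjectivity first and needs it for injectivity. -/
lemma epi_homologyMap_middle {i j : ℤ} (hij : i + 1 = j) (h₁ : Epi (homologyMap φ.τ₁ i))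
    (h₂ : Epi (homologyMap φ.τ₃ i)) (h₃ : Mono (homologyMap φ.τ₁ j)) :
    Epi (homologyMap φ.τ₂ i) :=
  Abelian.epi_of_epi_of_epi_of_mono'' (k := 0) (by lia) (composableArrows₅_exact hS₁ i j hij)
    (composableArrows₅_exact hS₂ i j hij) (mapComposableArrows₅ φ hS₁ hS₂ i j hij) 0 1 2 3
    rfl rfl rfl rfl h₁ h₂ h₃

lemma mono_homologyMap_middle {i j : ℤ} (hij : i + 1 = j) (h₁ : Mono (homologyMap φ.τ₁ j))
    (h₂ : Mono (homologyMap φ.τ₃ j)) (h₃ : Epi (homologyMap φ.τ₃ i)) :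
    Mono (homologyMap φ.τ₂ j) :=
  Abelian.mono_of_epi_of_mono_of_mono'' (k := 2) (by lia) (composableArrows₅_exact hS₁ i j hij)
    (composableArrows₅_exact hS₂ i j hij) (mapComposableArrows₅ φ hS₁ hS₂ i j hij) 2 3 4 5
    rfl rfl rfl rfl h₃ h₁ h₂

end

end ComplexLemmas

namespace ComplexLemmas

open CochainComplex CochainComplex.HomComplex

/-! ### The dual of a complex of modules and biduality -/

variable {R : Type u} [CommRing R]

/-- The Hom complex from `C` to `E`. -/
noncomputable def dual (E C : CochainComplex (ModuleCat.{u} R) ℤ) :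
    CochainComplex (ModuleCat.{u} R) ℤ where
  X n := ModuleCat.of R (Cochain C E n)
  d n m := ModuleCat.ofHom (δ_hom R C E n m)
  shape _ _ hnm := ModuleCat.hom_ext (LinearMap.ext fun z => δ_shape _ _ hnm z)
  d_comp_d' _ _ _ _ _ := ModuleCat.hom_ext (LinearMap.ext fun z => δ_δ _ _ _ z)

variable (E : CochainComplex (ModuleCat.{u} R) ℤ) {C C' : CochainComplex (ModuleCat.{u} R) ℤ}

/-- Contravariant functoriality of the dual. -/
noncomputable def dualMap (φ : C ⟶ C') : dual E C' ⟶ dual E C where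
  f n := ModuleCat.ofHom
    { toFun (z : Cochain C' E n) := (Cochain.ofHom φ).comp z (zero_add n)
      map_add' _ _ := Cochain.comp_add _ _ _ _
      map_smul' _ _ := Cochain.comp_smul _ _ _ _ }
  comm' _ m _ := ModuleCat.hom_ext (LinearMap.ext fun z => δ_ofHom_comp φ (K := E) z m)

lemma dualMap_comp {C'' : CochainComplex (ModuleCat.{u} R) ℤ} (φ : C ⟶ C') (ψ : C' ⟶ C'') :
    dualMap E (φ ≫ ψ) = dualMap E ψ ≫ dualMap E φ := by
  refine HomologicalComplex.hom_ext _ _ (fun n => ModuleCat.hom_ext (LinearMap.ext fun z => ?_))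
  have key (z : Cochain C'' E n) : (Cochain.ofHom (φ ≫ ψ)).comp z (zero_add n) =
      (Cochain.ofHom φ).comp ((Cochain.ofHom ψ).comp z (zero_add n)) (zero_add n) := by
    rw [← Cochain.comp_assoc_of_first_is_zero_cochain, ← Cochain.ofHom_comp]
  exact key z

lemma quasiIso_dualMap [E.IsKInjective] (φ : C ⟶ C') [QuasiIso φ] : QuasiIso (dualMap E φ) := by
  have h2 := eq_δ_of_isKInjective (L := E) ((acyclic_mappingCone_iff φ).2 inferInstance)
  refine quasiIso_of_forall _ (fun m n k hm hk x y hx hy => ?_) (fun m n k hm hk y hy => ?_)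
  · exact eq_δ_of_ofHom_comp_eq_δ _ _ h2 hm hk x hx y hy
  · exact exists_ofHom_comp_add_δ _ _ h2 hm hk y hy

lemma shortExact_iff {S : ShortComplex (ModuleCat.{u} R)} : S.ShortExact ↔
    Function.Injective S.f.hom ∧ Function.Surjective S.g.hom ∧
      ∀ x, S.g.hom x = 0 → ∃ y, S.f.hom y = x := by
  constructor
  · intro h
    have h1 := h.mono_f
    have h2 := h.epi_g
    exact ⟨(ModuleCat.mono_iff_injective _).1 h1, (ModuleCat.epi_iff_surjective _).1 h2,
      (ShortComplex.moduleCat_exact_iff _).1 h.exact⟩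
  · rintro ⟨h1, h2, h3⟩
    exact { exact := (ShortComplex.moduleCat_exact_iff _).2 h3
            mono_f := (ModuleCat.mono_iff_injective _).2 h1
            epi_g := (ModuleCat.epi_iff_surjective _).2 h2 }

/-- The dual of a short complex. -/
noncomputable def dualShort (S : ShortComplex (CochainComplex (ModuleCat.{u} R) ℤ)) :
    ShortComplex (CochainComplex (ModuleCat.{u} R) ℤ) :=
  ShortComplex.mk (dualMap E S.g) (dualMap E S.f) (by
    rw [← dualMap_comp, S.zero]
    refine HomologicalComplex.hom_ext _ _ (fun n => ModuleCat.hom_ext (LinearMap.ext fun z => ?_))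
    have key (z : Cochain S.X₃ E n) :
        (Cochain.ofHom (0 : S.X₁ ⟶ S.X₃)).comp z (zero_add n) = 0 := by simp
    exact key z)

/-- Cochains into `E` are products of groups `Hom(-, E^q)`, and each of these functors is exact. -/
lemma shortExact_dualShort (hE : ∀ n, Injective (E.X n))
    {S : ShortComplex (CochainComplex (ModuleCat.{u} R) ℤ)} (hS : S.ShortExact) :
    (dualShort E S).ShortExact := by
  rw [HomologicalComplex.shortExact_iff_degreewise_shortExact] at hS ⊢
  intro n
  rw [shortExact_iff]
  have hm (p : ℤ) : Mono (S.f.f p) := (hS p).mono_f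
  have he (p : ℤ) : Epi (S.g.f p) := (hS p).epi_g
  refine ⟨?_, ?_, ?_⟩
  · rw [injective_iff_map_eq_zero]
    intro (z : Cochain S.X₃ E n) hz
    refine Cochain.ext _ _ (fun p q hpq => ?_)
    have h : S.g.f p ≫ z.v p q hpq = 0 := by
      have h2 : ((Cochain.ofHom S.g).comp z (zero_add n)).v p q hpq = 0 := by
        have h3 : (Cochain.ofHom S.g).comp z (zero_add n) = 0 := hz
        rw [h3]; rfl
      rwa [Cochain.zero_cochain_comp_v, Cochain.ofHom_v] at h2
    exact zero_of_epi_comp _ h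
  · intro (z : Cochain S.X₁ E n)
    refine ⟨(Cochain.mk (fun p q hpq => Injective.factorThru (z.v p q hpq) (S.f.f p)) :
      Cochain S.X₂ E n), ?_⟩
    refine Cochain.ext _ _ (fun p q hpq => ?_)
    refine (Cochain.zero_cochain_comp_v _ _ p q hpq).trans ?_
    rw [Cochain.ofHom_v, Cochain.mk_v]
    exact Injective.comp_factorThru _ _
  · intro (z : Cochain S.X₂ E n) hz
    have h (p q : ℤ) (hpq : p + n = q) : S.f.f p ≫ z.v p q hpq = 0 := by
      have h2 : ((Cochain.ofHom S.f).comp z (zero_add n)).v p q hpq = 0 := by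
        have h3 : (Cochain.ofHom S.f).comp z (zero_add n) = 0 := hz
        rw [h3]; rfl
      rwa [Cochain.zero_cochain_comp_v, Cochain.ofHom_v] at h2
    have (p : ℤ) : Epi (S.map (HomologicalComplex.eval _ _ p)).g := he p
    refine ⟨(Cochain.mk (fun p q hpq => (hS p).exact.desc (z.v p q hpq) (h p q hpq)) :
      Cochain S.X₃ E n), ?_⟩
    refine Cochain.ext _ _ (fun p q hpq => ?_)
    refine (Cochain.zero_cochain_comp_v _ _ p q hpq).trans ?_
    rw [Cochain.ofHom_v]
    exact (hS p).exact.g_desc _ _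

/-- Evaluation at `x ∈ C^n`. -/
noncomputable def evalCochain {n : ℤ} (x : C.X n) : Cochain (dual E C) E n :=
  Cochain.mk (fun p q hpq => ModuleCat.ofHom
    -- The Koszul sign for exchanging `x` of degree `n` with `φ` of degree `p`; it makes biduality
    -- commute with the differentials.
    { toFun (φ : Cochain C E p) := (n * p).negOnePow • (φ.v n q (by lia)).hom x
      map_add' φ ψ := by rw [Cochain.add_v, ModuleCat.hom_add, LinearMap.add_apply, smul_add]
      map_smul' r φ := by
        rw [Cochain.smul_v, ModuleCat.hom_smul, LinearMap.smul_apply]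
        exact smul_comm ((n * p).negOnePow : ℤ) r _ })

/-- The value of a cochain on the dual. -/
noncomputable def dualEval {n : ℤ} (z : Cochain (dual E C) E n) {p q : ℤ} (hpq : p + n = q)
    (φ : Cochain C E p) : E.X q := (z.v p q hpq).hom φ

variable {E} in
lemma dualEval_add {n : ℤ} (z z' : Cochain (dual E C) E n) {p q : ℤ} (hpq : p + n = q)
    (φ : Cochain C E p) : dualEval E (z + z') hpq φ = dualEval E z hpq φ + dualEval E z' hpq φ :=
  rfl

variable {E} in
lemma dualEval_smul {n : ℤ} (r : R) (z : Cochain (dual E C) E n) {p q : ℤ} (hpq : p + n = q)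
    (φ : Cochain C E p) : dualEval E (r • z) hpq φ = r • dualEval E z hpq φ := rfl

lemma dualEval_evalCochain {n : ℤ} (x : C.X n) {p q : ℤ} (hpq : p + n = q) (φ : Cochain C E p) :
    dualEval E (evalCochain E x) hpq φ = (n * p).negOnePow • (φ.v n q (by lia)).hom x := rfl

lemma evalCochain_ext {n : ℤ} {z z' : Cochain (dual E C) E n}
    (h : ∀ (p q : ℤ) (hpq : p + n = q) (φ : Cochain C E p),
      dualEval E z hpq φ = dualEval E z' hpq φ) : z = z' :=
  Cochain.ext _ _ (fun p q hpq => ModuleCat.hom_ext (LinearMap.ext fun φ => h p q hpq φ))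

lemma δ_v_apply {K L : CochainComplex (ModuleCat.{u} R) ℤ} {n m : ℤ} (hnm : n + 1 = m)
    (z : Cochain K L n) (p q : ℤ) (hpq : p + m = q) (q₁ p₂ : ℤ) (hq₁ : q₁ = q - 1)
    (hp₂ : p + 1 = p₂) (x : K.X p) :
    ((δ n m z).v p q hpq).hom x = (L.d q₁ q).hom ((z.v p q₁ (by lia)).hom x) +
      m.negOnePow • (z.v p₂ q (by lia)).hom ((K.d p p₂).hom x) := by
  rw [δ_v n m hnm z p q hpq q₁ p₂ hq₁ hp₂]
  rfl

lemma dualEval_δ {n m : ℤ} (hnm : n + 1 = m) (z : Cochain (dual E C) E n) {p q : ℤ}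
    (hpq : p + m = q) (q₁ p₂ : ℤ) (hq₁ : q₁ = q - 1) (hp₂ : p + 1 = p₂) (φ : Cochain C E p) :
    dualEval E (δ n m z) hpq φ = (E.d q₁ q).hom (dualEval E z (by lia) φ) +
      m.negOnePow • dualEval E z (show p₂ + n = q by lia) (δ p p₂ φ) :=
  δ_v_apply hnm z p q hpq q₁ p₂ hq₁ hp₂ φ

lemma map_units_smul {M N : ModuleCat.{u} R} (f : M ⟶ N) (ε : ℤˣ) (x : M) :
    f.hom (ε • x) = ε • f.hom x := map_zsmul f.hom (ε : ℤ) x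

lemma δ_evalCochain {n m : ℤ} (hnm : n + 1 = m) (x : C.X n) :
    δ n m (evalCochain E x) = evalCochain E ((C.d n m).hom x) := by
  refine evalCochain_ext E (fun p q hpq φ => ?_)
  rw [dualEval_δ E hnm _ hpq (q - 1) (p + 1) rfl rfl, dualEval_evalCochain,
    dualEval_evalCochain, dualEval_evalCochain,
    δ_v_apply rfl φ n q (by lia) (q - 1) m (by lia) hnm]
  subst hnm
  rw [map_units_smul]
  simp only [smul_add, smul_smul]
  -- `s1` cancels the two terms with `d(φ x)`; `s2` gives the remaining term `φ(dx)` the Koszul sign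
  -- of degree `n + 1`.
  have s1 : (n + 1).negOnePow * (n * (p + 1)).negOnePow = -(n * p).negOnePow := by
    rw [← Int.negOnePow_add, ← Int.negOnePow_succ, Int.negOnePow_eq_iff]
    exact ⟨n, by ring⟩
  have s2 : (n + 1).negOnePow * ((n * (p + 1)).negOnePow * (p + 1).negOnePow) =
      ((n + 1) * p).negOnePow := by
    rw [← Int.negOnePow_add, ← Int.negOnePow_add, Int.negOnePow_eq_iff]
    exact ⟨n + 1, by ring⟩
  rw [s1, s2, Units.neg_smul]
  abel

/-- The biduality morphism. -/
noncomputable def biduality (C : CochainComplex (ModuleCat.{u} R) ℤ) :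
    C ⟶ dual E (dual E C) where
  f n := ModuleCat.ofHom
    { toFun x := evalCochain E x
      map_add' x y := evalCochain_ext E (fun p q hpq φ => by
        rw [dualEval_add, dualEval_evalCochain, dualEval_evalCochain, dualEval_evalCochain,
          map_add, smul_add])
      map_smul' r x := evalCochain_ext E (fun p q hpq φ => by
        rw [RingHom.id_apply, dualEval_smul, dualEval_evalCochain, dualEval_evalCochain, map_smul]
        exact smul_comm ((n * p).negOnePow : ℤ) r _) }
  comm' n m hnm := ModuleCat.hom_ext (LinearMap.ext fun x => δ_evalCochain E hnm x)

lemma biduality_naturality (φ : C ⟶ C') :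
    biduality E C ≫ dualMap E (dualMap E φ) = φ ≫ biduality E C' := by
  refine HomologicalComplex.hom_ext _ _ (fun n => ModuleCat.hom_ext (LinearMap.ext fun x => ?_))
  refine evalCochain_ext E (fun p q hpq (z : Cochain C' E p) => ?_)
  have h : ((Cochain.ofHom (dualMap E φ)).comp (evalCochain E x) (zero_add n)).v p q hpq =
      (dualMap E φ).f p ≫ (evalCochain E x).v p q hpq := by
    rw [Cochain.zero_cochain_comp_v, Cochain.ofHom_v]
  refine (congrArg (fun t => t.hom z) h).trans ?_
  have h2 : ((Cochain.ofHom φ).comp z (zero_add p)).v n q (by lia) =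
      φ.f n ≫ z.v n q (by lia) := by
    rw [Cochain.zero_cochain_comp_v, Cochain.ofHom_v]
  exact congrArg (fun t => (n * p).negOnePow • t.hom x) h2

end ComplexLemmas

/-! ### The homothety isomorphism at the level of cochains -/

namespace ComplexLemmas

open CochainComplex CochainComplex.HomComplex

variable {R : Type u} [CommRing R]

section

variable {K L : CochainComplex (ModuleCat.{u} R) ℤ} [L.IsKInjective]

lemma homotopy_of_Q_map_eq {φ ψ : K ⟶ L}
    (h : DerivedCategory.Q.map φ = DerivedCategory.Q.map ψ) : Nonempty (Homotopy φ ψ) := by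
  have h2 : DerivedCategory.Qh.map ((HomotopyCategory.quotient _ _).map φ) =
      DerivedCategory.Qh.map ((HomotopyCategory.quotient _ _).map ψ) := by
    have e (φ : K ⟶ L) := (DerivedCategory.quotientCompQhIso (ModuleCat.{u} R)).hom.naturality φ
    rw [← cancel_mono ((DerivedCategory.quotientCompQhIso (ModuleCat.{u} R)).hom.app L)]
    exact (e φ).trans ((congrArg _ h).trans (e ψ).symm)
  exact ⟨HomotopyCategory.homotopyOfEq _ _ ((IsKInjective.Qh_map_bijective _ L).injective h2)⟩

/-- For K-injective `L`, a morphism `K → L⟦n⟧` that vanishes in the derived category is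
null-homotopic, and the homotopy unshifts to a primitive of the cocycle. -/
lemma eq_δ_of_shift_hom_eq_zero {n : ℤ}
    (h : ∀ f : DerivedCategory.Q.obj K ⟶ (DerivedCategory.Q.obj L)⟦n⟧, f = 0)
    (m k : ℤ) (hm : m + 1 = n) (hk : n + 1 = k) (z : Cochain K L n) (hz : δ n k z = 0) :
    ∃ w : Cochain K L m, δ m n w = z := by
  obtain ⟨φ, hφ⟩ := (Cocycle.equivHom ..).surjective
    ((Cocycle.mk z k hk hz).rightShift n 0 (zero_add n))
  rw [Cocycle.ext_iff] at hφ
  have h0 : DerivedCategory.Q.map φ = DerivedCategory.Q.map (0 : K ⟶ L⟦n⟧) := by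
    rw [← cancel_mono ((DerivedCategory.Q.commShiftIso n).hom.app L)]
    exact (h _).trans (h _).symm
  obtain ⟨h⟩ := homotopy_of_Q_map_eq h0
  obtain ⟨f, hf⟩ := Cochain.equivHomotopy _ _ h
  simp only [Int.reduceNeg, Cochain.ofHom_zero, add_zero] at hf
  refine ⟨n.negOnePow • Cochain.rightUnshift f m (by lia), ?_⟩
  apply (Cochain.rightShiftAddEquiv _ _ _ n 0 (by simp)).injective
  simp only [Cochain.rightShiftAddEquiv_apply]
  have hφ' : z.rightShift n 0 (zero_add n) = Cochain.ofHom φ := hφ.symm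
  rw [hφ', hf, δ_units_smul, Cochain.rightShift_units_smul,
    Cochain.δ_rightUnshift _ _ _ _ 0 (by simp)]
  simp [smul_smul]

end

/-- The homothety `R → RHom_R(E, E)` is an isomorphism, at the level of cochains. -/
structure HomothetyIso (E : CochainComplex (ModuleCat.{u} R) ℤ) : Prop where
  eq_δ (m n k : ℤ) (hm : m + 1 = n) (hk : n + 1 = k) (hn : n ≠ 0) (z : Cochain E E n)
    (hz : δ n k z = 0) : ∃ w : Cochain E E m, δ m n w = z
  exists_eq (z : Cochain E E 0) (hz : δ 0 1 z = 0) :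
    ∃ (r : R) (w : Cochain E E (-1)), z = r • Cochain.ofHom (𝟙 E) + δ (-1) 0 w
  eq_zero (r : R) (w : Cochain E E (-1)) (h : δ (-1) 0 w = r • Cochain.ofHom (𝟙 E)) : r = 0

lemma ofHom_smul {K L : CochainComplex (ModuleCat.{u} R) ℤ} (r : R) (φ : K ⟶ L) :
    Cochain.ofHom (r • φ) = r • Cochain.ofHom φ := by
  refine Cochain.ext₀ _ _ (fun p => ?_)
  rw [Cochain.smul_v, Cochain.ofHom_v, Cochain.ofHom_v, HomologicalComplex.smul_f_apply]

/-- Since `E` is K-injective, morphisms from `E` to its shifts in the derived category are cocycles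
modulo coboundaries. The three clauses are vanishing of the higher and lower self-extensions,
surjectivity and injectivity of the homothety. -/
lemma _root_.GrMod.IsDualizing.homothetyIso {ω : DerivedCategory (ModuleCat.{u} R)}
    (hω : GrMod.IsDualizing ω) {E : CochainComplex (ModuleCat.{u} R) ℤ} [E.IsKInjective]
    (e : DerivedCategory.Q.obj E ≅ ω) : HomothetyIso E where
  eq_δ m n k hm hk hn z hz := by
    refine eq_δ_of_shift_hom_eq_zero (fun f => ?_) m k hm hk z hz
    have h := hω.eq_zero n hn (e.inv ≫ f ≫ e.hom⟦n⟧')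
    rw [← cancel_epi e.inv, ← cancel_mono (e.hom⟦n⟧')]
    rw [Category.assoc, h, comp_zero, zero_comp]
  exists_eq z hz := by
    obtain ⟨φ, hφ⟩ := (Cocycle.equivHom E E).surjective (Cocycle.mk z 1 rfl hz)
    have hz' : z = Cochain.ofHom φ := (congrArg Subtype.val hφ).symm
    obtain ⟨r, hr⟩ := hω.bijective.surjective (e.inv ≫ DerivedCategory.Q.map φ ≫ e.hom)
    have h : DerivedCategory.Q.map φ = DerivedCategory.Q.map (r • 𝟙 E) := by
      rw [Functor.map_smul, CategoryTheory.Functor.map_id, ← cancel_epi e.inv,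
        ← cancel_mono e.hom, Category.assoc, ← hr]
      simp
    obtain ⟨h⟩ := homotopy_of_Q_map_eq h
    obtain ⟨f, hf⟩ := Cochain.equivHomotopy _ _ h
    refine ⟨r, f, ?_⟩
    rw [hz', hf, add_comm, ofHom_smul]
  eq_zero r w h := by
    have h1 : Homotopy (r • 𝟙 E) 0 := (Cochain.equivHomotopy _ _).symm ⟨w, by
      rw [h, ofHom_smul]; simp⟩
    have h2 := DerivedCategory.Q_map_eq_of_homotopy _ h1
    refine hω.bijective.injective ?_
    rw [Functor.map_smul, CategoryTheory.Functor.map_id, Functor.map_zero] at h2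
    have h3 : r • 𝟙 ω = e.inv ≫ (r • 𝟙 (DerivedCategory.Q.obj E)) ≫ e.hom := by simp
    show r • 𝟙 ω = (0 : R) • 𝟙 ω
    rw [h3, h2]
    simp

end ComplexLemmas

/-! ### Biduality for a shift of `R` -/

namespace ComplexLemmas

open CochainComplex CochainComplex.HomComplex

variable {R : Type u} [CommRing R]

section

variable (E : CochainComplex (ModuleCat.{u} R) ℤ) {U : CochainComplex (ModuleCat.{u} R) ℤ} {m : ℤ}
  (hU : ∀ p, p ≠ m → IsZero (U.X p)) (c : U.X m ≃ₗ[R] R)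

include hU

/-- With `U` free of rank one in the single degree `m`, a cochain to `E` is determined by its value
at the generator, which is arbitrary. Up to sign this identifies the dual of `U` with a shift of
`E`. -/
lemma evalCochain_bijective {p q : ℤ} (hpq : p + m = q) :
    Function.Bijective (fun φ : Cochain U E p => dualEval E (evalCochain E (c.symm 1)) hpq φ) := by
  constructor
  · intro φ ψ h
    have h1 : (φ.v m q (by lia)).hom (c.symm 1) = (ψ.v m q (by lia)).hom (c.symm 1) := by
      have h2 : (m * p).negOnePow • (φ.v m q (by lia)).hom (c.symm 1) =
        (m * p).negOnePow • (ψ.v m q (by lia)).hom (c.symm 1) := h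
      exact (MulAction.injective (m * p).negOnePow) h2
    refine Cochain.ext _ _ (fun p' q' hpq' => ?_)
    by_cases hp : p' = m
    · subst hp
      obtain rfl : q' = q := by lia
      refine ModuleCat.hom_ext (LinearMap.ext fun x => ?_)
      have hx : x = c x • c.symm 1 := by
        rw [← map_smul, smul_eq_mul, mul_one, LinearEquiv.symm_apply_apply]
      rw [hx, map_smul, map_smul, h1]
    · exact (hU p' hp).eq_of_src _ _
  · intro y
    let f : U.X m ⟶ E.X q := ModuleCat.ofHom ((LinearMap.toSpanSingleton R _ y).comp c.toLinearMap)
    let φ : Cochain U E p := (m * p).negOnePow • Cochain.single f p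
    refine ⟨φ, ?_⟩
    show (m * p).negOnePow • (((m * p).negOnePow • (Cochain.single f p)).v m q
      (by lia)).hom (c.symm 1) = y
    rw [Cochain.units_smul_v, Cochain.single_v]
    show (m * p).negOnePow • (m * p).negOnePow • (c (c.symm 1) • y) = y
    rw [smul_smul, Int.units_mul_self, one_smul, LinearEquiv.apply_symm_apply, one_smul]

lemma isIso_evalCochain_v {p q : ℤ} (hpq : p + m = q) :
    IsIso ((evalCochain E (c.symm 1)).v p q hpq) :=
  (ConcreteCategory.isIso_iff_bijective _).2 (evalCochain_bijective E hU c hpq)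

lemma exists_evalCochain_comp {n k : ℤ} (ζ : Cochain (dual E U) E n) (hk : m + k = n) :
    ∃ ψ : Cochain E E k, (evalCochain E (c.symm 1)).comp ψ hk = ζ := by
  have h (p q : ℤ) (hpq : p + m = q) := isIso_evalCochain_v E hU c hpq
  refine ⟨Cochain.mk (fun q q' hq => inv ((evalCochain E (c.symm 1)).v (q - m) q (by lia)) ≫
    ζ.v (q - m) q' (by lia)), Cochain.ext _ _ (fun p q hpq => ?_)⟩
  rw [Cochain.comp_v _ _ hk p (p + m) q rfl (by lia), Cochain.mk_v]
  obtain ⟨p', hp'⟩ : ∃ p', p' = p + m - m := ⟨_, rfl⟩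
  have key (p' : ℤ) (hp' : p' = p) (h1 : p' + m = p + m) (h2 : p' + n = q) :
      (evalCochain E (c.symm 1)).v p (p + m) rfl ≫
        inv ((evalCochain E (c.symm 1)).v p' (p + m) h1) ≫ ζ.v p' q h2 = ζ.v p q hpq := by
    subst hp'
    rw [IsIso.hom_inv_id_assoc]
  exact key (p + m - m) (by lia) _ _

lemma evalCochain_comp_injective {n k : ℤ} (hk : m + k = n) {ψ ψ' : Cochain E E k}
    (h : (evalCochain E (c.symm 1)).comp ψ hk = (evalCochain E (c.symm 1)).comp ψ' hk) :
    ψ = ψ' := by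
  refine Cochain.ext _ _ (fun q q' hq => ?_)
  have := isIso_evalCochain_v E hU c (show (q - m) + m = q by lia)
  have h1 := Cochain.congr_v h (q - m) q' (by lia)
  rw [Cochain.comp_v _ _ hk (q - m) q q' (by lia) hq,
    Cochain.comp_v _ _ hk (q - m) q q' (by lia) hq] at h1
  exact (cancel_epi _).1 h1

lemma d_eq_zero_of_isZero (n k : ℤ) (h : n ≠ k) (x : U.X n) : (U.d n k).hom x = 0 := by
  have h1 : U.d n k = 0 := by
    by_cases hn : n = m
    · exact (hU k (by lia)).eq_of_tgt _ _
    · exact (hU n hn).eq_of_src _ _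
  rw [h1]; rfl

/-- Evaluation at the generator is a cocycle, as `U` has no differential. So composition with it
identifies the double dual of `U` with the endomorphism complex of `E`, up to a shift of degrees. -/
lemma δ_evalCochain_comp {k k' n n' : ℤ} (hk : m + k = n) (hk' : m + k' = n') (h : k + 1 = k')
    (ψ : Cochain E E k) :
    δ n n' ((evalCochain E (c.symm 1)).comp ψ hk) = (evalCochain E (c.symm 1)).comp (δ k k' ψ) hk' := by
  rw [δ_comp _ _ hk (m + 1) k' n' (by lia) rfl h, δ_evalCochain E rfl,
    d_eq_zero_of_isZero hU m (m + 1) (by lia)]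
  have h0 : evalCochain E (0 : U.X (m + 1)) = 0 :=
    evalCochain_ext E (fun p q hpq φ => by
      rw [dualEval_evalCochain, map_zero, smul_zero]; rfl)
  rw [h0]
  simp

-- Under this identification biduality sends `r` times the generator to the homothety of `r`, so the
-- claim is that `R → RHom(E, E)` is an isomorphism.
include c in
lemma quasiIso_biduality_of_free (hE : HomothetyIso E) : QuasiIso (biduality E U) := by
  have hs (r : R) : evalCochain E (r • c.symm 1) =
      (evalCochain E (c.symm 1)).comp (r • Cochain.ofHom (𝟙 E)) (add_zero m) := by
    rw [Cochain.comp_smul, Cochain.comp_id]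
    exact map_smul ((biduality E U).f m).hom r (c.symm 1)
  have hx (x : U.X m) : x = c x • c.symm 1 := by
    rw [← map_smul, smul_eq_mul, mul_one, LinearEquiv.symm_apply_apply]
  refine quasiIso_of_forall _ (fun k n l hk hl x (y : Cochain (dual E U) E k) _ hy => ?_)
    (fun k n l hk hl (y : Cochain (dual E U) E n) hy => ?_)
  · by_cases hn : n = m
    · subst hn
      obtain ⟨w, hw⟩ := exists_evalCochain_comp E hU c y (show n + (-1) = k by lia)
      have hy' : δ k n y = evalCochain E x := hy
      rw [← hw, δ_evalCochain_comp E hU c _ (add_zero n) (by simp), hx x, hs] at hy'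
      have h0 := hE.eq_zero _ _ (evalCochain_comp_injective E hU c _ hy')
      exact ⟨0, by rw [map_zero, hx x, h0, zero_smul]⟩
    · exact ⟨0, (ModuleCat.subsingleton_of_isZero (hU n hn)).elim _ _⟩
  · obtain ⟨ψ, rfl⟩ := exists_evalCochain_comp E hU c y (show m + (n - m) = n by lia)
    have hy' : δ n l ((evalCochain E (c.symm 1)).comp ψ (by lia)) = 0 := hy
    rw [δ_evalCochain_comp E hU c (k' := l - m) _ (by lia) (by lia)] at hy'
    have h1 : δ (n - m) (l - m) ψ = 0 := evalCochain_comp_injective E hU c (n := l) (by lia) (by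
      rw [hy', Cochain.comp_zero])
    by_cases hn : n = m
    · subst hn
      have key (i j : ℤ) (hi : i = 0) (hj : j = 1) (hin : n + i = n) (ψ : Cochain E E i)
          (h : δ i j ψ = 0) : ∃ (r : R) (w : Cochain E E (-1)),
          (evalCochain E (c.symm 1)).comp ψ hin = evalCochain E (r • c.symm 1) +
            δ k n ((evalCochain E (c.symm 1)).comp w (show n + (-1) = k by lia)) := by
        subst hi hj
        obtain ⟨r, w, rfl⟩ := hE.exists_eq ψ h
        refine ⟨r, w, ?_⟩
        rw [hs, δ_evalCochain_comp E hU c _ (add_zero n) (by simp), Cochain.comp_add]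
      obtain ⟨r, w, h2⟩ := key (n - n) (l - n) (by lia) (by lia) (by lia) ψ h1
      exact ⟨r • c.symm 1, _, d_eq_zero_of_isZero hU n l (by lia) _, h2⟩
    · obtain ⟨w, hw⟩ := hE.eq_δ (k - m) (n - m) (l - m) (by lia) (by lia) (by lia) ψ h1
      refine ⟨0, (evalCochain E (c.symm 1)).comp w (by lia), map_zero _, ?_⟩
      rw [map_zero, zero_add, ← hw]
      exact (δ_evalCochain_comp E hU c (show m + (k - m) = k by lia)
        (show m + (n - m) = n by lia) (by lia) w).symm

end

end ComplexLemmas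

/-! ### Amplitude of the dual, and dévissage -/

namespace ComplexLemmas

open CochainComplex CochainComplex.HomComplex

variable {R : Type u} [CommRing R]

section windows

variable (E : CochainComplex (ModuleCat.{u} R) ℤ) [E.IsKInjective]
  (C : CochainComplex (ModuleCat.{u} R) ℤ)

lemma isZero_dual_X {C : CochainComplex (ModuleCat.{u} R) ℤ} {n : ℤ}
    (h : ∀ p q, p + n = q → IsZero (C.X p) ∨ IsZero (E.X q)) : IsZero ((dual E C).X n) := by
  have : Subsingleton (Cochain C E n) := ⟨fun z z' => Cochain.ext _ _ (fun p q hpq => by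
    rcases h p q hpq with h | h
    · exact h.eq_of_src _ _
    · exact h.eq_of_tgt _ _)⟩
  exact ModuleCat.isZero_of_subsingleton (ModuleCat.of R (Cochain C E n))

/-- The dual preserves quasi-isomorphisms, so `C` may be replaced by a truncation that vanishes
above `m`; cochains of degree `< a - m` then have zero source or zero target. -/
lemma isGE_dual (a m : ℤ) [E.IsStrictlyGE a] [C.IsLE m] : (dual E C).IsGE (a - m) := by
  rw [isGE_iff]
  intro n hn
  have := quasiIso_dualMap E (C.ιTruncLE m)
  rw [exactAt_iff_of_quasiIsoAt (dualMap E (C.ιTruncLE m)) n]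
  refine ShortComplex.exact_of_isZero_X₂ _ (isZero_dual_X E (fun p q hpq => ?_))
  by_cases hp : m < p
  · exact Or.inl ((C.truncLE m).isZero_of_isStrictlyLE m p hp)
  · exact Or.inr (E.isZero_of_isStrictlyGE a q (by lia))

lemma isLE_dual (b m : ℤ) [E.IsStrictlyLE b] [C.IsGE m] : (dual E C).IsLE (b - m) := by
  rw [isLE_iff]
  intro n hn
  have := quasiIso_dualMap E (C.πTruncGE m)
  rw [← exactAt_iff_of_quasiIsoAt (dualMap E (C.πTruncGE m)) n]
  refine ShortComplex.exact_of_isZero_X₂ _ (isZero_dual_X E (fun p q hpq => ?_))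
  by_cases hp : p < m
  · exact Or.inl ((C.truncGE m).isZero_of_isStrictlyGE m p hp)
  · exact Or.inr (E.isZero_of_isStrictlyLE b q (by lia))

end windows

section devissage

open HomologicalComplex

variable [IsNoetherianRing R]

lemma finite_of_exact {S : ShortComplex (ModuleCat.{u} R)} (hS : S.Exact)
    (h₁ : Module.Finite R S.X₁) (h₃ : Module.Finite R S.X₃) : Module.Finite R S.X₂ := by
  have h := isNoetherian_of_range_eq_ker S.f.hom S.g.hom hS.moduleCat_range_eq_ker
  exact Module.IsNoetherian.finite R S.X₂

/-- All cohomology modules are finitely generated. -/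
def FiniteCohomology (C : CochainComplex (ModuleCat.{u} R) ℤ) : Prop :=
  ∀ n, Module.Finite R (C.homology n)

lemma FiniteCohomology.of_quasiIso {C C' : CochainComplex (ModuleCat.{u} R) ℤ} (φ : C ⟶ C')
    [QuasiIso φ] : FiniteCohomology C ↔ FiniteCohomology C' := by
  refine forall_congr' (fun n => ?_)
  have e := (asIso (homologyMap φ n)).toLinearEquiv
  exact ⟨fun _ => Module.Finite.equiv e, fun _ => Module.Finite.equiv e.symm⟩

lemma finite_of_isZero {M : ModuleCat.{u} R} (h : IsZero M) : Module.Finite R M := by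
  have := ModuleCat.subsingleton_of_isZero h
  infer_instance

lemma FiniteCohomology.of_shortExact₃ {S : ShortComplex (CochainComplex (ModuleCat.{u} R) ℤ)}
    (hS : S.ShortExact) (h₁ : FiniteCohomology S.X₁) (h₂ : FiniteCohomology S.X₂) :
    FiniteCohomology S.X₃ :=
  fun n => finite_of_exact (hS.homology_exact₃ n (n + 1) (by simp)) (h₂ n) (h₁ (n + 1))

lemma isZero_homology_single {A : ModuleCat.{u} R} {m n : ℤ} (h : n ≠ m) :
    IsZero (((single _ (ComplexShape.up ℤ) m).obj A).homology n) :=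
  HomologicalComplex.ExactAt.isZero_homology
    (ShortComplex.exact_of_isZero_X₂ (((single _ (ComplexShape.up ℤ) m).obj A).sc n) (isZero_single_obj_X (ComplexShape.up ℤ) m A n h))

lemma finiteCohomology_single (A : ModuleCat.{u} R) [Module.Finite R A] (m : ℤ) :
    FiniteCohomology ((single _ (ComplexShape.up ℤ) m).obj A) := by
  intro n
  by_cases h : n = m
  · subst h
    exact Module.Finite.equiv (singleObjHomologySelfIso _ _ A).symm.toLinearEquiv
  · exact finite_of_isZero (isZero_homology_single h)

/-- Every cohomology class is the image of a generator of `R[-m]`. -/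
lemma exists_single_map (C : CochainComplex (ModuleCat.{u} R) ℤ) (m : ℤ) (x : C.homology m) :
    ∃ (φ : (single _ (ComplexShape.up ℤ) m).obj (ModuleCat.of R R) ⟶ C) (y : _),
      (homologyMap φ m).hom y = x := by
  obtain ⟨z, hz⟩ := (ModuleCat.epi_iff_surjective (C.homologyπ m)).1 inferInstance x
  let a : ModuleCat.of R R ⟶ C.cycles m := ModuleCat.ofHom (LinearMap.toSpanSingleton R _ z)
  let φ : (single _ (ComplexShape.up ℤ) m).obj (ModuleCat.of R R) ⟶ C :=
    mkHomFromSingle (a ≫ C.iCycles m) (fun k _ => by rw [Category.assoc, iCycles_d, comp_zero])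
  let g : ModuleCat.of R R ⟶ ((single _ (ComplexShape.up ℤ) m).obj (ModuleCat.of R R)).cycles m :=
    liftCycles _ (singleObjXSelf (ComplexShape.up ℤ) m (ModuleCat.of R R)).inv (m + 1) (by simp)
      (by simp)
  have hg : g ≫ cyclesMap φ m = a := by
    rw [← cancel_mono (C.iCycles m), Category.assoc, cyclesMap_i, liftCycles_i_assoc,
      mkHomFromSingle_f]
    simp
  have h2 : (g ≫ homologyπ _ m) ≫ homologyMap φ m = a ≫ C.homologyπ m := by
    rw [Category.assoc, homologyπ_naturality, ← Category.assoc, hg]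
  refine ⟨φ, (g ≫ homologyπ _ m).hom (1 : R), ?_⟩
  refine (congrArg (fun t => t.hom (1 : R)) h2).trans ?_
  exact (congrArg (C.homologyπ m).hom (one_smul R z)).trans hz

/-- Dévissage for complexes of modules with finitely generated, bounded above cohomology. -/
lemma finiteCohomology_induction {P : CochainComplex (ModuleCat.{u} R) ℤ → Prop} (m₀ : ℤ)
    (hbase : ∀ (C : CochainComplex (ModuleCat.{u} R) ℤ) [C.IsLE m₀], FiniteCohomology C → P C)
    (hstep : ∀ (S : ShortComplex (CochainComplex (ModuleCat.{u} R) ℤ)) (m : ℤ), S.ShortExact →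
      S.X₁ = (single _ (ComplexShape.up ℤ) m).obj (ModuleCat.of R R) → FiniteCohomology S.X₃ →
      S.X₃.IsLE m → P S.X₃ → P S.X₂)
    (hqis : ∀ {C C' : CochainComplex (ModuleCat.{u} R) ℤ} (φ : C ⟶ C') [QuasiIso φ], P C → P C')
    (C : CochainComplex (ModuleCat.{u} R) ℤ) (m : ℤ) [C.IsLE m] (hC : FiniteCohomology C) :
    P C := by
  -- Outer induction on the distance of the top degree from `m₀`, inner induction on the number of
  -- generators of the top cohomology. Without generators the top cohomology is zero and the top
  -- degree drops.
  obtain ⟨N, hN⟩ : ∃ N : ℕ, m ≤ m₀ + N := ⟨(m - m₀).toNat, by lia⟩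
  induction N generalizing C m with
  | zero =>
    have := C.isLE_of_le m m₀ (by simpa using hN)
    exact hbase C hC
  | succ N ih =>
    have := hC m
    obtain ⟨t, s, hs⟩ := Module.Finite.exists_fin (R := R) (M := C.homology m)
    induction t generalizing C with
    | zero =>
      have hz : IsZero (C.homology m) := by
        have : Subsingleton (C.homology m) := by
          rw [← Submodule.subsingleton_iff R, ← subsingleton_iff_bot_eq_top, ← hs]
          simp
        exact ModuleCat.isZero_of_subsingleton _
      have : C.IsLE (m - 1) := by
        rw [isLE_iff]
        intro i hi
        rcases eq_or_lt_of_le (show m ≤ i by lia) with rfl | h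
        · exact (exactAt_iff_isZero_homology _ _).2 hz
        · exact C.exactAt_of_isLE m i h
      exact ih C (m - 1) hC (by push_cast at hN; lia)
    | succ t iht =>
      -- A copy of `R` in degree `m` is mapped onto the first generator; passing to the quotient
      -- kills it.
      obtain ⟨φ, y, hy⟩ := exists_single_map C m (s 0)
      obtain ⟨Y, Z, i, p, w, π, hS, _, hπ, -⟩ := exists_shortExact φ
      have hY : FiniteCohomology Y := (FiniteCohomology.of_quasiIso π).2 hC
      have hZ : FiniteCohomology Z :=
        FiniteCohomology.of_shortExact₃ hS (finiteCohomology_single _ m) hY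
      have hZm : Z.IsLE m := by
        rw [isLE_iff]
        intro j hj
        rw [exactAt_iff_isZero_homology]
        refine (hS.homology_exact₃ j (j + 1) (by simp)).isZero_X₂ ?_ ?_
        · have : IsZero (Y.homology j) :=
            (C.isZero_of_isLE m j hj).of_iso (asIso (homologyMap π j))
          exact this.eq_of_src _ _
        · exact (isZero_homology_single (by lia)).eq_of_tgt _ _
      -- `H^m(C) ≅ H^m(Y)` surjects onto `H^m(Z)`, because `R` in degree `m` has no cohomology in
      -- degree `m + 1`, and the first generator dies there. The other `t` generators suffice.
      refine hqis π (hstep _ m hS rfl hZ hZm (iht Z hZ (hZ m) ?_ ?_))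
      · let e := (asIso (homologyMap π m)).toLinearEquiv.symm
        exact fun r => (homologyMap p m).hom (e (s r.succ))
      · let e := (asIso (homologyMap π m)).toLinearEquiv.symm
        have h0 : (homologyMap p m).hom (e (s 0)) = 0 := by
          have h1 : e (s 0) = (homologyMap i m).hom y := by
            rw [LinearEquiv.symm_apply_eq, ← hy, ← hπ, homologyMap_comp]
            rfl
          rw [h1, ← ModuleCat.comp_apply, ← homologyMap_comp, w, homologyMap_zero]
          rfl
        have hsurj : Function.Surjective (homologyMap p m).hom := by
          have : Epi (homologyMap p m) :=
            (hS.homology_exact₃ m (m + 1) (by simp)).epi_f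
              ((isZero_homology_single (by lia)).eq_of_tgt _ _)
          exact (ModuleCat.epi_iff_surjective _).1 this
        have h2 := congrArg (Submodule.map ((homologyMap p m).hom ∘ₗ e.toLinearMap)) hs
        have he : Function.Surjective ((homologyMap p m).hom ∘ₗ e.toLinearMap) :=
          by rw [LinearMap.coe_comp]; exact hsurj.comp e.surjective
        rw [Submodule.map_top, LinearMap.range_eq_top.2 he,
          Submodule.map_span, ← Set.range_comp] at h2
        rw [← top_le_iff, ← h2, Submodule.span_le]
        rintro _ ⟨r, rfl⟩
        refine Fin.cases ?_ (fun r => ?_) r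
        · show (homologyMap p m).hom (e (s 0)) ∈ _
          rw [h0]
          exact Submodule.zero_mem _
        · exact Submodule.subset_span ⟨r, rfl⟩

end devissage

end ComplexLemmas

/-! ### Biduality for finitely generated cohomology -/

namespace ComplexLemmas

open CochainComplex CochainComplex.HomComplex HomologicalComplex

variable {R : Type u} [CommRing R] (E : CochainComplex (ModuleCat.{u} R) ℤ)

/-- The biduality morphism of a short complex. -/
noncomputable def bidualityShort (S : ShortComplex (CochainComplex (ModuleCat.{u} R) ℤ)) :
    S ⟶ dualShort E (dualShort E S) where
  τ₁ := biduality E S.X₁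
  τ₂ := biduality E S.X₂
  τ₃ := biduality E S.X₃
  comm₁₂ := biduality_naturality E S.f
  comm₂₃ := biduality_naturality E S.g

lemma homologyMap_biduality [E.IsKInjective] {C C' : CochainComplex (ModuleCat.{u} R) ℤ}
    (φ : C ⟶ C') [QuasiIso φ] (k : ℤ) :
    ∃ (e : C'.homology k ≅ C.homology k)
      (e' : (dual E (dual E C)).homology k ≅ (dual E (dual E C')).homology k),
      homologyMap (biduality E C') k = e.hom ≫ homologyMap (biduality E C) k ≫ e'.hom := by
  have := quasiIso_dualMap E φ
  have := quasiIso_dualMap E (dualMap E φ)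
  refine ⟨(asIso (homologyMap φ k)).symm, asIso (homologyMap (dualMap E (dualMap E φ)) k), ?_⟩
  have h := congrArg (fun t => homologyMap t k) (biduality_naturality E φ)
  rw [homologyMap_comp, homologyMap_comp] at h
  rw [asIso_hom, h]
  simp

lemma epi_mono_homologyMap_biduality [E.IsKInjective] {C C' : CochainComplex (ModuleCat.{u} R) ℤ}
    (φ : C ⟶ C') [QuasiIso φ] (k : ℤ) :
    (Epi (homologyMap (biduality E C) k) → Epi (homologyMap (biduality E C') k)) ∧
    (Mono (homologyMap (biduality E C) k) → Mono (homologyMap (biduality E C') k)) := by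
  obtain ⟨e, e', h⟩ := homologyMap_biduality E φ k
  rw [h]
  exact ⟨fun _ => inferInstance, fun _ => inferInstance⟩

variable [IsNoetherianRing R] [E.IsKInjective] (hE : ∀ n, Injective (E.X n)) (hR : HomothetyIso E)
  (a b : ℤ) [E.IsStrictlyGE a] [E.IsStrictlyLE b]

include hE hR

lemma quasiIso_biduality_single (m : ℤ) :
    QuasiIso (biduality E ((single _ (ComplexShape.up ℤ) m).obj (ModuleCat.of R R))) :=
  quasiIso_biduality_of_free E (fun p hp => isZero_single_obj_X _ _ _ _ hp)
    (singleObjXSelf (ComplexShape.up ℤ) m (ModuleCat.of R R)).toLinearEquiv hR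

include a b

/-- In the dévissage step biduality is an isomorphism on the copy of `R` in every degree, so
surjectivity on the quotient in degree `k` is enough. -/
lemma epi_homologyMap_biduality (k : ℤ) (C : CochainComplex (ModuleCat.{u} R) ℤ) (m : ℤ) [C.IsLE m]
    (hC : FiniteCohomology C) : Epi (homologyMap (biduality E C) k) := by
  -- Double dualization raises the upper bound of the cohomology by at most `b - a`, so below this
  -- threshold the target vanishes in degree `k`.
  refine finiteCohomology_induction (k - 1 - max 0 (b - a)) (fun C _ _ => ?_)
    (fun S m hS h₁ _ _ h => ?_)
    (fun φ _ => (epi_mono_homologyMap_biduality E φ k).1) C m hC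
  · have := isGE_dual E C a (k - 1 - max 0 (b - a))
    have := isLE_dual E (dual E C) b (a - (k - 1 - max 0 (b - a)))
    have hz : IsZero ((dual E (dual E C)).homology k) :=
      isZero_of_isLE _ (b - (a - (k - 1 - max 0 (b - a)))) k (by lia)
    exact ⟨fun _ _ _ => hz.eq_of_src _ _⟩
  · have hq : QuasiIso (biduality E S.X₁) := by
      rw [h₁]; exact quasiIso_biduality_single E hE hR m
    exact epi_homologyMap_middle (bidualityShort E S) hS
      (shortExact_dualShort E hE (shortExact_dualShort E hE hS)) (rfl : k + 1 = k + 1)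
      (inferInstanceAs (Epi (homologyMap (biduality E S.X₁) k))) h
      (inferInstanceAs (Mono (homologyMap (biduality E S.X₁) (k + 1))))

/-- The base case is trivial, since `H^k(C) = 0` for `C` bounded above by `k - 1`. The step uses
surjectivity on the quotient in degree `k - 1`, which is already known in all degrees. -/
lemma mono_homologyMap_biduality (k : ℤ) (C : CochainComplex (ModuleCat.{u} R) ℤ) (m : ℤ) [C.IsLE m]
    (hC : FiniteCohomology C) : Mono (homologyMap (biduality E C) k) := by
  refine finiteCohomology_induction (k - 1) (fun C _ _ => ?_)
    (fun S m hS h₁ hf hm h => ?_)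
    (fun φ _ => (epi_mono_homologyMap_biduality E φ k).2) C m hC
  · have hz : IsZero (C.homology k) := isZero_of_isLE _ (k - 1) _ (by lia)
    exact ⟨fun _ _ _ => hz.eq_of_tgt _ _⟩
  · have hq : QuasiIso (biduality E S.X₁) := by
      rw [h₁]; exact quasiIso_biduality_single E hE hR m
    exact mono_homologyMap_middle (bidualityShort E S) hS
      (shortExact_dualShort E hE (shortExact_dualShort E hE hS)) (sub_add_cancel k 1)
      (inferInstanceAs (Mono (homologyMap (biduality E S.X₁) k))) h
      (epi_homologyMap_biduality E hE hR a b (k - 1) S.X₃ m hf)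

/-- Biduality for complexes with finitely generated cohomology. -/
theorem quasiIso_biduality (C : CochainComplex (ModuleCat.{u} R) ℤ) (hC : FiniteCohomology C) :
    QuasiIso (biduality E C) := by
  have key (k : ℤ) : Epi (homologyMap (biduality E C) k) ∧
      Mono (homologyMap (biduality E C) k) := by
    -- The cofiber `Z` of the truncation lives in degrees `> m`, and double dualization lowers this
    -- bound by at most `b - a`. With this `m`, both `Z` and its double dual have no cohomology in
    -- degrees `≤ k + 1`, so in degree `k` the complex behaves like its truncation.
    let m := k + 1 + max 0 (b - a)
    have hT : FiniteCohomology (C.truncLE m) := fun n => by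
      by_cases hn : n ≤ m
      · have := quasiIsoAt_ιTruncLE C m n hn
        have := hC n
        exact Module.Finite.equiv (asIso (homologyMap (C.ιTruncLE m) n)).symm.toLinearEquiv
      · exact finite_of_isZero (isZero_of_isLE _ m n (by lia))
    obtain ⟨Y, Z, i, p, w, π, hS, _, hπ, -⟩ := exists_shortExact (C.ιTruncLE m)
    have hi (n : ℤ) (hn : n ≤ m) : IsIso (homologyMap i n) := by
      have := quasiIsoAt_ιTruncLE C m n hn
      have h1 : IsIso (homologyMap i n ≫ homologyMap π n) := by
        rw [← homologyMap_comp, hπ]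
        infer_instance
      exact IsIso.of_isIso_comp_right _ (homologyMap π n)
    have hZ : Z.IsGE (m + 1) := by
      rw [isGE_iff]
      intro n hn
      rw [exactAt_iff_isZero_homology]
      refine (hS.homology_exact₃ n (n + 1) (by simp)).isZero_X₂ ?_ ?_
      · have := hi n (by lia)
        have h2 : homologyMap i n ≫ homologyMap p n = 0 := by
          rw [← homologyMap_comp, w, homologyMap_zero]
        exact zero_of_epi_comp (homologyMap i n) h2
      · by_cases hn' : n + 1 ≤ m
        · have := hi (n + 1) hn'
          have h2 := hS.δ_comp n (n + 1) (by simp)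
          exact zero_of_comp_mono (homologyMap i (n + 1)) h2
        · exact (isZero_of_isLE (C.truncLE m) m (n + 1) (by lia)).eq_of_tgt _ _
    have hDZ : (dual E (dual E Z)).IsGE (a - (b - (m + 1))) := by
      have := isLE_dual E Z b (m + 1)
      exact isGE_dual E (dual E Z) a (b - (m + 1))
    have hS2 := shortExact_dualShort E hE (shortExact_dualShort E hE hS)
    have hz₁ (n : ℤ) (hn : n ≤ k + 1) : IsZero (Z.homology n) :=
      isZero_of_isGE _ (m + 1) _ (by lia)
    have hz₂ (n : ℤ) (hn : n ≤ k + 1) : IsZero ((dual E (dual E Z)).homology n) :=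
      isZero_of_isGE _ (a - (b - (m + 1))) _ (by lia)
    refine ⟨(epi_mono_homologyMap_biduality E π k).1 ?_,
      (epi_mono_homologyMap_biduality E π k).2 ?_⟩
    · exact epi_homologyMap_middle (bidualityShort E _) hS hS2 (rfl : k + 1 = k + 1)
        (epi_homologyMap_biduality E hE hR a b k _ m hT)
        ⟨fun _ _ _ => (hz₂ k (by lia)).eq_of_src _ _⟩
        (mono_homologyMap_biduality E hE hR a b (k + 1) _ m hT)
    · exact mono_homologyMap_middle (bidualityShort E _) hS hS2 (sub_add_cancel k 1)
        (mono_homologyMap_biduality E hE hR a b k _ m hT)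
        ⟨fun _ _ _ => (hz₁ k (by lia)).eq_of_tgt _ _⟩
        ⟨fun _ _ _ => (hz₂ (k - 1) (by lia)).eq_of_src _ _⟩
  rw [quasiIso_iff]
  intro k
  rw [quasiIsoAt_iff_isIso_homologyMap]
  have := (key k).1
  have := (key k).2
  exact isIso_of_mono_of_epi _

end ComplexLemmas

namespace GrMod

open CochainComplex CochainComplex.HomComplex ComplexLemmas

variable {R A : Type u} [CommRing R] [CommRing A] [Algebra R A]
    {𝒜 : ℤ → Submodule R A} [GradedAlgebra 𝒜]

/-! ### Biduality for graded modules -/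

/-- Transport of weights, for complexes. -/
noncomputable def castC (M : CochainComplex (GrMod 𝒜) ℤ) {j k : ℤ} (h : j = k) :
    (weightC j).obj M ⟶ (weightC k).obj M :=
  (actC (show 0 + j = k by lia) ⟨1, SetLike.GradedOne.one_mem⟩).app M

lemma isIso_castC (M : CochainComplex (GrMod 𝒜) ℤ) {j k : ℤ} (h : j = k) :
    IsIso (castC M h) := by
  subst h
  have : castC M (rfl : j = j) = 𝟙 _ := by
    refine HomologicalComplex.hom_ext _ _ (fun n => ModuleCat.hom_ext (LinearMap.ext fun x => ?_))
    exact castW_rfl (M.X n) rfl x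
  rw [this]
  infer_instance

variable (E : CochainComplex (ModuleCat.{u} R) ℤ)

/-- The weight `j` part of the biduality morphism. -/
noncomputable def bidualityW (M : CochainComplex (GrMod 𝒜) ℤ) (j : ℤ) :
    (weightC j).obj M ⟶ (weightC j).obj (homDual E (homDual E M)) :=
  castC M (neg_neg j).symm ≫ biduality E ((weightC (-(-j))).obj M)

/-- The biduality morphism for graded modules. -/
noncomputable def gradedBiduality (M : CochainComplex (GrMod 𝒜) ℤ) :
    M ⟶ homDual E (homDual E M) where
  f n :=
    { f j := (bidualityW E M j).f n
      map_act {d j k} h a x := by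
        refine evalCochain_ext E (C := (weightC (-(-k))).obj M)
          (fun p q hpq (φ : Cochain ((weightC (-(-k))).obj M) E p) => ?_)
        have h1 : ((Cochain.ofHom ((actC (show d + -(-j) = -(-k) by lia) a).app M)).comp φ
            (zero_add p)).v n q (by lia) =
            (actNat (show d + -(-j) = -(-k) by lia) a).app (M.X n) ≫ φ.v n q (by lia) := by
          rw [Cochain.zero_cochain_comp_v, Cochain.ofHom_v]
          rfl
        have h2 : (M.X n).castW (neg_neg k).symm ((M.X n).act h a x) =
            (M.X n).act (show d + -(-j) = -(-k) by lia) a ((M.X n).castW (neg_neg j).symm x) := by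
          obtain ⟨j', hj⟩ : ∃ j', j' = -(-j) := ⟨_, rfl⟩
          obtain ⟨k', hk⟩ : ∃ k', k' = -(-k) := ⟨_, rfl⟩
          have key (j' k' : ℤ) (hj : j = j') (hk : k = k') (h' : d + j' = k') :
              (M.X n).castW hk ((M.X n).act h a x) = (M.X n).act h' a ((M.X n).castW hj x) := by
            subst hj hk
            rw [castW_rfl, castW_rfl]
          exact key _ _ _ _ _
        have h3 (z : Cochain ((weightC (-j)).obj (homDual E M)) E n) :
            ((Cochain.ofHom ((actC (show d + -k = -j by lia) a).app (homDual E M))).comp z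
              (zero_add n)).v p q hpq =
            (actNat (show d + -k = -j by lia) a).app ((homDual E M).X p) ≫ z.v p q hpq := by
          rw [Cochain.zero_cochain_comp_v, Cochain.ofHom_v]
          rfl
        refine Eq.trans ?_ (congrArg (fun t => t.hom φ) (h3 (evalCochain E
          (C := (weightC (-(-j))).obj M) ((M.X n).castW (neg_neg j).symm x)))).symm
        refine Eq.trans ?_ (congrArg (fun t => (n * p).negOnePow • t.hom
          ((M.X n).castW (neg_neg j).symm x)) h1).symm
        exact congrArg (fun t => (n * p).negOnePow • (φ.v n q (by lia)).hom t) h2 }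
  comm' n m hnm := hom_ext (fun j => (bidualityW E M j).comm n m)

lemma finiteCohomology_weightC {M : CochainComplex (GrMod 𝒜) ℤ} (hM : IsLocallyCoherent M)
    (j : ℤ) : FiniteCohomology ((weightC j).obj M) := fun n => by
  have : Module.Finite R ((weight j).obj (M.homology n)) := hM n j
  exact Module.Finite.equiv (homologyWeightIso M j n).symm.toLinearEquiv

section

variable [IsNoetherianRing R] {ω : DerivedCategory (ModuleCat.{u} R)} (hω : IsDualizing ω)

lemma IsDualizing.quasiIso_biduality (C : CochainComplex (ModuleCat.{u} R) ℤ)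
    (hC : FiniteCohomology C) : QuasiIso (biduality hω.exists_injective.choose C) := by
  have := hω.isKInjective
  obtain ⟨⟨a, b, _, _⟩, h, ⟨e⟩⟩ := hω.exists_injective.choose_spec
  exact ComplexLemmas.quasiIso_biduality _ h (hω.homothetyIso e) a b C hC

/-- In weight `j` the double dual is that of the `R`-complex of weight `-(-j)`, which has finitely
generated cohomology by local coherence. -/
lemma derivedIso_dualY_dualY {V : CochainComplex (GrMod 𝒜) ℤ} (hV : IsLocallyCoherent V) :
    DerivedIso V (dualY hω (dualY hω V)) := by
  let φ : V ⟶ dualY hω (dualY hω V) := gradedBiduality hω.exists_injective.choose V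
  have : QuasiIso φ := by
    rw [quasiIso_iff_weight]
    intro j
    have h1 := hω.quasiIso_biduality _ (finiteCohomology_weightC hV (-(-j)))
    have h2 := isIso_castC V (neg_neg j).symm
    exact quasiIso_comp (castC V (neg_neg j).symm) (biduality _ ((weightC (-(-j))).obj V))
  exact DerivedIso.of_quasiIso φ

end

lemma acyclic_dual [E.IsKInjective] {C : CochainComplex (ModuleCat.{u} R) ℤ} (hC : C.Acyclic) :
    (dual E C).Acyclic :=
  acyclic_iff_forall.2 (fun m n k hm hk z hz => eq_δ_of_isKInjective hC m n k hm hk z hz)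

/-- If the dual is acyclic then so is the double dual, and biduality carries this back to `V`.
Weight `0` is its own negative, so no other weight enters. -/
lemma acyclic_weight_dualY_iff [IsNoetherianRing R] {ω : DerivedCategory (ModuleCat.{u} R)}
    (hω : IsDualizing ω) {V : CochainComplex (GrMod 𝒜) ℤ} (hV : IsLocallyCoherent V) :
    ((weightC 0).obj (dualY hω V)).Acyclic ↔ ((weightC 0).obj V).Acyclic := by
  have := hω.isKInjective
  constructor
  · intro h
    have h1 := hω.quasiIso_biduality _ (finiteCohomology_weightC hV 0)
    have h2 : (dual hω.exists_injective.choose (dual hω.exists_injective.choose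
      ((weightC 0).obj V))).Acyclic := acyclic_dual _ h
    exact fun n => (exactAt_iff_of_quasiIsoAt (biduality _ ((weightC 0).obj V)) n).2 (h2 n)
  · exact fun h => acyclic_dual hω.exists_injective.choose (C := (weightC 0).obj V) h

lemma acyclic_weight_shift_iff (V : CochainComplex (GrMod 𝒜) ℤ) (a j : ℤ) :
    ((weightC j).obj (V⟦a⟧)).Acyclic ↔ ((weightC j).obj V).Acyclic := by
  have hd (n m : ℤ) (x : (V.X (n + a)).X j) : (((weightC j).obj (V⟦a⟧)).d n m).hom x =
      a.negOnePow • (((weightC j).obj V).d (n + a) (m + a)).hom x := rfl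
  rw [acyclic_iff_forall, acyclic_iff_forall]
  constructor
  · intro h m n k hm hk x hx
    obtain ⟨m', rfl⟩ : ∃ m', m = m' + a := ⟨m - a, by lia⟩
    obtain ⟨n', rfl⟩ : ∃ m', n = m' + a := ⟨n - a, by lia⟩
    obtain ⟨k', rfl⟩ : ∃ m', k = m' + a := ⟨k - a, by lia⟩
    obtain ⟨y, hy⟩ := h m' n' k' (by lia) (by lia) x ((hd n' k' x).trans (by
      have h0 : a.negOnePow • (0 : (V.X (k' + a)).X j) = 0 := smul_zero _
      exact (congrArg (fun t : (V.X (k' + a)).X j => a.negOnePow • t) hx).trans h0))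
    refine ⟨a.negOnePow • y, ?_⟩
    exact (map_units_smul _ _ _).trans ((hd m' n' y).symm.trans hy)
  · intro h m n k hm hk x hx
    have hx' := (hd n k x).symm.trans hx
    obtain ⟨y, hy⟩ := h (m + a) (n + a) (k + a) (by lia) (by lia) x
      ((smul_eq_zero_iff_eq (a.negOnePow)).1 hx')
    refine ⟨a.negOnePow • y, ?_⟩
    refine (map_units_smul _ _ _).trans ?_
    refine (congrArg (a.negOnePow • ·) (hd m n y)).trans ?_
    refine (congrArg (fun t => a.negOnePow • a.negOnePow • t) hy).trans ?_
    have h1 (x : (V.X (n + a)).X j) : a.negOnePow • a.negOnePow • x = x := by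
      rw [smul_smul, Int.units_mul_self, one_smul]
    exact h1 x

lemma isZero_Q_obj_iff {C : Type*} [Category* C] [Abelian C] [HasDerivedCategory C]
    (K : CochainComplex C ℤ) :
    IsZero (DerivedCategory.Q.obj K) ↔ K.Acyclic := by
  constructor
  · intro h n
    rw [HomologicalComplex.exactAt_iff_isZero_homology]
    exact IsZero.of_iso ((DerivedCategory.homologyFunctor _ n).map_isZero h)
      ((DerivedCategory.homologyFunctorFactors _ n).symm.app K)
  · intro h
    have : QuasiIso (0 : K ⟶ K) := by
      rw [quasiIso_iff]
      intro n
      rw [quasiIsoAt_iff_exactAt' _ _ (h n)]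
      exact h n
    rw [IsZero.iff_id_eq_zero]
    refine (IsIso.hom_inv_id (DerivedCategory.Q.map (0 : K ⟶ K))).symm.trans ?_
    exact (congrArg (· ≫ _) (Functor.map_zero _ _ _)).trans zero_comp

end GrMod

namespace ComplexLemmas

open CochainComplex CochainComplex.HomComplex

variable {R : Type u} [CommRing R]

/-! ### Finiteness of the cohomology of Hom complexes -/

/-- The homology is the image of the cycles in the quotient by the boundaries. In this form
finiteness can be tested on a filtration of the cycles inside one fixed module. -/
lemma finite_shortComplex_homology_iff (S : ShortComplex (ModuleCat.{u} R)) :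
    Module.Finite R S.homology ↔
      ((LinearMap.ker S.g.hom).map (LinearMap.range S.f.hom).mkQ).FG := by
  let q : LinearMap.ker S.g.hom →ₗ[R] (S.X₂ ⧸ LinearMap.range S.f.hom) :=
    (LinearMap.range S.f.hom).mkQ.comp (LinearMap.ker S.g.hom).subtype
  have hq : LinearMap.range q =
      (LinearMap.ker S.g.hom).map (LinearMap.range S.f.hom).mkQ := by
    rw [LinearMap.range_comp, Submodule.range_subtype]
  have hker : LinearMap.ker q = LinearMap.range S.moduleCatToCycles := by
    ext ⟨x, hx⟩
    rw [LinearMap.mem_ker]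
    refine (Submodule.Quotient.mk_eq_zero _).trans ?_
    constructor
    · rintro ⟨y, hy⟩
      exact ⟨y, Subtype.ext hy⟩
    · rintro ⟨y, hy⟩
      exact ⟨y, congrArg Subtype.val hy⟩
  have e1 : S.homology ≃ₗ[R] (LinearMap.ker S.g.hom ⧸ LinearMap.range S.moduleCatToCycles) :=
    S.moduleCatHomologyIso.toLinearEquiv
  have e2 : (LinearMap.ker S.g.hom ⧸ LinearMap.range S.moduleCatToCycles) ≃ₗ[R]
      LinearMap.range q := (Submodule.quotEquivOfEq _ _ hker.symm).trans q.quotKerEquivRange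
  rw [← hq, ← Module.Finite.iff_fg]
  exact ⟨fun _ => Module.Finite.equiv (e1.trans e2),
    fun _ => Module.Finite.equiv (e1.trans e2).symm⟩

/-- Finiteness of cohomology, in terms of the images of cocycles modulo coboundaries. -/
lemma finite_homology_iff {C : CochainComplex (ModuleCat.{u} R) ℤ} {m n k : ℤ} (hm : m + 1 = n)
    (hk : n + 1 = k) : Module.Finite R (C.homology n) ↔
      ((LinearMap.ker (C.d n k).hom).map (LinearMap.range (C.d m n).hom).mkQ).FG := by
  have e : C.homology n ≅ (C.sc' m n k).homology :=
    ShortComplex.homologyMapIso (C.isoSc' m n k (by simp; lia) (by simp; lia))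
  refine Iff.trans ⟨fun _ => Module.Finite.equiv e.toLinearEquiv,
    fun _ => Module.Finite.equiv e.symm.toLinearEquiv⟩ (finite_shortComplex_homology_iff _)

lemma exists_fg_le_of_fg_map {V T : Type*} [AddCommGroup V] [Module R V] [AddCommGroup T]
    [Module R T] (L : V →ₗ[R] T) (N : Submodule R V) (h : (N.map L).FG) :
    ∃ N' ≤ N, N'.FG ∧ N'.map L = N.map L := by
  classical
  obtain ⟨s, hs⟩ := h
  have h1 : (s : Set T) ⊆ L '' (N : Set V) := by
    rw [← Submodule.map_coe, ← hs]
    exact Submodule.subset_span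
  obtain ⟨t, ht, rfl⟩ := Finset.subset_set_image_iff.1 h1
  refine ⟨Submodule.span R t, Submodule.span_le.2 ht, ⟨t, rfl⟩, ?_⟩
  rw [Submodule.map_span, ← hs, Finset.coe_image]

lemma fg_pi {N : ℕ} {T : Fin N → Type*} [∀ r, AddCommGroup (T r)] [∀ r, Module R (T r)]
    {p : ∀ r, Submodule R (T r)} (hp : ∀ r, (p r).FG) : (Submodule.pi Set.univ p).FG := by
  have (r : Fin N) : Module.Finite R (p r) := Module.Finite.iff_fg.2 (hp r)
  let g : (∀ r, p r) →ₗ[R] (∀ r, T r) :=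
    LinearMap.pi (fun r => (p r).subtype.comp (LinearMap.proj r))
  have h : Submodule.pi Set.univ p = LinearMap.range g := by
    ext x
    constructor
    · intro hx
      exact ⟨fun r => ⟨x r, hx r trivial⟩, rfl⟩
    · rintro ⟨y, rfl⟩ r _
      exact (y r).2
  rw [h, LinearMap.range_eq_map]
  exact Module.Finite.fg_top.map g

/-- The inductive step for finiteness along a filtration. -/
lemma fg_map_mkQ_of_filtration [IsNoetherianRing R] {V : Type*} [AddCommGroup V] [Module R V]
    {B F F' : Submodule R V} (hF : (F.map B.mkQ).FG) {N : ℕ} {T : Fin N → Type*}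
    [∀ r, AddCommGroup (T r)] [∀ r, Module R (T r)] {p : ∀ r, Submodule R (T r)}
    (hp : ∀ r, (p r).FG) (L : ∀ r, V →ₗ[R] T r) (hL : ∀ r, ∀ z ∈ F', L r z ∈ p r)
    (h : ∀ z ∈ F', (∀ r, L r z = 0) → z ∈ F ⊔ B) : (F'.map B.mkQ).FG := by
  have h1 : (F'.map (LinearMap.pi L)).FG := by
    refine (fg_pi hp).of_le ?_
    rintro _ ⟨z, hz, rfl⟩ r _
    exact hL r z hz
  -- A finitely generated part of `F'` already has the same image under all the `L r`; hence `F'` is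
  -- contained in `N' + F + B`.
  obtain ⟨N', hN', hfg, hN⟩ := exists_fg_le_of_fg_map _ _ h1
  refine ((hfg.map B.mkQ).sup hF).of_le ?_
  rintro _ ⟨z, hz, rfl⟩
  obtain ⟨w, hw, hwz⟩ : LinearMap.pi L z ∈ N'.map (LinearMap.pi L) := by
    rw [hN]; exact ⟨z, hz, rfl⟩
  have h2 : z - w ∈ F ⊔ B := h _ (F'.sub_mem hz (hN' hw)) (fun r => by
    rw [map_sub, sub_eq_zero]
    exact (congrFun hwz r).symm)
  obtain ⟨x, hx, b, hb, hxb⟩ := Submodule.mem_sup.1 h2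
  have h3 : B.mkQ z = B.mkQ w + B.mkQ x := by
    have hb' : B.mkQ b = 0 := (Submodule.Quotient.mk_eq_zero B).2 hb
    rw [show z = w + (x + b) by rw [hxb]; abel, map_add, map_add, hb', add_zero]
  rw [h3]
  exact Submodule.add_mem_sup ⟨w, hw, rfl⟩ ⟨x, hx, rfl⟩

end ComplexLemmas

/-! ### Local coherence of `Hom(P, Y)` for perfect `P` -/

namespace GrMod

open CochainComplex CochainComplex.HomComplex ComplexLemmas

variable {R A : Type u} [CommRing R] [CommRing A] [Algebra R A]
    {𝒜 : ℤ → Submodule R A} [GradedAlgebra 𝒜]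

section

variable (P Y : CochainComplex (GrMod 𝒜) ℤ) (i n : ℤ)

/-- The cocycles that vanish in degrees `≥ k`. -/
noncomputable def cocyclesBelow (m k : ℤ) : Submodule R (Cochain P ((twC i).obj Y) n) where
  carrier := {z | δ n m z = 0 ∧ ∀ p q (hpq : p + n = q), k ≤ p → z.v p q hpq = 0}
  zero_mem' := ⟨δ_zero _ _, fun _ _ _ _ => rfl⟩
  add_mem' hz hz' := ⟨by rw [δ_add, hz.1, hz'.1, add_zero], fun p q hpq hp => by
    rw [Cochain.add_v, hz.2 p q hpq hp, hz'.2 p q hpq hp, add_zero]⟩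
  smul_mem' r z hz := ⟨by rw [δ_smul, hz.1, smul_zero], fun p q hpq hp => by
    rw [Cochain.smul_v, hz.2 p q hpq hp, smul_zero]⟩

/-- Evaluation of the degree `p` component at an element. -/
noncomputable def cochainEvalAt {p q : ℤ} (hpq : p + n = q) {w : ℤ} (x : (P.X p).X w) :
    Cochain P ((twC i).obj Y) n →ₗ[R] (Y.X q).X (i + w) where
  toFun z := ((z.v p q hpq).f w).hom x
  map_add' _ _ := rfl
  map_smul' _ _ := rfl

/-- Induction on the highest degree of `P` on which the cocycle is nonzero. The component there is
controlled by the classes of its values at finitely many generators, which lie in finitely generated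
cohomology of `Y`; if these classes vanish, a coboundary removes the component. -/
lemma fg_cocyclesBelow [IsNoetherianRing R] (a : ℤ) [P.IsStrictlyGE a]
    (hP : ∀ n, Projective (P.X n) ∧ (P.X n).FG) (hY : IsLocallyCoherent Y) {l m : ℤ}
    (hl : l + 1 = n) (hm : n + 1 = m) (t : ℕ) :
    ((cocyclesBelow P Y i n m (a + t)).map
      (LinearMap.range (δ_hom R P ((twC i).obj Y) l n)).mkQ).FG := by
  induction t with
  | zero =>
    have h : cocyclesBelow P Y i n m (a + (0 : ℕ)) = ⊥ := by
      rw [eq_bot_iff]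
      intro z hz
      refine Cochain.ext _ _ (fun p q hpq => ?_)
      by_cases hp : a ≤ p
      · exact hz.2 p q hpq (by simpa using hp)
      · exact (P.isZero_of_isStrictlyGE a p (by lia)).eq_of_src _ _
    rw [h, Submodule.map_bot]
    exact Submodule.fg_bot
  | succ t ih =>
    have := (hP (a + t)).1
    obtain ⟨N, w, x, hb⟩ := exists_dualBasis (P.X (a + t)) (hP (a + t)).2
    obtain ⟨ξ, hξ⟩ := hb (fun r => -(w r)) (fun r => neg_add_cancel _)
    have hfin (r : Fin N) := (finite_homology_iff (C := (weightC (i + w r)).obj Y)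
      (show (a + t + n - 1) + 1 = a + t + n by lia) (show a + t + n + 1 = a + t + m by lia)).1
      (finiteCohomology_weightC hY (i + w r) (a + t + n))
    refine fg_map_mkQ_of_filtration ih hfin (fun r => (Submodule.mkQ _).comp
      (cochainEvalAt P Y i n (rfl : a + t + n = a + t + n) (x r))) (fun r z hz => ?_)
      (fun z hz hz0 => ?_)
    · refine ⟨cochainEvalAt P Y i n rfl (x r) z, ?_, rfl⟩
      -- As `z` vanishes one degree higher, the cocycle condition says that its component in degree
      -- `a + t` takes values in cocycles of `Y`.
      have h1 := Cochain.congr_v hz.1 (a + t) (a + t + m) rfl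
      rw [δ_v n m hm z _ _ _ (a + t + n) (a + t + 1) (by lia) rfl, hz.2 (a + t + 1) (a + t + m)
        (by lia) (by push_cast; lia), comp_zero, smul_zero, add_zero] at h1
      exact congrArg (fun φ : P.X (a + t) ⟶ (twist i).obj (Y.X (a + t + m)) =>
        (φ.f (w r)).hom (x r)) h1
    · have h1 (r : Fin N) : ∃ y : (Y.X (a + t + n - 1)).X (i + w r),
          ((Y.d (a + t + n - 1) (a + t + n)).f (i + w r)).hom y =
            ((z.v (a + t) (a + t + n) rfl).f (w r)).hom (x r) :=
        (Submodule.Quotient.mk_eq_zero _).1 (hz0 r)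
      choose y hy using h1
      have hj (r : Fin N) : -(w r) + (i + w r) = i := by lia
      -- Primitives of the values at the generators are assembled by the dual basis, so the
      -- component of `z` factors through `d`. The coboundary of the resulting cochain affects only
      -- the degrees `a + t` and `a + t - 1` of `P`.
      let φ : P.X (a + t) ⟶ (twist i).obj (Y.X (a + t + n - 1)) :=
        ∑ r, ξ r ≫ evalAt (hj r) (y r)
      have hφ : φ ≫ (twist i).map (Y.d (a + t + n - 1) (a + t + n)) = z.v (a + t) (a + t + n) rfl := by
        refine Eq.trans ?_ (sum_dualBasis_twist hξ (z.v (a + t) (a + t + n) rfl) hj)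
        refine (Preadditive.sum_comp _ _ _).trans (Finset.sum_congr rfl (fun r _ => ?_))
        rw [Category.assoc, evalAt_map, hy]
        rfl
      let c : Cochain P ((twC i).obj Y) l := Cochain.single φ l
      have hc (p q : ℤ) (hpq : p + l = q) (hp : p ≠ a + t) : c.v p q hpq = 0 :=
        Cochain.single_v_eq_zero _ _ _ _ _ hp
      have hc' : c.v (a + t) (a + t + n - 1) (by lia) = φ := Cochain.single_v _ _ _
      have h2 : z - δ l n c ∈ cocyclesBelow P Y i n m (a + t) := by
        refine ⟨by rw [δ_sub, hz.1, δ_δ, sub_zero], fun p q hpq hp => ?_⟩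
        rw [Cochain.sub_v, δ_v l n hl c p q hpq (q - 1) (p + 1) rfl rfl,
          hc (p + 1) q _ (by lia), comp_zero, smul_zero, add_zero]
        by_cases hp' : p = a + t
        · subst hp'
          obtain rfl : q = a + t + n := by lia
          rw [hc']
          exact sub_eq_zero.2 hφ.symm
        · rw [hc p (q - 1) _ hp', zero_comp, hz.2 p q hpq (by push_cast; lia), sub_zero]
      rw [← sub_add_cancel z (δ l n c)]
      exact Submodule.add_mem_sup h2 ⟨c, rfl⟩

end

lemma isLocallyCoherent_gradedHom [IsNoetherianRing R]
    {P Y : CochainComplex (GrMod 𝒜) ℤ} {a b : ℤ} [P.IsStrictlyGE a] [P.IsStrictlyLE b]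
    (hP : ∀ n, Projective (P.X n) ∧ (P.X n).FG) (hY : IsLocallyCoherent Y) :
    IsLocallyCoherent (gradedHom P Y) := by
  intro n i
  have h : Module.Finite R (((weightC i).obj (gradedHom P Y)).homology n) := by
    rw [finite_homology_iff (sub_add_cancel n 1) rfl]
    -- After this many steps the threshold has passed `b`, so every cocycle is included.
    have h1 := fg_cocyclesBelow P Y i n a hP hY (sub_add_cancel n 1) rfl (b - a + 1).toNat
    refine h1.of_le (Submodule.map_mono (fun z hz => ⟨hz, fun p q hpq hp => ?_⟩))
    exact (P.isZero_of_isStrictlyLE b p (by lia)).eq_of_src _ _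
  exact Module.Finite.equiv (homologyWeightIso (gradedHom P Y) i n).toLinearEquiv

end GrMod

namespace ComplexLemmas

open CochainComplex CochainComplex.HomComplex

/-! ### Functoriality of mapping cocones -/

section

variable {C : Type*} [Category* C] [Preadditive C] {K L K' L' : CochainComplex C ℤ} {φ : K ⟶ L}
  {φ' : K' ⟶ L'} [HomologicalComplex.HasHomotopyCofiber φ]
  [HomologicalComplex.HasHomotopyCofiber φ']

lemma mappingCocone_X_ext_from {p q : ℤ} (hpq : p + -1 = q) {X : C}
    {s t : (mappingCocone φ).X p ⟶ X}
    (h₁ : (mappingCocone.inl φ).v p p (add_zero p) ≫ s =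
      (mappingCocone.inl φ).v p p (add_zero p) ≫ t)
    (h₂ : (mappingCocone.inr φ).1.v q p (by lia) ≫ s =
      (mappingCocone.inr φ).1.v q p (by lia) ≫ t) : s = t := by
  rw [← Category.id_comp s, ← Category.id_comp t, ← mappingCocone.id_X φ p q hpq,
    Preadditive.add_comp, Preadditive.add_comp, Category.assoc, Category.assoc, Category.assoc,
    Category.assoc, h₁, h₂]

lemma inl_comp_fst : (mappingCocone.inl φ).comp (Cochain.ofHom (mappingCocone.fst φ)) (add_zero 0) =
    Cochain.ofHom (𝟙 K) := by
  refine Cochain.ext _ _ (fun p q hpq => ?_)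
  obtain rfl : p = q := by lia
  simp

lemma inl_comp_snd : (mappingCocone.inl φ).comp (mappingCocone.snd φ) (zero_add (-1)) = 0 := by
  refine Cochain.ext _ _ (fun p q hpq => ?_)
  simp

lemma coconeInr_comp_fst :
    (coconeInr φ).comp (Cochain.ofHom (mappingCocone.fst φ)) (add_zero 1) = 0 := by
  refine Cochain.ext _ _ (fun p q hpq => ?_)
  simp [coconeInr]

lemma coconeInr_comp_snd : (coconeInr φ).comp (mappingCocone.snd φ) (add_neg_cancel 1) =
    Cochain.ofHom (𝟙 L) := by
  refine Cochain.ext _ _ (fun p q hpq => ?_)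
  obtain rfl : p = q := by lia
  rw [Cochain.comp_v _ _ (add_neg_cancel 1) p (p + 1) p rfl (by lia)]
  simp [coconeInr]

/-- The morphism of mapping cocones induced by a commutative square, with values in the image of
a mapping cocone under an additive functor. -/
noncomputable def coconeMapF (F : C ⥤ C) [F.Additive]
    (u : K ⟶ (F.mapHomologicalComplex _).obj K') (v : L ⟶ (F.mapHomologicalComplex _).obj L')
    (h : u ≫ (F.mapHomologicalComplex _).map φ' = φ ≫ v) :
    mappingCocone φ ⟶ (F.mapHomologicalComplex _).obj (mappingCocone φ') :=
  mappingCocone.desc φ ((Cochain.ofHom u).comp ((mappingCocone.inl φ').map F) (zero_add 0))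
    (Cocycle.mk ((Cochain.ofHom v).comp ((coconeInr φ').map F) (zero_add 1)) 2 rfl (by
      rw [δ_ofHom_comp, δ_map, δ_coconeInr, Cochain.map_zero, Cochain.comp_zero]))
    (by
      rw [δ_ofHom_comp, δ_map, δ_mappingCocone_inl, Cochain.map_neg, Cochain.map_comp,
        Cochain.map_ofHom, Cochain.comp_neg, ← Cochain.comp_assoc_of_first_is_zero_cochain,
        ← Cochain.ofHom_comp, h, Cochain.ofHom_comp]
      simp [Cochain.comp_assoc_of_first_is_zero_cochain])

section

variable (F : C ⥤ C) [F.Additive] (u : K ⟶ (F.mapHomologicalComplex _).obj K')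
  (v : L ⟶ (F.mapHomologicalComplex _).obj L')
  (h : u ≫ (F.mapHomologicalComplex _).map φ' = φ ≫ v)

lemma coconeMapF_fst : coconeMapF F u v h ≫ (F.mapHomologicalComplex _).map (mappingCocone.fst φ') =
    mappingCocone.fst φ ≫ u := by
  apply Cochain.ofHom_injective
  rw [Cochain.ofHom_comp, Cochain.ofHom_comp, ← Cochain.map_ofHom]
  refine mappingCocone_ext_from φ (add_zero 1) ?_ ?_
  · rw [← Cochain.comp_assoc_of_first_is_zero_cochain, coconeMapF, mappingCocone.ofHom_desc,
      mappingCocone.inl_comp_descCochain, Cochain.comp_assoc_of_first_is_zero_cochain,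
      ← Cochain.map_comp, inl_comp_fst, Cochain.map_ofHom,
      CategoryTheory.Functor.map_id, Cochain.comp_id, ← Cochain.comp_assoc_of_first_is_zero_cochain,
      inl_comp_fst, Cochain.id_comp]
  · rw [← Cochain.comp_assoc_of_second_is_zero_cochain, coconeMapF, mappingCocone.ofHom_desc,
      coconeInr_comp_descCochain, Cocycle.mk_coe, Cochain.comp_assoc_of_first_is_zero_cochain,
      ← Cochain.map_comp, coconeInr_comp_fst, Cochain.map_zero, Cochain.comp_zero,
      ← Cochain.comp_assoc_of_second_is_zero_cochain, coconeInr_comp_fst, Cochain.zero_comp]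

lemma coconeMapF_snd : (Cochain.ofHom (coconeMapF F u v h)).comp
      ((mappingCocone.snd φ').map F) (zero_add (-1)) =
    (mappingCocone.snd φ).comp (Cochain.ofHom v) (add_zero (-1)) := by
  refine mappingCocone_ext_from φ (add_neg_cancel 1) ?_ ?_
  · rw [← Cochain.comp_assoc_of_first_is_zero_cochain, coconeMapF, mappingCocone.ofHom_desc,
      mappingCocone.inl_comp_descCochain, Cochain.comp_assoc_of_first_is_zero_cochain,
      ← Cochain.map_comp, inl_comp_snd, Cochain.map_zero, Cochain.comp_zero,
      ← Cochain.comp_assoc_of_first_is_zero_cochain, inl_comp_snd, Cochain.zero_comp]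
  · rw [← Cochain.comp_assoc_of_second_is_zero_cochain, coconeMapF, mappingCocone.ofHom_desc,
      coconeInr_comp_descCochain, Cocycle.mk_coe, Cochain.comp_assoc_of_first_is_zero_cochain,
      ← Cochain.map_comp, coconeInr_comp_snd, Cochain.map_ofHom,
      CategoryTheory.Functor.map_id, Cochain.comp_id,
      ← Cochain.comp_assoc_of_third_is_zero_cochain, coconeInr_comp_snd, Cochain.id_comp]

end

/-- The morphism of mapping cocones induced by a commutative square. -/
noncomputable def coconeMap (u : K ⟶ K') (v : L ⟶ L') (h : u ≫ φ' = φ ≫ v) :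
    mappingCocone φ ⟶ mappingCocone φ' :=
  mappingCocone.desc φ ((Cochain.ofHom u).comp (mappingCocone.inl φ') (zero_add 0))
    (Cocycle.mk ((Cochain.ofHom v).comp (coconeInr φ') (zero_add 1)) 2 rfl (by
      rw [δ_ofHom_comp, δ_coconeInr, Cochain.comp_zero]))
    (by
      rw [δ_ofHom_comp, δ_mappingCocone_inl, Cochain.comp_neg,
        ← Cochain.comp_assoc_of_first_is_zero_cochain, ← Cochain.ofHom_comp, h, Cochain.ofHom_comp]
      simp [Cochain.comp_assoc_of_first_is_zero_cochain])

section

variable (u : K ⟶ K') (v : L ⟶ L') (h : u ≫ φ' = φ ≫ v)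

lemma coconeMap_fst (p : ℤ) : (coconeMap u v h).f p ≫ (mappingCocone.fst φ').f p =
    (mappingCocone.fst φ).f p ≫ u.f p := by
  refine mappingCocone_X_ext_from rfl ?_ ?_
  · rw [mappingCocone.inl_v_fst_f_assoc, coconeMap, mappingCocone.inl_v_desc_f_assoc]
    simp
  · rw [mappingCocone.inr_v_fst_f_assoc, coconeMap, mappingCocone.inr_v_desc_f_assoc]
    simp [coconeInr]

lemma coconeMap_snd (p q : ℤ) (hpq : p + -1 = q) :
    (coconeMap u v h).f p ≫ (mappingCocone.snd φ').v p q hpq =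
    (mappingCocone.snd φ).v p q hpq ≫ v.f q := by
  refine mappingCocone_X_ext_from hpq ?_ ?_
  · rw [mappingCocone.inl_v_snd_v_assoc, coconeMap, mappingCocone.inl_v_desc_f_assoc]
    simp
  · rw [mappingCocone.inr_v_snd_v_assoc, coconeMap, mappingCocone.inr_v_desc_f_assoc]
    simp [coconeInr]

end

end

end ComplexLemmas

namespace GrMod

open CochainComplex CochainComplex.HomComplex ComplexLemmas

variable {R A : Type u} [CommRing R] [CommRing A] [Algebra R A]
    {𝒜 : ℤ → Submodule R A} [GradedAlgebra 𝒜]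

/-! ### Exactness in each weight -/

lemma exact_iff_weight (S : ShortComplex (GrMod 𝒜)) :
    S.Exact ↔ ∀ j, (S.map (weight j)).Exact := by
  constructor
  · intro h j
    exact h.map (weight j)
  · intro h
    rw [ShortComplex.exact_iff_isZero_homology]
    refine isZero_of_weight (fun j => ?_)
    exact ((ShortComplex.exact_iff_isZero_homology _).1 (h j)).of_iso
      (S.mapHomologyIso (weight j)).symm

lemma exact_iff_forall (S : ShortComplex (GrMod 𝒜)) :
    S.Exact ↔ ∀ j (x : S.X₂.X j), (S.g.f j).hom x = 0 → ∃ y, (S.f.f j).hom y = x := by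
  rw [exact_iff_weight]
  exact forall_congr' (fun j => ShortComplex.moduleCat_exact_iff (S.map (weight j)))

lemma mono_of_injective {M N : GrMod 𝒜} (φ : M ⟶ N) (h : ∀ j, Function.Injective (φ.f j).hom) :
    Mono φ := ⟨fun g g' e => hom_ext (fun j => by
  have := (ModuleCat.mono_iff_injective (φ.f j)).2 (h j)
  exact (cancel_mono (φ.f j)).1 (congrArg (fun t => Hom.f t j) e))⟩

lemma epi_of_surjective {M N : GrMod 𝒜} (φ : M ⟶ N) (h : ∀ j, Function.Surjective (φ.f j).hom) :
    Epi φ := ⟨fun g g' e => hom_ext (fun j => by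
  have := (ModuleCat.epi_iff_surjective (φ.f j)).2 (h j)
  exact (cancel_epi (φ.f j)).1 (congrArg (fun t => Hom.f t j) e))⟩

lemma shortExact_iff (S : ShortComplex (GrMod 𝒜)) : S.ShortExact ↔
    ∀ j, Function.Injective (S.f.f j).hom ∧ Function.Surjective (S.g.f j).hom ∧
      ∀ x : S.X₂.X j, (S.g.f j).hom x = 0 → ∃ y, (S.f.f j).hom y = x := by
  constructor
  · intro h j
    exact ComplexLemmas.shortExact_iff.1 (h.map_of_exact (weight j))
  · intro h
    exact { exact := (exact_iff_forall S).2 (fun j => (h j).2.2)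
            mono_f := mono_of_injective _ (fun j => (h j).1)
            epi_g := epi_of_surjective _ (fun j => (h j).2.1) }

/-! ### Localization is exact -/

variable {d : ℤ} (f : 𝒜 d)

lemma map_locι {M N : GrMod 𝒜} (u : M ⟶ N) (n : ℕ) {j : ℤ} (x : M.X (n * d + j)) :
    (((loc f).map u).f j).hom ((((locι f n).app M).f j).hom x) =
      (((locι f n).app N).f j).hom ((u.f (n * d + j)).hom x) :=
  congrArg (fun t => (Hom.f t j).hom x) ((locι f n).naturality u).symm

lemma locι_act_pow (M : GrMod 𝒜) {j : ℤ} (n m : ℕ) (x : M.X (n * d + j))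
    (h : m * d + (n * d + j) = ((n + m : ℕ) : ℤ) * d + j) :
    (((locι f (n + m)).app M).f j).hom (M.act h (⟨f ^ m, by
      simpa using SetLike.pow_mem_graded m f.2⟩ : 𝒜 (m * d)) x) =
      (((locι f n).app M).f j).hom x := by
  rw [← locSeq_map_apply f M n m x h]
  exact congrArg (fun t => (Hom.f t j).hom x)
    (colimit.w ((locSeq f).flip.obj M) (homOfLE (Nat.le_add_right n m)))

/-- If `x / f^n` maps to zero, then some `f^m x` does so before localization and lifts to `y`; the
preimage is `y / f^{n+m}`. -/
instance : (loc f).PreservesHomology := by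
  refine Functor.preservesHomology_of_map_exact _ (fun S hS => ?_)
  rw [exact_iff_forall] at hS ⊢
  intro j x hx
  obtain ⟨n, x, rfl⟩ := exists_locι f S.X₂ x
  obtain ⟨m, hm⟩ := exists_act_pow_eq_zero f S.X₃ n _ ((map_locι f S.g n x).symm.trans hx)
  have h : m * d + (n * d + j) = ((n + m : ℕ) : ℤ) * d + j := by push_cast; ring
  obtain ⟨y, hy⟩ := hS _ (S.X₂.act h (⟨f ^ m, by
      simpa using SetLike.pow_mem_graded m f.2⟩ : 𝒜 (m * d)) x)
    ((S.g.map_act h _ x).trans (hm _ h))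
  refine ⟨(((locι f (n + m)).app S.X₁).f j).hom y, ?_⟩
  refine (map_locι f S.f (n + m) y).trans ?_
  rw [hy]
  exact locι_act_pow f S.X₂ n m x h

end GrMod

namespace ComplexLemmas

open CochainComplex CochainComplex.HomComplex

section

variable {C : Type*} [Category* C] [Abelian C]

lemma quasiIso_of_acyclic_X₃ {S : ShortComplex (CochainComplex C ℤ)} (hS : S.ShortExact)
    (h : S.X₃.Acyclic) : QuasiIso S.f := by
  have hZ (n : ℤ) : IsZero (S.X₃.homology n) :=
    (HomologicalComplex.exactAt_iff_isZero_homology _ _).1 (h n)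
  rw [quasiIso_iff]
  intro n
  rw [quasiIsoAt_iff_isIso_homologyMap]
  have h1 : Mono (HomologicalComplex.homologyMap S.f n) :=
    (hS.homology_exact₁ (n - 1) n (by simp)).mono_g ((hZ _).eq_of_src _ _)
  have h2 : Epi (HomologicalComplex.homologyMap S.f n) :=
    (hS.homology_exact₂ n).epi_f ((hZ _).eq_of_tgt _ _)
  exact isIso_of_mono_of_epi _

lemma acyclic_map {D : Type*} [Category* D] [Abelian D] (F : C ⥤ D) [F.Additive]
    [F.PreservesHomology] {K : CochainComplex C ℤ} (hK : K.Acyclic) :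
    ((F.mapHomologicalComplex _).obj K).Acyclic := fun n => by
  rw [HomologicalComplex.exactAt_iff_isZero_homology]
  exact (F.map_isZero ((HomologicalComplex.exactAt_iff_isZero_homology _ _).1 (hK n))).of_iso
    ((K.sc n).mapHomologyIso F)

end

end ComplexLemmas

/-! ### Exactness and functoriality of local cohomology -/

namespace GrMod

open CochainComplex CochainComplex.HomComplex ComplexLemmas

variable {R A : Type u} [CommRing R] [CommRing A] [Algebra R A]
    {𝒜 : ℤ → Submodule R A} [GradedAlgebra 𝒜]

section

variable {d : ℤ} (f : 𝒜 d)

lemma quasiIso_locCocone_fst {X : CochainComplex (GrMod 𝒜) ℤ} (h : ((locC f).obj X).Acyclic) :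
    QuasiIso (mappingCocone.fst (toLocC f X)) := by
  have h1 := (Pretriangulated.Triangle.isZero₃_iff_isIso₁ _
    (DerivedCategory.mappingCocone_triangle_distinguished (toLocC f X))).1
    ((isZero_Q_obj_iff _).2 h)
  rw [← DerivedCategory.isIso_Q_map_iff_quasiIso]
  exact h1

lemma acyclic_locCocone {X : CochainComplex (GrMod 𝒜) ℤ} (h : X.Acyclic) :
    (locCocone f X).Acyclic :=
  (isZero_Q_obj_iff _).1 (Pretriangulated.Triangle.isZero₁_of_isZero₂₃ _
    (DerivedCategory.mappingCocone_triangle_distinguished (toLocC f X))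
    ((isZero_Q_obj_iff _).2 h) ((isZero_Q_obj_iff _).2 (acyclic_map (loc f) h)))

/-! ### Elements of mapping cocones -/

variable (X Y : CochainComplex (GrMod 𝒜) ℤ)

/-- The first component of an element of a mapping cocone. -/
noncomputable def coconeFst (p j : ℤ) : ((locCocone f X).X p).X j →ₗ[R] (X.X p).X j :=
  (((mappingCocone.fst (toLocC f X)).f p).f j).hom

/-- The second component of an element of a mapping cocone. -/
noncomputable def coconeSnd {p q : ℤ} (h : p + -1 = q) (j : ℤ) :
    ((locCocone f X).X p).X j →ₗ[R] ((loc f).obj (X.X q)).X j :=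
  (((mappingCocone.snd (toLocC f X)).v p q h).f j).hom

variable {X Y}

lemma coconeFst_act {p i j k : ℤ} (h : i + j = k) (a : 𝒜 i) (x : ((locCocone f X).X p).X j) :
    coconeFst f X p k (((locCocone f X).X p).act h a x) =
      (X.X p).act h a (coconeFst f X p j x) :=
  ((mappingCocone.fst (toLocC f X)).f p).map_act h a x

lemma coconeSnd_act {p q i j k : ℤ} (hpq : p + -1 = q) (h : i + j = k) (a : 𝒜 i)
    (x : ((locCocone f X).X p).X j) :
    coconeSnd f X hpq k (((locCocone f X).X p).act h a x) =
      ((loc f).obj (X.X q)).act h a (coconeSnd f X hpq j x) :=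
  ((mappingCocone.snd (toLocC f X)).v p q hpq).map_act h a x

lemma cocone_ext {p q j : ℤ} (hpq : p + -1 = q) {x y : ((locCocone f X).X p).X j}
    (h₁ : coconeFst f X p j x = coconeFst f X p j y)
    (h₂ : coconeSnd f X hpq j x = coconeSnd f X hpq j y) : x = y := by
  have h (x : ((locCocone f X).X p).X j) :
      (((mappingCocone.inl (toLocC f X)).v p p (add_zero p)).f j).hom (coconeFst f X p j x) +
      (((mappingCocone.inr (toLocC f X)).1.v q p (by lia)).f j).hom (coconeSnd f X hpq j x) = x :=
    congrArg (fun t => (Hom.f t j).hom x) (mappingCocone.id_X (toLocC f X) p q hpq)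
  rw [← h x, ← h y, h₁, h₂]

lemma exists_cocone {p q j : ℤ} (hpq : p + -1 = q) (a : (X.X p).X j)
    (b : ((loc f).obj (X.X q)).X j) :
    ∃ x, coconeFst f X p j x = a ∧ coconeSnd f X hpq j x = b := by
  refine ⟨(((mappingCocone.inl (toLocC f X)).v p p (add_zero p)).f j).hom a +
    (((mappingCocone.inr (toLocC f X)).1.v q p (by lia)).f j).hom b, ?_, ?_⟩
  · have h1 : coconeFst f X p j ((((mappingCocone.inl (toLocC f X)).v p p (add_zero p)).f j).hom a)
      = a := congrArg (fun t => (Hom.f t j).hom a) (mappingCocone.inl_v_fst_f (toLocC f X) p)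
    have h2 : coconeFst f X p j
        ((((mappingCocone.inr (toLocC f X)).1.v q p (by lia)).f j).hom b) = 0 :=
      congrArg (fun t => (Hom.f t j).hom b) (mappingCocone.inr_v_fst_f (toLocC f X) q p (by lia))
    rw [map_add, h1, h2, add_zero]
  · have h1 : coconeSnd f X hpq j
        ((((mappingCocone.inl (toLocC f X)).v p p (add_zero p)).f j).hom a) = 0 :=
      congrArg (fun t => (Hom.f t j).hom a) (mappingCocone.inl_v_snd_v (toLocC f X) p q hpq)
    have h2 : coconeSnd f X hpq j
        ((((mappingCocone.inr (toLocC f X)).1.v q p (by lia)).f j).hom b) = b :=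
      congrArg (fun t => (Hom.f t j).hom b) (mappingCocone.inr_v_snd_v (toLocC f X) q p (by lia))
    rw [map_add, h1, h2, zero_add]

/-! ### Functoriality of local cohomology -/

lemma toLocC_naturality (u : X ⟶ Y) : u ≫ toLocC f Y = toLocC f X ≫ (locC f).map u :=
  HomologicalComplex.hom_ext _ _ (fun n => (toLoc f).naturality (u.f n))

/-- The map on local cohomology for one element. -/
noncomputable def locCoconeMap (u : X ⟶ Y) : locCocone f X ⟶ locCocone f Y :=
  coconeMap u ((locC f).map u) (toLocC_naturality f u)

lemma coconeFst_map (u : X ⟶ Y) (p j : ℤ) (x : ((locCocone f X).X p).X j) :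
    coconeFst f Y p j ((((locCoconeMap f u).f p).f j).hom x) =
      ((u.f p).f j).hom (coconeFst f X p j x) :=
  congrArg (fun t => (Hom.f t j).hom x)
    (coconeMap_fst u ((locC f).map u) (toLocC_naturality f u) p)

lemma coconeSnd_map (u : X ⟶ Y) {p q : ℤ} (hpq : p + -1 = q) (j : ℤ)
    (x : ((locCocone f X).X p).X j) :
    coconeSnd f Y hpq j ((((locCoconeMap f u).f p).f j).hom x) =
      (((loc f).map (u.f q)).f j).hom (coconeSnd f X hpq j x) :=
  congrArg (fun t => (Hom.f t j).hom x)
    (coconeMap_snd u ((locC f).map u) (toLocC_naturality f u) p q hpq)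

lemma hom_ext_apply {Z W : CochainComplex (GrMod 𝒜) ℤ} {u v : Z ⟶ W}
    (h : ∀ p j (x : (Z.X p).X j), ((u.f p).f j).hom x = ((v.f p).f j).hom x) : u = v :=
  HomologicalComplex.hom_ext _ _ (fun p => hom_ext (fun j =>
    ModuleCat.hom_ext (LinearMap.ext (h p j))))

lemma locCoconeMap_id : locCoconeMap f (𝟙 X) = 𝟙 _ := hom_ext_apply (fun p j x =>
  cocone_ext f rfl (coconeFst_map f (𝟙 X) p j x) ((coconeSnd_map f (𝟙 X) rfl j x).trans
    (congrArg (fun t => (Hom.f t j).hom (coconeSnd f X rfl j x)) ((loc f).map_id _))))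

lemma locCoconeMap_comp {Z : CochainComplex (GrMod 𝒜) ℤ} (u : X ⟶ Y) (v : Y ⟶ Z) :
    locCoconeMap f (u ≫ v) = locCoconeMap f u ≫ locCoconeMap f v := by
  refine hom_ext_apply (fun p j x => cocone_ext f rfl ?_ ?_)
  · refine (coconeFst_map f (u ≫ v) p j x).trans (Eq.symm ((coconeFst_map f v p j _).trans ?_))
    exact congrArg (fun t => ((v.f p).f j).hom t) (coconeFst_map f u p j x)
  · refine (coconeSnd_map f (u ≫ v) rfl j x).trans (Eq.symm ((coconeSnd_map f v rfl j _).trans ?_))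
    refine (congrArg (fun t => (((loc f).map (v.f _)).f j).hom t)
      (coconeSnd_map f u rfl j x)).trans ?_
    exact congrArg (fun t => (Hom.f t j).hom (coconeSnd f X rfl j x))
      ((loc f).map_comp (u.f _) (v.f _)).symm

lemma locCoconeMap_zero : locCoconeMap f (0 : X ⟶ Y) = 0 := hom_ext_apply (fun p j x =>
  cocone_ext f rfl ((coconeFst_map f (0 : X ⟶ Y) p j x).trans (map_zero _).symm)
    (((coconeSnd_map f (0 : X ⟶ Y) rfl j x).trans
      (congrArg (fun t => (Hom.f t j).hom (coconeSnd f X rfl j x)) ((loc f).map_zero _ _))).trans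
        (map_zero _).symm))

/-- In degree `p` the cocone is `X^p ⊕ (X^{p-1})_f`, and both summands depend exactly on `X`. -/
lemma shortExact_locCocone {S : ShortComplex (CochainComplex (GrMod 𝒜) ℤ)} (hS : S.ShortExact)
    (w : locCoconeMap f S.f ≫ locCoconeMap f S.g = 0) :
    (ShortComplex.mk (locCoconeMap f S.f) (locCoconeMap f S.g) w).ShortExact := by
  rw [HomologicalComplex.shortExact_iff_degreewise_shortExact] at hS ⊢
  have := (loc f).preservesFiniteLimits_of_preservesHomology
  have := (loc f).preservesFiniteColimits_of_preservesHomology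
  intro p
  rw [shortExact_iff]
  have h1 := (shortExact_iff _).1 (hS p)
  have h2 := (shortExact_iff _).1 ((hS (p + -1)).map_of_exact (loc f))
  intro j
  obtain ⟨i₁, s₁, e₁⟩ := h1 j
  obtain ⟨i₂, s₂, e₂⟩ := h2 j
  refine ⟨fun x y hxy => cocone_ext f rfl (i₁ ?_) (i₂ ?_), fun x => ?_, fun x hx => ?_⟩
  · have := congrArg (coconeFst f S.X₂ p j) hxy
    exact (coconeFst_map f S.f p j x).symm.trans (this.trans (coconeFst_map f S.f p j y))
  · have := congrArg (coconeSnd f S.X₂ rfl j) hxy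
    exact (coconeSnd_map f S.f rfl j x).symm.trans (this.trans (coconeSnd_map f S.f rfl j y))
  · obtain ⟨a, ha⟩ := s₁ (coconeFst f S.X₃ p j x)
    obtain ⟨b, hb⟩ := s₂ (coconeSnd f S.X₃ rfl j x)
    obtain ⟨y, rfl, rfl⟩ := exists_cocone f (X := S.X₂) rfl a b
    exact ⟨y, cocone_ext f rfl ((coconeFst_map f S.g p j y).trans ha)
      ((coconeSnd_map f S.g rfl j y).trans hb)⟩
  · obtain ⟨a, ha⟩ := e₁ (coconeFst f S.X₂ p j x) ((coconeFst_map f S.g p j x).symm.trans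
      ((congrArg (coconeFst f S.X₃ p j) hx).trans (map_zero _)))
    obtain ⟨b, hb⟩ := e₂ (coconeSnd f S.X₂ rfl j x) ((coconeSnd_map f S.g rfl j x).symm.trans
      ((congrArg (coconeSnd f S.X₃ rfl j) hx).trans (map_zero _)))
    obtain ⟨y, rfl, rfl⟩ := exists_cocone f (X := S.X₁) rfl a b
    exact ⟨y, cocone_ext f rfl ((coconeFst_map f S.f p j y).trans ha)
      ((coconeSnd_map f S.f rfl j y).trans hb)⟩

/-- For monomorphisms this follows from the acyclic cokernel. In general `u = i ≫ π`, where `π` has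
a section `s`; both `i` and `s` are monic quasi-isomorphisms, and two-out-of-three gives the claim
for `π` and then for `u`. -/
lemma quasiIso_locCoconeMap (u : X ⟶ Y) [QuasiIso u] : QuasiIso (locCoconeMap f u) := by
  have key {X Y : CochainComplex (GrMod 𝒜) ℤ} (i : X ⟶ Y) [Mono i] [QuasiIso i] :
      QuasiIso (locCoconeMap f i) := by
    have hS : (ShortComplex.mk i (cokernel.π i) (cokernel.condition i)).ShortExact :=
      { exact := ShortComplex.exact_cokernel i
        mono_f := inferInstance
        epi_g := inferInstance }
    have w : locCoconeMap f i ≫ locCoconeMap f (cokernel.π i) = 0 := by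
      rw [← locCoconeMap_comp, cokernel.condition, locCoconeMap_zero]
    exact quasiIso_of_acyclic_X₃ (shortExact_locCocone f hS w)
      (acyclic_locCocone f (ShortComplex.ShortExact.acyclic_X₃ hS inferInstance))
  obtain ⟨V, Z, i, p, w, π, hS, _, hπ, s, _, hs⟩ := exists_shortExact u
  have : Mono i := hS.mono_f
  have h1 : QuasiIso i := by
    have : QuasiIso (i ≫ π) := by rw [hπ]; infer_instance
    exact quasiIso_of_comp_right i π
  have h2 : QuasiIso s := by
    have : QuasiIso (s ≫ π) := by rw [hs]; infer_instance
    exact quasiIso_of_comp_right s π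
  have h3 := key i
  have h4 := key s
  have h5 : QuasiIso (locCoconeMap f π) := by
    have : QuasiIso (locCoconeMap f s ≫ locCoconeMap f π) := by
      rw [← locCoconeMap_comp, hs, locCoconeMap_id]; infer_instance
    exact quasiIso_of_comp_left (locCoconeMap f s) _
  rw [← hπ, locCoconeMap_comp]
  infer_instance

end

variable {X Y : CochainComplex (GrMod 𝒜) ℤ}

/-- The map on local cohomology. -/
noncomputable def localCohomologyMap (u : X ⟶ Y) : ∀ l : List (Σ d : ℤ, 𝒜 d),
    localCohomology l X ⟶ localCohomology l Y
  | [] => u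
  | p :: l => locCoconeMap p.2 (localCohomologyMap u l)

lemma localCohomologyMap_comp {Z : CochainComplex (GrMod 𝒜) ℤ} (u : X ⟶ Y) (v : Y ⟶ Z)
    (l : List (Σ d : ℤ, 𝒜 d)) :
    localCohomologyMap (u ≫ v) l = localCohomologyMap u l ≫ localCohomologyMap v l := by
  induction l with
  | nil => rfl
  | cons p l ih => exact (congrArg (locCoconeMap p.2) ih).trans (locCoconeMap_comp p.2 _ _)

lemma localCohomologyMap_zero (l : List (Σ d : ℤ, 𝒜 d)) :
    localCohomologyMap (0 : X ⟶ Y) l = 0 := by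
  induction l with
  | nil => rfl
  | cons p l ih => exact (congrArg (locCoconeMap p.2) ih).trans (locCoconeMap_zero p.2)

lemma quasiIso_localCohomologyMap (u : X ⟶ Y) [QuasiIso u] (l : List (Σ d : ℤ, 𝒜 d)) :
    QuasiIso (localCohomologyMap u l) := by
  induction l with
  | nil => assumption
  | cons p l ih =>
    have := ih
    exact quasiIso_locCoconeMap p.2 (localCohomologyMap u l)

lemma shortExact_localCohomology {S : ShortComplex (CochainComplex (GrMod 𝒜) ℤ)}
    (hS : S.ShortExact) (l : List (Σ d : ℤ, 𝒜 d)) :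
    (ShortComplex.mk (localCohomologyMap S.f l) (localCohomologyMap S.g l) (by
      rw [← localCohomologyMap_comp, S.zero, localCohomologyMap_zero])).ShortExact := by
  induction l with
  | nil => exact hS
  | cons p l ih => exact shortExact_locCocone p.2 ih _

lemma DerivedIso.localCohomology (l : List (Σ d : ℤ, 𝒜 d)) {M N : CochainComplex (GrMod 𝒜) ℤ}
    (h : DerivedIso M N) : DerivedIso (localCohomology l M) (GrMod.localCohomology l N) := by
  obtain ⟨Z, φ, ψ, _, _, _⟩ := h.exists_roof
  have := quasiIso_localCohomologyMap φ l
  have := quasiIso_localCohomologyMap ψ l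
  exact (of_quasiIso (localCohomologyMap φ l)).symm.trans (of_quasiIso (localCohomologyMap ψ l))

end GrMod

namespace ComplexLemmas

/-- This serves to show that multiplication by a homogeneous element on a complex induces
multiplication by that element on cohomology. -/
lemma homologyMap_natTrans {C : Type*} [Category* C] [Abelian C] {F : C ⥤ C} [F.Additive]
    [F.PreservesHomology] (τ : 𝟭 C ⟶ F) (S : ShortComplex C) (φ : S ⟶ S.map F)
    (h₁ : φ.τ₁ = τ.app S.X₁) (h₂ : φ.τ₂ = τ.app S.X₂) :
    ShortComplex.homologyMap φ ≫ (S.mapHomologyIso F).hom = τ.app S.homology := by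
  let h := S.leftHomologyData
  let γ : ShortComplex.LeftHomologyMapData φ h (h.map F) :=
    { φK := τ.app h.K
      φH := τ.app h.H
      commi := (τ.naturality h.i).symm.trans (congrArg (h.i ≫ ·) h₂.symm)
      commf' := by
        rw [ShortComplex.LeftHomologyData.map_f', h₁]
        exact τ.naturality h.f'
      commπ := τ.naturality h.π }
  have e : (S.mapHomologyIso F).hom =
      (h.map F).homologyIso.hom ≫ F.map h.homologyIso.inv := by
    rw [ShortComplex.LeftHomologyData.mapHomologyIso_eq h F]
    rfl
  rw [γ.homologyMap_eq, e, Category.assoc, Category.assoc]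
  refine (congrArg (h.homologyIso.hom ≫ γ.φH ≫ ·)
    (Iso.inv_hom_id_assoc (h.map F).homologyIso (F.map h.homologyIso.inv))).trans ?_
  have e2 : τ.app h.H ≫ F.map h.homologyIso.inv = h.homologyIso.inv ≫ τ.app S.homology :=
    (τ.naturality h.homologyIso.inv).symm
  refine (congrArg (h.homologyIso.hom ≫ ·) e2).trans ?_
  rw [Iso.hom_inv_id_assoc]

end ComplexLemmas

namespace GrMod

open CochainComplex CochainComplex.HomComplex ComplexLemmas

variable {R A : Type u} [CommRing R] [CommRing A] [Algebra R A]
    {𝒜 : ℤ → Submodule R A} [GradedAlgebra 𝒜]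

/-! ### Multiplication by a homogeneous element -/

/-- Multiplication by `a ∈ A_e` as a natural morphism `N ⟶ N(e)`. -/
def mulHom {e : ℤ} (a : 𝒜 e) : 𝟭 (GrMod 𝒜) ⟶ twist e where
  app N :=
    { f j := ModuleCat.ofHom (N.act (show e + j = e + j from rfl) a)
      map_act {i j k} h b x := N.act_comm h (show e + k = e + k from rfl)
        (show e + j = e + j from rfl) (show i + (e + j) = e + k by lia) b a x }
  naturality N N' φ := by
    ext j x
    exact (φ.map_act (show e + j = e + j from rfl) a x).symm

/-- Multiplication by `a ∈ A_e` on complexes. -/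
noncomputable def mulC {e : ℤ} (a : 𝒜 e) (X : CochainComplex (GrMod 𝒜) ℤ) : X ⟶ (twC e).obj X where
  f n := (mulHom a).app (X.X n)
  comm' n m _ := ((mulHom a).naturality (X.d n m)).symm

instance (e : ℤ) : (twist (𝒜 := 𝒜) e).PreservesHomology := by
  refine Functor.preservesHomology_of_map_exact _ (fun S hS => ?_)
  rw [exact_iff_forall] at hS ⊢
  exact fun j => hS (e + j)

/-- Cohomology commutes with weight shifts. -/
noncomputable def homologyTwistIso (e : ℤ) (X : CochainComplex (GrMod 𝒜) ℤ) (n : ℤ) :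
    ((twC e).obj X).homology n ≅ (twist e).obj (X.homology n) :=
  (X.sc n).mapHomologyIso (twist e)

lemma homologyMap_mulC {e : ℤ} (a : 𝒜 e) (X : CochainComplex (GrMod 𝒜) ℤ) (n : ℤ) :
    HomologicalComplex.homologyMap (mulC a X) n ≫ (homologyTwistIso e X n).hom =
      (mulHom a).app (X.homology n) :=
  homologyMap_natTrans (mulHom a) (X.sc n)
    ((HomologicalComplex.shortComplexFunctor _ _ n).map (mulC a X)) rfl rfl

/-! ### Localization commutes with weight shifts -/

section

variable {d : ℤ} (f : 𝒜 d) (e : ℤ)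

/-- `castW` as a linear map. -/
def castWHom (M : GrMod 𝒜) {i j : ℤ} (h : i = j) : M.X i →ₗ[R] M.X j where
  toFun := M.castW h
  map_add' := M.castW_add h
  map_smul' := M.castW_smul h

/-- The morphism `x ↦ x / f ^ n` from `M(e)(nd)` to `M_f(e)`. -/
noncomputable def twistLocι (M : GrMod 𝒜) (n : ℕ) :
    (twist ((n : ℤ) * d)).obj ((twist e).obj M) ⟶ (twist e).obj ((loc f).obj M) where
  f j := ModuleCat.ofHom ((((locι f n).app M).f (e + j)).hom ∘ₗ
    M.castWHom (show e + (n * d + j) = n * d + (e + j) by ring))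
  map_act {i j k} h a x := by
    have e1 : i + (e + (n * d + j)) = e + (n * d + k) := by lia
    have e2 : e + (n * d + k) = n * d + (e + k) := by ring
    have e3 : e + (n * d + j) = n * d + (e + j) := by ring
    have e4 : i + (n * d + (e + j)) = n * d + (e + k) := by lia
    have e5 : i + (e + j) = e + k := by lia
    have key (x : M.X (e + (n * d + j))) : (((locι f n).app M).f (e + k)).hom (M.castW e2 (M.act e1 a x)) =
        ((loc f).obj M).act e5 a ((((locι f n).app M).f (e + j)).hom (M.castW e3 x)) := by
      rw [castW_act]
      refine Eq.trans ?_ (((locι f n).app M).map_act e5 a (M.castW e3 x))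
      exact congrArg (fun t => (((locι f n).app M).f (e + k)).hom t)
        (act_castW M e3 e4 a x).symm
    exact key x

/-- The isomorphism `M(e)_f ⟶ M_f(e)`. -/
noncomputable def locTwist (M : GrMod 𝒜) :
    (loc f).obj ((twist e).obj M) ⟶ (twist e).obj ((loc f).obj M) :=
  locDesc f (twistLocι f e M) (fun n => hom_ext (fun j => ModuleCat.hom_ext
    (LinearMap.ext fun x => by
      have e1 : d + (e + (n * d + j)) = e + (((n + 1 : ℕ) : ℤ) * d + j) := by push_cast; ring
      have e2 : e + (((n + 1 : ℕ) : ℤ) * d + j) = ((n + 1 : ℕ) : ℤ) * d + (e + j) := by ring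
      have e3 : e + (n * d + j) = n * d + (e + j) := by ring
      have e4 : d + (n * d + (e + j)) = ((n + 1 : ℕ) : ℤ) * d + (e + j) := by push_cast; ring
      have key (x : M.X (e + (n * d + j))) :
          (((locι f (n + 1)).app M).f (e + j)).hom (M.castW e2 (M.act e1 f x)) =
          (((locι f n).app M).f (e + j)).hom (M.castW e3 x) := by
        rw [castW_act, ← locι_act f M n (M.castW e3 x) e4, act_castW]
      exact key x)))

lemma locTwist_apply (M : GrMod 𝒜) (n : ℕ) {j : ℤ} (x : M.X (e + (n * d + j))) :
    ((locTwist f e M).f j).hom ((((locι f n).app ((twist e).obj M)).f j).hom x) =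
      (((locι f n).app M).f (e + j)).hom
        (M.castW (show e + (n * d + j) = n * d + (e + j) by ring) x) :=
  locι_locDesc_apply f (M := (twist e).obj M) (twistLocι f e M) _ n x

lemma locTwist_bijective (M : GrMod 𝒜) (j : ℤ) :
    Function.Bijective ((locTwist f e M).f j).hom := by
  constructor
  · rw [injective_iff_map_eq_zero]
    intro y hy
    obtain ⟨n, x, rfl⟩ := exists_locι f _ y
    obtain ⟨m, hm⟩ := exists_act_pow_eq_zero f M n _ ((locTwist_apply f e M n x).symm.trans hy)
    have h : m * d + (n * d + j) = ((n + m : ℕ) : ℤ) * d + j := by push_cast; ring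
    refine (locι_act_pow f ((twist e).obj M) n m x h).symm.trans ?_
    have h1 := hm (e + (((n + m : ℕ) : ℤ) * d + j)) (by push_cast; ring)
    exact (congrArg (fun t => (((locι f (n + m)).app ((twist e).obj M)).f j).hom t)
      ((act_castW M _ _ _ x).symm.trans h1)).trans (map_zero _)
  · intro y
    obtain ⟨n, x, rfl⟩ := exists_locι f M y
    refine ⟨(((locι f n).app ((twist e).obj M)).f j).hom
      (M.castW (show n * d + (e + j) = e + (n * d + j) by ring) x), ?_⟩
    refine (locTwist_apply f e M n _).trans ?_
    rw [castW_castW, castW_rfl]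

lemma locTwist_naturality {M N : GrMod 𝒜} (u : M ⟶ N) :
    locTwist f e M ≫ (twist e).map ((loc f).map u) =
      (loc f).map ((twist e).map u) ≫ locTwist f e N := by
  refine hom_ext (fun j => ModuleCat.hom_ext (LinearMap.ext fun y => ?_))
  obtain ⟨n, x, rfl⟩ := exists_locι f _ y
  refine (congrArg (fun t => (((loc f).map u).f (e + j)).hom t) (locTwist_apply f e M n x)).trans ?_
  refine (map_locι f u n _).trans ?_
  refine Eq.trans ?_ (congrArg (fun t => ((locTwist f e N).f j).hom t)
    (map_locι f ((twist e).map u) n x)).symm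
  refine Eq.trans ?_ (locTwist_apply f e N n _).symm
  exact congrArg (fun t => (((locι f n).app N).f (e + j)).hom t) (map_castW u _ x)

lemma toLoc_locTwist (M : GrMod 𝒜) :
    (twist e).map ((toLoc f).app M) = (toLoc f).app ((twist e).obj M) ≫ locTwist f e M := by
  refine hom_ext (fun j => ModuleCat.hom_ext (LinearMap.ext fun x => ?_))
  refine Eq.trans ?_ (locTwist_apply f e M 0 (((toTwistZero (show ((0 : ℕ) : ℤ) * d = 0 by
    simp)).app ((twist e).obj M)).f j x)).symm
  exact congrArg (fun t => (((locι f 0).app M).f (e + j)).hom t)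
    (M.castW_act (show 0 + (e + j) = e + (((0 : ℕ) : ℤ) * d + j) by simp) (by simp) _ x).symm

lemma loc_mulHom {e : ℤ} (a : 𝒜 e) (M : GrMod 𝒜) :
    (loc f).map ((mulHom a).app M) ≫ locTwist f e M = (mulHom a).app ((loc f).obj M) := by
  refine hom_ext (fun j => ModuleCat.hom_ext (LinearMap.ext fun y => ?_))
  obtain ⟨n, x, rfl⟩ := exists_locι f _ y
  refine (congrArg (fun t => ((locTwist f e M).f j).hom t)
    (map_locι f ((mulHom a).app M) n x)).trans ?_
  refine (locTwist_apply f e M n _).trans ?_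
  refine (congrArg (fun t => (((locι f n).app M).f (e + j)).hom t)
    (M.castW_act (show e + (n * d + j) = e + (n * d + j) from rfl) _ a x)).trans ?_
  exact ((locι f n).app M).map_act (show e + j = e + j from rfl) a x

/-- `locTwist` for complexes. -/
noncomputable def locTwistC (X : CochainComplex (GrMod 𝒜) ℤ) :
    (locC f).obj ((twC e).obj X) ⟶ (twC e).obj ((locC f).obj X) where
  f n := locTwist f e (X.X n)
  comm' n m _ := locTwist_naturality f e (X.d n m)

lemma toLocC_locTwistC (X : CochainComplex (GrMod 𝒜) ℤ) :
    𝟙 _ ≫ (twC e).map (toLocC f X) = toLocC f ((twC e).obj X) ≫ locTwistC f e X :=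
  (Category.id_comp _).trans
    (HomologicalComplex.hom_ext _ _ (fun n => toLoc_locTwist f e (X.X n)))

/-- Local cohomology for one element commutes with weight shifts. -/
noncomputable def locCoconeTwist (X : CochainComplex (GrMod 𝒜) ℤ) :
    locCocone f ((twC e).obj X) ⟶ (twC e).obj (locCocone f X) :=
  coconeMapF (twist e) (𝟙 _) (locTwistC f e X) (toLocC_locTwistC f e X)

lemma coconeFst_twist (X : CochainComplex (GrMod 𝒜) ℤ) (p j : ℤ)
    (x : ((locCocone f ((twC e).obj X)).X p).X j) :
    coconeFst f X p (e + j) ((((locCoconeTwist f e X).f p).f j).hom x) =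
      coconeFst f ((twC e).obj X) p j x :=
  congrArg (fun t => (Hom.f (HomologicalComplex.Hom.f t p) j).hom x)
    (coconeMapF_fst (twist e) (𝟙 _) (locTwistC f e X) (toLocC_locTwistC f e X))

lemma coconeSnd_twist (X : CochainComplex (GrMod 𝒜) ℤ) {p q : ℤ} (hpq : p + -1 = q) (j : ℤ)
    (x : ((locCocone f ((twC e).obj X)).X p).X j) :
    coconeSnd f X hpq (e + j) ((((locCoconeTwist f e X).f p).f j).hom x) =
      ((locTwist f e (X.X q)).f j).hom (coconeSnd f ((twC e).obj X) hpq j x) := by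
  have h1 := Cochain.congr_v (coconeMapF_snd (twist e) (𝟙 _) (locTwistC f e X)
    (toLocC_locTwistC f e X)) p q hpq
  rw [Cochain.zero_cochain_comp_v, Cochain.comp_zero_cochain_v] at h1
  exact congrArg (fun t => (Hom.f t j).hom x) h1

lemma isIso_locCoconeTwist (X : CochainComplex (GrMod 𝒜) ℤ) : IsIso (locCoconeTwist f e X) := by
  refine isIso_of_bijective_f _ (fun p j => ⟨fun x y hxy => cocone_ext f rfl ?_ ?_, fun y => ?_⟩)
  · exact (coconeFst_twist f e X p j x).symm.trans
      ((congrArg (coconeFst f X p (e + j)) hxy).trans (coconeFst_twist f e X p j y))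
  · refine (locTwist_bijective f e _ j).1 ?_
    exact (coconeSnd_twist f e X rfl j x).symm.trans
      ((congrArg (coconeSnd f X rfl (e + j)) hxy).trans (coconeSnd_twist f e X rfl j y))
  · obtain ⟨b, hb⟩ := (locTwist_bijective f e _ j).2 (coconeSnd f X rfl (e + j) y)
    obtain ⟨x, hx, rfl⟩ := exists_cocone f (X := (twC e).obj X) rfl (coconeFst f X p (e + j) y) b
    exact ⟨x, cocone_ext f rfl ((coconeFst_twist f e X p j x).trans hx)
      ((coconeSnd_twist f e X rfl j x).trans hb)⟩

lemma locCoconeMap_mulC {e : ℤ} (a : 𝒜 e) (X : CochainComplex (GrMod 𝒜) ℤ) :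
    locCoconeMap f (mulC a X) ≫ locCoconeTwist f e X = mulC a (locCocone f X) := by
  refine hom_ext_apply (fun p j x => cocone_ext (X := X) f (j := e + j) rfl ?_ ?_)
  · refine (coconeFst_twist f e X p j _).trans ((coconeFst_map f (mulC a X) p j x).trans ?_)
    exact (coconeFst_act f (show e + j = e + j from rfl) a x).symm
  · refine (coconeSnd_twist f e X rfl j _).trans ((congrArg (fun t => ((locTwist f e _).f j).hom t)
      (coconeSnd_map f (mulC a X) rfl j x)).trans ?_)
    refine (congrArg (fun t => (Hom.f t j).hom (coconeSnd f X rfl j x))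
      (loc_mulHom f a (X.X _))).trans ?_
    exact (coconeSnd_act f rfl (show e + j = e + j from rfl) a x).symm

end

/-- Local cohomology commutes with weight shifts. -/
noncomputable def localCohomologyTwist (e : ℤ) (X : CochainComplex (GrMod 𝒜) ℤ) :
    ∀ l : List (Σ d : ℤ, 𝒜 d), localCohomology l ((twC e).obj X) ⟶
      (twC e).obj (localCohomology l X)
  | [] => 𝟙 _
  | p :: l => locCoconeMap p.2 (localCohomologyTwist e X l) ≫
      locCoconeTwist p.2 e (localCohomology l X)

lemma quasiIso_localCohomologyTwist (e : ℤ) (X : CochainComplex (GrMod 𝒜) ℤ)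
    (l : List (Σ d : ℤ, 𝒜 d)) : QuasiIso (localCohomologyTwist e X l) := by
  induction l with
  | nil => exact inferInstanceAs (QuasiIso (𝟙 ((twC e).obj X)))
  | cons p l ih =>
    have h1 := quasiIso_locCoconeMap p.2 (localCohomologyTwist e X l)
    have h2 := isIso_locCoconeTwist p.2 e (localCohomology l X)
    exact quasiIso_comp (locCoconeMap p.2 (localCohomologyTwist e X l))
      (locCoconeTwist p.2 e (localCohomology l X))

/-- Up to the comparison of `RΓ(X(e))` with `RΓ(X)(e)`, the map that `a` induces on local cohomology
is multiplication by `a`. Long exact sequences for the cone of `a` can then be read on `RΓ X`. -/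
lemma localCohomologyMap_mulC {e : ℤ} (a : 𝒜 e) (X : CochainComplex (GrMod 𝒜) ℤ)
    (l : List (Σ d : ℤ, 𝒜 d)) :
    localCohomologyMap (mulC a X) l ≫ localCohomologyTwist e X l =
      mulC a (localCohomology l X) := by
  induction l with
  | nil => exact Category.comp_id _
  | cons p l ih =>
    refine (Category.assoc _ _ _).symm.trans ?_
    refine (congrArg (· ≫ locCoconeTwist p.2 e (localCohomology l X))
      (locCoconeMap_comp p.2 _ _).symm).trans ?_
    refine (congrArg (fun t => locCoconeMap p.2 t ≫ locCoconeTwist p.2 e (localCohomology l X))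
      ih).trans ?_
    exact locCoconeMap_mulC p.2 a (localCohomology l X)

end GrMod

namespace GrMod

open CochainComplex CochainComplex.HomComplex ComplexLemmas

variable {R A : Type u} [CommRing R] [CommRing A] [Algebra R A]
    {𝒜 : ℤ → Submodule R A} [GradedAlgebra 𝒜]

/-! ### Graded submodules -/

/-- Graded submodules. -/
@[ext]
structure GrSub (M : GrMod 𝒜) where
  S : ∀ j, Submodule R (M.X j)
  act_mem : ∀ {i j k : ℤ} (h : i + j = k) (a : 𝒜 i) {x : M.X j}, x ∈ S j → M.act h a x ∈ S k

namespace GrSub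

instance (M : GrMod 𝒜) : PartialOrder (GrSub M) :=
  PartialOrder.lift GrSub.S (fun _ _ h => GrSub.ext h)

variable {M N : GrMod 𝒜}

/-- The preimage of a graded submodule. -/
def comap (φ : M ⟶ N) (T : GrSub N) : GrSub M where
  S j := (T.S j).comap (φ.f j).hom
  act_mem {i j k} h a x hx := by
    have := T.act_mem h a hx
    rwa [← φ.map_act] at this

/-- The image of a graded submodule. -/
def map (φ : M ⟶ N) (T : GrSub M) : GrSub N where
  S j := (T.S j).map (φ.f j).hom
  act_mem {i j k} h a x hx := by
    obtain ⟨y, hy, rfl⟩ := hx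
    exact ⟨M.act h a y, T.act_mem h a hy, φ.map_act h a y⟩

/-- The graded submodule generated by a list of homogeneous elements. -/
def span : List (Σ j : ℤ, M.X j) → GrSub M
  | [] => ⟨fun _ => ⊥, fun h a x hx => by
      rw [Submodule.mem_bot] at hx ⊢
      rw [hx, map_zero]⟩
  | p :: L =>
    { S j := LinearMap.range ((M.act (show j - p.1 + p.1 = j by lia)).flip p.2) ⊔ (span L).S j
      act_mem {i j k} h a x hx := by
        rw [Submodule.mem_sup] at hx ⊢
        obtain ⟨_, ⟨b, rfl⟩, z, hz, rfl⟩ := hx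
        refine ⟨_, ⟨⟨a * b, ?_⟩, rfl⟩, _, (span L).act_mem h a hz, ?_⟩
        · rw [show k - p.1 = i + (j - p.1) by lia]
          exact SetLike.mul_mem_graded a.2 b.2
        · rw [map_add]
          refine congrArg (· + _) (Eq.trans ?_ (M.mul_act (show j - p.1 + p.1 = j by lia) h a b p.2))
          exact M.act_congr (i := k - p.1) (i' := i + (j - p.1)) (by lia) (by lia) _ _ rfl p.2 }

lemma mem_span_cons {p : Σ j : ℤ, M.X j} {L : List (Σ j : ℤ, M.X j)} {j : ℤ} {x : M.X j} :
    x ∈ (span (p :: L)).S j ↔ ∃ a : 𝒜 (j - p.1), ∃ z ∈ (span L).S j,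
      M.act (show j - p.1 + p.1 = j by lia) a p.2 + z = x := by
  refine Submodule.mem_sup.trans ⟨?_, ?_⟩
  · rintro ⟨_, ⟨a, rfl⟩, z, hz, rfl⟩
    exact ⟨a, z, hz, rfl⟩
  · rintro ⟨a, z, hz, rfl⟩
    exact ⟨_, ⟨a, rfl⟩, z, hz, rfl⟩

lemma span_le_cons (p : Σ j : ℤ, M.X j) (L : List (Σ j : ℤ, M.X j)) : span L ≤ span (p :: L) :=
  fun _ _ hx => Submodule.mem_sup_right hx

lemma mem_span_head (p : Σ j : ℤ, M.X j) (L : List (Σ j : ℤ, M.X j)) :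
    p.2 ∈ (span (p :: L)).S p.1 := by
  refine Submodule.mem_sup_left ⟨⟨1, ?_⟩, ?_⟩
  · rw [sub_self]
    exact SetLike.GradedOne.one_mem
  · exact M.act_of_eq_one _ _ rfl _

lemma mem_span {p : Σ j : ℤ, M.X j} {L : List (Σ j : ℤ, M.X j)} (h : p ∈ L) :
    p.2 ∈ (span L).S p.1 := by
  induction L with
  | nil => simp at h
  | cons q L ih =>
    rcases List.mem_cons.1 h with rfl | h
    · exact mem_span_head p L
    · exact span_le_cons q L _ (ih h)

lemma map_mem_span (φ : M ⟶ N) {L : List (Σ j : ℤ, M.X j)} {j : ℤ} {x : M.X j}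
    (h : x ∈ (span L).S j) :
    (φ.f j).hom x ∈ (span (L.map fun p => (⟨p.1, (φ.f p.1).hom p.2⟩ : Σ j : ℤ, N.X j))).S j := by
  induction L generalizing x with
  | nil =>
    rw [(Submodule.mem_bot R).1 h, map_zero]
    exact zero_mem _
  | cons p L ih =>
    obtain ⟨a, z, hz, rfl⟩ := mem_span_cons.1 h
    exact mem_span_cons.2 ⟨a, _, ih hz, by rw [map_add, φ.map_act]⟩

end GrSub

/-- Noetherian graded modules. -/
def IsNoeth (M : GrMod 𝒜) : Prop := WellFoundedGT (GrSub M)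

/-- A graded submodule of the middle term is determined, among those comparable to it, by its
preimage on the left and its image on the right. -/
lemma isNoeth_of_exact {S : ShortComplex (GrMod 𝒜)} (hS : S.Exact) (h₁ : S.X₁.IsNoeth)
    (h₃ : S.X₃.IsNoeth) : S.X₂.IsNoeth := by
  have := h₁
  have := h₃
  unfold IsNoeth at *
  rw [exact_iff_forall] at hS
  have key {T T' : GrSub S.X₂} (h : T ≤ T') (h₁ : T'.comap S.f ≤ T.comap S.f)
      (h₂ : T'.map S.g ≤ T.map S.g) : T' ≤ T := by
    intro j x hx
    obtain ⟨x', hx', e⟩ := h₂ j ⟨x, hx, rfl⟩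
    obtain ⟨y, hy⟩ := hS j (x - x') (by rw [map_sub, e, sub_self])
    have h4 : y ∈ (T'.comap S.f).S j := by
      refine (congrArg (· ∈ T'.S j) hy).mpr ?_
      exact sub_mem hx (h j hx')
    have h5 : x - x' ∈ T.S j := (congrArg (· ∈ T.S j) hy).mp (h₁ j h4)
    have h6 := add_mem h5 hx'
    rwa [sub_add_cancel] at h6
  refine StrictMono.wellFoundedGT (β := GrSub S.X₁ × GrSub S.X₃)
    (f := fun T => (T.comap S.f, T.map S.g)) (fun T T' h => ?_)
  have hle : (T.comap S.f, T.map S.g) ≤ (T'.comap S.f, T'.map S.g) :=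
    ⟨fun j x hx => h.le j hx, fun j => Submodule.map_mono (h.le j)⟩
  exact lt_of_le_not_ge hle (fun h' => h.not_ge (key h.le h'.1 h'.2))

lemma IsNoeth.of_mono {M N : GrMod 𝒜} (φ : M ⟶ N) [Mono φ] (h : N.IsNoeth) : M.IsNoeth := by
  have := h
  unfold IsNoeth at *
  refine StrictMono.wellFoundedGT (f := GrSub.map φ) (Monotone.strictMono_of_injective
    (fun T T' h j => Submodule.map_mono (h j)) (fun T T' h => GrSub.ext (funext fun j => ?_)))
  have hφ : Function.Injective (φ.f j).hom :=
    (ModuleCat.mono_iff_injective _).1 (inferInstanceAs (Mono ((weight j).map φ)))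
  exact Submodule.map_injective_of_injective hφ (congrArg (fun t => t.S j) h)

lemma IsNoeth.of_epi {M N : GrMod 𝒜} (φ : M ⟶ N) [Epi φ] (h : M.IsNoeth) : N.IsNoeth := by
  have := h
  unfold IsNoeth at *
  refine StrictMono.wellFoundedGT (f := GrSub.comap φ) (Monotone.strictMono_of_injective
    (fun T T' h j x hx => h j hx) (fun T T' h => GrSub.ext (funext fun j => ?_)))
  exact Submodule.comap_injective_of_surjective (surjective_of_epi φ j)
    (congrArg (fun t => t.S j) h)

/-! ### Finitely generated graded modules over Noetherian graded rings -/

/-- The ideal of elements all of whose components lie in a graded submodule of `A(n)`. -/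
def GrSub.toIdeal {n : ℤ} (T : GrSub (free (𝒜 := 𝒜) n)) : Ideal A where
  carrier := {a | ∀ j, DirectSum.decompose 𝒜 a (n + j) ∈ T.S j}
  add_mem' {a b} ha hb j := by
    rw [DirectSum.decompose_add]
    exact add_mem (ha j) (hb j)
  zero_mem' j := by
    rw [DirectSum.decompose_zero]
    exact zero_mem (T.S j)
  smul_mem' c a ha := by
    induction c using DirectSum.Decomposition.inductionOn 𝒜 with
    | zero =>
      intro j
      rw [zero_smul, DirectSum.decompose_zero]
      exact zero_mem (T.S j)
    | homogeneous m =>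
      rename_i i
      intro j
      have h := T.act_mem (show i + (j - i) = j by lia) m (ha (j - i))
      refine (congrArg (· ∈ T.S j) (Subtype.ext ?_)).mp h
      refine (DirectSum.coe_decompose_mul_add_of_left_mem 𝒜 m.2 (b := a)
        (j := n + (j - i))).symm.trans ?_
      rw [show i + (n + (j - i)) = n + j by lia, smul_eq_mul]
    | add b c hb hc =>
      intro j
      rw [add_smul, DirectSum.decompose_add]
      exact add_mem (hb j) (hc j)

lemma GrSub.coe_mem_toIdeal {n j : ℤ} {T : GrSub (free (𝒜 := 𝒜) n)} {x : 𝒜 (n + j)} :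
    (x : A) ∈ T.toIdeal ↔ x ∈ T.S j := by
  constructor
  · intro h
    have h1 := h j
    rwa [DirectSum.decompose_coe, DirectSum.of_eq_same] at h1
  · intro h k
    rw [DirectSum.decompose_coe]
    by_cases hk : k = j
    · subst hk
      rwa [DirectSum.of_eq_same]
    · rw [DirectSum.of_eq_of_ne _ _ _ (by lia)]
      exact zero_mem (T.S k)

/-- Graded submodules of `A(n)` embed monotonically into the ideals of the ungraded ring `A`. -/
lemma isNoeth_free [IsNoetherianRing A] (n : ℤ) : (free (𝒜 := 𝒜) n).IsNoeth := by
  unfold IsNoeth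
  refine StrictMono.wellFoundedGT (f := GrSub.toIdeal (𝒜 := 𝒜) (n := n))
    (Monotone.strictMono_of_injective (fun T T' h a ha j => h j (ha j))
      (fun T T' h => GrSub.ext (funext fun j => Submodule.ext fun x => ?_)))
  exact GrSub.coe_mem_toIdeal.symm.trans ((Iff.of_eq (congrArg ((show 𝒜 (n + j) from x : A) ∈ ·) h)).trans
    GrSub.coe_mem_toIdeal)

/-- Induction on the number of generators: the first one is the image of a shift of `A`, and the
cokernel needs one generator fewer. -/
lemma isNoeth_of_span [IsNoetherianRing A] {M : GrMod 𝒜} (L : List (Σ j : ℤ, M.X j))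
    (h : ∀ j (x : M.X j), x ∈ (GrSub.span L).S j) : M.IsNoeth := by
  obtain ⟨n, hn⟩ : ∃ n, L.length = n := ⟨_, rfl⟩
  induction n generalizing M with
  | zero =>
    obtain rfl := List.length_eq_zero_iff.1 hn
    have (j : ℤ) : IsZero (M.X j) := by
      refine @ModuleCat.isZero_of_subsingleton _ _ _ ⟨fun x y => ?_⟩
      rw [(Submodule.mem_bot R).1 (h j x), (Submodule.mem_bot R).1 (h j y)]
    have : Mono (0 : M ⟶ free 0) := (isZero_of_weight this).mono _
    exact IsNoeth.of_mono (0 : M ⟶ free 0) (isNoeth_free 0)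
  | succ n ih =>
    obtain ⟨p, L, rfl⟩ := List.exists_cons_of_length_eq_add_one hn
    have hS : (ShortComplex.mk (freeHom p.2) (cokernel.π (freeHom p.2))
      (cokernel.condition _)).Exact := ShortComplex.exact_cokernel _
    refine isNoeth_of_exact hS (isNoeth_free _)
      (ih (L.map fun q => ⟨q.1, ((cokernel.π (freeHom p.2)).f q.1).hom q.2⟩) ?_ (by simpa using hn))
    intro j y
    obtain ⟨x, rfl⟩ := surjective_of_epi (cokernel.π (freeHom p.2)) j y
    obtain ⟨a, z, hz, rfl⟩ := GrSub.mem_span_cons.1 (h j x)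
    have h1 : ((cokernel.π (freeHom p.2)).f j).hom
        (M.act (show j - p.1 + p.1 = j by lia) a p.2) = 0 := by
      refine Eq.trans ?_ (congrArg (fun t => (Hom.f t j).hom
        (⟨a, mem_of_eq (show j - p.1 = -p.1 + j by lia) a⟩ : 𝒜 (-p.1 + j)))
        (cokernel.condition (freeHom p.2)))
      exact congrArg (fun t => ((cokernel.π (freeHom p.2)).f j).hom t)
        (M.act_congr _ (show -p.1 + j + p.1 = j by lia) a
          (⟨a, mem_of_eq (show j - p.1 = -p.1 + j by lia) a⟩ : 𝒜 (-p.1 + j)) rfl p.2)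
    rw [map_add, h1, zero_add]
    exact GrSub.map_mem_span _ hz

lemma isNoeth_of_fg [IsNoetherianRing A] {M : GrMod 𝒜} (h : M.FG) : M.IsNoeth := by
  obtain ⟨n, w, x, hx⟩ := h
  refine isNoeth_of_span (List.ofFn fun r => ⟨w r, x r⟩) (fun j y => ?_)
  obtain ⟨a, rfl⟩ := hx j y
  refine sum_mem (fun r _ => (GrSub.span _).act_mem _ _ ?_)
  exact GrSub.mem_span (p := ⟨w r, x r⟩) (List.mem_ofFn.2 ⟨r, rfl⟩)

/-- The predicate allows generators to be chosen among all homogeneous elements, or among those of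
one fixed weight; the first gives finite generation over `A`, the second finiteness over `R`. -/
lemma IsNoeth.exists_span {M : GrMod 𝒜} (h : M.IsNoeth) (P : (Σ j : ℤ, M.X j) → Prop) :
    ∃ L : List (Σ j : ℤ, M.X j), (∀ p ∈ L, P p) ∧
      ∀ p : (Σ j : ℤ, M.X j), P p → p.2 ∈ (GrSub.span L).S p.1 := by
  -- The order is reversed, so this minimum is a maximal span; adjoining another admissible element
  -- would enlarge it.
  obtain ⟨T, ⟨L, hL, rfl⟩, hT⟩ := h.wf.has_min
    {T | ∃ L : List (Σ j : ℤ, M.X j), (∀ p ∈ L, P p) ∧ GrSub.span L = T} ⟨_, [], by simp, rfl⟩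
  refine ⟨L, hL, fun p hp => ?_⟩
  by_contra hn
  refine hT (GrSub.span (p :: L)) ⟨_, by simpa using ⟨hp, hL⟩, rfl⟩ ?_
  exact lt_of_le_not_ge (GrSub.span_le_cons p L) (fun h => hn (h p.1 (GrSub.mem_span_head p L)))

lemma fg_of_span {M : GrMod 𝒜} (L : List (Σ j : ℤ, M.X j))
    (h : ∀ j (x : M.X j), x ∈ (GrSub.span L).S j) : M.FG := by
  refine ⟨L.length, fun r => (L.get r).1, fun r => (L.get r).2, fun j y => ?_⟩
  have hy := h j y
  clear h
  induction L generalizing y with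
  | nil => exact ⟨fun r => r.elim0, by simpa using (Submodule.mem_bot R).1 hy⟩
  | cons p L ih =>
    obtain ⟨a, z, hz, rfl⟩ := GrSub.mem_span_cons.1 hy
    obtain ⟨b, rfl⟩ := ih z hz
    refine ⟨Fin.cons (α := fun r => 𝒜 (j - ((p :: L).get r).1)) a b, ?_⟩
    exact (Fin.sum_univ_succ (n := L.length) (fun r => M.act (show j - ((p :: L).get r).1 +
      ((p :: L).get r).1 = j by lia) (Fin.cons (α := fun r => 𝒜 (j - ((p :: L).get r).1)) a b r)
        ((p :: L).get r).2)).symm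

lemma IsNoeth.fg {M : GrMod 𝒜} (h : M.IsNoeth) : M.FG := by
  obtain ⟨L, -, hL⟩ := h.exists_span (fun _ => True)
  exact fg_of_span L (fun j x => hL ⟨j, x⟩ trivial)

/-- The submodule generated by `M_j` is generated by finitely many elements of weight `j`, and their
span in weight `j` uses only coefficients from `A_0`, which is finite over `R`. -/
lemma IsNoeth.finite [Module.Finite R (𝒜 0)] {M : GrMod 𝒜} (h : M.IsNoeth) (j : ℤ) :
    Module.Finite R (M.X j) := by
  obtain ⟨L, hj, hL⟩ := h.exists_span (fun p => p.1 = j)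
  have key : ∀ L : List (Σ j : ℤ, M.X j), (∀ p ∈ L, p.1 = j) → ((GrSub.span L).S j).FG := by
    intro L hL
    induction L with
    | nil => exact Submodule.fg_bot
    | cons p L ih =>
      have h0 : j - p.1 = 0 := by rw [hL p (by simp), sub_self]
      have : Module.Finite R (𝒜 (j - p.1)) := by rw [h0]; infer_instance
      exact Submodule.FG.sup (Module.Finite.iff_fg.1 (Module.Finite.range _))
        (ih (fun q hq => hL q (List.mem_cons_of_mem _ hq)))
  have h1 : (GrSub.span L).S j = ⊤ := eq_top_iff.2 (fun x _ => hL ⟨j, x⟩ rfl)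
  exact ⟨h1 ▸ key L hj⟩

lemma FG.twist {M : GrMod 𝒜} (h : M.FG) (e : ℤ) : ((twist e).obj M).FG := by
  obtain ⟨n, w, x, hx⟩ := h
  refine ⟨n, fun r => w r - e, fun r => M.castW (show w r = e + (w r - e) by lia) (x r),
    fun j y => ?_⟩
  obtain ⟨a, ha⟩ := hx (e + j) y
  refine ⟨fun r => ⟨a r, mem_of_eq (by lia) (a r)⟩, ha.trans (Finset.sum_congr rfl fun r _ => ?_)⟩
  refine Eq.trans ?_ (M.act_castW (show w r = e + (w r - e) by lia)
    (show j - (w r - e) + (e + (w r - e)) = e + j by lia)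
    (⟨a r, mem_of_eq (by lia) (a r)⟩ : 𝒜 (j - (w r - e))) (x r)).symm
  exact M.act_congr _ _ (a r) (⟨a r, mem_of_eq (by lia) (a r)⟩ : 𝒜 (j - (w r - e))) rfl _

lemma isNoeth_homology [IsNoetherianRing A] {P : CochainComplex (GrMod 𝒜) ℤ} (n : ℤ)
    (h : (P.X n).IsNoeth) : (P.homology n).IsNoeth :=
  (h.of_mono (P.iCycles n)).of_epi (P.homologyπ n)

lemma isCoherent_of_fg [IsNoetherianRing A]
    {P : CochainComplex (GrMod 𝒜) ℤ} (hP : ∀ n, (P.X n).FG) : IsCoherent P :=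
  fun n => (isNoeth_homology n (isNoeth_of_fg (hP n))).fg

end GrMod

namespace GrMod

open CochainComplex CochainComplex.HomComplex ComplexLemmas

variable {R A : Type u} [CommRing R] [CommRing A] [Algebra R A]
    {𝒜 : ℤ → Submodule R A} [GradedAlgebra 𝒜]

/-! ### Annihilators and torsion -/

lemma zero_act (M : GrMod 𝒜) {i j k : ℤ} (h : i + j = k) (x : M.X j) :
    M.act h (0 : 𝒜 i) x = 0 := LinearMap.map_zero₂ _ _

lemma add_act (M : GrMod 𝒜) {i j k : ℤ} (h : i + j = k) (a b : 𝒜 i) (x : M.X j) :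
    M.act h (a + b) x = M.act h a x + M.act h b x := LinearMap.map_add₂ _ _ _ _

/-- The annihilator of a homogeneous element. -/
def ann {M : GrMod 𝒜} {j : ℤ} (x : M.X j) : Ideal A where
  carrier := {a | ∀ (i k : ℤ) (h : i + j = k), M.act h (DirectSum.decompose 𝒜 a i) x = 0}
  add_mem' {a b} ha hb i k h := by
    rw [DirectSum.decompose_add, DirectSum.add_apply, add_act, ha i k h, hb i k h, add_zero]
  zero_mem' i k h := by
    rw [DirectSum.decompose_zero]
    exact M.zero_act h x
  smul_mem' c a ha := by
    induction c using DirectSum.Decomposition.inductionOn 𝒜 with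
    | zero =>
      intro i k h
      rw [zero_smul, DirectSum.decompose_zero]
      exact M.zero_act h x
    | homogeneous m =>
      rename_i e
      intro i k h
      refine Eq.trans ?_ ((M.mul_act (show i - e + j = k - e by lia) (show e + (k - e) = k by lia)
        m (DirectSum.decompose 𝒜 a (i - e)) x).trans ?_)
      · refine M.act_congr (i := i) (i' := e + (i - e)) _ _ _ _ ?_ x
        refine Eq.trans ?_ (DirectSum.coe_decompose_mul_add_of_left_mem 𝒜 m.2 (b := a)
          (j := i - e))
        rw [smul_eq_mul, show e + (i - e) = i by lia]
      · rw [ha, map_zero]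
    | add b c hb hc =>
      intro i k h
      rw [add_smul, DirectSum.decompose_add, DirectSum.add_apply, add_act, hb i k h, hc i k h,
        add_zero]

lemma coe_mem_ann_iff {M : GrMod 𝒜} {i j k : ℤ} (h : i + j = k) (a : 𝒜 i) (x : M.X j) :
    (a : A) ∈ ann x ↔ M.act h a x = 0 := by
  constructor
  · intro ha
    have := ha i k h
    rwa [DirectSum.decompose_coe, DirectSum.of_eq_same] at this
  · intro ha i' k' h'
    rw [DirectSum.decompose_coe]
    by_cases hi : i' = i
    · subst hi
      obtain rfl : k = k' := by lia
      rwa [DirectSum.of_eq_same]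
    · rw [DirectSum.of_eq_of_ne _ _ _ hi]
      exact M.zero_act h' x

lemma mul_mem_ann_iff {M : GrMod 𝒜} {e i j k : ℤ} (h : i + j = k) (a : 𝒜 i) (b : 𝒜 e)
    (x : M.X j) : (b : A) * a ∈ ann x ↔ (b : A) ∈ ann (M.act h a x) := by
  rw [coe_mem_ann_iff (show e + k = e + k from rfl) b]
  refine (coe_mem_ann_iff (show e + i + j = e + k by lia)
    (⟨b * a, SetLike.mul_mem_graded b.2 a.2⟩ : 𝒜 (e + i)) x).trans ?_
  rw [M.mul_act h (show e + k = e + k from rfl)]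

/-- The graded piece containing a power of a homogeneous element. -/
def powA {d : ℤ} (t : 𝒜 d) (m : ℕ) : 𝒜 (m * d) :=
  ⟨t ^ m, by simpa using SetLike.pow_mem_graded m t.2⟩

lemma ann_le_map {M N : GrMod 𝒜} (φ : M ⟶ N) {j : ℤ} (x : M.X j) : ann x ≤ ann ((φ.f j).hom x) :=
  fun a ha i k h => by rw [← φ.map_act, ha, map_zero]

/-- Every homogeneous element is killed by a power of `t`. -/
def IsTorsion (M : GrMod 𝒜) (t : A) : Prop :=
  ∀ (j : ℤ) (x : M.X j), t ∈ (ann x).radical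

/-- Radicals of annihilators are ideals, so torsion for a list of generators is torsion for the
ideal. This permits changing generators without comparing Čech complexes. -/
lemma IsTorsion.of_mem_span {M : GrMod 𝒜} {l : List (Σ d : ℤ, 𝒜 d)}
    (h : ∀ p ∈ l, M.IsTorsion (p.2 : A)) {t : A} (ht : t ∈ idealOf l) : M.IsTorsion t := by
  intro j x
  have h1 : idealOf l ≤ (ann x).radical := by
    refine Ideal.span_le.2 ?_
    rintro _ ⟨p, hp, rfl⟩
    exact h p hp j x
  exact h1 ht

lemma isTorsion_of_exact {S : ShortComplex (GrMod 𝒜)} (hS : S.Exact) {d : ℤ} (t : 𝒜 d)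
    (h₁ : S.X₁.IsTorsion (t : A)) (h₃ : S.X₃.IsTorsion (t : A)) : S.X₂.IsTorsion (t : A) := by
  intro j x
  obtain ⟨m, hm⟩ := h₃ j ((S.g.f j).hom x)
  have hm' := (coe_mem_ann_iff (show m * d + j = m * d + j from rfl) (powA t m) _).1 hm
  rw [← S.g.map_act] at hm'
  obtain ⟨y, hy⟩ := (exact_iff_forall S).1 hS _ _ hm'
  obtain ⟨n, hn⟩ := h₁ _ y
  refine ⟨n + m, ?_⟩
  rw [pow_add]
  refine (mul_mem_ann_iff (show m * d + j = m * d + j from rfl) (powA t m) (powA t n) x).2 ?_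
  have h4 := ann_le_map S.f y hn
  exact (congrArg (fun z => (t : A) ^ n ∈ ann z) hy).mp h4

lemma IsTorsion.of_epi {M N : GrMod 𝒜} (φ : M ⟶ N) [Epi φ] {t : A} (h : M.IsTorsion t) :
    N.IsTorsion t := by
  intro j y
  obtain ⟨x, rfl⟩ := surjective_of_epi φ j y
  exact Ideal.radical_mono (ann_le_map φ x) (h j x)

lemma IsTorsion.twist {M : GrMod 𝒜} {d : ℤ} {t : 𝒜 d} (h : M.IsTorsion (t : A)) (e : ℤ) :
    ((twist e).obj M).IsTorsion (t : A) := by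
  intro j x
  obtain ⟨m, hm⟩ := h (e + j) x
  refine ⟨m, (coe_mem_ann_iff (M := (GrMod.twist e).obj M) (show m * d + j = m * d + j from rfl)
    (powA t m) x).2 ?_⟩
  exact (coe_mem_ann_iff (M := M) (show m * d + (e + j) = e + (m * d + j) by lia)
    (powA t m) x).1 hm

/-! ### Modules that vanish in large weights -/

/-- The weight components are finitely generated `R`-modules, and vanish in the weights `j` with
`s * j` large. -/
structure IsSmall (s : ℤ) (M : GrMod 𝒜) : Prop where
  finite (j : ℤ) : Module.Finite R (M.X j)
  exists_bound : ∃ b : ℤ, ∀ j, b ≤ s * j → ∀ x : M.X j, x = 0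

variable {s : ℤ}

/-- A torsion module is small as soon as the kernel of multiplication by the torsion element is a
quotient of a submodule of a small module. -/
lemma isSmall_of_torsion [IsNoetherianRing R] {K M : GrMod 𝒜} (hK : K.IsSmall s) (δ : K ⟶ M)
    {d : ℤ} (hd : 0 < s * d) (t : 𝒜 d) (ht : M.IsTorsion (t : A))
    (hδ : ∀ (j k : ℤ) (h : d + j = k) (x : M.X j), M.act h t x = 0 → ∃ y, (δ.f j).hom y = x) :
    M.IsSmall s := by
  obtain ⟨b, hb⟩ := hK.exists_bound
  -- Multiplication by `t` increases `s * j`, so `t x` stays in the range and is killed by a smaller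
  -- power of `t`. By induction `t x = 0`, so `x` comes from `K`, which vanishes there.
  have hM : ∀ j, b ≤ s * j → ∀ x : M.X j, x = 0 := by
    intro j hj x
    obtain ⟨m, hm⟩ := ht j x
    induction m generalizing j with
    | zero =>
      rw [pow_zero] at hm
      exact (M.one_act x).symm.trans ((coe_mem_ann_iff (zero_add j)
        (⟨1, SetLike.GradedOne.one_mem⟩ : 𝒜 0) x).1 hm)
    | succ m ih =>
      rw [pow_succ] at hm
      obtain ⟨y, rfl⟩ := hδ j (d + j) rfl x (ih (d + j) (by rw [mul_add]; lia) _
        ((mul_mem_ann_iff (show d + j = d + j from rfl) t (powA t m) x).1 hm))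
      rw [hb j hj y, map_zero]
  refine ⟨fun j => ?_, b, hM⟩
  -- Descending induction on `s * j`: the image of `t` on `M_j` lies in `M_{d+j}`, and its kernel
  -- lies in the image of `K_j`.
  have key : ∀ (n : ℕ) (j : ℤ), b ≤ s * j + n * (s * d) → Module.Finite R (M.X j) := by
    intro n
    induction n with
    | zero =>
      intro j hj
      have : Subsingleton (M.X j) := ⟨fun x y => by
        rw [hM j (by simpa using hj) x, hM j (by simpa using hj) y]⟩
      infer_instance
    | succ n ih =>
      intro j hj
      have h1 := ih (d + j) (by rw [mul_add]; push_cast at hj; linarith)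
      have h2 := hK.finite j
      have h3 : (LinearMap.range (δ.f j).hom).FG := Module.Finite.iff_fg.1 (Module.Finite.range _)
      exact ⟨Submodule.fg_of_fg_map_of_fg_inf_ker (M.act (show d + j = d + j from rfl) t)
        (IsNoetherian.noetherian _)
        (h3.of_le (fun x hx => hδ j (d + j) rfl x hx.2))⟩
  -- Every step increases `s * j` by `s * d ≥ 1`, so this number of steps passes the bound.
  refine key (b - s * j).toNat j ?_
  have h1 := Int.self_le_toNat (b - s * j)
  nlinarith [Int.natCast_nonneg (b - s * j).toNat]

/-- The ideal generated by the homogeneous elements whose weight has the sign of `s`. -/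
def idealSign (𝒜 : ℤ → Submodule R A) (s : ℤ) : Ideal A :=
  Ideal.span {a | ∃ d : ℤ, 0 < s * d ∧ a ∈ 𝒜 d}

/-- A list of homogeneous generators of `I⁺` or `I⁻` may contain elements of any weight. The
arguments on weights need generators of the right sign, which Noetherianity provides. -/
lemma exists_list_idealSign [IsNoetherianRing A] (s : ℤ) :
    ∃ g : List (Σ d : ℤ, 𝒜 d), (∀ p ∈ g, 0 < s * p.1) ∧ idealOf g = idealSign 𝒜 s := by
  obtain ⟨T, hT, hT'⟩ := (Submodule.fg_span_iff_fg_span_finset_subset _).1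
    (IsNoetherian.noetherian (idealSign 𝒜 s))
  choose d hd hd' using fun a : T => hT a.2
  refine ⟨T.attach.toList.map fun a => ⟨d a, a, hd' a⟩, ?_, ?_⟩
  · intro p hp
    obtain ⟨a, -, rfl⟩ := List.mem_map.1 hp
    exact hd a
  · refine Eq.trans ?_ hT'.symm
    refine congrArg Ideal.span (Set.ext fun a => ⟨?_, fun ha => ?_⟩)
    · rintro ⟨p, hp, rfl⟩
      obtain ⟨a, -, rfl⟩ := List.mem_map.1 hp
      exact a.2
    · exact ⟨_, List.mem_map.2 ⟨⟨a, ha⟩, by simp, rfl⟩, rfl⟩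

/-- In an expression of `a` through the generators the coefficients may be taken homogeneous. The
weights of the generators are bounded, so these coefficients have large weight too and lie in the
previous power. -/
lemma exists_le_pow (g : List (Σ d : ℤ, 𝒜 d)) (hg : idealOf g = idealSign 𝒜 s) (N : ℕ) :
    ∃ c : ℤ, ∀ i, c ≤ s * i → ∀ a : 𝒜 i, (a : A) ∈ idealSign 𝒜 s ^ N := by
  obtain ⟨D, hD⟩ := (g.map fun p => s * p.1).toFinset.exists_le
  have hD' (p) (hp : p ∈ g) : s * p.1 ≤ D :=
    hD _ (List.mem_toFinset.2 (List.mem_map.2 ⟨p, hp, rfl⟩))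
  induction N with
  | zero => exact ⟨0, fun _ _ _ => by simp⟩
  | succ N ih =>
    obtain ⟨c, hc⟩ := ih
    -- The `1` puts `a` into the ideal; `c + D` leaves weight at least `c` for a coefficient after a
    -- generator of weight at most `D` is split off. Weights are measured by `s * i`.
    refine ⟨max 1 (c + D), fun i hi a => ?_⟩
    have ha : (a : A) ∈ idealOf g := by
      rw [hg]
      exact Ideal.subset_span ⟨i, by lia, a.2⟩
    have key (b : A) (hb : b ∈ idealOf g) :
        (DirectSum.decompose 𝒜 b i : A) ∈ idealSign 𝒜 s ^ (N + 1) := by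
      refine Submodule.closure_induction (p := fun b _ => (DirectSum.decompose 𝒜 b i : A) ∈
        idealSign 𝒜 s ^ (N + 1)) ?_ ?_ ?_ hb
      · rw [DirectSum.decompose_zero]
        exact zero_mem _
      · intro x y _ _ hx hy
        rw [DirectSum.decompose_add]
        exact add_mem hx hy
      · rintro r _ ⟨p, hp, rfl⟩
        have h1 := DirectSum.coe_decompose_mul_add_of_right_mem 𝒜 p.2.2 (a := r) (i := i - p.1)
        rw [show i - p.1 + p.1 = i by lia] at h1
        rw [smul_eq_mul, h1, pow_succ]
        refine Ideal.mul_mem_mul (hc _ ?_ _) ?_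
        · have := hD' p hp
          rw [mul_sub]
          lia
        · rw [← hg]
          exact Ideal.subset_span ⟨p, hp, rfl⟩
    have h2 := key a ha
    rwa [DirectSum.decompose_coe, DirectSum.of_eq_same] at h2

/-- Finitely generated modules that are torsion with respect to the ideal generated by the elements
of positive (or negative) weight are small. -/
lemma isSmall_of_fg [IsNoetherianRing A] [Module.Finite R (𝒜 0)] {M : GrMod 𝒜} (hM : M.FG)
    (g : List (Σ d : ℤ, 𝒜 d)) (hg : idealOf g = idealSign 𝒜 s)
    (ht : ∀ p ∈ g, M.IsTorsion (p.2 : A)) : M.IsSmall s := by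
  refine ⟨(isNoeth_of_fg hM).finite, ?_⟩
  obtain ⟨n, w, x, hx⟩ := hM
  have h1 (r : Fin n) : ∃ c : ℤ, ∀ i, c ≤ s * i → ∀ a : 𝒜 i, (a : A) ∈ ann (x r) := by
    have h2 : idealSign 𝒜 s ≤ (ann (x r)).radical := by
      rw [← hg]
      refine Ideal.span_le.2 ?_
      rintro _ ⟨p, hp, rfl⟩
      exact ht p hp _ _
    -- The ideal is finitely generated, so a single power of it kills the generator `x r`; elements
    -- of large weight lie in that power.
    obtain ⟨N, hN⟩ := Ideal.exists_pow_le_of_le_radical_of_fg h2 (IsNoetherian.noetherian _)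
    obtain ⟨c, hc⟩ := exists_le_pow g hg N
    exact ⟨c, fun i hi a => hN (hc i hi a)⟩
  choose c hc using h1
  obtain ⟨b, hb⟩ := (Finset.univ.image fun r => c r + s * w r).exists_le
  refine ⟨b, fun j hj y => ?_⟩
  obtain ⟨a, rfl⟩ := hx j y
  refine Finset.sum_eq_zero (fun r _ => (coe_mem_ann_iff _ _ _).1 (hc r _ ?_ _))
  have := hb _ (Finset.mem_image_of_mem _ (Finset.mem_univ r))
  rw [mul_sub]
  lia

end GrMod

namespace GrMod

open CochainComplex CochainComplex.HomComplex ComplexLemmas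

variable {R A : Type u} [CommRing R] [CommRing A] [Algebra R A]
    {𝒜 : ℤ → Submodule R A} [GradedAlgebra 𝒜]

/-! ### Torsion and localization -/

section

variable {d : ℤ} (f : 𝒜 d)

lemma locι_castW (M : GrMod 𝒜) {n n' : ℕ} (hn : n = n') {j : ℤ} (x : M.X (n * d + j))
    (h : n * d + j = n' * d + j) :
    (((locι f n').app M).f j).hom (M.castW h x) = (((locι f n).app M).f j).hom x := by
  subst hn
  rw [castW_rfl]

lemma toLoc_eq (M : GrMod 𝒜) {j : ℤ} (x : M.X j) :
    (((toLoc f).app M).f j).hom x =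
      (((locι f 0).app M).f j).hom (M.castW (show j = ((0 : ℕ) : ℤ) * d + j by simp) x) := by
  have h : M.act (show 0 + j = ((0 : ℕ) : ℤ) * d + j by simp)
      (⟨1, SetLike.GradedOne.one_mem⟩ : 𝒜 0) x =
      M.castW (show j = ((0 : ℕ) : ℤ) * d + j by simp) x := by
    rw [← castW_act M (zero_add j), M.one_act]
  exact congrArg (fun t => (((locι f 0).app M).f j).hom t) h

lemma act_powA_locι (M : GrMod 𝒜) (n : ℕ) {j : ℤ} (x : M.X (n * d + j)) :
    ((loc f).obj M).act rfl (powA f n) ((((locι f n).app M).f j).hom x) =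
      (((toLoc f).app M).f (n * d + j)).hom x := by
  refine (((locι f n).app M).map_act rfl (powA f n) x).symm.trans ?_
  refine Eq.trans ?_ (toLoc_eq f M x).symm
  refine Eq.trans ?_ (locι_act_pow f M 0 n (j := n * d + j) _
    (show n * d + (((0 : ℕ) : ℤ) * d + (n * d + j)) = ((0 + n : ℕ) : ℤ) * d + (n * d + j) by
      push_cast; ring))
  refine (locι_castW f M (zero_add n).symm (j := n * d + j)
    (M.act (show n * d + (n * d + j) = n * d + (n * d + j) from rfl) (powA f n) x)
    (by push_cast; ring)).symm.trans ?_
  refine congrArg (fun t => (((locι f (0 + n)).app M).f (n * d + j)).hom t) ?_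
  rw [act_castW]
  exact castW_act M (show n * d + (n * d + j) = n * d + (n * d + j) from rfl) _ (powA f n) x

lemma toLoc_eq_zero_iff (M : GrMod 𝒜) {j : ℤ} (x : M.X j) :
    (((toLoc f).app M).f j).hom x = 0 ↔ (f : A) ∈ (ann x).radical := by
  constructor
  · intro h
    obtain ⟨m, hm⟩ := exists_act_pow_eq_zero f M 0 _ ((toLoc_eq f M x).symm.trans h)
    refine ⟨m, (coe_mem_ann_iff (show m * d + j = m * d + j from rfl) (powA f m) x).2 ?_⟩
    exact (act_castW M _ (show m * d + (((0 : ℕ) : ℤ) * d + j) = m * d + j by simp) _ x).symm.trans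
      (hm _ _)
  · rintro ⟨m, hm⟩
    have h1 := (coe_mem_ann_iff (show m * d + j = ((0 + m : ℕ) : ℤ) * d + j by simp)
      (powA f m) x).1 hm
    refine (toLoc_eq f M x).trans ((locι_act_pow f M 0 m _ (by simp)).symm.trans ?_)
    refine (congrArg (fun t => (((locι f (0 + m)).app M).f j).hom t) ?_).trans (map_zero _)
    rw [act_castW]
    exact h1

lemma isZero_of_forall {M : GrMod 𝒜} (h : ∀ j (x : M.X j), x = 0) : IsZero M := by
  rw [IsZero.iff_id_eq_zero]
  exact hom_ext (fun j => ModuleCat.hom_ext (LinearMap.ext fun x => (h j _).trans (h j _).symm))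

lemma eq_zero_of_isZero {M : GrMod 𝒜} (h : IsZero M) {j : ℤ} (x : M.X j) : x = 0 :=
  congrArg (fun t : M ⟶ M => (t.f j).hom x) ((IsZero.iff_id_eq_zero M).1 h)

lemma isZero_loc_iff (M : GrMod 𝒜) : IsZero ((loc f).obj M) ↔ M.IsTorsion (f : A) := by
  constructor
  · intro h j x
    exact (toLoc_eq_zero_iff f M x).1 (eq_zero_of_isZero h _)
  · intro h
    refine isZero_of_forall (fun j y => ?_)
    obtain ⟨n, x, rfl⟩ := exists_locι f M y
    obtain ⟨m, hm⟩ := h _ x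
    have h1 := (coe_mem_ann_iff (show m * d + (n * d + j) = ((n + m : ℕ) : ℤ) * d + j by
      push_cast; ring) (powA f m) x).1 hm
    refine (locι_act_pow f M n m x (by push_cast; ring)).symm.trans ?_
    exact (congrArg (fun t => (((locι f (n + m)).app M).f j).hom t) h1).trans (map_zero _)

/-- Localization is exact, so it commutes with cohomology, and `M_f = 0` means that `M` is
`f`-torsion. -/
lemma acyclic_locC_iff (X : CochainComplex (GrMod 𝒜) ℤ) :
    ((locC f).obj X).Acyclic ↔ ∀ n, (X.homology n).IsTorsion (f : A) := by
  refine forall_congr' (fun n => ?_)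
  rw [HomologicalComplex.exactAt_iff_isZero_homology, ← isZero_loc_iff]
  exact ((X.sc n).mapHomologyIso (loc f)).isZero_iff

/-- Localizing twice is localizing once: `(x / f^m) / f^n` is the image of `x / f^{n+m}`. -/
lemma isIso_loc_map_toLoc (M : GrMod 𝒜) : IsIso ((loc f).map ((toLoc f).app M)) := by
  refine isIso_of_weight _ (fun j => (ConcreteCategory.isIso_iff_bijective _).2 ⟨?_, ?_⟩)
  · refine (injective_iff_map_eq_zero (((loc f).map ((toLoc f).app M)).f j).hom).2 (fun y hy => ?_)
    obtain ⟨n, x, rfl⟩ := exists_locι f M y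
    obtain ⟨m, hm⟩ := exists_act_pow_eq_zero f _ n _ ((map_locι f ((toLoc f).app M) n x).symm.trans hy)
    have h1 := (((toLoc f).app M).map_act rfl (powA f m) x).trans (hm _ rfl)
    obtain ⟨m', hm'⟩ := (toLoc_eq_zero_iff f M _).1 h1
    have h2 := (coe_mem_ann_iff (show (m' + m : ℕ) * d + (n * d + j) =
      ((n + (m' + m) : ℕ) : ℤ) * d + j by push_cast; ring) (powA f (m' + m)) x).1 (by
        have := (mul_mem_ann_iff (show m * d + (n * d + j) = m * d + (n * d + j) from rfl)
          (powA f m) (powA f m') x).2 hm'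
        exact (congrArg (· ∈ ann x) (pow_add (f : A) m' m).symm).mp this)
    refine (locι_act_pow f M n (m' + m) x (by push_cast; ring)).symm.trans ?_
    exact (congrArg (fun t => (((locι f (n + (m' + m))).app M).f j).hom t) h2).trans (map_zero _)
  · intro z
    obtain ⟨n, y, rfl⟩ := exists_locι f _ z
    obtain ⟨m, x, rfl⟩ := exists_locι f M y
    refine ⟨(((locι f (n + m)).app M).f j).hom (M.castW (show m * d + (n * d + j) =
      ((n + m : ℕ) : ℤ) * d + j by push_cast; ring) x), ?_⟩
    refine (map_locι f ((toLoc f).app M) (n + m) _).trans ?_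
    refine Eq.trans ?_ (locι_act_pow f ((loc f).obj M) n m (j := j) _
      (show m * d + (n * d + j) = ((n + m : ℕ) : ℤ) * d + j by push_cast; ring))
    refine congrArg (fun t => (((locι f (n + m)).app ((loc f).obj M)).f j).hom t) ?_
    refine (map_castW ((toLoc f).app M) _ x).trans ?_
    refine (congrArg (castW _ _) (act_powA_locι f M m x).symm).trans ?_
    exact castW_act _ _ _ _ _

/-- Localizing the triangle of the cocone of `X → X_f` makes its second map invertible, so the first
term becomes zero. -/
lemma acyclic_locC_locCocone (X : CochainComplex (GrMod 𝒜) ℤ) :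
    ((locC f).obj (locCocone f X)).Acyclic := by
  have := (loc f).preservesFiniteLimits_of_preservesHomology
  have := (loc f).preservesFiniteColimits_of_preservesHomology
  have h1 := (loc f).mapDerivedCategory.map_distinguished _
    (DerivedCategory.mappingCocone_triangle_distinguished (toLocC f X))
  have h2 : IsIso ((loc f).mapDerivedCategory.map (DerivedCategory.Q.map (toLocC f X))) := by
    have h3 : IsIso ((locC f).map (toLocC f X)) := by
      have (n : ℤ) : IsIso (((locC f).map (toLocC f X)).f n) := isIso_loc_map_toLoc f (X.X n)
      exact HomologicalComplex.Hom.isIso_of_components _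
    exact (NatIso.isIso_map_iff (loc f).mapDerivedCategoryFactors (toLocC f X)).2
      (inferInstanceAs (IsIso (DerivedCategory.Q.map ((locC f).map (toLocC f X)))))
  have h4 := Pretriangulated.Triangle.isZero₁_of_isIso₂ _ h1 h2
  exact (isZero_Q_obj_iff _).1 (h4.of_iso ((loc f).mapDerivedCategoryFactors.app _).symm)

end

lemma IsTorsion.loc {M : GrMod 𝒜} {d e : ℤ} (f : 𝒜 d) {t : 𝒜 e} (h : M.IsTorsion (t : A)) :
    ((loc f).obj M).IsTorsion (t : A) := by
  intro j y
  obtain ⟨n, x, rfl⟩ := exists_locι f M y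
  obtain ⟨m, hm⟩ := h _ x
  refine ⟨m, (coe_mem_ann_iff (show m * e + j = m * e + j from rfl) (powA t m) _).2 ?_⟩
  have h1 := (coe_mem_ann_iff (show m * e + (n * d + j) = n * d + (m * e + j) by ring)
    (powA t m) x).1 hm
  exact (((locι f n).app M).map_act rfl (powA t m) x).symm.trans
    ((congrArg (fun t => (((locι f n).app M).f _).hom t) h1).trans (map_zero _))

/-- Localization at `f` preserves `t`-torsion, so torsion obtained for one element survives the
cocones for the others. -/
lemma acyclic_locC_locCocone_of_acyclic {d e : ℤ} (f : 𝒜 d) (t : 𝒜 e)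
    {X : CochainComplex (GrMod 𝒜) ℤ} (h : ((locC t).obj X).Acyclic) :
    ((locC t).obj (locCocone f X)).Acyclic := by
  have := (GrMod.loc t).preservesFiniteLimits_of_preservesHomology
  have := (GrMod.loc t).preservesFiniteColimits_of_preservesHomology
  have h1 := (GrMod.loc t).mapDerivedCategory.map_distinguished _
    (DerivedCategory.mappingCocone_triangle_distinguished (toLocC f X))
  have h2 (Y : CochainComplex (GrMod 𝒜) ℤ) (hY : ((locC t).obj Y).Acyclic) :
      IsZero ((GrMod.loc t).mapDerivedCategory.obj (DerivedCategory.Q.obj Y)) :=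
    ((isZero_Q_obj_iff _).2 hY).of_iso ((GrMod.loc t).mapDerivedCategoryFactors.app Y)
  have h3 : ((locC t).obj ((locC f).obj X)).Acyclic := by
    rw [acyclic_locC_iff] at h ⊢
    exact fun n => ((h n).loc f).of_epi ((X.sc n).mapHomologyIso (GrMod.loc f)).inv
  have h4 := Pretriangulated.Triangle.isZero₁_of_isZero₂₃ _ h1 (h2 _ h) (h2 _ h3)
  exact (isZero_Q_obj_iff _).1 (h4.of_iso ((GrMod.loc t).mapDerivedCategoryFactors.app _).symm)

/-- Local cohomology modules are torsion. -/
lemma isTorsion_homology_localCohomology (l : List (Σ d : ℤ, 𝒜 d))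
    (X : CochainComplex (GrMod 𝒜) ℤ) {p : Σ d : ℤ, 𝒜 d} (hp : p ∈ l) (n : ℤ) :
    ((localCohomology l X).homology n).IsTorsion (p.2 : A) := by
  refine (acyclic_locC_iff p.2 _).1 ?_ n
  induction l with
  | nil => simp at hp
  | cons q l ih =>
    rcases List.mem_cons.1 hp with rfl | hp
    · exact acyclic_locC_locCocone p.2 (localCohomology l X)
    · exact acyclic_locC_locCocone_of_acyclic q.2 p.2 (ih hp)

/-- Complexes with torsion cohomology agree with their local cohomology. -/
lemma exists_quasiIso_localCohomology (l : List (Σ d : ℤ, 𝒜 d))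
    (X : CochainComplex (GrMod 𝒜) ℤ)
    (h : ∀ p ∈ l, ∀ n, (X.homology n).IsTorsion (p.2 : A)) :
    ∃ φ : localCohomology l X ⟶ X, QuasiIso φ := by
  induction l with
  | nil => exact ⟨𝟙 X, inferInstanceAs (QuasiIso (𝟙 X))⟩
  | cons q l ih =>
    obtain ⟨φ, hφ⟩ := ih (fun p hp => h p (List.mem_cons_of_mem _ hp))
    have h1 : QuasiIso (mappingCocone.fst (toLocC q.2 (localCohomology l X))) := by
      refine quasiIso_locCocone_fst q.2 ((acyclic_locC_iff q.2 _).2 (fun n => ?_))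
      exact (h q List.mem_cons_self n).of_epi (inv (HomologicalComplex.homologyMap φ n))
    let ψ : localCohomology (q :: l) X ⟶ localCohomology l X :=
      mappingCocone.fst (toLocC q.2 (localCohomology l X))
    have : QuasiIso ψ := h1
    exact ⟨ψ ≫ φ, inferInstance⟩

end GrMod

namespace GrMod

open CochainComplex CochainComplex.HomComplex ComplexLemmas

variable {R A : Type u} [CommRing R] [CommRing A] [Algebra R A]
    {𝒜 : ℤ → Submodule R A} [GradedAlgebra 𝒜]

/-! ### Local cohomology of coherent complexes -/

section

variable {d : ℤ} {a : 𝒜 d}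

lemma map_eq_zero_iff_act_eq_zero {M N : GrMod 𝒜} {u : M ⟶ N} {ψ : N ⟶ (twist d).obj M} [IsIso ψ]
    (h : u ≫ ψ = (mulHom a).app M) {j : ℤ} (x : M.X j) :
    (u.f j).hom x = 0 ↔ M.act (rfl : d + j = d + j) a x = 0 := by
  have h1 : (ψ.f j).hom ((u.f j).hom x) = M.act (rfl : d + j = d + j) a x :=
    congrArg (fun t => (Hom.f t j).hom x) h
  have h2 (y : N.X j) : ((inv ψ).f j).hom ((ψ.f j).hom y) = y :=
    congrArg (fun t => (Hom.f t j).hom y) (IsIso.hom_inv_id ψ)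
  constructor
  · intro hx
    exact h1.symm.trans ((congrArg (ψ.f j).hom hx).trans (map_zero _))
  · intro hx
    exact (h2 _).symm.trans ((congrArg ((inv ψ).f j).hom (h1.trans hx)).trans (map_zero _))

lemma exists_map_eq_act {M N : GrMod 𝒜} {u : M ⟶ N} {ψ : N ⟶ (twist d).obj M} [IsIso ψ]
    (h : u ≫ ψ = (mulHom a).app M) {j : ℤ} (y : N.X j) :
    ∃ x, (u.f (d + j)).hom x = N.act (rfl : d + j = d + j) a y := by
  have h2 (k : ℤ) (y : N.X k) : ((inv ψ).f k).hom ((ψ.f k).hom y) = y :=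
    congrArg (fun t => (Hom.f t k).hom y) (IsIso.hom_inv_id ψ)
  let x : M.X (d + j) := (ψ.f j).hom y
  have h1 : (ψ.f (d + j)).hom ((u.f (d + j)).hom x) = M.act rfl a x :=
    congrArg (fun t => (Hom.f t (d + j)).hom x) h
  refine ⟨x, (h2 _ _).symm.trans ((congrArg ((inv ψ).f (d + j)).hom ?_).trans (h2 _ _))⟩
  exact h1.trans (ψ.map_act rfl a y).symm

/-- Here `i` is a monic replacement of multiplication by `a`. Its map on cohomology is
multiplication by `a` up to an isomorphism, which is all that is read off the long exact sequence.
-/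
lemma exists_homologyMap_comp_eq_mulHom {X Y : CochainComplex (GrMod 𝒜) ℤ} {i : X ⟶ Y}
    {π : Y ⟶ (twC d).obj X} [QuasiIso π] (h : i ≫ π = mulC a X) (n : ℤ) :
    ∃ ψ : Y.homology n ⟶ (twist d).obj (X.homology n), IsIso ψ ∧
      HomologicalComplex.homologyMap i n ≫ ψ = (mulHom a).app (X.homology n) := by
  refine ⟨HomologicalComplex.homologyMap π n ≫ (homologyTwistIso d X n).hom, inferInstance, ?_⟩
  rw [← homologyMap_mulC, ← h, HomologicalComplex.homologyMap_comp, Category.assoc]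

variable {S : ShortComplex (CochainComplex (GrMod 𝒜) ℤ)} (hS : S.ShortExact)
  {π : S.X₂ ⟶ (twC d).obj S.X₁} [QuasiIso π] (h : S.f ≫ π = mulC a S.X₁)

include hS h

lemma isNoeth_homology_X₃ [IsNoetherianRing A] (hX : ∀ n, (S.X₁.homology n).IsNoeth) (n : ℤ) :
    (S.X₃.homology n).IsNoeth := by
  obtain ⟨ψ, _, -⟩ := exists_homologyMap_comp_eq_mulHom h n
  exact isNoeth_of_exact (hS.homology_exact₃ n (n + 1) (by simp))
    ((isNoeth_of_fg ((hX n).fg.twist d)).of_mono ψ) (hX (n + 1))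

lemma isTorsion_homology_X₃ {e : ℤ} {t : 𝒜 e} (hX : ∀ n, (S.X₁.homology n).IsTorsion (t : A))
    (n : ℤ) : (S.X₃.homology n).IsTorsion (t : A) := by
  obtain ⟨ψ, _, -⟩ := exists_homologyMap_comp_eq_mulHom h n
  exact isTorsion_of_exact (hS.homology_exact₃ n (n + 1) (by simp)) t
    (((hX n).twist d).of_epi (inv ψ)) (hX (n + 1))

/-- `H^n` of the cone lies between a cokernel and a kernel of multiplication by `a`, and `a`
annihilates both; hence `a²` annihilates it. -/
lemma isTorsion_homology_X₃_self (n : ℤ) : (S.X₃.homology n).IsTorsion (a : A) := by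
  intro j z
  obtain ⟨ψ, _, hψ⟩ := exists_homologyMap_comp_eq_mulHom h n
  obtain ⟨ψ', _, hψ'⟩ := exists_homologyMap_comp_eq_mulHom h (n + 1)
  have hij : (ComplexShape.up ℤ).Rel n (n + 1) := by simp
  have w : HomologicalComplex.homologyMap S.f n ≫ HomologicalComplex.homologyMap S.g n = 0 := by
    rw [← HomologicalComplex.homologyMap_comp, S.zero, HomologicalComplex.homologyMap_zero]
  have h1 : (((hS.δ n (n + 1) hij)).f (d + j)).hom
      ((S.X₃.homology n).act (rfl : d + j = d + j) a z) = 0 :=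
    ((hS.δ n (n + 1) hij).map_act _ _ _).trans ((map_eq_zero_iff_act_eq_zero hψ' _).1
      (congrArg (fun t => (Hom.f t j).hom z) (hS.δ_comp n (n + 1) hij)))
  obtain ⟨y, hy⟩ := (exact_iff_forall _).1 (hS.homology_exact₃ n (n + 1) hij) _ _ h1
  obtain ⟨x, hx⟩ := exists_map_eq_act hψ y
  have h2 : (S.X₃.homology n).act (rfl : d + (d + j) = d + (d + j)) a
      ((S.X₃.homology n).act (rfl : d + j = d + j) a z) = 0 := by
    refine (congrArg ((S.X₃.homology n).act rfl a) hy).symm.trans ?_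
    refine ((HomologicalComplex.homologyMap S.g n).map_act rfl a y).symm.trans ?_
    refine (congrArg ((HomologicalComplex.homologyMap S.g n).f (d + (d + j))).hom hx).symm.trans ?_
    exact congrArg (fun t => (Hom.f t (d + (d + j))).hom x) w
  refine ⟨2, ?_⟩
  rw [pow_two]
  exact (mul_mem_ann_iff rfl a a z).2 ((coe_mem_ann_iff rfl a _).2 h2)

end

variable [IsNoetherianRing R] [IsNoetherianRing A] [Module.Finite R (𝒜 0)] {s : ℤ}

/-- The list `r` holds the generators whose action on the cohomology of `X` is not yet known to be
torsion. The induction replaces `X` by the cone of the first of them, and smallness returns to `X`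
through the long exact sequence of local cohomology. -/
lemma isSmall_localCohomology_of_torsion {f g : List (Σ d : ℤ, 𝒜 d)}
    (hf : idealOf f = idealSign 𝒜 s) (hg : idealOf g = idealSign 𝒜 s)
    (hgs : ∀ p ∈ g, 0 < s * p.1) (r : List (Σ d : ℤ, 𝒜 d)) (hr : r ⊆ g)
    (X : CochainComplex (GrMod 𝒜) ℤ) (hX : ∀ n, (X.homology n).IsNoeth)
    (ht : ∀ p ∈ g, p ∈ r ∨ ∀ n, (X.homology n).IsTorsion (p.2 : A)) (n : ℤ) :
    ((localCohomology f X).homology n).IsSmall s := by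
  induction r generalizing X n with
  | nil =>
    have h1 (n : ℤ) (p) (hp : p ∈ g) : (X.homology n).IsTorsion (p.2 : A) :=
      ((ht p hp).resolve_left (by simp)) n
    -- All of `g` acts in a torsion way, hence so does every element of `f`, as both generate the
    -- same ideal. Thus `RΓ X` agrees with `X`.
    obtain ⟨φ, _⟩ := exists_quasiIso_localCohomology f X (fun p hp n =>
      IsTorsion.of_mem_span (h1 n) (by rw [hg, ← hf]; exact Ideal.subset_span ⟨p, hp, rfl⟩))
    refine isSmall_of_fg ((hX n).of_epi (inv (HomologicalComplex.homologyMap φ n))).fg g hg ?_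
    exact fun p hp => (h1 n p hp).of_epi (inv (HomologicalComplex.homologyMap φ n))
  | cons q r ih =>
    obtain ⟨hq, hr⟩ := List.cons_subset.1 hr
    -- `Z` is a model of the cone of `q : X → X(q.1)`. Its cohomology is still Noetherian, earlier
    -- torsion persists, and `q` has become torsion.
    obtain ⟨Y, Z, i, p, w, π, hS, hπ, h, -⟩ := exists_shortExact (mulC q.2 X)
    have hZ := ih hr Z (isNoeth_homology_X₃ hS h hX) (fun t htg => by
      rcases ht t htg with hm | hm
      · rcases List.mem_cons.1 hm with rfl | hm
        · exact Or.inr (isTorsion_homology_X₃_self hS h)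
        · exact Or.inl hm
      · exact Or.inr (isTorsion_homology_X₃ hS h hm))
    have hS' := shortExact_localCohomology hS f
    have : QuasiIso (localCohomologyMap π f) := quasiIso_localCohomologyMap π f
    have : QuasiIso (localCohomologyTwist q.1 X f) := quasiIso_localCohomologyTwist q.1 X f
    have h' : localCohomologyMap i f ≫ localCohomologyMap π f ≫ localCohomologyTwist q.1 X f =
        mulC q.2 (localCohomology f X) := by
      rw [← Category.assoc, ← localCohomologyMap_comp, h, localCohomologyMap_mulC]
    obtain ⟨ψ, _, hψ⟩ := exists_homologyMap_comp_eq_mulHom h' n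
    have hij : (ComplexShape.up ℤ).Rel (n - 1) n := by simp
    -- The connecting map from `H^{n-1}(RΓ Z)` has the kernel of `q` on `H^n(RΓ X)` as its image,
    -- and `H^n(RΓ X)` is torsion for every element of the ideal.
    refine isSmall_of_torsion (hZ (n - 1)) (hS'.δ (n - 1) n hij) (hgs q hq) q.2
      (IsTorsion.of_mem_span (l := f)
        (fun p hp => isTorsion_homology_localCohomology f X hp n) ?_) ?_
    · rw [hf, ← hg]
      exact Ideal.subset_span ⟨q, hq, rfl⟩
    · rintro j _ rfl x hx
      exact (exact_iff_forall _).1 (hS'.homology_exact₁ (n - 1) n hij) j x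
        ((map_eq_zero_iff_act_eq_zero hψ x).2 hx)

/-- The local cohomology of a coherent complex is locally coherent. -/
lemma isLocallyCoherent_localCohomology {f : List (Σ d : ℤ, 𝒜 d)}
    (hf : idealOf f = idealSign 𝒜 s) {N : CochainComplex (GrMod 𝒜) ℤ} (hN : IsCoherent N) :
    IsLocallyCoherent (localCohomology f N) := by
  obtain ⟨g, hgs, hg⟩ := exists_list_idealSign (𝒜 := 𝒜) s
  exact fun n => (isSmall_localCohomology_of_torsion hf hg hgs g (List.Subset.refl g) N
    (fun n => isNoeth_of_fg (hN n)) (fun p hp => Or.inl hp) n).finite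

lemma isLocallyCoherent_localCohomology_pos (f : List (Σ d : ℤ, 𝒜 d))
    (hf : idealOf f = idealPos 𝒜) {N : CochainComplex (GrMod 𝒜) ℤ} (hN : IsCoherent N) :
    IsLocallyCoherent (localCohomology f N) :=
  isLocallyCoherent_localCohomology (s := 1) (hf.trans (by simp [idealPos, idealSign])) hN

lemma isLocallyCoherent_localCohomology_neg (f : List (Σ d : ℤ, 𝒜 d))
    (hf : idealOf f = idealNeg 𝒜) {N : CochainComplex (GrMod 𝒜) ℤ} (hN : IsCoherent N) :
    IsLocallyCoherent (localCohomology f N) :=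
  isLocallyCoherent_localCohomology (s := -1) (hf.trans (by simp [idealNeg, idealSign])) hN

end GrMod

namespace GrMod

open CochainComplex CochainComplex.HomComplex ComplexLemmas

variable {R A : Type u} [CommRing R] [CommRing A] [Algebra R A]
    {𝒜 : ℤ → Submodule R A} [GradedAlgebra 𝒜]

/-! ### The duality -/

variable [IsNoetherianRing R] [IsNoetherianRing A] [Module.Finite R (𝒜 0)]

/-- The second conclusion accompanies the isomorphism because comparing vanishing in weight `0`
requires biduality for the complex that is dualized. -/
theorem duality {ω : DerivedCategory (ModuleCat.{u} R)} (hω : IsDualizing ω)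
    (f g : List (Σ d : ℤ, 𝒜 d)) (hg : idealOf g = idealNeg 𝒜)
    (Ψ : DerivedIso ((localCohomology f (unit 𝒜))⟦(1 : ℤ)⟧)
      (dualY hω (localCohomology g (unit 𝒜))))
    (M N : CochainComplex (GrMod 𝒜) ℤ) (hM : IsPerfect M)
    (hN : IsLocallyCoherent (localCohomology f N)) :
    DerivedIso (gradedRHom N (localCohomology g M))
      ((dualY hω (gradedRHom M (localCohomology f N)))⟦(-1 : ℤ)⟧) ∧
    IsLocallyCoherent (gradedRHom M (localCohomology f N)) := by
  obtain ⟨P, ⟨a, b, _, _⟩, hP, ePM⟩ := hM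
  obtain ⟨S, hS⟩ := exists_finset_isZero P a b
  have hPK : P.IsKProjective := by
    have (n : ℤ) : Projective (P.X n) := (hP n).1
    exact isKProjective_of_projective P b
  unfold gradedRHom
  have hQM := kProjRes_spec M
  have hQN := kProjRes_spec N
  generalize kProjRes M = Q' at hQM ⊢
  generalize kProjRes N = Q at hQN ⊢
  obtain ⟨_, eQ'⟩ := hQM
  obtain ⟨_, eQ⟩ := hQN
  have e₀ (Y : CochainComplex (GrMod 𝒜) ℤ) : DerivedIso (gradedHom Q' Y) (gradedHom P Y) :=
    DerivedIso.gradedHom_left (eQ'.trans ePM.symm) Y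
  refine ⟨?_, isLocallyCoherent_of_derivedIso (e₀ _).symm (isLocallyCoherent_gradedHom
    (a := a) (b := b) hP hN)⟩
  have hE : hω.exists_injective.choose.IsKInjective := hω.isKInjective
  have hPg : IsLocallyCoherent (localCohomology g P) :=
    isLocallyCoherent_localCohomology_neg g hg (isCoherent_of_fg (fun n => (hP n).2))
  have hDD := derivedIso_dualY_dualY hω hPg
  unfold dualY at Ψ hDD ⊢
  -- The properties of `ω` beyond K-injectivity of `E` have been used up in `hDD`; the rest is
  -- formal.
  generalize hω.exists_injective.choose = E at Ψ hDD hE ⊢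
  -- contravariant comparison on the `f` side
  obtain ⟨Ξ', hΞ⟩ := exists_gradedHom_localCohomology_iso f (homDual E (dualC P))
  have hvi (X : CochainComplex (GrMod 𝒜) ℤ) :
      DerivedIso (homDual E (gradedHom P X)) (gradedHom X (homDual E (dualC P))) := by
    have := isIso_homDualGradedHom (E := E) (X := X) hS hP
    exact DerivedIso.of_iso (asIso (homDualGradedHom E P X))
  -- Contraction followed by the adjunction for `f`: the same `Ξ'` works for every `X`.
  have hD (X : CochainComplex (GrMod 𝒜) ℤ) :
      DerivedIso (homDual E (gradedHom P (localCohomology f X))) (gradedHom X Ξ') :=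
    (hvi _).trans (DerivedIso.of_iso (hΞ X).some)
  -- the dual of `RΓ_{I⁻}(P)`
  obtain ⟨J, hJ⟩ := exists_homDual_iso (𝒜 := 𝒜) E
  obtain ⟨J', hJ'⟩ := exists_gradedHom_localCohomology_iso g J
  have eJ (X : CochainComplex (GrMod 𝒜) ℤ) :
      DerivedIso (homDual E (localCohomology g X)) (gradedHom X J') :=
    DerivedIso.of_iso ((hJ _).some ≪≫ (hJ' X).some)
  have eU (X : CochainComplex (GrMod 𝒜) ℤ) : DerivedIso (gradedHom (unit 𝒜) X) X := by
    exact (DerivedIso.of_iso (asIso (toGradedHomUnit X))).symm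
  -- Evaluation at `X = A` identifies the representing object, and `Ψ` enters here.
  have eJU : DerivedIso J' ((localCohomology f (unit 𝒜))⟦(1 : ℤ)⟧) :=
    ((eU J').symm.trans (eJ (unit 𝒜)).symm).trans Ψ.symm
  have eDP : DerivedIso (homDual E (localCohomology g P))
      ((gradedHom P (localCohomology f (unit 𝒜)))⟦(1 : ℤ)⟧) :=
    ((eJ P).trans (DerivedIso.gradedHom_right P eJU)).trans
      (DerivedIso.of_iso (asIso (gradedHomShift P (localCohomology f (unit 𝒜)) 1)))
  -- The dual of `RΓ_g P` is `Hom(P, RΓ_f(A)[1])`. Dualizing again gives `Hom(RΓ_f(A)[1], D(P^∨))`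
  -- by contraction; the shift leaves the first argument as `[-1]`, and the adjunction at `X = A`
  -- yields `Ξ'`.
  have eDDP : DerivedIso (localCohomology g P) (Ξ'⟦(-1 : ℤ)⟧) := by
    refine (hDD.trans (DerivedIso.homDual E ((eJ P).trans (DerivedIso.gradedHom_right P eJU)))).trans ?_
    refine (hvi _).trans ((DerivedIso.of_iso (asIso (gradedHomShiftLeft _ _ 1))).trans ?_)
    exact DerivedIso.shift ((DerivedIso.of_iso (hΞ _).some).trans (eU _)) (-1)
  have eM : DerivedIso (localCohomology g M) (Ξ'⟦(-1 : ℤ)⟧) :=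
    (DerivedIso.localCohomology g ePM.symm).trans eDDP
  have eL := (DerivedIso.gradedHom_right Q eM).trans
    (DerivedIso.of_iso (asIso (gradedHomShift Q Ξ' (-1))))
  refine eL.trans (DerivedIso.shift ?_ _)
  -- What `Ξ'` represents is read at the resolution `Q` of `N`; then `P` and `Q` are exchanged for
  -- the chosen resolution of `M` and for `N`.
  refine (DerivedIso.homDual E ((e₀ _).trans (DerivedIso.gradedHom_right P
    (DerivedIso.localCohomology f eQ.symm)))).trans (hD Q) |>.symm

end GrMod

/-- On affine `Y = Spec R`, a Noetherian `ℤ`-graded ring `A` with a homological flop duality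
`RΓ_{I⁺}(A)[1] ≅ 𝔻_Y(RΓ_{I⁻}(A))`. -/
theorem proposition6p3 {R A : Type u} [CommRing R] [IsNoetherianRing R]
    [CommRing A] [IsNoetherianRing A] [Algebra R A]
    (𝒜 : ℤ → Submodule R A) [GradedAlgebra 𝒜] [Module.Finite R (𝒜 0)]
    (ω : DerivedCategory (ModuleCat.{u} R)) (hω : GrMod.IsDualizing ω)
    (f g : List (Σ d : ℤ, 𝒜 d))
    (hf : GrMod.idealOf f = GrMod.idealPos 𝒜) (hg : GrMod.idealOf g = GrMod.idealNeg 𝒜)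
    (Ψ : GrMod.DerivedIso ((GrMod.localCohomology f (GrMod.unit 𝒜))⟦(1 : ℤ)⟧)
      (GrMod.dualY hω (GrMod.localCohomology g (GrMod.unit 𝒜)))) :
    (∀ M N : CochainComplex (GrMod 𝒜) ℤ, GrMod.IsPerfect M →
      GrMod.IsLocallyCoherent (GrMod.localCohomology f N) →
        GrMod.DerivedIso (GrMod.gradedRHom N (GrMod.localCohomology g M))
          ((GrMod.dualY hω (GrMod.gradedRHom M (GrMod.localCohomology f N)))⟦(-1 : ℤ)⟧) ∧
        (IsZero (DerivedCategory.Q.obj (GrMod.RHom M (GrMod.localCohomology f N))) ↔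
          IsZero (DerivedCategory.Q.obj (GrMod.RHom N (GrMod.localCohomology g M))))) ∧
    (∀ N : CochainComplex (GrMod 𝒜) ℤ, GrMod.IsCoherent N →
      GrMod.IsLocallyCoherent (GrMod.localCohomology f N)) := by
  refine ⟨fun M N hM hN => ?_, fun N hN =>
    GrMod.isLocallyCoherent_localCohomology_pos f hf hN⟩
  obtain ⟨h1, h2⟩ := GrMod.duality hω f g hg Ψ M N hM hN
  refine ⟨h1, ?_⟩
  have h3 (K : CochainComplex (ModuleCat.{u} R) ℤ) :
      IsZero (DerivedCategory.Q.obj K) ↔ K.Acyclic := GrMod.isZero_Q_obj_iff K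
  rw [h3, h3]
  -- Weight `0` of the duality: the shift does not affect acyclicity, and a locally coherent complex
  -- is acyclic in weight `0` exactly when its dual is.
  refine Iff.trans ?_ (h1.acyclic_weight_iff 0).symm
  refine Iff.trans ?_ (GrMod.acyclic_weight_shift_iff _ _ _).symm
  exact (GrMod.acyclic_weight_dualY_iff hω h2).symm
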